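/- **Uhlmann transformation algorithm in the purified sample access model.** *Setting.* Let $\mathsf A$, $\mathsf B$ be systems of $a$ and $b$ qubits, $a+b\ge 1$, $d_{\mathsf A}=2^a$, $d_{\mathsf B}=2^b$, and let $|\rho\rangle^{\mathsf{AB}}$, $|\sigma\rangle^{\mathsf{AB}}$ be pure states with reduced states $\rho^{\mathsf A},\sigma^{\mathsf A}$. Put $M^{\mathsf B}=\mathrm{tr}_{\mathsf A}|\sigma\rangle\langle\rho|$ and let $V^{\mathsf B}=\mathrm{sgn}^{(\mathrm{SV})}(M^{\mathsf B})$ be the Uhlmann partial isometry, where $f^{(\mathrm{SV})}(\sum_j s_j|\eta_j\rangle\langle\xi_j|)=\sum_j f(s_j)|\eta_j\rangle\langle\xi_j|$ for a singular value decomposition. The fidelity is $\mathrm F(\omega,\tau)=\|\sqrt\omega\sqrt\tau\|_1^2$, and $\|\cdot\|_\diamond$ is the diamond norm. A calligraphic letter denotes the conjugation $\mathcal U(\cdot)=U(\cdot)U^\dagger$. $\hat{\mathsf A},\hat{\mathsf B}$ are copies of $\mathsf A,\mathsf B$, and $\mathsf H=\mathsf C\mathsf D$ is a two-qubit system. A unitary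 is an exact block-encoding of an operator $X$ if its block on the ancilla state $|0\cdots0\rangle$ equals $X$. *Algorithm*, with parameters $m\ge1$ and phases $\varphi_1,\dots,\varphi_u\in\mathbb R$, $u$ odd. Let $\xi=\mathrm{tr}_{\mathsf A_2}|\Xi\rangle\langle\Xi|$ with $|\Xi\rangle=\frac1{\sqrt2}\big(|0\rangle^{\mathsf C_3}|\sigma\rangle^{\mathsf A_1\mathsf B_1}|\rho\rangle^{\mathsf A_2\mathsf B_2}+|1\rangle^{\mathsf C_3}|\rho\rangle^{\mathsf A_1\mathsf B_1}|\sigma\rangle^{\mathsf A_2\mathsf B_2}\big)$, and let $\Upsilon=\frac12\big(|0\rangle\langle0|^{\mathsf C_2}\otimes\xi+|1\rangle\langle1|^{\mathsf C_2}\otimes Z^{\mathsf C_3}\xi Z^{\mathsf C_3}\big)$. The channel $\mathtt{DMESUB}$ (resp. $\mathtt{DMESUB}^\dagger$) on $\mathsf C\hat{\mathsf A}\hat{\mathsf B}\mathsf B$ repeats $m$ times: take a fresh copy of $\Upsilon$, apply $|0\rangle\langle0|^{\mathsf C_2}\otimes e^{i\theta F}+|1\rangle\langle1|^{\mathsf C_2}\otimes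 e^{-i\theta F}$ with $\theta=2/m$ (resp. $\theta=-2/m$), where $F$ swaps $\mathsf C_3\mathsf A_1\mathsf B_1\mathsf B_2$ with $\mathsf C\hat{\mathsf A}\hat{\mathsf B}\mathsf B$, and discard the copy. Let $\mathcal G=\mathcal X^{\mathsf C}\circ\mathtt{DMESUB}$ and $\mathcal G_{\rm inv}=\mathtt{DMESUB}^\dagger\circ\mathcal X^{\mathsf C}$. The output channel $\mathcal J$ on $\mathsf B\mathsf H\hat{\mathsf A}\hat{\mathsf B}$ is the quantum singular value transformation circuit: a Hadamard gate on $\mathsf D$; then for $j=1,\dots,u$ the channel $\mathcal G$ ($j$ odd) or $\mathcal G_{\rm inv}$ ($j$ even) followed by $e^{i\varphi_jZ^{\mathsf C}\otimes Z^{\mathsf D}}$; then a Hadamard gate on $\mathsf D$. Let $\mathcal P$ be the channel that prepares $|0^2\rangle^{\mathsf H}|\sigma\rangle^{\hat{\mathsf A}\hat{\mathsf B}}$. *Theorem.* There is an absolute constant $C>0$ such that the following holds for all $\delta\in(0,1)$, $s\in(0,1]$ and integers $r\ge1$. (1) There are parameters $m,(\varphi_j)_{j\le u}$, depending only on $\delta$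 and $s$, such that for all $a,b$ with $a+b\ge1$ and all $|\rho\rangle,|\sigma\rangle$ for which every non-zero singular value of $\sqrt{\sigma^{\mathsf A}}\sqrt{\rho^{\mathsf A}}$ is at least $s$ (i.e. $s\le s_{\min}$) there is a unitary $U_{\rm ideal}$ on $\mathsf B\mathsf H\hat{\mathsf A}\hat{\mathsf B}$ that is an exact block-encoding of $|\rho\rangle\langle\sigma|^{\hat{\mathsf A}\hat{\mathsf B}}\otimes V^{\mathsf B}$ and satisfies $$\tfrac12\big\|\mathcal J\circ\mathcal P-\mathcal U_{\rm ideal}\circ\mathcal P\big\|_\diamond\le\delta .$$ The total number $w$ of samples of $|\rho\rangle$ and $|\sigma\rangle$ used is at most $C\,\frac1{\delta s^2}\log^2(2/\delta)$. (2) There are parameters $m,(\varphi_j)_{j\le u}$, depending only on $\delta$, $s$ and $r$, such that for all $a,b$ with $a+b\ge1$ and all $|\rho\rangle,|\sigma\rangle$ for which moreover $\operatorname{rank}(\sqrt{\sigma^{\mathsf A}}\sqrt{\rho^{\mathsf A}})\le r$, the channel $\mathcal T^{\mathsf B}=\mathrm{tr}_{\mathsf H\hat{\mathsf A}\hat{\mathsf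 B}}\circ\mathcal J\circ\mathcal P$ satisfies $$\mathrm F\big(\mathcal T^{\mathsf B}(|\rho\rangle\langle\rho|^{\mathsf{AB}}),|\sigma\rangle\langle\sigma|^{\mathsf{AB}}\big)\ge\mathrm F(\rho^{\mathsf A},\sigma^{\mathsf A})-\delta .$$ The total number $w$ of samples used is at most $C\,\frac1\delta\min\{\frac1{s^2},\frac{r^2}{\delta^2}\}\log^2(2/\delta)$. In both cases $\mathcal G$ and $\mathcal G_{\rm inv}$ are $\frac{\delta}{2u}$-close, in $\frac12\|\cdot\|_\diamond$, to $\mathcal U_2$ and $\mathcal U_2^\dagger$ for a unitary $U_2$ that is an exact block-encoding of $|\rho\rangle\langle\sigma|^{\hat{\mathsf A}\hat{\mathsf B}}\otimes\sin^{(\mathrm{SV})}(M^{\mathsf B})$. Moreover, in both cases $\mathcal J$ is realized exactly, simultaneously for all pairs $|\rho\rangle,|\sigma\rangle$, by one quantum circuit that may load fresh samples of the two states, apply one- and two-qubit gates and reset qubits; it has at most $C\,w\log(d_{\mathsf A}d_{\mathsf B})$ gates and resets, and at any time at most $C\log(d_{\mathsf A}d_{\mathsf B})$ qubits besides those of $\mathsf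 B$ are in use. -/

import Mathlib

open scoped Matrix Kronecker ENNReal

noncomputable section

namespace UhlmannSample

/-! ### Matrices, norms and linear maps between matrix algebras -/

/-- The density operators and observables of a system whose computational basis is `α`. -/
abbrev Op (α : Type*) := Matrix α α ℂ

/-- The computational basis of an `n`-qubit system (`false` is `0`, `true` is `1`). -/
abbrev Q (n : ℕ) := Fin n → Bool

section Basics

variable {α β γ R : Type*} [Fintype α] [DecidableEq α] [Fintype β] [DecidableEq β]
  [Fintype γ] [DecidableEq γ] [Fintype R] [DecidableEq R]

/-- `ψ` is a pure state, i.e. a unit vector for the Euclidean norm. -/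
def IsPureState (ψ : α → ℂ) : Prop := ∑ i, ‖ψ i‖ ^ 2 = 1

/-- `|ψ⟩⟨φ|`. -/
def ketbra (ψ φ : α → ℂ) : Op α := Matrix.vecMulVec ψ (star φ)

/-- The trace norm `tr √(A† A)`. -/
def traceNorm (A : Op α) : ℝ := (cfc Real.sqrt (Aᴴ * A)).trace.re

/-- The (squared) fidelity `‖√ρ √σ‖₁²` of two positive semidefinite operators. -/
def fidelity (ρ σ : Op α) : ℝ := traceNorm (cfc Real.sqrt ρ * cfc Real.sqrt σ) ^ 2

/-- The set of non-zero singular values. -/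
def nonzeroSingularValues (A : Op α) : Set ℝ :=
  {x | x ≠ 0 ∧ ∃ i, x = (Matrix.toEuclideanLin A).singularValues i}

/-- For a real function `f` with `f 0 = 0` and `A = ∑ⱼ sⱼ |ηⱼ⟩⟨ξⱼ|` a singular value decomposition,
`svMap f A = ∑ⱼ f(sⱼ) |ηⱼ⟩⟨ξⱼ|`: if `sⱼ ≠ 0` then `ξⱼ` is an eigenvector of `A† A` for the
eigenvalue `sⱼ²` and `A ξⱼ = sⱼ ηⱼ`; the kernel of `A` is sent to zero. -/
def svMap (f : ℝ → ℝ) (A : Op α) : Op α :=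
  A * cfc (fun x => f (√x) / √x) (Aᴴ * A)

/-- The map `X ↦ K X K†`. -/
def conjBy (K : Op α) : Op α →ₗ[ℂ] Op α where
  toFun X := K * X * Kᴴ
  map_add' X Y := by rw [Matrix.mul_add, Matrix.add_mul]
  map_smul' c X := by simp

/-- Relabelling of the basis of a system. -/
def relabel (e : α ≃ β) : Op α →ₗ[ℂ] Op β :=
  (Matrix.reindexLinearEquiv ℂ ℂ e e).toLinearMap

/-- The map `X ↦ X ⊗ τ` that appends a system in the state `τ`. -/
def append (τ : Op β) : Op α →ₗ[ℂ] Op (α × β) where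
  toFun X := X ⊗ₖ τ
  map_add' X Y := Matrix.add_kronecker X Y τ
  map_smul' c X := Matrix.smul_kronecker c X τ

/-- The map `X ↦ τ ⊗ X` that puts a system in the state `τ` in front. -/
def prepend (τ : Op β) : Op α →ₗ[ℂ] Op (β × α) where
  toFun X := τ ⊗ₖ X
  map_add' X Y := Matrix.kronecker_add τ X Y
  map_smul' c X := Matrix.kronecker_smul c τ X

/-- Partial trace over the first factor. -/
def traceFst : Op (α × β) →ₗ[ℂ] Op β where
  toFun X := Matrix.of fun i j => ∑ k, X (k, i) (k, j)
  map_add' X Y := by ext i j; simp [Finset.sum_add_distrib]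
  map_smul' c X := by ext i j; simp [Finset.mul_sum]

/-- Partial trace over the second factor. -/
def traceSnd : Op (α × β) →ₗ[ℂ] Op α where
  toFun X := Matrix.of fun i j => ∑ k, X (i, k) (j, k)
  map_add' X Y := by ext i j; simp [Finset.sum_add_distrib]
  map_smul' c X := by ext i j; simp [Finset.mul_sum]

/-- The map `id ⊗ T` on the system `R ⊗ α`. -/
def idTensor (R : Type*) (T : Op α →ₗ[ℂ] Op β) : Op (R × α) →ₗ[ℂ] Op (R × β) where
  toFun X := Matrix.of fun i j => T (fun k l => X (i.1, k) (j.1, l)) i.2 j.2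
  map_add' X Y := by
    ext i j
    exact congrFun (congrFun (T.map_add (fun k l => X (i.1, k) (j.1, l))
      (fun k l => Y (i.1, k) (j.1, l))) i.2) j.2
  map_smul' c X := by
    ext i j
    exact congrFun (congrFun (T.map_smul c (fun k l => X (i.1, k) (j.1, l))) i.2) j.2

/-- The diamond norm: the supremum of `‖(id_R ⊗ T)(X)‖₁` over all finite reference systems `R` and
all `X` with `‖X‖₁ ≤ 1`. -/
def diamondNorm (T : Op α →ₗ[ℂ] Op β) : ℝ≥0∞ :=
  ⨆ (n : ℕ) (X : Op (Fin n × α)) (_ : traceNorm X ≤ 1),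
    ENNReal.ofReal (traceNorm (idTensor (Fin n) T X))

/-- `½ ‖S - T‖_⋄ ≤ ε`. -/
def DiamondClose (S T : Op α →ₗ[ℂ] Op β) (ε : ℝ) : Prop :=
  diamondNorm (S - T) / 2 ≤ ENNReal.ofReal ε

/-- `U` is a unitary, and `A` is its block on the subspace spanned by the basis vectors in the
range of `e` (for instance `e x = (0, x)`). -/
def IsBlockEncoding (e : β → α) (U : Op α) (A : Op β) : Prop :=
  U ∈ Matrix.unitaryGroup α ℂ ∧ U.submatrix e e = A

end Basics

/-! ### The Uhlmann transformation -/

section Uhlmann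

variable {A B : Type*} [Fintype A] [DecidableEq A] [Fintype B] [DecidableEq B]

/-- The reduced state on `A` of a pure state on `A ⊗ B`. -/
def reduced (ψ : A × B → ℂ) : Op A := traceSnd (ketbra ψ ψ)

/-- `√σ^A √ρ^A`. -/
def rootProduct (ρ σ : A × B → ℂ) : Op A :=
  cfc Real.sqrt (reduced σ) * cfc Real.sqrt (reduced ρ)

/-- `M^B = tr_A |σ⟩⟨ρ|`. -/
def overlap (ρ σ : A × B → ℂ) : Op B := traceFst (ketbra σ ρ)

/-- The Uhlmann partial isometry `V^B = sgn^(SV)(tr_A |σ⟩⟨ρ|)`. -/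
def uhlmannIsometry (ρ σ : A × B → ℂ) : Op B := svMap Real.sign (overlap ρ σ)

end Uhlmann

/-! ### The algorithm -/

section Algorithm

variable {A B τ : Type*} [Fintype A] [DecidableEq A] [Fintype B] [DecidableEq B]
  [Fintype τ] [DecidableEq τ]

/-- The computational basis of the system `C Â B̂ B`. -/
abbrev Tgt (A B : Type*) := Bool × ((A × B) × B)

/-- The computational basis of the system `B H Â B̂`, where the two-qubit system `H` consists of the
qubit `C` and one further qubit `D`. -/
abbrev Sys (A B : Type*) := B × ((Bool × Bool) × (A × B))

/-- The vector `(|0⟩|σ⟩|ρ⟩ + |1⟩|ρ⟩|σ⟩) / √2` on `C₃, A₁B₁, A₂B₂`, with the system `A₂` listed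
first. -/
def xiVec (ρ σ : A × B → ℂ) : A × Tgt A B → ℂ := fun x =>
  (1 / √2 : ℝ) *
    (if x.2.1 then ρ x.2.2.1 * σ (x.1, x.2.2.2) else σ x.2.2.1 * ρ (x.1, x.2.2.2))

/-- The state `ξ` on `C₃ A₁ B₁ B₂`. -/
def xi (ρ σ : A × B → ℂ) : Op (Tgt A B) := traceFst (ketbra (xiVec ρ σ) (xiVec ρ σ))

/-- Pauli `Z` on the first qubit. -/
def pauliZ (τ : Type*) [DecidableEq τ] : Op (Bool × τ) :=
  Matrix.diagonal fun x => if x.1 then -1 else 1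

/-- Pauli `X` on the first qubit. -/
def pauliX (τ : Type*) [DecidableEq τ] : Op (Bool × τ) := fun x y =>
  if x.1 = !y.1 ∧ x.2 = y.2 then 1 else 0

/-- The state `Υ = ½ (|0⟩⟨0| ⊗ ξ + |1⟩⟨1| ⊗ Z ξ Z)` on `C₂ C₃ A₁ B₁ B₂`. -/
def upsilon (ρ σ : A × B → ℂ) : Op (Bool × Tgt A B) :=
  (1 / 2 : ℂ) • (Matrix.single false false (1 : ℂ) ⊗ₖ xi ρ σ +
    Matrix.single true true (1 : ℂ) ⊗ₖ (pauliZ _ * xi ρ σ * pauliZ _))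

/-- The partial swap `e^{iθF} = cos θ + i sin θ F`, where `F` exchanges the two copies of `τ`. -/
def partialSwap (τ : Type*) [DecidableEq τ] (θ : ℝ) : Op (τ × τ) := fun x y =>
  Real.cos θ * (if x = y then 1 else 0) +
    Complex.I * Real.sin θ * (if x = y.swap then 1 else 0)

/-- The unitary `|0⟩⟨0| ⊗ e^{iθF} + |1⟩⟨1| ⊗ e^{-iθF}`. -/
def dmeUnitary (τ : Type*) [DecidableEq τ] (θ : ℝ) : Op ((Bool × τ) × τ) := fun x y =>
  if x.1.1 = y.1.1 then
    partialSwap τ (if x.1.1 then -θ else θ) (x.1.2, x.2) (y.1.2, y.2)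
  else 0

/-- One step of density matrix exponentiation, consuming one copy of `Υ`. -/
def dmeStep (Υ : Op (Bool × τ)) (θ : ℝ) : Op τ →ₗ[ℂ] Op τ :=
  traceFst ∘ₗ conjBy (dmeUnitary τ θ) ∘ₗ prepend Υ

/-- `DMESUB` with `m` copies of `Υ = |0⟩⟨0| ⊗ ξ₀ + |1⟩⟨1| ⊗ ξ₁`, approximating the conjugation with
`e^{it(ξ₀ - ξ₁)}`. Replacing `t` by `-t` gives `DMESUB†`. -/
def dmesub (Υ : Op (Bool × τ)) (m : ℕ) (t : ℝ) : Op τ →ₗ[ℂ] Op τ := dmeStep Υ (t / m) ^ m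

/-- The channel `𝒢 = 𝒳^C ∘ DMESUB(Υ; t = 2)` on `C Â B̂ B`. -/
def chanG (ρ σ : A × B → ℂ) (m : ℕ) : Op (Tgt A B) →ₗ[ℂ] Op (Tgt A B) :=
  conjBy (pauliX _) ∘ₗ dmesub (upsilon ρ σ) m 2

/-- The channel `𝒢_inv = DMESUB†(Υ; t = 2) ∘ 𝒳^C` on `C Â B̂ B`. -/
def chanGinv (ρ σ : A × B → ℂ) (m : ℕ) : Op (Tgt A B) →ₗ[ℂ] Op (Tgt A B) :=
  dmesub (upsilon ρ σ) m (-2) ∘ₗ conjBy (pauliX _)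

/-- The rearrangement of `B (C D) (Â B̂)` into `D (C (Â B̂ B))`. -/
def sysEquivTgt (A B : Type*) : Sys A B ≃ Bool × Tgt A B where
  toFun x := (x.2.1.2, (x.2.1.1, (x.2.2, x.1)))
  invFun y := (y.2.2.2, ((y.2.1, y.1), y.2.2.1))
  left_inv _ := rfl
  right_inv _ := rfl

/-- A map on `C Â B̂ B`, as a map on `B H Â B̂`. -/
def onSys (T : Op (Tgt A B) →ₗ[ℂ] Op (Tgt A B)) : Op (Sys A B) →ₗ[ℂ] Op (Sys A B) :=
  relabel (sysEquivTgt A B).symm ∘ₗ idTensor Bool T ∘ₗ relabel (sysEquivTgt A B)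

/-- The phase gate `e^{iφ Z⊗Z}` on the two qubits of `H`. For `D` in `|0⟩` it is `e^{iφ(2Π-1)}` and
for `D` in `|1⟩` it is `e^{-iφ(2Π-1)}`, where `Π = |0⟩⟨0|^C`. -/
def phaseGate (A B : Type*) [DecidableEq A] [DecidableEq B] (φ : ℝ) : Op (Sys A B) :=
  Matrix.diagonal fun x =>
    Complex.exp (Complex.I * φ * (if x.2.1.1 = x.2.1.2 then 1 else -1))

/-- The Hadamard gate on the qubit `D` of `H`. -/
def hadamardD (A B : Type*) [DecidableEq A] [DecidableEq B] : Op (Sys A B) := fun x y =>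
  if x.1 = y.1 ∧ x.2.1.1 = y.2.1.1 ∧ x.2.2 = y.2.2 then
    ((1 / √2 : ℝ) : ℂ) * (if x.2.1.2 && y.2.1.2 then -1 else 1)
  else 0

/-- The alternating phase modulation sequence: apply `G`, a phase gate, `G'`, a phase gate, `G`, ….
The phases are listed in the order in which they are applied. -/
def alternate (G G' : Op (Sys A B) →ₗ[ℂ] Op (Sys A B)) : List ℝ → (Op (Sys A B) →ₗ[ℂ] Op (Sys A B))
  | [] => LinearMap.id
  | φ :: l => alternate G' G l ∘ₗ conjBy (phaseGate A B φ) ∘ₗ G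

/-- Quantum singular value transformation by a real polynomial, with every use of the
block-encoding unitary and of its inverse replaced by the channels `G` and `G'`. The length of the
list of phases is the degree of the polynomial. -/
def qsvt (G G' : Op (Tgt A B) →ₗ[ℂ] Op (Tgt A B)) (Φ : List ℝ) :
    Op (Sys A B) →ₗ[ℂ] Op (Sys A B) :=
  conjBy (hadamardD A B) ∘ₗ alternate (onSys G) (onSys G') Φ ∘ₗ conjBy (hadamardD A B)

/-- The channel `𝒥` on `B H Â B̂` produced by the algorithm, run with `m` copies of `Υ` for each
call of `DMESUB` or `DMESUB†` and with the phases `Φ` in the singular value transformation. -/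
def uhlmannPurifiedSample (ρ σ : A × B → ℂ) (m : ℕ) (Φ : List ℝ) :
    Op (Sys A B) →ₗ[ℂ] Op (Sys A B) :=
  qsvt (chanG ρ σ m) (chanGinv ρ σ m) Φ

/-- The channel `𝒫` from `B` to `B H Â B̂` that prepares `|0²⟩` on `H` and `|σ⟩` on `Â B̂`. -/
def prep (σ : A × B → ℂ) : Op B →ₗ[ℂ] Op (Sys A B) :=
  append (Matrix.single (false, false) (false, false) (1 : ℂ) ⊗ₖ ketbra σ σ)

/-- The embedding `x ↦ |0⟩^C ⊗ x`. -/
def blockC {A B : Type*} (x : (A × B) × B) : Tgt A B := (false, x)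

/-- The embedding `x ↦ |0²⟩^H ⊗ x`. -/
def blockH {A B : Type*} (x : (A × B) × B) : Sys A B := (x.2, ((false, false), x.1))

end Algorithm

/-! ### Circuits with access to samples -/

section Circuit

variable {ι κ : Type} [Fintype ι] [DecidableEq ι] [Fintype κ] [DecidableEq κ]

open Classical in
/-- The operator `U` on the qubits `e`, tensored with the identity on the other qubits. -/
def actOn (e : κ ↪ ι) (U : Op (κ → Bool)) : Op (ι → Bool) := fun x y =>
  if ∀ i, i ∉ Set.range e → x i = y i then U (x ∘ e) (y ∘ e) else 0

/-- Discard the content of the qubits `e` (partial trace) and put them in the state `τ`. -/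
def replaceOn (e : κ ↪ ι) (τ : Op (κ → Bool)) : Op (ι → Bool) →ₗ[ℂ] Op (ι → Bool) where
  toFun X := Matrix.of fun x y =>
    τ (x ∘ e) (y ∘ e) * ∑ z, X (Function.extend e z x) (Function.extend e z y)
  map_add' X Y := by ext x y; simp [Finset.sum_add_distrib, mul_add]
  map_smul' c X := by ext x y; simp [← Finset.mul_sum, mul_left_comm]

/-- The instructions of a circuit on the qubits `ι`, with samples of two unknown pure states of
`a + b` qubits: a one- or two-qubit gate, loading a fresh copy of the first or of the second unknown
state into `a + b` of the qubits (whose content is discarded), and resetting a qubit to `|0⟩`. -/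
inductive Instr (a b : ℕ) (ι : Type) : Type
  | gate (k : ℕ) (hk : k = 1 ∨ k = 2) (e : Fin k ↪ ι) (U : Matrix.unitaryGroup (Q k) ℂ)
  | loadRho (e : Fin a ⊕ Fin b ↪ ι)
  | loadSigma (e : Fin a ⊕ Fin b ↪ ι)
  | reset (i : ι)

/-- A pure state on `A ⊗ B`, as a vector on `a + b` qubits. -/
def flat {a b : ℕ} (ψ : Q a × Q b → ℂ) : (Fin a ⊕ Fin b → Bool) → ℂ := fun x =>
  ψ (x ∘ Sum.inl, x ∘ Sum.inr)

/-- All qubits of `κ` in the state `|0⟩`. -/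
def zeroState (κ : Type) [DecidableEq κ] [Fintype κ] : Op (κ → Bool) :=
  Matrix.single (fun _ => false) (fun _ => false) 1

/-- The effect of an instruction when the unknown states are `ρ` and `σ`. -/
def Instr.eval {a b : ℕ} (ρ σ : Q a × Q b → ℂ) :
    Instr a b ι → (Op (ι → Bool) →ₗ[ℂ] Op (ι → Bool))
  | .gate _ _ e U => conjBy (actOn e (U : Op _))
  | .loadRho e => replaceOn e (ketbra (flat ρ) (flat ρ))
  | .loadSigma e => replaceOn e (ketbra (flat σ) (flat σ))
  | .reset i => replaceOn (Function.Embedding.subtype (· = i)) (zeroState {j // j = i})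

/-- The number of samples that an instruction consumes. -/
def Instr.samples {a b : ℕ} : Instr a b ι → ℕ
  | .loadRho _ => 1
  | .loadSigma _ => 1
  | _ => 0

/-- The number of elementary operations (gates and resets) of an instruction. -/
def Instr.gates {a b : ℕ} : Instr a b ι → ℕ
  | .gate _ _ _ _ => 1
  | .reset _ => 1
  | _ => 0

/-- The effect of a circuit; the head of the list is executed first. -/
def evalCircuit {a b : ℕ} (ρ σ : Q a × Q b → ℂ) :
    List (Instr a b ι) → (Op (ι → Bool) →ₗ[ℂ] Op (ι → Bool))
  | [] => LinearMap.id
  | c :: l => evalCircuit ρ σ l ∘ₗ c.eval ρ σ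

/-- The number of samples that a circuit consumes. -/
def sampleCount {a b : ℕ} (l : List (Instr a b ι)) : ℕ := (l.map Instr.samples).sum

/-- The number of gates and resets of a circuit. -/
def gateCount {a b : ℕ} (l : List (Instr a b ι)) : ℕ := (l.map Instr.gates).sum

/-- The qubits of `B H Â B̂`. -/
abbrev SysQubits (a b : ℕ) := Fin b ⊕ (Fin 2 ⊕ (Fin a ⊕ Fin b))

/-- The identification of the computational basis of the qubits of `B H Â B̂`. -/
def sysBasis (a b : ℕ) : (SysQubits a b → Bool) ≃ Sys (Q a) (Q b) :=
  (Equiv.sumArrowEquivProdArrow _ _ _).trans <| (Equiv.refl _).prodCongr <|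
    (Equiv.sumArrowEquivProdArrow _ _ _).trans <|
      (finTwoArrowEquiv Bool).prodCongr (Equiv.sumArrowEquivProdArrow _ _ _)

/-- The map on `B H Â B̂` that a circuit with `k` ancilla qubits realizes: the ancillas start in
`|0⟩` and are discarded at the end. -/
def realizedMap {a b k : ℕ} (l : List (Instr a b (SysQubits a b ⊕ Fin k)))
    (ρ σ : Q a × Q b → ℂ) : Op (Sys (Q a) (Q b)) →ₗ[ℂ] Op (Sys (Q a) (Q b)) :=
  relabel (sysBasis a b) ∘ₗ traceSnd ∘ₗ
    relabel (Equiv.sumArrowEquivProdArrow (SysQubits a b) (Fin k) Bool) ∘ₗ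
    evalCircuit ρ σ l ∘ₗ
    relabel (Equiv.sumArrowEquivProdArrow (SysQubits a b) (Fin k) Bool).symm ∘ₗ
    append (zeroState (Fin k)) ∘ₗ relabel (sysBasis a b).symm

/-- The algorithm with parameters `m` and `Φ` on `a + b` qubits is realized by one circuit, the same
for all pairs of pure states. With the copy of `|σ⟩` that `𝒫` prepares, it uses `w ≤ N` samples in
total. It has at most `C w log(d_A d_B)` gates and resets, and the number of qubits in use besides
those of `B` (the samples being stored, `H` and the ancillas) is at most `C log(d_A d_B)`. -/
def ImplementedWith (C N : ℝ) (a b m : ℕ) (Φ : List ℝ) : Prop :=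
  ∃ (k w : ℕ) (l : List (Instr a b (SysQubits a b ⊕ Fin k))),
    (∀ ρ σ : Q a × Q b → ℂ, IsPureState ρ → IsPureState σ →
      realizedMap l ρ σ = uhlmannPurifiedSample ρ σ m Φ) ∧
    w = sampleCount l + 1 ∧
    (w : ℝ) ≤ N ∧
    (gateCount l : ℝ) ≤ C * w * Real.log ((2 : ℝ) ^ a * 2 ^ b) ∧
    ((2 + (a + b) + k : ℕ) : ℝ) ≤ C * Real.log ((2 : ℝ) ^ a * 2 ^ b)

/-- In every call, the channels `𝒢` and `𝒢_inv` are `ε`-close to the conjugation with a unitary `U₂`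
and with its inverse, where `U₂` is an exact block-encoding of `|ρ⟩⟨σ| ⊗ sin^(SV)(M)`. -/
def SineBlockEncoding {A B : Type*} [Fintype A] [DecidableEq A] [Fintype B] [DecidableEq B]
    (ρ σ : A × B → ℂ) (m : ℕ) (ε : ℝ) : Prop :=
  ∃ U₂ : Op (Tgt A B),
    IsBlockEncoding blockC U₂ (ketbra ρ σ ⊗ₖ svMap Real.sin (overlap ρ σ)) ∧
    DiamondClose (chanG ρ σ m) (conjBy U₂) ε ∧
    DiamondClose (chanGinv ρ σ m) (conjBy U₂ᴴ) ε

end Circuit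

end UhlmannSample

end

open UhlmannSample
open scoped Kronecker

/-! Put N = |ρ⟩⟨σ| ⊗ M. The two diagonal blocks of Υ are ½ξ and ½ZξZ, and their difference is half
of the Hermitian operator S = |1⟩⟨0| ⊗ N + |0⟩⟨1| ⊗ N† (`qubitBlock_upsilon_sub`). One step of
density matrix exponentiation agrees with conjugation by e^{iθS/2} up to O(θ²) in the diamond norm,
so m steps of angle 2/m simulate e^{iS} with error O(1/m) (`diamondBound_dmesub_sub`). Up to a
global phase, X e^{iS} is a unitary whose |0⟩-block is sin^(SV)(N) (`sineUnitary_block`). This is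
U₂.

Singular value transformation then applies an odd polynomial p to sin. A real odd p bounded by 1 on
[-1, 1] is the real part of a signal processing polynomial (`exists_phases_of_odd`): Lukács' theorem
writes 1 - y p₁(y)², where p(x) = x p₁(x²), as y A² + (1-y) B², which completes p to a unitary
column, and phases are then peeled off one degree at a time. The qubit D averages the sequence of
phases with its negative and so extracts the real part (`qsvtUnitary_block`). For p take a
polynomial close to the sign on [t/2, 1], of degree O(log(1/ε)/t), obtained as the composition of an
integrated Fejér-type kernel with an integral of (1-x²)ⁿ (`exists_sign_polynomial`); the half comes
from sin y ≥ y/2.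

The assumptions speak of √σ√ρ on A, the algorithm acts through M on B. Both Gram matrices have the
traces tr (σρ)^k of their positive powers, hence the same nonzero spectrum with multiplicities
(`trace_gram_rootProduct_pow`); smallest singular value, rank and fidelity are transferred this way.

For the diamond norm, the unitary circuit is corrected on the support of its block so that the block
becomes exactly V. The squared error is linear in the polynomial error, so precision of order δ² is
needed there (`exists_ideal_unitary`). For the fidelity only the amplitude tr M†f(M) matters:
singular values below δ/(8r) lose at most δ/8 altogether, so t = max(s, δ/(8r)) suffices
(`GoodParameters.fidelity_ge`).

For the circuit, every step loads |σ⟩ and |ρ⟩, superposes the two orders of the samples by a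
controlled swap, applies the partial swap through phase kickback on one ancilla, and overwrites all
ancillas in the next step. Its Kraus operators are matched one by one with those of the abstract
step (`toSys_comp_evalCircuit_stepCircuit`). -/

noncomputable section

open scoped Matrix Kronecker ENNReal ComplexOrder

namespace UhlmannSample

set_option linter.unusedSectionVars false

/-! ### Functional calculus of Hermitian matrices, traces and intertwiners. -/

section FunctionalCalculus

variable {α β γ : Type*} [Fintype α] [DecidableEq α] [Fintype β] [DecidableEq β]
  [Fintype γ] [DecidableEq γ]

/-- The spectrum is finite, so every real function is continuous on it, and the calculus applies to
sign, inverse square root and indicator functions without side conditions. -/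
lemma continuousOn_spectrum (H : Op α) (f : ℝ → ℝ) : ContinuousOn f (spectrum ℝ H) :=
  Matrix.finite_real_spectrum.continuousOn f

lemma cfc_mul_cfc (f g : ℝ → ℝ) (H : Op α) :
    cfc f H * cfc g H = cfc (fun x => f x * g x) H :=
  (cfc_mul f g H (continuousOn_spectrum H f) (continuousOn_spectrum H g)).symm

lemma cfc_add_cfc (f g : ℝ → ℝ) (H : Op α) :
    cfc f H + cfc g H = cfc (fun x => f x + g x) H :=
  (cfc_add H f g (continuousOn_spectrum H f) (continuousOn_spectrum H g)).symm

lemma cfc_sub_cfc (f g : ℝ → ℝ) (H : Op α) :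
    cfc f H - cfc g H = cfc (fun x => f x - g x) H :=
  (cfc_sub f g H (continuousOn_spectrum H f) (continuousOn_spectrum H g)).symm

lemma conjTranspose_cfc (f : ℝ → ℝ) (H : Op α) : (cfc f H)ᴴ = cfc f H :=
  (cfc_predicate f H : IsSelfAdjoint (cfc f H))

lemma cfc_commute_cfc (f g : ℝ → ℝ) (H : Op α) : cfc f H * cfc g H = cfc g H * cfc f H := by
  rw [cfc_mul_cfc, cfc_mul_cfc]; simp only [mul_comm]

lemma cfc_fun_id {H : Op α} (hH : H.IsHermitian) : cfc (fun x : ℝ => x) H = H :=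
  cfc_id' ℝ H hH

lemma cfc_id_mul {H : Op α} (hH : H.IsHermitian) (g : ℝ → ℝ) :
    H * cfc g H = cfc (fun x => x * g x) H := by
  rw [← cfc_mul_cfc, cfc_fun_id hH]

lemma cfc_mul_id {H : Op α} (hH : H.IsHermitian) (g : ℝ → ℝ) :
    cfc g H * H = cfc (fun x => g x * x) H := by
  rw [← cfc_mul_cfc, cfc_fun_id hH]

-- Lagrange interpolation on the union of both spectra and `t`. One polynomial computes `f` on two
-- matrices of possibly different sizes; the nodes `t` allow values such as `f 0` to be prescribed
-- as well.
open Polynomial in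
lemma exists_polynomial_cfc {H : Op α} {H' : Op β} (hH : H.IsHermitian) (hH' : H'.IsHermitian)
    (f : ℝ → ℝ) (t : Finset ℝ) :
    ∃ q : ℝ[X], (∀ x ∈ t, q.eval x = f x) ∧ cfc f H = aeval H q ∧ cfc f H' = aeval H' q := by
  classical
  set s : Finset ℝ := t ∪ (Matrix.finite_real_spectrum (A := H)).toFinset ∪
    (Matrix.finite_real_spectrum (A := H')).toFinset with hs
  have key : ∀ x ∈ s, (Lagrange.interpolate s id f).eval x = f x := fun x hx =>
    Lagrange.eval_interpolate_at_node (s := s) (v := id) f (Set.injOn_id _) hx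
  refine ⟨Lagrange.interpolate s id f, fun x hx => key x (by simp [hs, hx]), ?_, ?_⟩
  · rw [← cfc_polynomial _ H hH]
    exact cfc_congr fun x hx => (key x (by simp [hs, hx])).symm
  · rw [← cfc_polynomial _ H' hH']
    exact cfc_congr fun x hx => (key x (by simp [hs, hx])).symm

open Polynomial in
lemma mul_aeval_of_intertwine {K : Type*} [Field K] [Algebra K ℂ] {H : Op α} {H' : Op β}
    {T : Matrix β α ℂ} (h : T * H = H' * T) (q : K[X]) : T * aeval H q = aeval H' q * T := by
  have hpow : ∀ n : ℕ, T * H ^ n = H' ^ n * T := by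
    intro n
    induction n with
    | zero => simp
    | succ n ih => rw [pow_succ, ← Matrix.mul_assoc, ih, Matrix.mul_assoc, h, ← Matrix.mul_assoc,
        ← pow_succ]
  induction q using Polynomial.induction_on' with
  | add p q hp hq => simp [Matrix.mul_add, Matrix.add_mul, hp, hq]
  | monomial n a =>
    simp only [aeval_monomial, Algebra.algebraMap_eq_smul_one, smul_mul_assoc, one_mul,
      Matrix.mul_smul, Matrix.smul_mul, hpow]

/-- An intertwiner passes through powers, hence through a polynomial representing `f` on both
matrices. This moves functions of Gram matrices through isometries and Pauli operators, in place of
explicit singular value decompositions. -/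
lemma mul_cfc_of_intertwine {H : Op α} {H' : Op β} (hH : H.IsHermitian) (hH' : H'.IsHermitian)
    {T : Matrix β α ℂ} (h : T * H = H' * T) (f : ℝ → ℝ) :
    T * cfc f H = cfc f H' * T := by
  obtain ⟨q, -, h1, h2⟩ := exists_polynomial_cfc hH hH' f ∅
  rw [h1, h2, mul_aeval_of_intertwine h]

open Polynomial in
/-- Two Hermitian matrices whose positive powers have the same traces have the same nonzero
eigenvalues with multiplicities. -/
lemma trace_cfc_eq_of_trace_pow_eq {H : Op α} {H' : Op β} (hH : H.IsHermitian)
    (hH' : H'.IsHermitian) (h : ∀ k : ℕ, (H ^ (k + 1)).trace = (H' ^ (k + 1)).trace)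
    {f : ℝ → ℝ} (hf : f 0 = 0) : (cfc f H).trace = (cfc f H').trace := by
  obtain ⟨q, h0, h1, h2⟩ := exists_polynomial_cfc hH hH' f {0}
  -- `f 0 = 0` removes the zeroth power, whose trace is the dimension and may differ for the two
  -- matrices.
  have hq : X ∣ q := by
    rw [X_dvd_iff, coeff_zero_eq_eval_zero, h0 0 (by simp), hf]
  obtain ⟨g, rfl⟩ := hq
  rw [h1, h2]
  clear h0 h1 h2
  induction g using Polynomial.induction_on' with
  | add p q hp hq => simp only [mul_add, map_add, Matrix.trace_add, hp, hq]
  | monomial n a =>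
    rw [X_mul_monomial]
    simp only [aeval_monomial, Algebra.algebraMap_eq_smul_one, smul_mul_assoc, one_mul,
      Matrix.trace_smul, h]

lemma trace_cfc {H : Op α} (hH : H.IsHermitian) (f : ℝ → ℝ) :
    (cfc f H).trace = ∑ i, (f (hH.eigenvalues i) : ℂ) := by
  rw [hH.cfc_eq, Matrix.IsHermitian.cfc, Unitary.conjStarAlgAut_apply, Matrix.trace_mul_comm,
    ← Matrix.mul_assoc]
  simp [Matrix.trace_diagonal]

lemma trace_cfc_re {H : Op α} (hH : H.IsHermitian) (f : ℝ → ℝ) :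
    (cfc f H).trace.re = ∑ i, f (hH.eigenvalues i) := by
  rw [trace_cfc hH]; simp

lemma spectrum_nonneg_of_posSemidef {H : Op α} (hH : H.PosSemidef) {x : ℝ}
    (hx : x ∈ spectrum ℝ H) : 0 ≤ x := by
  rw [hH.1.spectrum_real_eq_range_eigenvalues] at hx
  obtain ⟨i, rfl⟩ := hx
  exact hH.eigenvalues_nonneg i

lemma posSemidef_cfc {H : Op α} {f : ℝ → ℝ}
    (hf : ∀ x ∈ spectrum ℝ H, 0 ≤ f x) : (cfc f H).PosSemidef := by
  have : cfc f H = cfc (fun x => √(f x)) H * (cfc (fun x => √(f x)) H)ᴴ := by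
    rw [conjTranspose_cfc, cfc_mul_cfc]
    exact cfc_congr fun x hx => (Real.mul_self_sqrt (hf x hx)).symm
  rw [this]
  exact Matrix.posSemidef_self_mul_conjTranspose _

end FunctionalCalculus

/-! ### Operator norm estimates. -/

section OperatorNorm

open scoped Matrix.Norms.L2Operator

variable {α β γ R : Type*} [Fintype α] [DecidableEq α] [Fintype β] [DecidableEq β]
  [Fintype γ] [DecidableEq γ] [Fintype R] [DecidableEq R]

lemma norm_cfc_le_of_le {H : Op α} {f : ℝ → ℝ} {c : ℝ} (hc : 0 ≤ c)
    (h : ∀ x ∈ spectrum ℝ H, |f x| ≤ c) : ‖cfc f H‖ ≤ c :=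
  norm_cfc_le hc h

lemma abs_le_norm_of_mem_spectrum {H : Op α} {x : ℝ} (hx : x ∈ spectrum ℝ H) : |x| ≤ ‖H‖ := by
  have : Nonempty α := by
    by_contra hne
    rw [not_nonempty_iff] at hne
    exact hx ((isUnit_of_subsingleton _))
  have := spectrum.norm_le_norm_of_mem hx
  simpa using this

/-- `‖A‖ ≤ c` as soon as `A† A ≤ c²`; here for isometries. -/
lemma norm_le_one_of_isometry {A : Matrix β α ℂ} (h : Aᴴ * A = 1) : ‖A‖ ≤ 1 := by
  have h1 := Matrix.l2_opNorm_conjTranspose_mul_self A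
  rw [h] at h1
  have h2 : ‖(1 : Op α)‖ ≤ 1 := by
    rcases isEmpty_or_nonempty α with h | h
    · have : (1 : Op α) = 0 := Subsingleton.elim _ _
      rw [this]; simp
    · exact norm_one.le
  nlinarith [norm_nonneg A]

/-- `A ↦ 1 ⊗ A` is a star homomorphism of C⋆-algebras, hence contractive. -/
lemma norm_one_kronecker_le (A : Op α) : ‖(1 : Op R) ⊗ₖ A‖ ≤ ‖A‖ := by
  let φ : Op α →⋆ₐ[ℂ] Op (R × α) :=
    { toFun := fun A => (1 : Op R) ⊗ₖ A
      map_one' := by simp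
      map_mul' := fun A B => by rw [← Matrix.mul_kronecker_mul, one_mul]
      map_zero' := by simp
      map_add' := fun A B => Matrix.kronecker_add _ _ _
      commutes' := fun r => by
        simp [Algebra.algebraMap_eq_smul_one, Matrix.kronecker_smul]
      map_star' := fun A => by
        simp [Matrix.star_eq_conjTranspose, Matrix.conjTranspose_kronecker] }
  exact NonUnitalStarAlgHom.norm_apply_le φ A

end OperatorNorm

/-! ### The trace norm and its duality with the operator norm. -/

section TraceNorm

open scoped Matrix.Norms.L2Operator

variable {α β γ R : Type*} [Fintype α] [DecidableEq α] [Fintype β] [DecidableEq β]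
  [Fintype γ] [DecidableEq γ] [Fintype R] [DecidableEq R]

lemma norm_apply_self_le (A : Op α) (i : α) : ‖A i i‖ ≤ ‖A‖ := by
  have h := Matrix.l2_opNorm_mulVec A (EuclideanSpace.single i 1)
  have h2 : ‖(WithLp.toLp 2 (A *ᵥ (EuclideanSpace.single i (1 : ℂ)).ofLp) : EuclideanSpace ℂ α) i‖
      ≤ _ := PiLp.norm_apply_le _ i
  refine (le_of_eq ?_).trans (h2.trans (h.trans ?_))
  · simp
  · simp

lemma isHermitian_gram (A : Matrix β α ℂ) : (Aᴴ * A).IsHermitian :=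
  Matrix.isHermitian_conjTranspose_mul_self A

lemma spectrum_gram_nonneg (A : Matrix β α ℂ) {x : ℝ} (hx : x ∈ spectrum ℝ (Aᴴ * A)) : 0 ≤ x :=
  spectrum_nonneg_of_posSemidef (Matrix.posSemidef_conjTranspose_mul_self A) hx

/-- If `f` vanishes at no nonzero point where it differs from `1`, then `A f(A† A) = A`. -/
lemma mul_cfc_gram_eq_self (A : Op α) {f : ℝ → ℝ} (hf : ∀ x ∈ spectrum ℝ (Aᴴ * A), x ≠ 0 → f x = 1) :
    A * cfc f (Aᴴ * A) = A := by
  -- The Gram matrix of the difference is a function of `A† A` that vanishes on the spectrum: at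
  -- zero because of a factor `x`, elsewhere because `f = 1`.
  have h : (A * cfc f (Aᴴ * A) - A)ᴴ * (A * cfc f (Aᴴ * A) - A) = 0 := by
    set G := Aᴴ * A with hG
    have hGH : G.IsHermitian := isHermitian_gram A
    have e1 : (A * cfc f G - A)ᴴ * (A * cfc f G - A) =
        cfc f G * (G * cfc f G) - cfc f G * G - G * cfc f G + G := by
      rw [Matrix.conjTranspose_sub, Matrix.conjTranspose_mul, conjTranspose_cfc]
      simp only [hG]
      noncomm_ring
    rw [e1]
    have e2 : G = cfc (fun x : ℝ => x) G := (cfc_fun_id hGH).symm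
    rw [cfc_id_mul hGH, cfc_mul_id hGH, cfc_mul_cfc]
    conv_lhs => rhs; rw [e2]
    rw [cfc_sub_cfc, cfc_sub_cfc, cfc_add_cfc]
    have : cfc (fun x => f x * (x * f x) - f x * x - x * f x + x) G = cfc (fun _ => (0 : ℝ)) G := by
      refine cfc_congr fun x hx => ?_
      by_cases h0 : x = 0
      · simp [h0]
      · simp [hf x hx h0]
    rw [this, cfc_const_zero]
  exact sub_eq_zero.mp (Matrix.conjTranspose_mul_self_eq_zero.mp h)

/-- The adjoint of the partial isometry of the polar decomposition. -/
def polarAdj (A : Op α) : Op α := cfc (fun x => (√x)⁻¹) (Aᴴ * A) * Aᴴ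

lemma polarAdj_mul (A : Op α) : polarAdj A * A = cfc Real.sqrt (Aᴴ * A) := by
  rw [polarAdj, Matrix.mul_assoc, cfc_mul_id (isHermitian_gram A)]
  refine cfc_congr fun x hx => ?_
  have hx0 := spectrum_gram_nonneg A hx
  rcases hx0.eq_or_lt with h | h
  · simp [← h]
  · have h1 : √x ≠ 0 := (Real.sqrt_pos.mpr h).ne'
    rw [inv_mul_eq_div, Real.div_sqrt]

/-- Its product with its adjoint is the spectral projection of `A† A` onto the nonzero eigenvalues;
the convention `0⁻¹ = 0` takes care of the kernel. -/
lemma norm_polarAdj_le (A : Op α) : ‖polarAdj A‖ ≤ 1 := by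
  have h1 : polarAdj A * (polarAdj A)ᴴ = cfc (fun x => (√x)⁻¹ * (x * (√x)⁻¹)) (Aᴴ * A) := by
    rw [polarAdj, Matrix.conjTranspose_mul, conjTranspose_cfc, Matrix.conjTranspose_conjTranspose,
      Matrix.mul_assoc, ← Matrix.mul_assoc Aᴴ, cfc_id_mul (isHermitian_gram A), cfc_mul_cfc]
  have h2 := Matrix.l2_opNorm_conjTranspose_mul_self (polarAdj A)ᴴ
  rw [Matrix.conjTranspose_conjTranspose, h1, Matrix.l2_opNorm_conjTranspose] at h2
  have h3 : ‖cfc (fun x => (√x)⁻¹ * (x * (√x)⁻¹)) (Aᴴ * A)‖ ≤ 1 := by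
    refine norm_cfc_le_of_le zero_le_one fun x hx => ?_
    have hx0 := spectrum_gram_nonneg A hx
    rcases hx0.eq_or_lt with h | h
    · simp [← h]
    · have h1 : √x ≠ 0 := (Real.sqrt_pos.mpr h).ne'
      have : (√x)⁻¹ * (x * (√x)⁻¹) = 1 := by
        field_simp
        rw [Real.sq_sqrt hx0]
      rw [this]; simp
  nlinarith [norm_nonneg (polarAdj A)]

lemma conjTranspose_polarAdj_mul (A : Op α) :
    (polarAdj A)ᴴ * cfc Real.sqrt (Aᴴ * A) = A := by
  rw [polarAdj, Matrix.conjTranspose_mul, conjTranspose_cfc, Matrix.conjTranspose_conjTranspose,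
    Matrix.mul_assoc, cfc_mul_cfc]
  refine mul_cfc_gram_eq_self A fun x hx h0 => ?_
  have h1 : √x ≠ 0 := (Real.sqrt_pos.mpr (lt_of_le_of_ne (spectrum_gram_nonneg A hx) h0.symm)).ne'
  exact inv_mul_cancel₀ h1

lemma norm_trace_mul_le_of_posSemidef (D : Op α) {H : Op α} (hH : H.PosSemidef) :
    ‖(D * H).trace‖ ≤ ‖D‖ * H.trace.re := by
  have hs := hH.1.spectral_theorem
  set U := hH.1.eigenvectorUnitary with hU
  rw [Unitary.conjStarAlgAut_apply] at hs
  have e1 : (D * H).trace =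
      ∑ i, ((star U : Op α) * D * (U : Op α)) i i * (hH.1.eigenvalues i : ℂ) := by
    conv_lhs => rw [hs]
    rw [← Matrix.mul_assoc, ← Matrix.mul_assoc, Matrix.trace_mul_comm, ← Matrix.mul_assoc,
      ← Matrix.mul_assoc, Matrix.trace]
    simp [Matrix.mul_diagonal]
  have e2 : H.trace.re = ∑ i, hH.1.eigenvalues i := by
    rw [hH.1.trace_eq_sum_eigenvalues]; simp
  have hUn : ‖(U : Op α)‖ ≤ 1 := norm_le_one_of_isometry (Unitary.coe_star_mul_self U)
  have hUn' : ‖(star U : Op α)‖ ≤ 1 := by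
    rw [Matrix.star_eq_conjTranspose, Matrix.l2_opNorm_conjTranspose]; exact hUn
  rw [e1, e2, Finset.mul_sum]
  refine (norm_sum_le _ _).trans (Finset.sum_le_sum fun i _ => ?_)
  rw [norm_mul, Complex.norm_real, Real.norm_of_nonneg (hH.eigenvalues_nonneg i)]
  refine mul_le_mul_of_nonneg_right ?_ (hH.eigenvalues_nonneg i)
  refine (norm_apply_self_le _ i).trans ?_
  calc ‖(star U : Op α) * D * (U : Op α)‖ ≤ ‖(star U : Op α)‖ * ‖D‖ * ‖(U : Op α)‖ :=
        (norm_mul_le _ _).trans (mul_le_mul_of_nonneg_right (norm_mul_le _ _) (norm_nonneg _))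
    _ ≤ 1 * ‖D‖ * 1 := by gcongr
    _ = ‖D‖ := by ring

lemma posSemidef_sqrt_gram (A : Op α) : (cfc Real.sqrt (Aᴴ * A)).PosSemidef :=
  posSemidef_cfc fun _ _ => Real.sqrt_nonneg _

/-- Hölder's inequality, from the polar decomposition of `A`. Together with
`traceNorm_le_of_forall`, where `polarAdj A` attains the supremum, it reduces trace norm
inequalities to operator norms of test matrices. -/
lemma norm_trace_mul_le (D A : Op α) : ‖(D * A).trace‖ ≤ ‖D‖ * traceNorm A := by
  conv_lhs => rw [← conjTranspose_polarAdj_mul A, ← Matrix.mul_assoc]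
  have h0 : 0 ≤ (cfc Real.sqrt (Aᴴ * A)).trace.re := by
    have := (posSemidef_sqrt_gram A).trace_nonneg
    exact (Complex.le_def.mp this).1
  refine (norm_trace_mul_le_of_posSemidef _ (posSemidef_sqrt_gram A)).trans ?_
  refine mul_le_mul_of_nonneg_right ?_ h0
  refine (norm_mul_le _ _).trans ?_
  rw [Matrix.l2_opNorm_conjTranspose]
  exact mul_le_of_le_one_right (norm_nonneg _) (norm_polarAdj_le A)

lemma traceNorm_eq (A : Op α) : traceNorm A = (polarAdj A * A).trace.re := by
  rw [polarAdj_mul, traceNorm]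

lemma traceNorm_nonneg (A : Op α) : 0 ≤ traceNorm A :=
  (Complex.le_def.mp (posSemidef_sqrt_gram A).trace_nonneg).1

lemma traceNorm_le_of_forall {A : Op α} {c : ℝ}
    (h : ∀ D : Op α, ‖D‖ ≤ 1 → ‖(D * A).trace‖ ≤ c) : traceNorm A ≤ c := by
  rw [traceNorm_eq]
  exact (Complex.re_le_norm _).trans (h _ (norm_polarAdj_le A))

lemma traceNorm_add_le (A B : Op α) : traceNorm (A + B) ≤ traceNorm A + traceNorm B := by
  refine traceNorm_le_of_forall fun D hD => ?_
  rw [Matrix.mul_add, Matrix.trace_add]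
  refine (norm_add_le _ _).trans (add_le_add ?_ ?_) <;>
  refine (norm_trace_mul_le _ _).trans (mul_le_of_le_one_left (traceNorm_nonneg _) hD)

lemma traceNorm_smul_le (c : ℂ) (A : Op α) : traceNorm (c • A) ≤ ‖c‖ * traceNorm A := by
  refine traceNorm_le_of_forall fun D hD => ?_
  rw [Matrix.mul_smul, Matrix.trace_smul, norm_smul]
  refine mul_le_mul_of_nonneg_left ?_ (norm_nonneg c)
  exact (norm_trace_mul_le _ _).trans (mul_le_of_le_one_left (traceNorm_nonneg _) hD)

lemma traceNorm_sandwich_le (A : Matrix β α ℂ) (X : Op α) (B : Matrix α β ℂ) :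
    traceNorm (A * X * B) ≤ ‖A‖ * ‖B‖ * traceNorm X := by
  refine traceNorm_le_of_forall fun D hD => ?_
  have : (D * (A * X * B)).trace = (B * D * A * X).trace := by
    rw [← Matrix.mul_assoc, Matrix.trace_mul_comm]
    simp only [Matrix.mul_assoc]
  rw [this]
  refine (norm_trace_mul_le _ _).trans (mul_le_mul_of_nonneg_right ?_ (traceNorm_nonneg _))
  calc ‖B * D * A‖ ≤ ‖B‖ * ‖D‖ * ‖A‖ := (Matrix.l2_opNorm_mul _ _).trans
        (mul_le_mul_of_nonneg_right (Matrix.l2_opNorm_mul _ _) (norm_nonneg _))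
    _ ≤ ‖B‖ * 1 * ‖A‖ := by gcongr
    _ = ‖A‖ * ‖B‖ := by ring

lemma norm_one_kronecker_rect_le (A : Matrix β α ℂ) : ‖(1 : Op R) ⊗ₖ A‖ ≤ ‖A‖ := by
  have h := Matrix.l2_opNorm_conjTranspose_mul_self ((1 : Op R) ⊗ₖ A)
  rw [Matrix.conjTranspose_kronecker, ← Matrix.mul_kronecker_mul, Matrix.conjTranspose_one,
    one_mul] at h
  have h2 := norm_one_kronecker_le (R := R) (Aᴴ * A)
  rw [h, Matrix.l2_opNorm_conjTranspose_mul_self] at h2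
  exact abs_le_of_sq_le_sq' (by nlinarith) (norm_nonneg _) |>.2

lemma norm_kronecker_one_le (A : Op α) : ‖A ⊗ₖ (1 : Op R)‖ ≤ ‖A‖ := by
  let φ : Op α →⋆ₐ[ℂ] Op (α × R) :=
    { toFun := fun A => A ⊗ₖ (1 : Op R)
      map_one' := by simp
      map_mul' := fun A B => by rw [← Matrix.mul_kronecker_mul, one_mul]
      map_zero' := by simp
      map_add' := fun A B => Matrix.add_kronecker _ _ _
      commutes' := fun r => by
        simp [Algebra.algebraMap_eq_smul_one, Matrix.smul_kronecker]
      map_star' := fun A => by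
        simp [Matrix.star_eq_conjTranspose, Matrix.conjTranspose_kronecker] }
  exact NonUnitalStarAlgHom.norm_apply_le φ A

/-- The partial trace is dual to `D ↦ D ⊗ 1`; contractivity of the latter in operator norm gives
contractivity of the former in trace norm. -/
lemma trace_mul_traceSnd (D : Op α) (X : Op (α × R)) :
    (D * traceSnd X).trace = ((D ⊗ₖ (1 : Op R)) * X).trace := by
  simp only [Matrix.trace, Matrix.diag, Matrix.mul_apply, traceSnd, LinearMap.coe_mk,
    AddHom.coe_mk, Matrix.of_apply, Fintype.sum_prod_type, Matrix.kroneckerMap_apply,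
    Matrix.one_apply, mul_ite, mul_one, mul_zero, ite_mul, zero_mul, Finset.sum_ite_eq,
    Finset.mem_univ, if_true, Finset.mul_sum]
  exact Finset.sum_congr rfl fun i _ => Finset.sum_comm

lemma traceNorm_traceSnd_le (X : Op (α × R)) : traceNorm (traceSnd X) ≤ traceNorm X := by
  refine traceNorm_le_of_forall fun D hD => ?_
  rw [trace_mul_traceSnd]
  refine (norm_trace_mul_le _ _).trans (mul_le_of_le_one_left (traceNorm_nonneg _) ?_)
  exact (norm_kronecker_one_le D).trans hD

lemma norm_submatrix_equiv_le (e : α ≃ β) :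
    ‖((1 : Op β).submatrix id e : Matrix β α ℂ)‖ ≤ 1 := by
  refine norm_le_one_of_isometry ?_
  ext i j
  simp [Matrix.mul_apply, Matrix.one_apply]

lemma traceNorm_relabel_le (e : α ≃ β) (X : Op α) : traceNorm (relabel e X) ≤ traceNorm X := by
  have h : relabel e X = ((1 : Op β).submatrix id e : Matrix β α ℂ) * X *
      ((1 : Op β).submatrix id e : Matrix β α ℂ)ᴴ := by
    ext i j
    simp only [relabel, LinearEquiv.coe_coe, Matrix.coe_reindexLinearEquiv, Matrix.reindex_apply,
      Matrix.submatrix_apply, Matrix.mul_apply, Matrix.conjTranspose_apply, Matrix.one_apply, id,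
      ite_mul, one_mul, zero_mul]
    rw [Finset.sum_eq_single (e.symm j)]
    · rw [Finset.sum_eq_single (e.symm i)]
      · simp
      · intro k _ hk
        rw [if_neg]; rintro rfl; simp at hk
      · simp
    · intro k _ hk
      rw [if_neg (by rintro rfl; simp at hk)]; simp
    · simp
  rw [h]
  refine (traceNorm_sandwich_le _ _ _).trans ?_
  rw [Matrix.l2_opNorm_conjTranspose]
  have := norm_submatrix_equiv_le e
  refine mul_le_of_le_one_left (traceNorm_nonneg _) ?_
  nlinarith [norm_nonneg ((1 : Op β).submatrix id e : Matrix β α ℂ)]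

/-- The operator `|x⟩ ↦ |x⟩ ⊗ |w⟩`. -/
def appendVec (α : Type*) [DecidableEq α] (w : β → ℂ) : Matrix (α × β) α ℂ :=
  fun x y => if x.1 = y then w x.2 else 0

lemma conjTranspose_appendVec_mul (v w : β → ℂ) :
    (appendVec α v)ᴴ * appendVec α w = (∑ i, star (v i) * w i) • (1 : Op α) := by
  ext i j
  simp only [Matrix.mul_apply, Matrix.conjTranspose_apply, appendVec, Fintype.sum_prod_type,
    Matrix.smul_apply, Matrix.one_apply, smul_eq_mul]
  rw [Finset.sum_eq_single i]
  · by_cases h : i = j <;> simp [h]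
  · intro k _ hk; simp [hk]
  · simp

lemma norm_appendVec_le {w : β → ℂ} {c : ℝ} (hc : 0 ≤ c) (h : ∑ i, ‖w i‖ ^ 2 ≤ c ^ 2) :
    ‖appendVec α w‖ ≤ c := by
  have h1 := Matrix.l2_opNorm_conjTranspose_mul_self (appendVec α w)
  rw [conjTranspose_appendVec_mul, norm_smul] at h1
  have h2 : ‖(1 : Op α)‖ ≤ 1 := by
    refine norm_le_one_of_isometry ?_
    simp
  have h3 : ∑ i, star (w i) * w i = ((∑ i, ‖w i‖ ^ 2 : ℝ) : ℂ) := by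
    push_cast
    exact Finset.sum_congr rfl fun i _ => by
      rw [RCLike.star_def, Complex.conj_mul']
  rw [h3, Complex.norm_real, Real.norm_of_nonneg (by positivity)] at h1
  refine abs_le_of_sq_le_sq' ?_ hc |>.2
  have h4 : 0 ≤ ∑ i, ‖w i‖ ^ 2 := by positivity
  nlinarith [norm_nonneg (1 : Op α)]

/-- Appending a rank-one operator is a sandwich between two maps of the form `|x⟩ ↦ |x⟩ ⊗ |w⟩`, so
that norm bounds follow from those on sandwiches. -/
lemma kronecker_ketbra (X : Op α) (v w : β → ℂ) :
    X ⊗ₖ ketbra v w = appendVec α v * X * (appendVec α w)ᴴ := by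
  ext ⟨i, k⟩ ⟨j, l⟩
  simp only [Matrix.kroneckerMap_apply, ketbra, Matrix.vecMulVec_apply, Pi.star_apply,
    Matrix.mul_apply, appendVec, Matrix.conjTranspose_apply, ite_mul, zero_mul,
    Finset.sum_ite_eq, Finset.mem_univ, if_true]
  rw [Finset.sum_eq_single j]
  · simp; ring
  · intro b _ hb; simp [hb.symm]
  · simp

lemma traceNorm_kronecker_ketbra_le (X : Op α) (w : β → ℂ) :
    traceNorm (X ⊗ₖ ketbra w w) ≤ (∑ i, ‖w i‖ ^ 2) * traceNorm X := by
  rw [kronecker_ketbra]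
  refine (traceNorm_sandwich_le _ _ _).trans ?_
  rw [Matrix.l2_opNorm_conjTranspose]
  refine mul_le_mul_of_nonneg_right ?_ (traceNorm_nonneg _)
  have h0 : (0 : ℝ) ≤ ∑ i, ‖w i‖ ^ 2 := by positivity
  have h := norm_appendVec_le (α := α) (w := w) (Real.sqrt_nonneg _) (Real.sq_sqrt h0).ge
  calc _ ≤ √(∑ i, ‖w i‖ ^ 2) * √(∑ i, ‖w i‖ ^ 2) := by gcongr
    _ = _ := Real.mul_self_sqrt h0

end TraceNorm

/-! ### Diamond norm bounds for linear maps; Hermiticity preservation. -/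

section Diamond

variable {α β γ : Type*} [Fintype α] [DecidableEq α] [Fintype β] [DecidableEq β]
  [Fintype γ] [DecidableEq γ]

/-- `‖(id_R ⊗ T)(X)‖₁ ≤ c ‖X‖₁` for all finite reference systems `R` and all `X`. -/
def DiamondBound (T : Op α →ₗ[ℂ] Op β) (c : ℝ) : Prop :=
  ∀ (R : Type) [Fintype R] [DecidableEq R] (X : Op (R × α)),
    traceNorm (idTensor R T X) ≤ c * traceNorm X

lemma idTensor_apply (R : Type*) (T : Op α →ₗ[ℂ] Op β) (X : Op (R × α)) (i j : R × β) :
    idTensor R T X i j = T (fun k l => X (i.1, k) (j.1, l)) i.2 j.2 := rfl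

lemma idTensor_add (R : Type*) (S T : Op α →ₗ[ℂ] Op β) (X : Op (R × α)) :
    idTensor R (S + T) X = idTensor R S X + idTensor R T X := rfl

lemma idTensor_smul (R : Type*) (c : ℂ) (T : Op α →ₗ[ℂ] Op β) (X : Op (R × α)) :
    idTensor R (c • T) X = c • idTensor R T X := rfl

lemma idTensor_comp (R : Type*) (S : Op β →ₗ[ℂ] Op γ) (T : Op α →ₗ[ℂ] Op β) (X : Op (R × α)) :
    idTensor R (S ∘ₗ T) X = idTensor R S (idTensor R T X) := rfl

lemma DiamondBound.diamondClose {S T : Op α →ₗ[ℂ] Op β} {ε : ℝ} (hε : 0 ≤ ε)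
    (h : DiamondBound (S - T) (2 * ε)) : DiamondClose S T ε := by
  have h1 : diamondNorm (S - T) ≤ ENNReal.ofReal (2 * ε) := by
    refine iSup_le fun n => iSup_le fun X => iSup_le fun hX => ENNReal.ofReal_le_ofReal ?_
    exact (h (Fin n) X).trans (mul_le_of_le_one_right (by linarith) hX)
  unfold DiamondClose
  calc diamondNorm (S - T) / 2 ≤ ENNReal.ofReal (2 * ε) / 2 := by gcongr
    _ = ENNReal.ofReal ε := by
      rw [ENNReal.ofReal_mul (by norm_num), mul_comm]
      simp only [ENNReal.ofReal_ofNat]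
      exact ENNReal.mul_div_cancel_right (by norm_num) (by norm_num)

lemma DiamondBound.mono {T : Op α →ₗ[ℂ] Op β} {c d : ℝ} (h : DiamondBound T c) (hcd : c ≤ d) :
    DiamondBound T d := fun R _ _ X =>
  (h R X).trans (mul_le_mul_of_nonneg_right hcd (traceNorm_nonneg _))

lemma DiamondBound.add {S T : Op α →ₗ[ℂ] Op β} {c d : ℝ} (hS : DiamondBound S c)
    (hT : DiamondBound T d) : DiamondBound (S + T) (c + d) := fun R _ _ X => by
  rw [idTensor_add, add_mul]
  exact (traceNorm_add_le _ _).trans (add_le_add (hS R X) (hT R X))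

lemma DiamondBound.smul {T : Op α →ₗ[ℂ] Op β} {c : ℝ} (hT : DiamondBound T c) (z : ℂ) :
    DiamondBound (z • T) (‖z‖ * c) := fun R _ _ X => by
  rw [idTensor_smul, mul_assoc]
  exact (traceNorm_smul_le _ _).trans (mul_le_mul_of_nonneg_left (hT R X) (norm_nonneg z))

lemma DiamondBound.neg {T : Op α →ₗ[ℂ] Op β} {c : ℝ} (hT : DiamondBound T c) :
    DiamondBound (-T) c := by
  have h := hT.smul (-1)
  have e : (-1 : ℂ) • T = -T := LinearMap.ext fun X => by simp
  rwa [e, norm_neg, norm_one, one_mul] at h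

lemma DiamondBound.sub {S T : Op α →ₗ[ℂ] Op β} {c d : ℝ} (hS : DiamondBound S c)
    (hT : DiamondBound T d) : DiamondBound (S - T) (c + d) := by
  rw [sub_eq_add_neg]; exact hS.add hT.neg

lemma DiamondBound.comp {S : Op β →ₗ[ℂ] Op γ} {T : Op α →ₗ[ℂ] Op β} {c d : ℝ} (hc : 0 ≤ c)
    (hS : DiamondBound S c) (hT : DiamondBound T d) : DiamondBound (S ∘ₗ T) (c * d) :=
  fun R _ _ X => by
  rw [idTensor_comp, mul_assoc]
  exact (hS R _).trans (mul_le_mul_of_nonneg_left (hT R X) hc)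

lemma DiamondBound.id : DiamondBound (LinearMap.id : Op α →ₗ[ℂ] Op α) 1 := fun R _ _ X => by
  rw [one_mul]; rfl

/-- The map `X ↦ A X B`. -/
def sandwich (A : Matrix β α ℂ) (B : Matrix α β ℂ) : Op α →ₗ[ℂ] Op β where
  toFun X := A * X * B
  map_add' X Y := by rw [Matrix.mul_add, Matrix.add_mul]
  map_smul' c X := by simp

lemma sandwich_apply (A : Matrix β α ℂ) (B : Matrix α β ℂ) (X : Op α) :
    sandwich A B X = A * X * B := rfl

lemma idTensor_sandwich (R : Type*) [Fintype R] [DecidableEq R] (A : Matrix β α ℂ)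
    (B : Matrix α β ℂ) (X : Op (R × α)) :
    idTensor R (sandwich A B) X = ((1 : Op R) ⊗ₖ A) * X * ((1 : Op R) ⊗ₖ B) := by
  ext ⟨i, k⟩ ⟨j, l⟩
  simp only [idTensor_apply, Matrix.mul_apply, Fintype.sum_prod_type,
    Matrix.kroneckerMap_apply, Matrix.one_apply, ite_mul, one_mul, zero_mul]
  symm
  rw [Finset.sum_eq_single j]
  · refine Finset.sum_congr rfl fun x _ => ?_
    rw [if_pos rfl, Finset.sum_eq_single i]
    · simp only [if_true]
      rfl
    · intro r _ hr; simp [hr.symm]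
    · simp
  · intro r _ hr; simp [hr]
  · simp

open scoped Matrix.Norms.L2Operator in
lemma diamondBound_sandwich (A : Matrix β α ℂ) (B : Matrix α β ℂ) :
    DiamondBound (sandwich A B) (‖A‖ * ‖B‖) := fun R _ _ X => by
  rw [idTensor_sandwich]
  refine (traceNorm_sandwich_le _ _ _).trans (mul_le_mul_of_nonneg_right ?_ (traceNorm_nonneg _))
  exact mul_le_mul (norm_one_kronecker_rect_le A) (norm_one_kronecker_rect_le B) (norm_nonneg _)
    (norm_nonneg _)

lemma conjBy_eq_sandwich (K : Op α) : conjBy K = sandwich K Kᴴ := rfl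

lemma conjBy_apply (K X : Op α) : conjBy K X = K * X * Kᴴ := rfl

lemma conjBy_comp (K L : Op α) : conjBy K ∘ₗ conjBy L = conjBy (K * L) := by
  ext1 X
  simp only [LinearMap.comp_apply, conjBy_apply, Matrix.conjTranspose_mul, Matrix.mul_assoc]

open scoped Matrix.Norms.L2Operator in
lemma diamondBound_conjBy {K : Op α} (h : Kᴴ * K = 1) : DiamondBound (conjBy K) 1 := by
  rw [conjBy_eq_sandwich]
  refine (diamondBound_sandwich _ _).mono ?_
  have := norm_le_one_of_isometry h
  rw [Matrix.l2_opNorm_conjTranspose]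
  nlinarith [norm_nonneg K]

-- Telescoping: `J X J† - J' X J'† = (J - J') X J† + J' X (J - J')†`, and each summand costs `c`.
open scoped Matrix.Norms.L2Operator in
lemma diamondBound_sandwich_sub {J J' : Matrix β α ℂ} {c : ℝ} (hJ : ‖J‖ ≤ 1) (hJ' : ‖J'‖ ≤ 1)
    (h : ‖J - J'‖ ≤ c) : DiamondBound (sandwich J Jᴴ - sandwich J' J'ᴴ) (2 * c) := by
  have e : sandwich J Jᴴ - sandwich J' J'ᴴ = sandwich (J - J') Jᴴ + sandwich J' (J - J')ᴴ := by
    ext1 X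
    simp only [LinearMap.sub_apply, LinearMap.add_apply, sandwich_apply, Matrix.conjTranspose_sub,
      Matrix.sub_mul, Matrix.mul_sub]
    abel
  rw [e]
  refine ((diamondBound_sandwich _ _).add (diamondBound_sandwich _ _)).mono ?_
  rw [Matrix.l2_opNorm_conjTranspose, Matrix.l2_opNorm_conjTranspose]
  nlinarith [norm_nonneg J, norm_nonneg J', norm_nonneg (J - J')]

/-- The map `X ↦ tr(X) Y`. -/
def replaceBy (Y : Op β) : Op α →ₗ[ℂ] Op β where
  toFun X := X.trace • Y
  map_add' X Y := by rw [Matrix.trace_add, add_smul]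
  map_smul' c X := by simp [smul_smul]

lemma idTensor_replaceBy (R : Type*) [Fintype R] [DecidableEq R] (Y : Op β) (X : Op (R × α)) :
    idTensor R (replaceBy Y) X = traceSnd X ⊗ₖ Y := rfl

lemma diamondBound_replaceBy_ketbra (w : β → ℂ) :
    DiamondBound (replaceBy (α := α) (ketbra w w)) (∑ i, ‖w i‖ ^ 2) := fun R _ _ X => by
  rw [idTensor_replaceBy]
  refine (traceNorm_kronecker_ketbra_le _ _).trans ?_
  exact mul_le_mul_of_nonneg_left (traceNorm_traceSnd_le X) (by positivity)

lemma append_ketbra (w : β → ℂ) :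
    (append (ketbra w w) : Op α →ₗ[ℂ] _) = sandwich (appendVec α w) (appendVec α w)ᴴ := by
  ext1 X
  exact kronecker_ketbra X w w

lemma idTensor_traceSnd (R : Type*) [Fintype R] [DecidableEq R] (X : Op (R × (α × β))) :
    idTensor R traceSnd X = traceSnd (relabel (Equiv.prodAssoc R α β).symm X) := rfl

lemma diamondBound_traceSnd : DiamondBound (traceSnd : Op (α × β) →ₗ[ℂ] Op α) 1 :=
  fun R _ _ X => by
  rw [one_mul, idTensor_traceSnd]
  exact (traceNorm_traceSnd_le _).trans (traceNorm_relabel_le _ _)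

lemma DiamondBound.relabel_comp {T : Op α →ₗ[ℂ] Op β} {c : ℝ} (h : DiamondBound T c)
    (e : β ≃ γ) : DiamondBound (relabel e ∘ₗ T) c := fun R _ _ X => by
  have : idTensor R (relabel e ∘ₗ T) X =
    relabel ((Equiv.refl R).prodCongr e) (idTensor R T X) := rfl
  rw [this]
  exact (traceNorm_relabel_le _ _).trans (h R X)

lemma DiamondBound.comp_relabel {T : Op α →ₗ[ℂ] Op β} {c : ℝ} (hc : 0 ≤ c) (h : DiamondBound T c)
    (e : γ ≃ α) : DiamondBound (T ∘ₗ relabel e) c := fun R _ _ X => by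
  have : idTensor R (T ∘ₗ relabel e) X =
    idTensor R T (relabel ((Equiv.refl R).prodCongr e) X) := rfl
  rw [this]
  exact (h R _).trans (mul_le_mul_of_nonneg_left (traceNorm_relabel_le _ _) hc)

/-- The quantifier over all reference systems absorbs `R`: a reference `S` for `id_R ⊗ T` is a
reference `S × R` for `T`. -/
lemma DiamondBound.idTensor {R : Type} [Fintype R] [DecidableEq R] {T : Op α →ₗ[ℂ] Op β} {c : ℝ}
    (hc : 0 ≤ c) (h : DiamondBound T c) : DiamondBound (idTensor R T) c := fun S _ _ X => by
  have : UhlmannSample.idTensor S (UhlmannSample.idTensor R T) X =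
    relabel (Equiv.prodAssoc S R β) (UhlmannSample.idTensor (S × R) T
      (relabel (Equiv.prodAssoc S R α).symm X)) := rfl
  rw [this]
  refine (traceNorm_relabel_le _ _).trans ((h _ _).trans ?_)
  exact mul_le_mul_of_nonneg_left (traceNorm_relabel_le _ _) hc

lemma DiamondBound.comp_sub_comp {S S' : Op β →ₗ[ℂ] Op γ} {T T' : Op α →ₗ[ℂ] Op β} {a b s t : ℝ}
    (hb : 0 ≤ b) (hs : 0 ≤ s) (hS : DiamondBound S s) (hSS : DiamondBound (S - S') b)
    (hT' : DiamondBound T' t) (hTT : DiamondBound (T - T') a) :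
    DiamondBound (S ∘ₗ T - S' ∘ₗ T') (s * a + b * t) := by
  have : S ∘ₗ T - S' ∘ₗ T' = S ∘ₗ (T - T') + (S - S') ∘ₗ T' := by
    ext1 X; simp
  rw [this]
  exact (hS.comp hs hTT).add (hSS.comp hb hT')

/-- `T(X†) = T(X)†` for all `X`. -/
def HermPreserving (T : Op α →ₗ[ℂ] Op β) : Prop := ∀ X, T Xᴴ = (T X)ᴴ

/-- Hermiticity of the output state is what the lower bound on the fidelity with a pure state asks
for; positivity of the output is not needed there. -/
lemma HermPreserving.comp {S : Op β →ₗ[ℂ] Op γ} {T : Op α →ₗ[ℂ] Op β} (hS : HermPreserving S)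
    (hT : HermPreserving T) : HermPreserving (S ∘ₗ T) := fun X => by
  rw [LinearMap.comp_apply, hT, hS]; rfl

lemma hermPreserving_id : HermPreserving (LinearMap.id : Op α →ₗ[ℂ] Op α) := fun _ => rfl

lemma hermPreserving_conjBy (K : Op α) : HermPreserving (conjBy K) := fun X => by
  simp [conjBy_apply, Matrix.mul_assoc]

lemma hermPreserving_relabel (e : α ≃ β) : HermPreserving (relabel e) := fun _ => rfl

lemma hermPreserving_traceSnd : HermPreserving (traceSnd : Op (α × β) →ₗ[ℂ] Op α) := fun X => by
  ext i j; simp [traceSnd]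

lemma hermPreserving_traceFst : HermPreserving (traceFst : Op (α × β) →ₗ[ℂ] Op β) := fun X => by
  ext i j; simp [traceFst]

lemma hermPreserving_append {τ : Op β} (h : τ.IsHermitian) :
    HermPreserving (append τ : Op α →ₗ[ℂ] _) := fun X => by
  simp [append, Matrix.conjTranspose_kronecker, h.eq]

lemma hermPreserving_prepend {τ : Op β} (h : τ.IsHermitian) :
    HermPreserving (prepend τ : Op α →ₗ[ℂ] _) := fun X => by
  simp [prepend, Matrix.conjTranspose_kronecker, h.eq]

lemma HermPreserving.idTensor (R : Type*) {T : Op α →ₗ[ℂ] Op β} (h : HermPreserving T) :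
    HermPreserving (idTensor R T) := fun X => by
  ext i j
  have := congrFun (congrFun (h fun k l => X (j.1, k) (i.1, l)) i.2) j.2
  exact this

lemma HermPreserving.pow {T : Op α →ₗ[ℂ] Op α} (h : HermPreserving T) (n : ℕ) :
    HermPreserving (T ^ n) := by
  induction n with
  | zero => exact hermPreserving_id
  | succ n ih => rw [pow_succ]; exact ih.comp h

lemma isHermitian_ketbra (ψ : α → ℂ) : (ketbra ψ ψ).IsHermitian := by
  ext i j; simp [ketbra, Matrix.vecMulVec_apply, mul_comm]

end Diamond

/-! ### Lukács' theorem on polynomials that are nonnegative on the unit interval. -/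

section Lukacs

open Polynomial

/-- `h = A² + y(1-y) B²` with `deg h ≤ n` if `n` is even, `h = y A² + (1-y) B²` if `n` is odd, with
the corresponding bounds on the degrees of `A` and `B`. -/
def IsWeightedSOS (n : ℕ) (h : ℝ[X]) : Prop :=
  (∃ k, n = 2 * k ∧ ∃ A B : ℝ[X], A.degree ≤ k ∧ B.degree < k ∧ h = A ^ 2 + X * (1 - X) * B ^ 2) ∨
  ∃ k, n = 2 * k + 1 ∧ ∃ A B : ℝ[X], A.degree ≤ k ∧ B.degree ≤ k ∧ h = X * A ^ 2 + (1 - X) * B ^ 2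

lemma degree_le_iff_coeff {A : ℝ[X]} {k : ℕ} : A.degree ≤ k ↔ A.natDegree ≤ k :=
  natDegree_le_iff_degree_le.symm

lemma degree_mul_le_of {A B : ℝ[X]} {a b c : ℕ} (hA : A.degree ≤ a) (hB : B.degree ≤ b)
    (h : a + b ≤ c) : (A * B).degree ≤ c := by
  rw [degree_le_iff_coeff] at *
  exact natDegree_mul_le.trans (by omega)

lemma degree_lt_iff_exists {A : ℝ[X]} {k : ℕ} (h : A.degree < k) :
    A = 0 ∨ ∃ j, k = j + 1 ∧ A.degree ≤ j := by
  by_cases h0 : A = 0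
  · exact Or.inl h0
  · right
    rw [degree_eq_natDegree h0] at h
    have h' : A.natDegree < k := by exact_mod_cast h
    exact ⟨k - 1, by omega, by rw [degree_le_iff_coeff]; omega⟩

lemma degree_mul_lt_of {A B : ℝ[X]} {a b c : ℕ} (hA : A.degree ≤ a) (hB : B.degree < b)
    (h : a + b ≤ c) : (A * B).degree < c := by
  rcases degree_lt_iff_exists hB with rfl | ⟨j, rfl, hj⟩
  · simp
  · refine lt_of_le_of_lt (degree_mul_le_of hA hj (c := a + j) le_rfl) ?_
    exact_mod_cast (by omega : a + j < c)

lemma degree_X_mul_one_sub_X : (X * (1 - X) : ℝ[X]).degree ≤ (2 : ℕ) := by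
  rw [degree_le_iff_coeff]; compute_degree

lemma degree_one_sub_X : (1 - X : ℝ[X]).degree ≤ (1 : ℕ) := by
  rw [degree_le_iff_coeff]; compute_degree

lemma degree_X_le_one : (X : ℝ[X]).degree ≤ (1 : ℕ) := by
  rw [degree_le_iff_coeff]; compute_degree

lemma degree_lin_mul_le {L A B : ℝ[X]} {k l m : ℕ} (hL : L.degree ≤ (2 : ℕ)) (hA : A.degree < k)
    (hB : B.degree < l) (h : k + l ≤ m) : (L * (A * B)).degree ≤ m := by
  rcases degree_lt_iff_exists hA with rfl | ⟨i, rfl, hi⟩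
  · simp
  rcases degree_lt_iff_exists hB with rfl | ⟨j, rfl, hj⟩
  · simp
  exact degree_mul_le_of hL (degree_mul_le_of hi hj le_rfl) (by omega)

lemma degree_lin_mul_le' {L A B : ℝ[X]} {k l m : ℕ} (hL : L.degree ≤ (1 : ℕ)) (hA : A.degree ≤ k)
    (hB : B.degree < l) (h : k + l ≤ m) : (L * (A * B)).degree ≤ m := by
  rcases degree_lt_iff_exists hB with rfl | ⟨j, rfl, hj⟩
  · simp
  exact degree_mul_le_of hL (degree_mul_le_of hA hj le_rfl) (by omega)

lemma degree_sub_le_of {A B : ℝ[X]} {n : WithBot ℕ} (hA : A.degree ≤ n) (hB : B.degree ≤ n) :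
    (A - B).degree ≤ n := (degree_sub_le _ _).trans (max_le hA hB)

lemma degree_add_le_of {A B : ℝ[X]} {n : WithBot ℕ} (hA : A.degree ≤ n) (hB : B.degree ≤ n) :
    (A + B).degree ≤ n := (degree_add_le _ _).trans (max_le hA hB)

/-- Brahmagupta-type identities. With `w = X (1 - X)`, for instance, `(A² + w B²)(A'² + w B'²) = (A
A' - w B B')² + w (A B' + A' B)²`; the other parities redistribute the factors `X` and `1 - X`. -/
lemma IsWeightedSOS.mul {m n : ℕ} {f g : ℝ[X]} (hf : IsWeightedSOS m f) (hg : IsWeightedSOS n g) :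
    IsWeightedSOS (m + n) (f * g) := by
  have mixed : ∀ {m n : ℕ} {f g : ℝ[X]},
      (∃ k, m = 2 * k ∧ ∃ A B : ℝ[X], A.degree ≤ k ∧ B.degree < k ∧
        f = A ^ 2 + X * (1 - X) * B ^ 2) →
      (∃ k, n = 2 * k + 1 ∧ ∃ A B : ℝ[X], A.degree ≤ k ∧ B.degree ≤ k ∧
        g = X * A ^ 2 + (1 - X) * B ^ 2) → IsWeightedSOS (m + n) (f * g) := by
    rintro m n f g ⟨k, rfl, A, B, hA, hB, rfl⟩ ⟨l, rfl, A', B', hA', hB', rfl⟩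
    refine Or.inr ⟨k + l, by ring, A * A' - (1 - X) * (B' * B), A * B' + X * (A' * B), ?_, ?_,
      by ring⟩
    · exact degree_sub_le_of (degree_mul_le_of hA hA' le_rfl)
        (degree_lin_mul_le' degree_one_sub_X hB' hB (by omega))
    · exact degree_add_le_of (degree_mul_le_of hA hB' le_rfl)
        (degree_lin_mul_le' degree_X_le_one hA' hB (by omega))
  rcases hf with hf | hf <;> rcases hg with hg | hg
  · obtain ⟨k, rfl, A, B, hA, hB, rfl⟩ := hf
    obtain ⟨l, rfl, A', B', hA', hB', rfl⟩ := hg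
    refine Or.inl ⟨k + l, by ring, A * A' - X * (1 - X) * (B * B'), A * B' + A' * B, ?_, ?_, by ring⟩
    · exact degree_sub_le_of (degree_mul_le_of hA hA' le_rfl)
        (degree_lin_mul_le degree_X_mul_one_sub_X hB hB' le_rfl)
    · exact lt_of_le_of_lt (degree_add_le _ _) (max_lt (degree_mul_lt_of hA hB' le_rfl)
        (degree_mul_lt_of hA' hB (by omega)))
  · exact mixed hf hg
  · rw [add_comm, mul_comm]; exact mixed hg hf
  · obtain ⟨k, rfl, A, B, hA, hB, rfl⟩ := hf
    obtain ⟨l, rfl, A', B', hA', hB', rfl⟩ := hg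
    refine Or.inl ⟨k + l + 1, by ring, X * (A * A') - (1 - X) * (B * B'), A * B' + A' * B, ?_, ?_,
      by ring⟩
    · exact degree_sub_le_of
        (degree_mul_le_of degree_X_le_one (degree_mul_le_of hA hA' le_rfl) (by omega))
        (degree_mul_le_of degree_one_sub_X (degree_mul_le_of hB hB' le_rfl) (by omega))
    · refine lt_of_le_of_lt (degree_add_le_of (n := ((k + l : ℕ) : WithBot ℕ))
        (degree_mul_le_of hA hB' le_rfl) (degree_mul_le_of hA' hB (by omega))) ?_
      exact_mod_cast Nat.lt_succ_self _

lemma isWeightedSOS_C {c : ℝ} (hc : 0 ≤ c) : IsWeightedSOS 0 (C c) := by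
  refine Or.inl ⟨0, rfl, C √c, 0, degree_C_le, by simp, ?_⟩
  rw [← C_pow, Real.sq_sqrt hc]; ring

lemma isWeightedSOS_linear {a b : ℝ} (ha : 0 ≤ a) (hb : 0 ≤ b) :
    IsWeightedSOS 1 (C a * X + C b * (1 - X)) := by
  refine Or.inr ⟨0, rfl, C √a, C √b, degree_C_le, degree_C_le, ?_⟩
  rw [← C_pow, ← C_pow, Real.sq_sqrt ha, Real.sq_sqrt hb]; ring

lemma isWeightedSOS_one (n : ℕ) : IsWeightedSOS n 1 := by
  induction n with
  | zero => simpa using isWeightedSOS_C zero_le_one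
  | succ n ih =>
    have h := ih.mul (isWeightedSOS_linear (a := 1) (b := 1) zero_le_one zero_le_one)
    simpa using h

lemma isWeightedSOS_sq_linear (a : ℝ) : IsWeightedSOS 2 ((X - C a) ^ 2) := by
  refine Or.inl ⟨1, rfl, X - C a, 0, ?_, ?_, by ring⟩
  · rw [degree_le_iff_coeff]; compute_degree
  · simp

/-- The quadratic takes the values `|z|²` at `0` and `|1 - z|²` at `1`, as does the square of the
linear form running from `-|z|` to `|1 - z|`. So they differ by a multiple of `X (1 - X)`, with
coefficient `(|z| + |1 - z|)² - 1`, nonnegative by the triangle inequality. -/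
lemma isWeightedSOS_quadratic (z : ℂ) :
    IsWeightedSOS 2 (X ^ 2 - C (2 * z.re) * X + C (‖z‖ ^ 2)) := by
  set β := ‖z‖ with hβ
  set γ := ‖1 - z‖ with hγ
  have h1 : 1 ≤ β + γ := by
    have := norm_add_le z (1 - z)
    simpa using this
  have h0 : 0 ≤ β + γ := by positivity
  have hγ2 : γ ^ 2 = 1 - 2 * z.re + β ^ 2 := by
    rw [hγ, hβ, ← Complex.normSq_eq_norm_sq, ← Complex.normSq_eq_norm_sq, Complex.normSq_apply,
      Complex.normSq_apply]
    simp; ring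
  have h2 : 0 ≤ (β + γ) ^ 2 - 1 := by nlinarith
  refine Or.inl ⟨1, rfl, C (β + γ) * X - C β, C √((β + γ) ^ 2 - 1), ?_, ?_, ?_⟩
  · rw [degree_le_iff_coeff]; compute_degree
  · exact lt_of_le_of_lt degree_C_le (by norm_num)
  · rw [← C_pow, Real.sq_sqrt h2]
    have : (C (2 * z.re) : ℝ[X]) = 1 + C β ^ 2 - C γ ^ 2 := by
      rw [← C_pow, ← C_pow, hγ2]
      simp only [map_sub, map_add, map_one]; ring
    rw [this]
    simp only [map_sub, map_add, map_pow, map_one]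
    ring

/-- A polynomial of degree at most `n` that is nonnegative on the unit interval is a weighted sum
of two squares. -/
theorem isWeightedSOS_of_nonneg {n : ℕ} {h : ℝ[X]} (hn : h.natDegree ≤ n)
    (hpos : ∀ x ∈ Set.Ioo (0 : ℝ) 1, 0 ≤ h.eval x) : IsWeightedSOS n h := by
  induction n using Nat.strong_induction_on generalizing h with
  | _ n ih =>
  by_cases hd : h.natDegree = 0
  · rw [eq_C_of_natDegree_eq_zero hd] at hpos ⊢
    have := (isWeightedSOS_C (c := h.coeff 0) (by simpa using hpos (1 / 2) (by norm_num))).mul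
      (isWeightedSOS_one n)
    simpa using this
  have h0 : h ≠ 0 := fun h0 => hd (by simp [h0])
  obtain ⟨z, hz⟩ : ∃ z : ℂ, aeval z h = 0 := by
    have hdeg : (h.map (algebraMap ℝ ℂ)).degree ≠ 0 := by
      rw [degree_map, degree_eq_natDegree h0]
      exact_mod_cast hd
    obtain ⟨z, hz⟩ := IsAlgClosed.exists_root _ hdeg
    exact ⟨z, by rwa [IsRoot.def, eval_map_algebraMap] at hz⟩
  -- Induction on the degree, splitting off a complex root. A real root outside the open interval
  -- gives a linear factor of constant sign there, one inside gives a square, and a non-real root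
  -- gives a real quadratic; all of these factors are weighted sums of squares.
  by_cases hzi : z.im = 0
  · obtain ⟨a, rfl⟩ : ∃ a : ℝ, z = a := ⟨z.re, Complex.ext rfl (by simpa using hzi)⟩
    have hroot : h.IsRoot a := by
      have := hz
      rw [← Complex.coe_algebraMap, aeval_algebraMap_apply] at this
      rw [IsRoot.def, ← coe_aeval_eq_eval]
      exact (map_eq_zero (algebraMap ℝ ℂ)).mp this
    obtain ⟨g, hg⟩ := dvd_iff_isRoot.mpr hroot
    have hg0 : g ≠ 0 := by rintro rfl; simp [hg] at h0
    have hgd : h.natDegree = 1 + g.natDegree := by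
      rw [hg, natDegree_mul (X_sub_C_ne_zero a) hg0, natDegree_X_sub_C]
    rcases le_or_gt a 0 with ha | ha
    · have hgS := ih (n - 1) (by omega) (h := g) (by omega) (fun x hx => by
        have := hpos x hx
        rw [hg, eval_mul, eval_sub, eval_X, eval_C] at this
        exact nonneg_of_mul_nonneg_right this (by linarith [hx.1]))
      have := (isWeightedSOS_linear (a := 1 - a) (b := -a) (by linarith) (by linarith)).mul hgS
      rw [show 1 + (n - 1) = n by omega] at this
      convert this using 1
      rw [hg]; simp only [map_sub, map_neg, map_one]; ring
    rcases le_or_gt 1 a with ha1 | ha1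
    · have hgS := ih (n - 1) (by omega) (h := -g) (by rw [natDegree_neg]; omega) (fun x hx => by
        have := hpos x hx
        rw [hg, eval_mul, eval_sub, eval_X, eval_C] at this
        rw [eval_neg]
        have hx2 := hx.2
        by_contra hc
        nlinarith)
      have := (isWeightedSOS_linear (a := a - 1) (b := a) (by linarith) (by linarith)).mul hgS
      rw [show 1 + (n - 1) = n by omega] at this
      convert this using 1
      rw [hg]; simp only [map_sub, map_one]; ring
    -- A zero inside the interval is a minimum of `h`, so the derivative vanishes as well and the
    -- root is double.
    · have hmin : IsLocalMin (fun x => h.eval x) a := by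
        filter_upwards [Ioo_mem_nhds ha ha1] with x hx
        rw [hroot.eq_zero]; exact hpos x hx
      have hder := hmin.deriv_eq_zero
      rw [Polynomial.deriv, hg] at hder
      have hga : g.IsRoot a := by
        simpa [derivative_mul] using hder
      obtain ⟨f, hf⟩ := dvd_iff_isRoot.mpr hga
      have hf0 : f ≠ 0 := by rintro rfl; simp [hf] at hg0
      have hfd : g.natDegree = 1 + f.natDegree := by
        rw [hf, natDegree_mul (X_sub_C_ne_zero a) hf0, natDegree_X_sub_C]
      have hne : ∀ x ∈ Set.Ioo (0 : ℝ) 1, x ≠ a → 0 ≤ f.eval x := fun x hx hxa => by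
        have := hpos x hx
        rw [hg, hf, ← mul_assoc, eval_mul, eval_mul, eval_sub, eval_X, eval_C] at this
        exact nonneg_of_mul_nonneg_right this (mul_self_pos.mpr (sub_ne_zero.mpr hxa))
      -- Division by the square gives no information at `a` itself; nonnegativity there follows by
      -- density and continuity.
      have hfS := ih (n - 2) (by omega) (h := f) (by omega) (fun x hx => by
        have hcl : x ∈ closure (Set.Ioo (0 : ℝ) 1 ∩ {a}ᶜ) :=
          Dense.open_subset_closure_inter (dense_compl_singleton a) isOpen_Ioo hx
        have hclosed : IsClosed {y : ℝ | 0 ≤ f.eval y} :=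
          isClosed_le continuous_const f.continuous
        exact closure_minimal (fun y hy => hne y hy.1 hy.2) hclosed hcl)
      have := (isWeightedSOS_sq_linear a).mul hfS
      rw [show 2 + (n - 2) = n by omega] at this
      convert this using 1
      rw [hg, hf]; ring
  · obtain ⟨g, hg⟩ := quadratic_dvd_of_aeval_eq_zero_im_ne_zero h hz hzi
    have hg0 : g ≠ 0 := by rintro rfl; simp [hg] at h0
    have hqd : (X ^ 2 - C (2 * z.re) * X + C (‖z‖ ^ 2) : ℝ[X]).natDegree = 2 := by
      compute_degree!
    have hq0 : (X ^ 2 - C (2 * z.re) * X + C (‖z‖ ^ 2) : ℝ[X]) ≠ 0 := by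
      intro hq; rw [hq] at hqd; simp at hqd
    have hgd : h.natDegree = 2 + g.natDegree := by
      rw [hg, natDegree_mul hq0 hg0, hqd]
    have hgS := ih (n - 2) (by omega) (h := g) (by omega) (fun x hx => by
      have := hpos x hx
      rw [hg, eval_mul] at this
      refine nonneg_of_mul_nonneg_right this ?_
      have hn : ‖z‖ ^ 2 = z.re * z.re + z.im * z.im := by
        rw [← Complex.normSq_eq_norm_sq, Complex.normSq_apply]
      have := mul_self_pos.mpr hzi
      simp only [eval_add, eval_sub, eval_pow, eval_X, eval_mul, eval_C, hn]
      nlinarith [sq_nonneg (x - z.re)])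
    have := (isWeightedSOS_quadratic z).mul hgS
    rw [show 2 + (n - 2) = n by omega] at this
    rwa [hg]

end Lukacs

/-! ### Quantum signal processing: phases from polynomials. -/

section SignalProcessing

open Polynomial

/-- One step of quantum signal processing, on the pair of polynomials in the first column. -/
def qspStep (S : ℂ[X] × ℂ[X]) (φ : ℝ) : ℂ[X] × ℂ[X] :=
  (C (Complex.exp (Complex.I * φ)) * (X * S.1 + (1 - X ^ 2) * S.2),
    C (Complex.exp (-(Complex.I * φ))) * (S.1 - X * S.2))

/-- The polynomials produced by a sequence of phases. -/
def qspPoly (Φ : List ℝ) : ℂ[X] × ℂ[X] := Φ.foldl qspStep (1, 0)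

lemma qspPoly_concat (Φ : List ℝ) (φ : ℝ) : qspPoly (Φ ++ [φ]) = qspStep (qspPoly Φ) φ := by
  simp [qspPoly, List.foldl_append]

/-- The polynomial with complex conjugate coefficients. -/
def conjPoly (P : ℂ[X]) : ℂ[X] := P.map (starRingEnd ℂ)

lemma coeff_conjPoly (P : ℂ[X]) (n : ℕ) : (conjPoly P).coeff n = star (P.coeff n) := by
  simp [conjPoly]

lemma star_exp_I_mul (φ : ℝ) :
    (starRingEnd ℂ) (Complex.exp (Complex.I * φ)) = Complex.exp (-(Complex.I * φ)) := by
  rw [← Complex.exp_conj]; simp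

lemma star_exp_neg_I_mul (φ : ℝ) :
    (starRingEnd ℂ) (Complex.exp (-(Complex.I * φ))) = Complex.exp (Complex.I * φ) := by
  rw [← Complex.exp_conj]; simp

lemma conjPoly_qspStep (S : ℂ[X] × ℂ[X]) (φ : ℝ) :
    qspStep (conjPoly S.1, conjPoly S.2) (-φ) =
      (conjPoly (qspStep S φ).1, conjPoly (qspStep S φ).2) := by
  simp only [qspStep, conjPoly, Polynomial.map_mul, Polynomial.map_add, Polynomial.map_sub, map_C,
    map_X, Polynomial.map_pow, Polynomial.map_one, star_exp_I_mul, star_exp_neg_I_mul]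
  push_cast
  simp only [mul_neg, neg_neg]

lemma foldl_qspStep_neg (Φ : List ℝ) (S : ℂ[X] × ℂ[X]) :
    (Φ.map Neg.neg).foldl qspStep (conjPoly S.1, conjPoly S.2) =
      (conjPoly (Φ.foldl qspStep S).1, conjPoly (Φ.foldl qspStep S).2) := by
  induction Φ generalizing S with
  | nil => rfl
  | cons φ Φ ih => rw [List.map_cons, List.foldl_cons, conjPoly_qspStep, ih]; rfl

/-- Averaging a sequence of phases with its negative therefore yields the polynomial with the real
parts of the coefficients. -/
lemma qspPoly_neg (Φ : List ℝ) :
    qspPoly (Φ.map Neg.neg) = (conjPoly (qspPoly Φ).1, conjPoly (qspPoly Φ).2) := by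
  have h := foldl_qspStep_neg Φ (1, 0)
  simpa [qspPoly, conjPoly] using h

/-- `P` and `R` form the first column of a quantum signal processing sequence of length `n`. -/
structure IsQSPPair (n : ℕ) (P R : ℂ[X]) : Prop where
  degree_left : ∀ k, n < k → P.coeff k = 0
  degree_right : ∀ k, n ≤ k → R.coeff k = 0
  parity_left : ∀ k, Odd (k + n) → P.coeff k = 0
  parity_right : ∀ k, Even (k + n) → R.coeff k = 0
  unitary : P * conjPoly P + (1 - X ^ 2) * (R * conjPoly R) = 1

/-- The coefficient of `X ^ (2 n + 2)` in the unitarity relation is `|p|² - |r|²` for the two top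
coefficients. Equal moduli are what lets a single phase cancel both leading terms. -/
lemma IsQSPPair.norm_coeff_eq {n : ℕ} {P R : ℂ[X]} (h : IsQSPPair (n + 1) P R) :
    ‖P.coeff (n + 1)‖ = ‖R.coeff n‖ := by
  have hP : P.natDegree ≤ n + 1 := natDegree_le_iff_coeff_eq_zero.mpr fun k hk => h.degree_left k hk
  have hR : R.natDegree ≤ n := natDegree_le_iff_coeff_eq_zero.mpr fun k hk => h.degree_right k hk
  have hP' : (conjPoly P).natDegree ≤ n + 1 := natDegree_map_le.trans hP
  have hR' : (conjPoly R).natDegree ≤ n := natDegree_map_le.trans hR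
  have hu := congrArg (fun p => p.coeff ((n + 1) + (n + 1))) h.unitary
  have hRR : (R * conjPoly R).coeff (n + n) = R.coeff n * star (R.coeff n) := by
    rw [coeff_mul_add_eq_of_natDegree_le hR hR', coeff_conjPoly]
  have hRR2 : (R * conjPoly R).coeff (n + 1 + (n + 1)) = 0 := by
    refine coeff_eq_zero_of_natDegree_lt (lt_of_le_of_lt natDegree_mul_le ?_)
    omega
  simp only [coeff_add] at hu
  rw [coeff_mul_add_eq_of_natDegree_le hP hP', coeff_conjPoly, sub_mul, one_mul, coeff_sub, hRR2,
    show n + 1 + (n + 1) = n + n + 2 by ring, mul_comm (X ^ 2), coeff_mul_X_pow, hRR] at hu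
  have h1 : (1 : ℂ[X]).coeff (n + n + 2) = 0 := by
    rw [coeff_one]; simp
  rw [h1, zero_sub, ← sub_eq_add_neg, sub_eq_zero] at hu
  simp only [RCLike.star_def, Complex.mul_conj, Complex.normSq_eq_norm_sq] at hu
  have hu' : ‖P.coeff (n + 1)‖ ^ 2 = ‖R.coeff n‖ ^ 2 := by exact_mod_cast hu
  exact (sq_eq_sq₀ (norm_nonneg _) (norm_nonneg _)).mp hu'

lemma exists_phase_mul_eq {p r : ℂ} (h : ‖p‖ = ‖r‖) :
    ∃ φ : ℝ, Complex.exp (-(Complex.I * φ)) * p = Complex.exp (Complex.I * φ) * r := by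
  by_cases hr : r = 0
  · refine ⟨0, ?_⟩
    have : p = 0 := by rw [← norm_eq_zero, h, hr, norm_zero]
    simp [this, hr]
  · have hn : ‖p / r‖ = 1 := by rw [norm_div, h, div_self (norm_ne_zero_iff.mpr hr)]
    refine ⟨(p / r).arg / 2, ?_⟩
    have h1 := Complex.norm_mul_exp_arg_mul_I (p / r)
    rw [hn, Complex.ofReal_one, one_mul] at h1
    have hp : p = Complex.exp ((p / r).arg * Complex.I) * r := by
      rw [h1, div_mul_cancel₀ _ hr]
    generalize (p / r).arg = t at hp
    rw [hp, ← mul_assoc, ← Complex.exp_add]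
    congr 2
    push_cast; ring

lemma exp_mul_exp_neg (φ : ℝ) :
    (C (Complex.exp (Complex.I * φ)) * C (Complex.exp (-(Complex.I * φ))) : ℂ[X]) = 1 := by
  rw [← C_mul, ← Complex.exp_add, add_neg_cancel, Complex.exp_zero, C_1]

/-- The new pair is obtained by inverting one step. The phase is chosen with `e^{-iφ} p = e^{iφ} r`,
which cancels the top coefficients; the next ones vanish by parity, so the length drops by one. -/
lemma IsQSPPair.exists_step {n : ℕ} {P R : ℂ[X]} (h : IsQSPPair (n + 1) P R) :
    ∃ (φ : ℝ) (P' R' : ℂ[X]), IsQSPPair n P' R' ∧ qspStep (P', R') φ = (P, R) := by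
  obtain ⟨φ, hφ⟩ := exists_phase_mul_eq h.norm_coeff_eq
  set e := Complex.exp (Complex.I * φ) with he
  set f := Complex.exp (-(Complex.I * φ)) with hf
  have hef : (C e * C f : ℂ[X]) = 1 := exp_mul_exp_neg φ
  have cs : conjPoly (C e) = C f := by
    simp [conjPoly, he, hf, star_exp_I_mul]
  have cs' : conjPoly (C f) = C e := by
    simp [conjPoly, he, hf, star_exp_neg_I_mul]
  refine ⟨φ, X * (C f * P) + (1 - X ^ 2) * (C e * R), C f * P - X * (C e * R),
    ⟨?_, ?_, ?_, ?_, ?_⟩, ?_⟩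
  · intro k hk
    obtain ⟨k, rfl⟩ : ∃ j, k = j + 1 := ⟨k - 1, by omega⟩
    rw [sub_mul, one_mul, mul_comm (X ^ 2)]
    simp only [coeff_add, coeff_sub, coeff_X_mul, coeff_C_mul, coeff_mul_X_pow']
    rcases Nat.lt_or_ge k (n + 1) with hk1 | hk1
    · have hk2 : k = n := by omega
      subst hk2
      rw [h.parity_left k ⟨k, by ring⟩, h.degree_right (k + 1) le_rfl]
      split_ifs with h2
      · rw [h.parity_right (k + 1 - 2) ⟨k, by omega⟩]; ring
      · ring
    · rcases hk1.eq_or_lt with hk2 | hk2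
      · subst hk2
        rw [h.degree_right (n + 1 + 1) (by omega), if_pos (by omega),
          show n + 1 + 1 - 2 = n by omega, hφ]; ring
      · rw [h.degree_left k hk2, h.degree_right (k + 1) (by omega), if_pos (by omega),
          h.degree_right (k + 1 - 2) (by omega)]; ring
  · intro k hk
    rcases Nat.eq_zero_or_pos k with h0 | h0
    · subst h0
      have : n = 0 := by omega
      subst this
      simp only [coeff_sub, coeff_C_mul, coeff_X_mul_zero]
      rw [h.parity_left 0 ⟨0, rfl⟩]; ring
    · obtain ⟨k, rfl⟩ : ∃ j, k = j + 1 := ⟨k - 1, by omega⟩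
      simp only [coeff_sub, coeff_X_mul, coeff_C_mul]
      rcases Nat.lt_or_ge k n with hk1 | hk1
      · have : n = k + 1 := by omega
        subst this
        rw [h.parity_left (k + 1) ⟨k + 1, by ring⟩, h.parity_right k ⟨k + 1, by ring⟩]; ring
      · rcases hk1.eq_or_lt with hk2 | hk2
        · subst hk2; rw [hφ]; ring
        · rw [h.degree_left (k + 1) (by omega), h.degree_right k (by omega)]; ring
  · intro k hk
    rw [sub_mul, one_mul, mul_comm (X ^ 2)]
    simp only [coeff_add, coeff_sub, coeff_C_mul, coeff_mul_X_pow']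
    have h1 : (X * (C f * P)).coeff k = 0 := by
      rcases k with _ | k
      · simp
      · rw [coeff_X_mul, coeff_C_mul, h.parity_left k (by
          have : k + 1 + n = k + (n + 1) := by ring
          rwa [this] at hk), mul_zero]
    have h2 : R.coeff k = 0 := h.parity_right k (by
      rw [← add_assoc]; exact hk.add_one)
    rw [h1, h2]
    split_ifs with h3
    · rw [h.parity_right (k - 2) (by
        have : k + n + 1 = k - 2 + (n + 1) + 2 := by omega
        have h4 := hk.add_one
        rw [this] at h4
        simpa [Nat.even_add] using h4)]; ring
    · ring
  · intro k hk
    simp only [coeff_sub, coeff_C_mul]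
    have h1 : (X * (C e * R)).coeff k = 0 := by
      rcases k with _ | k
      · simp
      · rw [coeff_X_mul, coeff_C_mul, h.parity_right k (by
          have : k + 1 + n = k + (n + 1) := by ring
          rwa [this] at hk), mul_zero]
    rw [h1, h.parity_left k (by rw [← add_assoc]; exact hk.add_one)]; ring
  · have hu := h.unitary
    have c1 : conjPoly (X * (C f * P) + (1 - X ^ 2) * (C e * R)) =
        X * (C e * conjPoly P) + (1 - X ^ 2) * (C f * conjPoly R) := by
      rw [← cs, ← cs']; simp [conjPoly]
    have c2 : conjPoly (C f * P - X * (C e * R)) =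
        C e * conjPoly P - X * (C f * conjPoly R) := by
      rw [← cs, ← cs']; simp [conjPoly]
    rw [c1, c2]
    linear_combination (C e * C f) * hu + hef
  · simp only [qspStep, Prod.mk.injEq]
    constructor
    · linear_combination P * hef
    · linear_combination R * hef

lemma IsQSPPair.exists_phases {n : ℕ} {P R : ℂ[X]} (h : IsQSPPair n P R) :
    ∃ (Φ : List ℝ) (φ₀ : ℝ), Φ.length = n ∧
      P = C (Complex.exp (Complex.I * φ₀)) * (qspPoly Φ).1 ∧
      R = C (Complex.exp (Complex.I * φ₀)) * (qspPoly Φ).2 := by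
  induction n generalizing P R with
  | zero =>
    have hR : R = 0 := by ext k; simpa using h.degree_right k (Nat.zero_le k)
    have hP : P = C (P.coeff 0) := by
      ext k
      rcases k with _ | k
      · simp
      · rw [h.degree_left (k + 1) (by omega)]; simp
    have hu := congrArg (fun p => p.coeff 0) h.unitary
    have hn : ‖P.coeff 0‖ = ‖(1 : ℂ)‖ := by
      rw [hR] at hu
      simp only [mul_coeff_zero, coeff_conjPoly, zero_mul, mul_zero,
        add_zero, coeff_one_zero, RCLike.star_def, Complex.mul_conj,
        Complex.normSq_eq_norm_sq] at hu
      have hu' : ‖P.coeff 0‖ ^ 2 = 1 := by exact_mod_cast hu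
      rw [norm_one]
      exact (sq_eq_sq₀ (norm_nonneg _) zero_le_one).mp (by rw [hu', one_pow])
    obtain ⟨φ, hφ⟩ := exists_phase_mul_eq hn
    refine ⟨[], 2 * φ, rfl, ?_, ?_⟩
    · have hc : P.coeff 0 = Complex.exp (Complex.I * (2 * φ : ℝ)) := by
        have : P.coeff 0 = Complex.exp (Complex.I * φ) *
            (Complex.exp (-(Complex.I * φ)) * P.coeff 0) := by
          rw [← mul_assoc, ← Complex.exp_add, add_neg_cancel, Complex.exp_zero, one_mul]
        rw [this, hφ, mul_one, ← Complex.exp_add]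
        congr 1; push_cast; ring
      rw [← hc]; simpa [qspPoly] using hP
    · simp [qspPoly, hR]
  | succ n ih =>
    obtain ⟨φ, P', R', h', hstep⟩ := h.exists_step
    obtain ⟨Φ, φ₀, hlen, hP', hR'⟩ := ih h'
    refine ⟨Φ ++ [φ], φ₀, by simp [hlen], ?_, ?_⟩
    · have : (qspStep (P', R') φ).1 = P := congrArg Prod.fst hstep
      rw [qspPoly_concat, ← this, hP', hR']
      simp only [qspStep]; ring
    · have : (qspStep (P', R') φ).2 = R := congrArg Prod.snd hstep
      rw [qspPoly_concat, ← this, hP', hR']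
      simp only [qspStep]; ring

/-- The leftover global phase is merged into the last phase. This alters `R` by a phase, so only `P`
is matched, which is all that the block depends on. -/
lemma IsQSPPair.exists_qspPoly_eq {n : ℕ} {P R : ℂ[X]} (h : IsQSPPair (n + 1) P R) :
    ∃ Φ : List ℝ, Φ.length = n + 1 ∧ (qspPoly Φ).1 = P := by
  obtain ⟨Φ, φ₀, hlen, hP, -⟩ := h.exists_phases
  rcases List.eq_nil_or_concat Φ with rfl | ⟨Ψ, φ, rfl⟩
  · simp at hlen
  refine ⟨Ψ ++ [φ + φ₀], by simpa using hlen, ?_⟩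
  rw [hP, List.concat_eq_append, qspPoly_concat, qspPoly_concat]
  simp only [qspStep]
  have : Complex.exp (Complex.I * ((φ + φ₀ : ℝ) : ℂ)) =
      Complex.exp (Complex.I * φ₀) * Complex.exp (Complex.I * φ) := by
    rw [← Complex.exp_add]; congr 1; push_cast; ring
  rw [this, C_mul, mul_assoc]

/-- Every odd real polynomial that is bounded by `1` on `[-1, 1]` is the real part of a quantum
signal processing polynomial. -/
theorem exists_phases_of_odd {k : ℕ} {p : ℝ[X]} (hdeg : p.natDegree ≤ 2 * k + 1)
    (hodd : ∀ j, Even j → p.coeff j = 0) (hb : ∀ x ∈ Set.Icc (-1 : ℝ) 1, |p.eval x| ≤ 1) :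
    ∃ Φ : List ℝ, Φ.length = 2 * k + 1 ∧
      (qspPoly Φ).1 + conjPoly (qspPoly Φ).1 = 2 * p.map (algebraMap ℝ ℂ) := by
  set p₁ : ℝ[X] := contract 2 p.divX with hp₁
  have hp : p = X * expand ℝ 2 p₁ := by
    ext j
    rcases j with _ | j
    · rw [hodd 0 (by simp)]; simp
    · rw [coeff_X_mul, coeff_expand (by norm_num)]
      split_ifs with h
      · obtain ⟨i, rfl⟩ := h
        rw [hp₁, coeff_contract (by norm_num), coeff_divX, Nat.mul_div_cancel_left _ (by norm_num),
          mul_comm]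
      · exact hodd _ (by
          rw [Nat.even_add_one]
          intro h2; exact h h2.two_dvd)
  have hp₁d : p₁.natDegree ≤ k := by
    refine natDegree_le_iff_coeff_eq_zero.mpr fun j hj => ?_
    rw [hp₁, coeff_contract (by norm_num), coeff_divX]
    exact coeff_eq_zero_of_natDegree_lt (by omega)
  have hev : ∀ x : ℝ, p.eval x = x * p₁.eval (x ^ 2) := fun x => by
    conv_lhs => rw [hp]
    simp [expand_eval]
  -- At `y = x²` the polynomial equals `1 - p(x)²`, hence is nonnegative. Its degree bound is odd,
  -- so Lukács' theorem supplies the weights `y` and `1 - y`.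
  obtain ⟨j, hj, A, B, hA, hB, hAB⟩ : ∃ j, 2 * k + 1 = 2 * j + 1 ∧ ∃ A B : ℝ[X],
      A.degree ≤ j ∧ B.degree ≤ j ∧ 1 - X * p₁ ^ 2 = X * A ^ 2 + (1 - X) * B ^ 2 := by
    have h := isWeightedSOS_of_nonneg (n := 2 * k + 1) (h := 1 - X * p₁ ^ 2) (by
      refine (natDegree_sub_le _ _).trans (max_le (by simp) ?_)
      refine natDegree_mul_le.trans ?_
      rw [natDegree_X]
      have := natDegree_pow_le (p := p₁) (n := 2)
      omega) (fun y hy => by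
        have h1 := hb √y ⟨by linarith [Real.sqrt_nonneg y], Real.sqrt_le_one.mpr hy.2.le⟩
        rw [hev, Real.sq_sqrt hy.1.le] at h1
        have h2 := (sq_le_one_iff_abs_le_one _).mpr h1
        rw [mul_pow, Real.sq_sqrt hy.1.le] at h2
        simp only [eval_sub, eval_one, eval_mul, eval_X, eval_pow]
        linarith)
    rcases h with ⟨j, hj, -⟩ | h
    · omega
    · exact h
  have hjk : j = k := by omega
  subst hjk
  rw [degree_le_iff_coeff] at hA hB
  set ι := algebraMap ℝ ℂ
  -- With `P = p + i x A(x²)` and `R = B(x²)`, unitarity is exactly the decomposition at `y = x²`,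
  -- and `p` is the real part of `P`.
  set P : ℂ[X] := p.map ι + C Complex.I * (X * expand ℂ 2 (A.map ι)) with hP
  set R : ℂ[X] := expand ℂ 2 (B.map ι) with hR
  have conj_map : ∀ q : ℝ[X], conjPoly (q.map ι) = q.map ι := fun q => by
    rw [conjPoly, Polynomial.map_map]
    congr 1
    ext x; simp [ι]
  have conj_exp : ∀ q : ℝ[X], conjPoly (expand ℂ 2 (q.map ι)) = expand ℂ 2 (q.map ι) := fun q => by
    rw [← map_expand, conj_map]
  have hcP : conjPoly P = p.map ι - C Complex.I * (X * expand ℂ 2 (A.map ι)) := by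
    have h1 := conj_map p
    have h2 := conj_exp A
    rw [hP]
    simp only [conjPoly, Polynomial.map_add, Polynomial.map_mul, map_C, map_X] at h1 h2 ⊢
    rw [h1, h2]
    simp [sub_eq_add_neg]
  have coeffXexp : ∀ (q : ℂ[X]) (i : ℕ), Even i → (X * expand ℂ 2 q).coeff i = 0 := by
    intro q i hi
    rcases i with _ | i
    · simp
    · rw [coeff_X_mul, coeff_expand (by norm_num), if_neg]
      intro h2
      exact (Nat.even_add_one.mp hi) (even_iff_two_dvd.mpr h2)
  have coeffXexp' : ∀ (q : ℝ[X]) (i : ℕ), q.natDegree ≤ j → 2 * j + 1 < i →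
      (X * expand ℂ 2 (q.map ι)).coeff i = 0 := by
    intro q i hq hi
    obtain ⟨i, rfl⟩ : ∃ l, i = l + 1 := ⟨i - 1, by omega⟩
    rw [coeff_X_mul, coeff_expand (by norm_num)]
    split_ifs with h2
    · rw [coeff_map, coeff_eq_zero_of_natDegree_lt (by omega), map_zero]
    · rfl
  have hpair : IsQSPPair (2 * j + 1) P R := by
    refine ⟨fun i hi => ?_, fun i hi => ?_, fun i hi => ?_, fun i hi => ?_, ?_⟩
    · rw [hP, coeff_add, coeff_map, coeff_eq_zero_of_natDegree_lt (by omega), coeff_C_mul,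
        coeffXexp' A i hA hi]; simp
    · rw [hR, coeff_expand (by norm_num)]
      split_ifs with h2
      · rw [coeff_map, coeff_eq_zero_of_natDegree_lt (by omega), map_zero]
      · rfl
    · have hi' : Even i := by
        have : Odd (2 * j + 1) := ⟨j, rfl⟩
        rw [Nat.odd_add] at hi
        by_contra hc
        exact (Nat.not_even_iff_odd.mpr this) (hi.mp (Nat.not_even_iff_odd.mp hc))
      rw [hP, coeff_add, coeff_map, hodd i hi', coeff_C_mul, coeffXexp _ i hi']; simp
    · rw [hR, coeff_expand (by norm_num), if_neg]
      intro h2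
      obtain ⟨l, rfl⟩ := h2
      have : Odd (2 * l + (2 * j + 1)) := ⟨l + j, by ring⟩
      exact (Nat.not_even_iff_odd.mpr this) hi
    · have hRR : conjPoly R = R := conj_exp B
      rw [hcP, hRR]
      have key := congrArg (fun q => expand ℂ 2 (q.map ι)) hAB
      simp only [Polynomial.map_sub, Polynomial.map_one, Polynomial.map_mul, map_X,
        Polynomial.map_pow, Polynomial.map_add, map_sub, map_add, map_mul, map_one, map_pow,
        expand_X] at key
      have hpm : p.map ι = X * expand ℂ 2 (p₁.map ι) := by
        conv_lhs => rw [hp]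
        rw [Polynomial.map_mul, map_X, map_expand]
      have hI : (C Complex.I * C Complex.I : ℂ[X]) = -1 := by
        rw [← C_mul, Complex.I_mul_I]; simp
      rw [hP, hpm]
      linear_combination -key - (X * expand ℂ 2 (A.map ι)) ^ 2 * hI
  obtain ⟨Φ, hlen, hΦ⟩ := hpair.exists_qspPoly_eq
  refine ⟨Φ, hlen, ?_⟩
  rw [hΦ, hcP, hP]; ring

end SignalProcessing

/-! ### Polynomial approximation of the sign function. -/

section SignApproximation

open Polynomial

lemma coeff_eq_zero_of_eval_neg {p : ℝ[X]} (h : ∀ x, p.eval (-x) = -p.eval x) {j : ℕ}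
    (hj : Even j) : p.coeff j = 0 := by
  have h1 : p.comp (C (-1) * X) = -p := by
    refine Polynomial.funext fun x => ?_
    simpa [eval_comp] using h x
  have h2 := congrArg (fun q => q.coeff j) h1
  simp only [comp_C_mul_X_coeff, coeff_neg, hj.neg_one_pow, mul_one] at h2
  linarith

lemma exists_antiderivative (k : ℝ[X]) :
    ∃ Q : ℝ[X], derivative Q = k ∧ Q.eval 0 = 0 ∧ Q.natDegree ≤ k.natDegree + 1 := by
  refine ⟨∑ i ∈ Finset.range (k.natDegree + 1), monomial (i + 1) (k.coeff i / (i + 1)), ?_, ?_, ?_⟩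
  · rw [derivative_sum]
    conv_rhs => rw [k.as_sum_range]
    refine Finset.sum_congr rfl fun i _ => ?_
    rw [derivative_monomial]
    push_cast
    rw [div_mul_cancel₀]
    positivity
  · rw [eval_finsetSum]
    exact Finset.sum_eq_zero fun i _ => by simp
  · refine natDegree_sum_le_of_forall_le _ _ fun i hi => ?_
    refine (natDegree_monomial_le _).trans ?_
    have := Finset.mem_range.mp hi
    omega

lemma mul_sub_le_eval_sub {q : ℝ[X]} {a b c : ℝ} (hab : a ≤ b)
    (h : ∀ x ∈ Set.Ioo a b, c ≤ (derivative q).eval x) : c * (b - a) ≤ q.eval b - q.eval a := by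
  refine (convex_Icc a b).mul_sub_le_image_sub_of_le_deriv q.continuous.continuousOn
    q.differentiable.differentiableOn (fun x hx => ?_) a ⟨le_rfl, hab⟩ b ⟨hab, le_rfl⟩ hab
  rw [interior_Icc] at hx
  rw [Polynomial.deriv]; exact h x hx

/-- A kernel on `[-1, 1]` that is even and nonnegative integrates to an odd monotone polynomial. -/
lemma exists_odd_of_kernel {k : ℝ[X]} (heven : ∀ x, k.eval (-x) = k.eval x)
    (hpos : ∀ x ∈ Set.Ioo (-1 : ℝ) 1, 0 ≤ k.eval x) :
    ∃ Q : ℝ[X], derivative Q = k ∧ Q.eval 0 = 0 ∧ Q.natDegree ≤ k.natDegree + 1 ∧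
      (∀ x, Q.eval (-x) = -Q.eval x) ∧
      (∀ x y, -1 ≤ x → x ≤ y → y ≤ 1 → Q.eval x ≤ Q.eval y) := by
  obtain ⟨Q, hQ, hQ0, hQd⟩ := exists_antiderivative k
  refine ⟨Q, hQ, hQ0, hQd, ?_, ?_⟩
  · have hd : derivative (Q + Q.comp (-X)) = 0 := by
      refine Polynomial.funext fun x => ?_
      simp [derivative_comp, hQ, eval_comp, heven]
    have hc := eq_C_of_natDegree_eq_zero (derivative_eq_zero.mp hd)
    intro x
    have h0 := congrArg (fun p => p.eval 0) hc
    have hx := congrArg (fun p => p.eval x) hc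
    simp only [eval_add, eval_comp, eval_neg, eval_X, eval_C, neg_zero, hQ0] at h0 hx
    linarith
  · intro x y hx hxy hy
    have := mul_sub_le_eval_sub (q := Q) (c := 0) hxy (fun z hz => by
      rw [hQ]; exact hpos z ⟨by linarith [hz.1], by linarith [hz.2]⟩)
    linarith

/-- An odd polynomial of degree `O(1/t)`, bounded by `1` on `[-1, 1]` and at least `1/2` on
`[t, 1]`. -/
lemma exists_odd_half {t : ℝ} (ht : 0 < t) (ht1 : t ≤ 1) :
    ∃ (l : ℕ) (q : ℝ[X]), (4 * l + 1 : ℝ) ≤ 16 / t ∧ q.natDegree ≤ 4 * l + 1 ∧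
      (∀ x, q.eval (-x) = -q.eval x) ∧
      (∀ x y, -1 ≤ x → x ≤ y → y ≤ 1 → q.eval x ≤ q.eval y) ∧ q.eval 1 = 1 ∧
      1 / 2 ≤ q.eval t := by
  set l := ⌈5 / (2 * t)⌉₊ with hl
  have hl1 : 5 / (2 * t) ≤ l := Nat.le_ceil _
  have hl2 : (l : ℝ) < 5 / (2 * t) + 1 := Nat.ceil_lt_add_one (by positivity)
  set n : ℤ := 2 * l + 1 with hn
  set L : ℝ := 2 * l + 1 with hL
  have hLt : 5 / t ≤ L := by
    have : 5 / (2 * t) = 5 / t / 2 := by field_simp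
    rw [this] at hl1; rw [hL]; linarith
  have hL0 : 0 < L := by positivity
  have hLt1 : 1 / L ≤ t := by
    rw [div_le_iff₀ hL0]
    rw [div_le_iff₀ ht] at hLt
    linarith
  set T := Chebyshev.T ℝ n with hT
  have hTodd : ∀ x, T.eval (-x) = -T.eval x := fun x => by
    rw [hT, Chebyshev.T_eval_neg, Int.negOnePow_odd n ⟨l, by simp [hn]⟩]
    simp
  have hT0 : T.eval 0 = 0 := by have := hTodd 0; simp at this; linarith
  have hTX : T = X * T.divX := by
    conv_lhs => rw [← T.divX_mul_X_add]
    rw [coeff_zero_eq_eval_zero, hT0]; simp [mul_comm]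
  have hTe : ∀ x, T.eval x = x * T.divX.eval x := fun x => by
    conv_lhs => rw [hTX]
    simp
  have hTsin : ∀ θ : ℝ, T.eval (Real.sin θ) ^ 2 = Real.sin (L * θ) ^ 2 := by
    intro θ
    rw [← Real.cos_pi_div_two_sub, hT, Chebyshev.T_real_cos]
    have : ((n : ℝ)) * (Real.pi / 2 - θ) = (l : ℝ) * Real.pi + (Real.pi / 2 - L * θ) := by
      rw [hn, hL]; push_cast; ring
    rw [this, Real.cos_add, Real.sin_nat_mul_pi, zero_mul, sub_zero, Real.cos_pi_div_two_sub,
      mul_pow]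
    have : Real.cos ((l : ℝ) * Real.pi) ^ 2 = 1 := by
      have := Real.sin_sq_add_cos_sq ((l : ℝ) * Real.pi)
      rw [Real.sin_nat_mul_pi] at this; linarith
    rw [this, one_mul]
  -- The kernel `(T_n(x)/x)²`, with `n` odd, equals `(sin nθ / sin θ)²` at `x = sin θ`. It has
  -- height of order `n²` on `[0, 1/n]` and decays like `1/x²`, so most of the mass of its integral
  -- lies near zero.
  set k := T.divX ^ 2 with hk
  have hkx : ∀ x ∈ Set.Ioc (0 : ℝ) 1, k.eval x * x ^ 2 = Real.sin (L * Real.arcsin x) ^ 2 := by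
    intro x hx
    rw [← hTsin, Real.sin_arcsin (by linarith [hx.1]) hx.2, hTe, hk, eval_pow]; ring
  have hkup : ∀ x ∈ Set.Ioc (0 : ℝ) 1, k.eval x * x ^ 2 ≤ 1 := fun x hx => by
    rw [hkx x hx]; exact Real.sin_sq_le_one _
  have hklow : ∀ x ∈ Set.Ioo (0 : ℝ) (1 / L), 4 * L ^ 2 / Real.pi ^ 2 ≤ k.eval x := by
    intro x hx
    have hx1 : x < 1 := hx.2.trans_le (hLt1.trans ht1)
    have e := hkx x ⟨hx.1, hx1.le⟩
    set θ := Real.arcsin x with hθ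
    have hs : Real.sin θ = x := Real.sin_arcsin (by linarith [hx.1]) hx1.le
    have hθ0 : 0 < θ := Real.arcsin_pos.mpr hx.1
    have hθ1 : θ ≤ Real.pi / 2 := Real.arcsin_le_pi_div_two x
    have hpi := Real.pi_pos
    have hxθ : x ≤ θ := by rw [← hs]; exact Real.sin_le hθ0.le
    have hθx : 2 / Real.pi * θ ≤ x := by rw [← hs]; exact Real.mul_le_sin hθ0.le hθ1
    have hLθ : L * θ ≤ Real.pi / 2 := by
      have h1 : x * L < 1 := by rw [← lt_div_iff₀ hL0]; exact hx.2
      have h2 : 2 * θ ≤ x * Real.pi := by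
        rw [div_mul_eq_mul_div, div_le_iff₀ hpi] at hθx; exact hθx
      nlinarith
    have hsin := Real.mul_le_sin (x := L * θ) (by positivity) hLθ
    have h3 : 2 / Real.pi * (L * x) ≤ Real.sin (L * θ) :=
      le_trans (by gcongr) hsin
    have h4 : (2 / Real.pi * (L * x)) ^ 2 ≤ k.eval x * x ^ 2 := by
      rw [e]; exact pow_le_pow_left₀ (by have := hx.1; positivity) h3 2
    have h5 : (2 / Real.pi * (L * x)) ^ 2 = 4 * L ^ 2 / Real.pi ^ 2 * x ^ 2 := by
      field_simp; ring
    rw [h5] at h4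
    exact le_of_mul_le_mul_right h4 (by have := hx.1; positivity)
  obtain ⟨Q, hQ, hQ0, hQd, hQodd, hQmono⟩ := exists_odd_of_kernel (k := k) (fun x => by
      by_cases hx : x = 0
      · simp [hx]
      · have h1 := hTodd x
        rw [hTe, hTe] at h1
        have h2 : T.divX.eval (-x) = T.divX.eval x := mul_left_cancel₀ hx (by linarith)
        rw [hk, eval_pow, eval_pow, h2])
    (fun x _ => by rw [hk, eval_pow]; positivity)
  have hpi2 : Real.pi ^ 2 ≤ 10 := by nlinarith [Real.pi_lt_d2, Real.pi_gt_three]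
  -- The interval `[0, 1/L]` alone contributes `4 L / π²`; with `π² ≤ 10` and `L ≥ 5 / t` this is at
  -- least `2 / t`, twice the bound `1 / t` for the mass on `[t, 1]`.
  have hlow : 2 / t ≤ Q.eval t := by
    have h1 := mul_sub_le_eval_sub (q := Q) (a := 0) (b := 1 / L) (by positivity)
      (fun x hx => by rw [hQ]; exact hklow x hx)
    have h2 := hQmono (1 / L) t (by have : 0 < 1 / L := by positivity
                                    linarith) hLt1 ht1
    have h3 : 4 * L ^ 2 / Real.pi ^ 2 * (1 / L - 0) = 4 * L / Real.pi ^ 2 := by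
      field_simp; ring
    have h4 : 4 * L / 10 ≤ 4 * L / Real.pi ^ 2 := by gcongr
    have h5 : 2 / t = 4 * (5 / t) / 10 := by field_simp; norm_num
    rw [h3, hQ0] at h1
    rw [h5]
    linarith
  -- Since the kernel is at most `1/x²`, adding `1/x` to its integral gives a decreasing function.
  have hup : Q.eval 1 - Q.eval t ≤ 1 / t := by
    have hanti : AntitoneOn (fun x => Q.eval x + x⁻¹) (Set.Icc t 1) := by
      refine antitoneOn_of_deriv_nonpos (convex_Icc _ _) ?_ ?_ ?_
      · refine Q.continuous.continuousOn.add (ContinuousOn.inv₀ continuousOn_id fun x hx => ?_)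
        exact (ht.trans_le hx.1).ne'
      · intro x hx
        rw [interior_Icc] at hx
        exact (Q.differentiable.differentiableAt.add
          (differentiableAt_inv (ht.trans hx.1).ne')).differentiableWithinAt
      · intro x hx
        rw [interior_Icc] at hx
        have hx0 : 0 < x := ht.trans hx.1
        have : HasDerivAt (fun x => Q.eval x + x⁻¹) (k.eval x + -(x ^ 2)⁻¹) x := by
          have := (Q.hasDerivAt x).add (hasDerivAt_inv hx0.ne')
          rwa [hQ] at this
        rw [this.deriv]
        have h1 := hkup x ⟨hx0, hx.2.le⟩
        have h2 : k.eval x ≤ (x ^ 2)⁻¹ := by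
          rw [inv_eq_one_div, le_div_iff₀ (by positivity)]; exact h1
        linarith
    have := hanti ⟨le_rfl, ht1⟩ ⟨ht1, le_rfl⟩ ht1
    simp only [inv_one] at this
    rw [one_div]; linarith
  have hQ1 : 0 < Q.eval 1 := by
    have := hQmono t 1 (by linarith) ht1 le_rfl
    have h2 : 0 < 2 / t := by positivity
    linarith
  refine ⟨l, C (Q.eval 1)⁻¹ * Q, ?_, ?_, ?_, ?_, ?_, ?_⟩
  · have : 5 / (2 * t) = 5 / t / 2 := by field_simp
    rw [this] at hl2
    have h2 : 1 ≤ 1 / t := by rw [le_div_iff₀ ht]; linarith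
    have h3 : 5 / t = 5 * (1 / t) := by ring
    have h4 : 16 / t = 16 * (1 / t) := by ring
    rw [h3] at hl2; rw [h4]; linarith
  · refine (natDegree_C_mul_le _ _).trans (hQd.trans ?_)
    have h1 : T.natDegree = 2 * l + 1 := by
      rw [hT, Chebyshev.natDegree_T, hn]; omega
    have h2 : k.natDegree ≤ 2 * T.divX.natDegree := natDegree_pow_le
    rw [natDegree_divX_eq_natDegree_tsub_one, h1] at h2
    omega
  · intro x; simp [hQodd]
  · intro x y hx hxy hy
    simp only [eval_mul, eval_C]
    exact mul_le_mul_of_nonneg_left (hQmono x y hx hxy hy) (by positivity)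
  · simp [hQ1.ne']
  · rw [eval_mul, eval_C, inv_mul_eq_div, le_div_iff₀ hQ1]
    have h5 : 2 / t = 2 * (1 / t) := by ring
    have h6 : 0 < 1 / t := by positivity
    linarith

/-- An odd polynomial of degree `O(log(1/ε))`, bounded by `1` on `[-1, 1]` and at least `1 - ε` on
`[1/2, 1]`. -/
lemma exists_odd_amplify {ε : ℝ} (hε : 0 < ε) (hε1 : ε ≤ 1) :
    ∃ (n : ℕ) (g : ℝ[X]), (2 * n + 1 : ℝ) ≤ 15 * Real.log (2 / ε) ∧ g.natDegree ≤ 2 * n + 1 ∧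
      (∀ x, g.eval (-x) = -g.eval x) ∧
      (∀ x y, -1 ≤ x → x ≤ y → y ≤ 1 → g.eval x ≤ g.eval y) ∧ g.eval 1 = 1 ∧
      1 - ε ≤ g.eval (1 / 2) := by
  set n := ⌈5 * Real.log (2 / ε)⌉₊ with hn
  have hlog : Real.log 2 ≤ Real.log (2 / ε) := by
    refine Real.log_le_log (by norm_num) ?_
    rw [le_div_iff₀ hε]; linarith
  have hlog2 := Real.log_two_gt_d9
  have hn1 : 5 * Real.log (2 / ε) ≤ n := Nat.le_ceil _
  have hn2 : (n : ℝ) < 5 * Real.log (2 / ε) + 1 := Nat.ceil_lt_add_one (by linarith)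
  obtain ⟨Q, hQ, hQ0, hQd, hQodd, hQmono⟩ := exists_odd_of_kernel (k := (1 - X ^ 2) ^ n)
    (fun x => by simp)
    (fun x hx => by
      have : 0 ≤ 1 - x ^ 2 := by nlinarith [hx.1, hx.2]
      simp only [eval_pow, eval_sub, eval_one, eval_X]; positivity)
  -- For the kernel `(1 - x²)ⁿ` the mass on `[0, 1/4]` is at least `(15/16)ⁿ / 4` and the mass on
  -- `[1/2, 1]` at most `(3/4)ⁿ / 2`. Their quotient is governed by `(4/5)ⁿ`, and `n ≥ 5 log (2/ε)`
  -- makes this at most `ε / 2`.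
  have h1 : (15 / 16 : ℝ) ^ n * (1 / 4 - 0) ≤ Q.eval (1 / 4) - Q.eval 0 :=
    mul_sub_le_eval_sub (by norm_num) fun x hx => by
      rw [hQ]
      simp only [eval_pow, eval_sub, eval_one, eval_X]
      exact pow_le_pow_left₀ (by norm_num) (by nlinarith [hx.1, hx.2]) n
  have h2 : -(3 / 4 : ℝ) ^ n * (1 - 1 / 2) ≤ (-Q).eval 1 - (-Q).eval (1 / 2) :=
    mul_sub_le_eval_sub (by norm_num) fun x hx => by
      rw [derivative_neg, eval_neg, hQ]
      simp only [eval_pow, eval_sub, eval_one, eval_X]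
      exact neg_le_neg (pow_le_pow_left₀ (by nlinarith [hx.1, hx.2]) (by nlinarith [hx.1, hx.2]) n)
  have h3 := hQmono (1 / 4) 1 (by norm_num) (by norm_num) le_rfl
  have hp : (0 : ℝ) < (15 / 16 : ℝ) ^ n := by positivity
  have hQ1 : 0 < Q.eval 1 := by rw [hQ0] at h1; linarith
  have h45 : (4 / 5 : ℝ) ^ n ≤ ε / 2 := by
    have e1 : (4 / 5 : ℝ) ≤ Real.exp (-(1 / 5)) := by
      have := Real.add_one_le_exp (-(1 / 5) : ℝ); linarith
    calc (4 / 5 : ℝ) ^ n ≤ Real.exp (-(1 / 5)) ^ n := pow_le_pow_left₀ (by norm_num) e1 n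
      _ = Real.exp (-(n / 5)) := by rw [← Real.exp_nat_mul]; ring_nf
      _ ≤ Real.exp (-Real.log (2 / ε)) := Real.exp_le_exp.mpr (by linarith)
      _ = ε / 2 := by rw [Real.exp_neg, Real.exp_log (by positivity), inv_div]
  have h34 : (3 / 4 : ℝ) ^ n = (4 / 5 : ℝ) ^ n * (15 / 16 : ℝ) ^ n := by
    rw [← mul_pow]; norm_num
  refine ⟨n, C (Q.eval 1)⁻¹ * Q, ?_, ?_, ?_, ?_, ?_, ?_⟩
  · linarith
  · refine (natDegree_C_mul_le _ _).trans (hQd.trans ?_)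
    have e1 : (1 - X ^ 2 : ℝ[X]).natDegree ≤ 2 := by compute_degree
    have e2 := natDegree_pow_le (p := (1 - X ^ 2 : ℝ[X])) (n := n)
    nlinarith
  · intro x; simp [hQodd]
  · intro x y hx hxy hy
    simp only [eval_mul, eval_C]
    exact mul_le_mul_of_nonneg_left (hQmono x y hx hxy hy) (by positivity)
  · simp [hQ1.ne']
  · rw [eval_mul, eval_C, inv_mul_eq_div, le_div_iff₀ hQ1]
    simp only [eval_neg] at h2
    rw [hQ0] at h1
    nlinarith

/-- An odd polynomial of degree `O(log(1/ε)/t)` that approximates the sign function on `[t, 1]`. -/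
theorem exists_sign_polynomial {t ε : ℝ} (ht : 0 < t) (ht1 : t ≤ 1) (hε : 0 < ε) (hε1 : ε ≤ 1) :
    ∃ (k : ℕ) (p : ℝ[X]), (2 * k + 1 : ℝ) ≤ 240 / t * Real.log (2 / ε) ∧
      p.natDegree ≤ 2 * k + 1 ∧ (∀ x, p.eval (-x) = -p.eval x) ∧
      (∀ x ∈ Set.Icc (-1 : ℝ) 1, |p.eval x| ≤ 1) ∧ (∀ x ∈ Set.Icc (0 : ℝ) 1, 0 ≤ p.eval x) ∧
      ∀ x ∈ Set.Icc t 1, 1 - ε ≤ p.eval x := by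
  obtain ⟨l, q, hl, hqd, hqodd, hqmono, hq1, hqt⟩ := exists_odd_half ht ht1
  obtain ⟨n, g, hn, hgd, hgodd, hgmono, hg1, hgt⟩ := exists_odd_amplify hε hε1
  have hzero : ∀ p : ℝ[X], (∀ x, p.eval (-x) = -p.eval x) → p.eval 0 = 0 := fun p hp => by
    have := hp 0; simp at this; linarith
  have hbd : ∀ p : ℝ[X], (∀ x, p.eval (-x) = -p.eval x) →
      (∀ x y, -1 ≤ x → x ≤ y → y ≤ 1 → p.eval x ≤ p.eval y) → p.eval 1 = 1 →
      ∀ x ∈ Set.Icc (-1 : ℝ) 1, p.eval x ∈ Set.Icc (-1 : ℝ) 1 := by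
    intro p hodd hmono h1 x hx
    have e1 := hmono x 1 hx.1 hx.2 le_rfl
    have e2 := hmono (-1) x le_rfl hx.1 hx.2
    rw [hodd, h1] at e2
    exact ⟨e2, h1 ▸ e1⟩
  -- The polynomial `q` lifts `[t, 1]` above `1/2`, and `g` lifts `[1/2, 1]` above `1 - ε`. Both are
  -- odd, monotone and equal to `1` at `1`, so the composition stays within `[-1, 1]`. The degrees
  -- multiply: `(4l+1)(2n+1) = 2(4ln+2l+n)+1`.
  refine ⟨4 * l * n + 2 * l + n, g.comp q, ?_, ?_, ?_, ?_, ?_, ?_⟩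
  · have : (2 * ((4 * l * n + 2 * l + n : ℕ) : ℝ) + 1) = (4 * l + 1) * (2 * n + 1) := by
      push_cast; ring
    rw [this]
    calc ((4 * l + 1) * (2 * n + 1) : ℝ) ≤ 16 / t * (15 * Real.log (2 / ε)) := by gcongr
      _ = 240 / t * Real.log (2 / ε) := by ring
  · refine natDegree_comp_le.trans ?_
    calc g.natDegree * q.natDegree ≤ (2 * n + 1) * (4 * l + 1) := Nat.mul_le_mul hgd hqd
      _ = _ := by ring
  · intro x
    simp [eval_comp, hqodd, hgodd]
  · intro x hx
    rw [eval_comp]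
    exact abs_le.mpr (hbd g hgodd hgmono hg1 _ (hbd q hqodd hqmono hq1 x hx))
  · intro x hx
    rw [eval_comp]
    have hx' : x ∈ Set.Icc (-1 : ℝ) 1 := ⟨by linarith [hx.1], hx.2⟩
    have e1 := hqmono 0 x (by norm_num) hx.1 hx.2
    rw [hzero q hqodd] at e1
    have e2 := hgmono 0 (q.eval x) (by norm_num) e1 (hbd q hqodd hqmono hq1 x hx').2
    rwa [hzero g hgodd] at e2
  · intro x hx
    rw [eval_comp]
    have hx' : x ∈ Set.Icc (-1 : ℝ) 1 := ⟨by linarith [hx.1], hx.2⟩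
    have e1 := hqmono t x (by linarith) hx.1 hx.2
    exact hgt.trans (hgmono (1 / 2) (q.eval x) (by norm_num) (hqt.trans e1)
      (hbd q hqodd hqmono hq1 x hx').2)

end SignApproximation

/-! ### The unitaries `e^{iθH}` and their first-order expansion. -/

section Exponential

open scoped Matrix.Norms.L2Operator

variable {τ : Type*} [Fintype τ] [DecidableEq τ]

/-- `e^{iθH}` for a Hermitian matrix `H`. -/
def expI (H : Op τ) (θ : ℝ) : Op τ :=
  cfc (fun x => Real.cos (θ * x)) H + Complex.I • cfc (fun x => Real.sin (θ * x)) H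

lemma conjTranspose_expI (H : Op τ) (θ : ℝ) : (expI H θ)ᴴ = expI H (-θ) := by
  simp only [expI, Matrix.conjTranspose_add, Matrix.conjTranspose_smul, conjTranspose_cfc, neg_mul,
    Real.cos_neg, Real.sin_neg, cfc_neg, RCLike.star_def, Complex.conj_I, neg_smul, smul_neg]

lemma expI_mul (H : Op τ) (s t : ℝ) : expI H s * expI H t = expI H (s + t) := by
  have hc : cfc (fun x => Real.cos ((s + t) * x)) H =
      cfc (fun x => Real.cos (s * x)) H * cfc (fun x => Real.cos (t * x)) H -
        cfc (fun x => Real.sin (s * x)) H * cfc (fun x => Real.sin (t * x)) H := by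
    rw [cfc_mul_cfc, cfc_mul_cfc, cfc_sub_cfc]
    simp only [add_mul, Real.cos_add]
  have hs : cfc (fun x => Real.sin ((s + t) * x)) H =
      cfc (fun x => Real.sin (s * x)) H * cfc (fun x => Real.cos (t * x)) H +
        cfc (fun x => Real.cos (s * x)) H * cfc (fun x => Real.sin (t * x)) H := by
    rw [cfc_mul_cfc, cfc_mul_cfc, cfc_add_cfc]
    simp only [add_mul, Real.sin_add]
  rw [expI, expI, expI, hc, hs, add_mul, mul_add, mul_add, smul_mul_assoc, smul_mul_assoc,
    mul_smul_comm, mul_smul_comm, smul_smul, Complex.I_mul_I, smul_add, neg_smul, one_smul]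
  abel

lemma expI_zero {H : Op τ} (hH : H.IsHermitian) : expI H 0 = 1 := by
  simp only [expI, zero_mul, Real.cos_zero, Real.sin_zero]
  have h1 : cfc (fun _ : ℝ => (1 : ℝ)) H = 1 := cfc_const_one ℝ H hH
  have h0 : cfc (fun _ : ℝ => (0 : ℝ)) H = 0 := cfc_const_zero ℝ H
  rw [h1, h0]; simp

lemma expI_pow {H : Op τ} (hH : H.IsHermitian) (θ : ℝ) (m : ℕ) :
    expI H θ ^ m = expI H (m * θ) := by
  induction m with
  | zero => simp [expI_zero hH]
  | succ m ih => rw [pow_succ, ih, expI_mul]; push_cast; ring_nf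

lemma expI_unitary {H : Op τ} (hH : H.IsHermitian) (θ : ℝ) : (expI H θ)ᴴ * expI H θ = 1 := by
  rw [conjTranspose_expI, expI_mul, neg_add_cancel, expI_zero hH]

lemma abs_sin_sub_self_le {y : ℝ} (hy : |y| ≤ 1) : |Real.sin y - y| ≤ y ^ 2 := by
  rw [← sq_abs y]
  have key : ∀ z : ℝ, 0 ≤ z → z ≤ 1 → |Real.sin z - z| ≤ z ^ 2 := by
    intro z hz hz1
    rcases hz.eq_or_lt with h | h
    · simp [← h]
    · have h1 := Real.sin_gt_sub_cube h
      have h2 := Real.sin_lt h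
      rw [abs_le]
      constructor <;> nlinarith [sq_nonneg z, mul_nonneg hz hz]
  rcases abs_cases y with ⟨h, h0⟩ | ⟨h, h0⟩
  · rw [h] at hy ⊢; exact key y h0 hy
  · rw [h] at hy ⊢
    have := key (-y) (by linarith) hy
    rw [Real.sin_neg] at this
    rwa [← abs_neg, show -(Real.sin y - y) = -Real.sin y - -y by ring]

lemma abs_cos_sub_one_le (y : ℝ) : |Real.cos y - 1| ≤ y ^ 2 := by
  rw [abs_le]
  constructor
  · have := Real.one_sub_sq_div_two_le_cos (x := y); nlinarith [sq_nonneg y]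
  · have := Real.cos_le_one y; nlinarith [sq_nonneg y]

lemma norm_expI_sub_le {H : Op τ} (hH : H.IsHermitian) (hn : ‖H‖ ≤ 1) {θ : ℝ} (hθ : |θ| ≤ 1) :
    ‖expI H θ - (1 + (Complex.I * θ) • H)‖ ≤ 2 * θ ^ 2 := by
  have h1 : cfc (fun x => Real.cos (θ * x) - 1) H = cfc (fun x => Real.cos (θ * x)) H - 1 := by
    have : cfc (fun _ : ℝ => (1 : ℝ)) H = 1 := cfc_const_one ℝ H hH
    rw [← this, cfc_sub_cfc]
  have h2 : cfc (fun x => Real.sin (θ * x) - θ * x) H =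
      cfc (fun x => Real.sin (θ * x)) H - (θ : ℂ) • H := by
    have : cfc (fun x : ℝ => θ * x) H = (θ : ℂ) • H := by
      rw [show (θ : ℂ) • H = θ • H from (Complex.coe_smul θ H)]
      have h3 : cfc (fun x : ℝ => θ • x) H = θ • cfc (fun x : ℝ => x) H :=
        cfc_smul θ (fun x : ℝ => x) H (continuousOn_spectrum H _)
      rw [cfc_fun_id hH] at h3
      exact h3
    rw [← this, cfc_sub_cfc]
  have e : expI H θ - (1 + (Complex.I * θ) • H) =
      cfc (fun x => Real.cos (θ * x) - 1) H +
        Complex.I • cfc (fun x => Real.sin (θ * x) - θ * x) H := by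
    rw [h1, h2, expI, smul_sub, smul_smul]; abel
  have hsq : ∀ x ∈ spectrum ℝ H, (θ * x) ^ 2 ≤ θ ^ 2 ∧ |θ * x| ≤ 1 := by
    intro x hx
    have hx1 : |x| ≤ 1 := (abs_le_norm_of_mem_spectrum hx).trans hn
    have hx2 : x ^ 2 ≤ 1 := (sq_le_one_iff_abs_le_one x).mpr hx1
    constructor
    · rw [mul_pow]; nlinarith [sq_nonneg θ]
    · rw [abs_mul]; exact mul_le_one₀ hθ (abs_nonneg x) hx1
  rw [e]
  refine (norm_add_le _ _).trans ?_
  rw [norm_smul, Complex.norm_I, one_mul, two_mul]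
  refine add_le_add ?_ ?_
  · exact norm_cfc_le_of_le (sq_nonneg θ) fun x hx =>
      (abs_cos_sub_one_le _).trans (hsq x hx).1
  · exact norm_cfc_le_of_le (sq_nonneg θ) fun x hx =>
      (abs_sin_sub_self_le (hsq x hx).2).trans (hsq x hx).1

end Exponential

/-! ### Density matrix exponentiation and its error. -/

section DensityMatrixExponentiation

variable {τ : Type*} [Fintype τ] [DecidableEq τ]

/-- The operator that exchanges two copies of a system. -/
def swapOp (τ : Type*) [DecidableEq τ] : Op (τ × τ) := fun x y => if x = y.swap then 1 else 0

lemma partialSwap_eq (θ : ℝ) : partialSwap τ θ =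
    (Real.cos θ : ℂ) • (1 : Op (τ × τ)) + (Complex.I * Real.sin θ) • swapOp τ := by
  ext x y
  simp [partialSwap, swapOp, Matrix.one_apply]

lemma swapOp_mul_apply (Z : Op (τ × τ)) (x y : τ × τ) : (swapOp τ * Z) x y = Z x.swap y := by
  simp only [Matrix.mul_apply, swapOp, ite_mul, one_mul, zero_mul]
  rw [Finset.sum_eq_single x.swap]
  · simp
  · intro b _ hb
    rw [if_neg]; rintro rfl; simp at hb
  · simp

lemma mul_swapOp_apply (Z : Op (τ × τ)) (x y : τ × τ) : (Z * swapOp τ) x y = Z x y.swap := by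
  simp only [Matrix.mul_apply, swapOp, mul_ite, mul_one, mul_zero]
  simp

lemma conjTranspose_swapOp : (swapOp τ)ᴴ = swapOp τ := by
  ext x y
  simp only [Matrix.conjTranspose_apply, swapOp]
  by_cases h : x = y.swap
  · subst h; simp
  · rw [if_neg h, if_neg]
    · simp
    · rintro rfl; simp at h

/-- Expand `cos θ + i sin θ F` on both sides: conjugation by the swap `F` exchanges `A` and `X`,
while the partial traces of `F (A ⊗ X)` and `(A ⊗ X) F` are `A X` and `X A`. The commutator is the
first-order term that drives the simulated evolution. -/
lemma traceFst_conjBy_partialSwap (θ : ℝ) (A X : Op τ) :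
    traceFst (conjBy (partialSwap τ θ) (A ⊗ₖ X)) =
      ((Real.cos θ : ℂ) ^ 2 * A.trace) • X + ((Real.sin θ : ℂ) ^ 2 * X.trace) • A +
        (Complex.I * Real.sin θ * Real.cos θ) • (A * X - X * A) := by
  have e : conjBy (partialSwap τ θ) (A ⊗ₖ X) =
      ((Real.cos θ : ℂ) ^ 2) • (A ⊗ₖ X) + ((Real.sin θ : ℂ) ^ 2) • (swapOp τ * (A ⊗ₖ X) * swapOp τ) +
      (Complex.I * Real.sin θ * Real.cos θ) • (swapOp τ * (A ⊗ₖ X) - (A ⊗ₖ X) * swapOp τ) := by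
    rw [conjBy_apply, partialSwap_eq, Matrix.conjTranspose_add, Matrix.conjTranspose_smul,
      Matrix.conjTranspose_smul, conjTranspose_swapOp, Matrix.conjTranspose_one]
    simp only [RCLike.star_def, Complex.conj_ofReal, map_mul, Complex.conj_I, add_mul, mul_add,
      smul_mul_assoc, mul_smul_comm, one_mul, mul_one, smul_sub]
    have h1 : Complex.I * (Real.sin θ : ℂ) * (-Complex.I * (Real.sin θ : ℂ)) =
      (Real.sin θ : ℂ) ^ 2 := by
      linear_combination -(Real.sin θ : ℂ) ^ 2 * Complex.I_mul_I
    rw [← h1]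
    module
  rw [e]
  ext i j
  simp only [traceFst, LinearMap.coe_mk, AddHom.coe_mk, Matrix.of_apply, Matrix.add_apply,
    Matrix.smul_apply, Matrix.sub_apply, swapOp_mul_apply, mul_swapOp_apply, smul_eq_mul,
    Matrix.kroneckerMap_apply, Prod.swap_prod_mk,
    Finset.sum_add_distrib, ← Finset.mul_sum, Finset.sum_sub_distrib]
  simp only [Matrix.mul_apply, Matrix.trace, Matrix.diag_apply]
  have h1 : ∑ k, A k j * X i k = ∑ k, X i k * A k j := Finset.sum_congr rfl fun k _ => mul_comm _ _
  have h2 : ∑ k, A k k * X i j = (∑ k, A k k) * X i j := (Finset.sum_mul _ _ _).symm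
  simp only [h1, h2]
  ring

/-- A diagonal block of an operator on a qubit and a further system. -/
def qubitBlock (Υ : Op (Bool × τ)) (c : Bool) : Op τ := Υ.submatrix (fun x => (c, x)) fun x => (c, x)

lemma dmeStep_apply (Υ : Op (Bool × τ)) (θ : ℝ) (X : Op τ) :
    dmeStep Υ θ X = traceFst (conjBy (partialSwap τ θ) (qubitBlock Υ false ⊗ₖ X)) +
      traceFst (conjBy (partialSwap τ (-θ)) (qubitBlock Υ true ⊗ₖ X)) := by
  ext i j
  simp only [dmeStep, LinearMap.comp_apply, traceFst, LinearMap.coe_mk, AddHom.coe_mk,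
    Matrix.of_apply, Fintype.sum_prod_type, Fintype.sum_bool, conjBy_apply, prepend,
    Matrix.add_apply, Matrix.mul_apply, Matrix.conjTranspose_apply, dmeUnitary,
    Matrix.kroneckerMap_apply, qubitBlock, Matrix.submatrix_apply]
  simp only [Bool.false_eq_true, reduceIte, Bool.true_eq_false, zero_mul, star_zero, mul_zero,
    Finset.sum_const_zero, add_zero, zero_add]
  rw [add_comm]

/-- Reversing the angle changes only the sign of the commutator term. Hence the evolution sees the
difference of the two blocks of `Υ`, and the second-order terms see their sum. -/
lemma dmeStep_eq {Υ : Op (Bool × τ)} (htr : Υ.trace = 1) (θ : ℝ) :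
    dmeStep Υ θ = ((Real.cos θ : ℂ) ^ 2) • LinearMap.id +
      ((Real.sin θ : ℂ) ^ 2) • replaceBy (qubitBlock Υ false + qubitBlock Υ true) +
      (Complex.I * Real.sin θ * Real.cos θ) •
        (sandwich (qubitBlock Υ false - qubitBlock Υ true) 1 -
          sandwich 1 (qubitBlock Υ false - qubitBlock Υ true)) := by
  have htr' : (qubitBlock Υ false).trace + (qubitBlock Υ true).trace = 1 := by
    rw [← htr]
    simp [Matrix.trace, qubitBlock, Fintype.sum_prod_type, add_comm]
  refine LinearMap.ext fun X => ?_
  rw [dmeStep_apply, traceFst_conjBy_partialSwap, traceFst_conjBy_partialSwap]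
  simp only [LinearMap.add_apply, LinearMap.smul_apply, LinearMap.sub_apply, sandwich_apply,
    LinearMap.id_apply, replaceBy, LinearMap.coe_mk, AddHom.coe_mk, Real.cos_neg, Real.sin_neg]
  set A := qubitBlock Υ false
  set B := qubitBlock Υ true
  have : ((Real.cos θ : ℂ) ^ 2) • X = ((Real.cos θ : ℂ) ^ 2 * (A.trace + B.trace)) • X := by
    rw [htr', mul_one]
  rw [this]
  simp only [Matrix.mul_one, Matrix.one_mul, Matrix.sub_mul, Matrix.mul_sub]
  push_cast
  module

/-- With errors recorded as `a - 1`, composition multiplies the numbers `a`. A bound on the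
approximating map is recovered from the error, so contractivity is needed only for the ideal maps.
-/
lemma DiamondBound.comp_sub_comp_of_one_le {α β γ : Type*} [Fintype α] [DecidableEq α] [Fintype β]
    [DecidableEq β] [Fintype γ] [DecidableEq γ] {S S' : Op β →ₗ[ℂ] Op γ} {T T' : Op α →ₗ[ℂ] Op β}
    {a b : ℝ} (ha : 1 ≤ a) (hS' : DiamondBound S' 1) (hSS : DiamondBound (S - S') (a - 1))
    (hT' : DiamondBound T' 1) (hTT : DiamondBound (T - T') (b - 1)) :
    DiamondBound (S ∘ₗ T - S' ∘ₗ T') (a * b - 1) := by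
  have hS : DiamondBound S a := by
    have := hSS.add hS'
    simpa using this
  exact (DiamondBound.comp_sub_comp (by linarith) (by linarith) hS hSS hT' hTT).mono
    (by linarith)

lemma DiamondBound.pow {T : Op τ →ₗ[ℂ] Op τ} (h : DiamondBound T 1) (m : ℕ) :
    DiamondBound (T ^ m) 1 := by
  induction m with
  | zero => exact DiamondBound.id
  | succ m ih =>
    rw [pow_succ]
    have := ih.comp zero_le_one h
    rwa [mul_one] at this

lemma DiamondBound.pow_sub_pow {T K : Op τ →ₗ[ℂ] Op τ} {e : ℝ} (he : 0 ≤ e)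
    (hK : DiamondBound K 1) (h : DiamondBound (T - K) e) (m : ℕ) :
    DiamondBound (T ^ m - K ^ m) ((1 + e) ^ m - 1) := by
  induction m with
  | zero =>
    intro R _ _ X
    have : UhlmannSample.idTensor R (T ^ 0 - K ^ 0) X = 0 := by
      rw [pow_zero, pow_zero, sub_self]; rfl
    rw [this]
    simp [traceNorm]
  | succ m ih =>
    rw [pow_succ, pow_succ, pow_succ]
    exact DiamondBound.comp_sub_comp_of_one_le (one_le_pow₀ (by linarith)) (hK.pow m) ih hK
      (h.mono (by linarith))

lemma one_add_pow_sub_one_le {e : ℝ} (he : 0 ≤ e) {m : ℕ} (h : m * e ≤ 1) :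
    (1 + e) ^ m - 1 ≤ 2 * (m * e) := by
  have h1 : (1 + e) ^ m ≤ Real.exp (m * e) := by
    rw [Real.exp_nat_mul]
    exact pow_le_pow_left₀ (by linarith) (by linarith [Real.add_one_le_exp e]) m
  have h0 : 0 ≤ m * e := by positivity
  have h2 := Real.abs_exp_sub_one_sub_id_le (x := m * e) (by rwa [abs_of_nonneg h0])
  have h3 := (abs_le.mp h2).2
  nlinarith

lemma conjBy_pow (K : Op τ) (m : ℕ) : conjBy K ^ m = conjBy (K ^ m) := by
  induction m with
  | zero => ext1 X; simp [conjBy_apply]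
  | succ m ih => rw [pow_succ, ih, pow_succ]; exact conjBy_comp _ _

open scoped Matrix.Norms.L2Operator in
/-- One step of density matrix exponentiation is second-order accurate. -/
lemma diamondBound_dmeStep_sub {Υ : Op (Bool × τ)} {H : Op τ} (htr : Υ.trace = 1)
    (hΥ : DiamondBound (replaceBy (α := τ) (qubitBlock Υ false + qubitBlock Υ true)) 1)
    (hH : qubitBlock Υ false - qubitBlock Υ true = H) (hherm : H.IsHermitian) (hn : ‖H‖ ≤ 1)
    {θ : ℝ} (hθ : |θ| ≤ 1) :
    DiamondBound (dmeStep Υ θ - conjBy (expI H θ)) (13 * θ ^ 2) := by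
  rw [dmeStep_eq htr, hH]
  set D := expI H θ - (1 + (Complex.I * θ) • H) with hD
  have hDn : ‖D‖ ≤ 2 * θ ^ 2 := norm_expI_sub_le hherm hn hθ
  have hE : expI H θ = 1 + (Complex.I * θ) • H + D := by rw [hD]; abel
  have hEn : ‖(expI H θ)ᴴ‖ ≤ 1 := by
    rw [Matrix.l2_opNorm_conjTranspose]
    exact norm_le_one_of_isometry (expI_unitary hherm θ)
  have hone : ‖(1 : Op τ)‖ ≤ 1 := norm_le_one_of_isometry (by simp)
  have hDn' : ‖Dᴴ‖ ≤ 2 * θ ^ 2 := by rwa [Matrix.l2_opNorm_conjTranspose]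
  have hsq : |θ| ^ 2 = θ ^ 2 := sq_abs θ
  have hθ2 : θ ^ 2 ≤ 1 := (sq_le_one_iff_abs_le_one θ).mpr hθ
  have h1H : ‖(1 : Op τ) + (Complex.I * θ) • H‖ ≤ 2 := by
    refine (norm_add_le _ _).trans ?_
    rw [norm_smul, norm_mul, Complex.norm_I, one_mul, Complex.norm_real, Real.norm_eq_abs]
    nlinarith [norm_nonneg H, abs_nonneg θ]
  -- With `e^{iθH} = 1 + iθH + D` and `‖D‖ ≤ 2 θ²`, the terms of order zero and one cancel; each
  -- summand that remains is of second order.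
  have e : ((Real.cos θ : ℂ) ^ 2) • (LinearMap.id : Op τ →ₗ[ℂ] Op τ) +
      ((Real.sin θ : ℂ) ^ 2) • replaceBy (qubitBlock Υ false + qubitBlock Υ true) +
      (Complex.I * Real.sin θ * Real.cos θ) • (sandwich H 1 - sandwich 1 H) -
      conjBy (expI H θ) =
      ((Real.sin θ : ℂ) ^ 2) • (replaceBy (qubitBlock Υ false + qubitBlock Υ true) -
        (LinearMap.id : Op τ →ₗ[ℂ] Op τ)) +
      (Complex.I * (Real.sin θ * Real.cos θ - θ : ℝ)) • (sandwich H 1 - sandwich 1 H) -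
      ((θ : ℂ) ^ 2) • sandwich H H - sandwich D (expI H θ)ᴴ -
      sandwich (1 + (Complex.I * θ) • H) Dᴴ := by
    have hcs : (Real.cos θ : ℂ) ^ 2 = 1 - (Real.sin θ : ℂ) ^ 2 := by
      rw [eq_sub_iff_add_eq]; exact_mod_cast Real.cos_sq_add_sin_sq θ
    refine LinearMap.ext fun X => ?_
    have hX : expI H θ * X * (expI H θ)ᴴ = X + (Complex.I * θ) • (H * X - X * H) +
        ((θ : ℂ) ^ 2) • (H * X * H) + D * X * (expI H θ)ᴴ +
        (1 + (Complex.I * θ) • H) * X * Dᴴ := by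
      have h1 : (expI H θ)ᴴ = 1 - (Complex.I * θ) • H + Dᴴ := by
        rw [hE, Matrix.conjTranspose_add, Matrix.conjTranspose_add, Matrix.conjTranspose_smul,
          hherm.eq, Matrix.conjTranspose_one]
        simp [sub_eq_add_neg]
      have h2 : expI H θ * X * (expI H θ)ᴴ =
          (1 + (Complex.I * θ) • H) * X * (expI H θ)ᴴ + D * X * (expI H θ)ᴴ := by
        rw [← add_mul, ← add_mul, ← hE]
      have h3 : (1 + (Complex.I * θ) • H) * X * (1 - (Complex.I * θ) • H) =
          X + (Complex.I * θ) • (H * X - X * H) + ((θ : ℂ) ^ 2) • (H * X * H) := by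
        have h4 : (θ : ℂ) ^ 2 = -((Complex.I * θ) * (Complex.I * θ)) := by
          linear_combination (θ : ℂ) ^ 2 * Complex.I_mul_I
        rw [h4]
        simp only [add_mul, one_mul, mul_sub, mul_one, smul_mul_assoc, mul_smul_comm, smul_sub]
        module
      rw [h2]
      conv_lhs => lhs; rw [h1]
      rw [mul_add, h3]
      abel
    simp only [LinearMap.add_apply, LinearMap.sub_apply, LinearMap.smul_apply, LinearMap.id_apply,
      sandwich_apply, conjBy_apply, hX, hcs, Matrix.mul_one, Matrix.one_mul]
    push_cast
    module
  rw [e]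
  have hH1 : DiamondBound (sandwich H 1) 1 :=
    (diamondBound_sandwich _ _).mono (by nlinarith [norm_nonneg H, norm_nonneg (1 : Op τ)])
  have hH2 : DiamondBound (sandwich 1 H) 1 :=
    (diamondBound_sandwich _ _).mono (by nlinarith [norm_nonneg H, norm_nonneg (1 : Op τ)])
  have hHH : DiamondBound (sandwich H H) 1 :=
    (diamondBound_sandwich _ _).mono (by nlinarith [norm_nonneg H])
  have hDE : DiamondBound (sandwich D (expI H θ)ᴴ) (2 * θ ^ 2) :=
    (diamondBound_sandwich _ _).mono (by nlinarith [norm_nonneg D, norm_nonneg (expI H θ)ᴴ])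
  have hDH : DiamondBound (sandwich (1 + (Complex.I * θ) • H) Dᴴ) (4 * θ ^ 2) :=
    (diamondBound_sandwich _ _).mono (by
      calc ‖(1 : Op τ) + (Complex.I * θ) • H‖ * ‖Dᴴ‖ ≤ 2 * (2 * θ ^ 2) := by gcongr
        _ = 4 * θ ^ 2 := by ring)
  -- The five summands contribute 2, 4, 1, 2 and 4 times `θ²`, which gives the constant 13.
  refine (((((hΥ.sub DiamondBound.id).smul _).add ((hH1.sub hH2).smul _)).sub (hHH.smul _)).sub
    hDE |>.sub hDH).mono ?_
  have n1 : ‖(Real.sin θ : ℂ) ^ 2‖ ≤ θ ^ 2 := by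
    rw [norm_pow, Complex.norm_real, Real.norm_eq_abs, sq_abs]
    exact Real.sin_sq_le_sq
  have n2 : ‖Complex.I * ((Real.sin θ * Real.cos θ - θ : ℝ) : ℂ)‖ ≤ 2 * θ ^ 2 := by
    rw [norm_mul, Complex.norm_I, one_mul, Complex.norm_real, Real.norm_eq_abs]
    have : Real.sin θ * Real.cos θ - θ =
      (Real.sin θ - θ) * Real.cos θ + θ * (Real.cos θ - 1) := by ring
    rw [this]
    refine (abs_add_le _ _).trans ?_
    rw [abs_mul, abs_mul]
    have a1 := abs_sin_sub_self_le hθ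
    have a2 := Real.abs_cos_le_one θ
    have a3 := abs_cos_sub_one_le θ
    nlinarith [abs_nonneg (Real.sin θ - θ), abs_nonneg (Real.cos θ), abs_nonneg (Real.cos θ - 1),
      abs_nonneg θ]
  have n3 : ‖(θ : ℂ) ^ 2‖ ≤ θ ^ 2 := by
    rw [norm_pow, Complex.norm_real, Real.norm_eq_abs, sq_abs]
  linarith

-- The angle per step is at most `2 / m`, so each step costs at most `52 / m²`. Over `m` steps the
-- error is `(1 + 52/m²)^m - 1`, at most `2 · 52 / m` as soon as `m ≥ 52`.
open scoped Matrix.Norms.L2Operator in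
lemma diamondBound_dmesub_sub {Υ : Op (Bool × τ)} {H : Op τ} (htr : Υ.trace = 1)
    (hΥ : DiamondBound (replaceBy (α := τ) (qubitBlock Υ false + qubitBlock Υ true)) 1)
    (hH : qubitBlock Υ false - qubitBlock Υ true = H) (hherm : H.IsHermitian) (hn : ‖H‖ ≤ 1)
    {t : ℝ} (ht : |t| ≤ 2) {m : ℕ} (hm : 52 ≤ m) :
    DiamondBound (dmesub Υ m t - conjBy (expI H t)) (104 / m) := by
  have hm' : (52 : ℝ) ≤ m := by exact_mod_cast hm
  have hm0 : (0 : ℝ) < m := by linarith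
  have hθ : |t / m| ≤ 2 / m := by
    rw [abs_div, abs_of_pos hm0]; gcongr
  have hθ1 : |t / m| ≤ 1 := hθ.trans (by rw [div_le_one hm0]; linarith)
  have h1 := diamondBound_dmeStep_sub htr hΥ hH hherm hn hθ1
  have hsq : (t / m) ^ 2 ≤ (2 / m) ^ 2 := by
    rw [← sq_abs]; exact pow_le_pow_left₀ (abs_nonneg _) hθ 2
  have hle : 13 * (t / m) ^ 2 ≤ 52 / (m : ℝ) ^ 2 := by
    calc 13 * (t / m) ^ 2 ≤ 13 * (2 / m) ^ 2 := by gcongr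
      _ = 52 / (m : ℝ) ^ 2 := by ring
  have h2 := DiamondBound.pow_sub_pow (by positivity)
      (diamondBound_conjBy (expI_unitary hherm (t / m))) (h1.mono hle) m
  rw [conjBy_pow, expI_pow hherm, mul_div_cancel₀ _ hm0.ne'] at h2
  refine h2.mono ?_
  have h3 : (m : ℝ) * (52 / m ^ 2) = 52 / m := by field_simp
  refine (one_add_pow_sub_one_le (by positivity) ?_).trans (le_of_eq ?_)
  · rw [h3, div_le_one hm0]; exact hm'
  · rw [h3]; ring

end DensityMatrixExponentiation

/-! ### The off-diagonal Hermitian dilation and the Pauli grading. -/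

section OffDiagonal

variable {β : Type*} [Fintype β] [DecidableEq β]

/-- The Hermitian operator `|1⟩⟨0| ⊗ N + |0⟩⟨1| ⊗ N†`. -/
def offDiag (N : Op β) : Op (Bool × β) := fun x y =>
  if x.1 = !y.1 then (if x.1 then N x.2 y.2 else Nᴴ x.2 y.2) else 0

/-- The embedding `|x⟩ ↦ |c⟩ ⊗ |x⟩`. -/
def ketQubit (β : Type*) [DecidableEq β] (c : Bool) : Matrix (Bool × β) β ℂ := fun x y =>
  if x = (c, y) then 1 else 0

lemma isHermitian_offDiag (N : Op β) : (offDiag N).IsHermitian := by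
  ext ⟨c, x⟩ ⟨d, y⟩
  cases c <;> cases d <;> simp [offDiag]

lemma mul_ketQubit_apply {γ : Type*} (Y : Matrix γ (Bool × β) ℂ) (c : Bool) (x : γ) (y : β) :
    (Y * ketQubit β c) x y = Y x (c, y) := by
  simp [Matrix.mul_apply, ketQubit]

lemma ketQubit_mul_apply {γ : Type*} (Y : Matrix (Bool × β) γ ℂ) (c : Bool) (x : β) (y : γ) :
    ((ketQubit β c)ᴴ * Y) x y = Y (c, x) y := by
  simp [Matrix.mul_apply, ketQubit, Matrix.conjTranspose_apply]

lemma ketQubit_mul_self (c : Bool) : (ketQubit β c)ᴴ * ketQubit β c = 1 := by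
  ext x y
  rw [ketQubit_mul_apply]
  simp [ketQubit, Matrix.one_apply]

lemma ketQubit_true_mul_offDiag (N : Op β) :
    (ketQubit β true)ᴴ * offDiag N = N * (ketQubit β false)ᴴ := by
  ext x ⟨c, y⟩
  rw [ketQubit_mul_apply]
  cases c <;> simp [offDiag, Matrix.mul_apply, ketQubit, Matrix.conjTranspose_apply]

lemma ketQubit_false_mul_offDiag (N : Op β) :
    (ketQubit β false)ᴴ * offDiag N = Nᴴ * (ketQubit β true)ᴴ := by
  ext x ⟨c, y⟩
  rw [ketQubit_mul_apply]
  cases c <;> simp [offDiag, Matrix.mul_apply, ketQubit, Matrix.conjTranspose_apply]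

/-- An odd function of `|1⟩⟨0| ⊗ N + |0⟩⟨1| ⊗ N†` acts by the singular values of `N`. -/
lemma ketQubit_cfc_offDiag {f : ℝ → ℝ} (hf : ∀ x, f (-x) = -f x) (N : Op β) :
    (ketQubit β true)ᴴ * cfc f (offDiag N) * ketQubit β false = svMap f N := by
  have hS := isHermitian_offDiag N
  have h0 : f 0 = 0 := by have := hf 0; simp at this; linarith
  set g : ℝ → ℝ := fun x => f (√x) / √x with hg
  have hS2 : (offDiag N * offDiag N).IsHermitian := by
    have := isHermitian_gram (offDiag N)
    rwa [hS.eq] at this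
  -- An odd `f` has the form `f(x) = x g(x²)`. The square of the dilation preserves the qubit and
  -- acts as `N† N` on `|0⟩`, so `g` is evaluated there and the remaining factor maps `|0⟩` to `|1⟩`
  -- through `N`.
  have e1 : cfc f (offDiag N) = offDiag N * cfc g (offDiag N * offDiag N) := by
    have : cfc g (offDiag N * offDiag N) = cfc (fun x => g (x ^ 2)) (offDiag N) := by
      rw [← sq]
      exact (cfc_comp_pow g 2 (offDiag N) ((Set.Finite.image _
        Matrix.finite_real_spectrum).continuousOn _) hS).symm
    rw [this, cfc_id_mul hS]
    refine cfc_congr fun x _ => ?_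
    simp only [hg]
    rw [Real.sqrt_sq_eq_abs]
    rcases lt_trichotomy x 0 with h | h | h
    · rw [abs_of_neg h, hf, neg_div_neg_eq, mul_div_cancel₀ _ h.ne]
    · simp [h, h0]
    · rw [abs_of_pos h]; field_simp
  have e2 : (ketQubit β false)ᴴ * (offDiag N * offDiag N) = Nᴴ * N * (ketQubit β false)ᴴ := by
    rw [← Matrix.mul_assoc, ketQubit_false_mul_offDiag, Matrix.mul_assoc,
      ketQubit_true_mul_offDiag, Matrix.mul_assoc]
  rw [e1, ← Matrix.mul_assoc, ketQubit_true_mul_offDiag, Matrix.mul_assoc N,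
    mul_cfc_of_intertwine hS2 (isHermitian_gram N) e2, Matrix.mul_assoc, Matrix.mul_assoc,
    ketQubit_mul_self, Matrix.mul_one, svMap]

lemma pauliZ_mul_offDiag (N : Op β) : pauliZ β * offDiag N = -offDiag N * pauliZ β := by
  ext ⟨c, x⟩ ⟨d, y⟩
  cases c <;> cases d <;> simp [pauliZ, offDiag]

/-- `Z` anticommutes with the dilation, hence commutes with its even functions and anticommutes with
its odd ones. This grading decides which parts a phase gate multiplies by `e^{iφ}` and which by
`e^{-iφ}`. -/
lemma pauliZ_mul_cfc (N : Op β) (f : ℝ → ℝ) :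
    pauliZ β * cfc f (offDiag N) = cfc (fun x => f (-x)) (offDiag N) * pauliZ β := by
  have hS := isHermitian_offDiag N
  rw [mul_cfc_of_intertwine hS hS.neg (pauliZ_mul_offDiag N)]
  congr 1
  exact (cfc_comp_neg f (offDiag N) ((Matrix.finite_real_spectrum.image _).continuousOn _) hS).symm

lemma pauliZ_mul_ketQubit_false : pauliZ β * ketQubit β false = ketQubit β false := by
  ext ⟨c, x⟩ y
  cases c <;> simp [pauliZ, ketQubit]

lemma ketQubit_true_mul_pauliZ : (ketQubit β true)ᴴ * pauliZ β = -(ketQubit β true)ᴴ := by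
  ext x ⟨c, y⟩
  rw [ketQubit_mul_apply]
  by_cases h : x = y
  · cases c <;> simp [pauliZ, ketQubit, Matrix.conjTranspose_apply, h]
  · cases c <;> simp [pauliZ, ketQubit, Matrix.conjTranspose_apply, h, Ne.symm h]

lemma eq_zero_of_eq_neg {γ δ : Type*} {v : Matrix γ δ ℂ} (h : v = -v) : v = 0 := by
  ext x y
  exact self_eq_neg.mp (congrFun (congrFun h x) y)

lemma pauliX_mul_apply {γ : Type*} (Y : Matrix (Bool × β) γ ℂ) (x : Bool × β) (y : γ) :
    (pauliX β * Y) x y = Y (!x.1, x.2) y := by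
  rw [Matrix.mul_apply, Finset.sum_eq_single (!x.1, x.2)]
  · simp [pauliX]
  · rintro ⟨c, z⟩ _ h
    have : ¬(x.1 = !c ∧ x.2 = z) := by
      rintro ⟨h1, rfl⟩; apply h; rw [h1]; simp
    simp [pauliX, this]
  · simp

lemma pauliX_mul_self : pauliX β * pauliX β = 1 := by
  ext ⟨c, x⟩ ⟨d, y⟩
  rw [pauliX_mul_apply]
  cases c <;> cases d <;> simp [pauliX, Matrix.one_apply]

lemma conjTranspose_pauliX : (pauliX β)ᴴ = pauliX β := by
  ext ⟨c, x⟩ ⟨d, y⟩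
  cases c <;> cases d <;> simp [pauliX, eq_comm]

lemma pauliZ_mul_pauliX : pauliZ β * pauliX β = -(pauliX β * pauliZ β) := by
  ext ⟨c, x⟩ ⟨d, y⟩
  rw [Matrix.neg_apply, pauliX_mul_apply]
  by_cases h : x = y <;> cases c <;> cases d <;> simp [pauliX, pauliZ, h]

lemma ketQubit_false_mul_pauliX : (ketQubit β false)ᴴ * pauliX β = (ketQubit β true)ᴴ := by
  ext x ⟨c, y⟩
  rw [ketQubit_mul_apply]
  cases c <;> simp [pauliX, ketQubit, Matrix.conjTranspose_apply, eq_comm]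

end OffDiagonal

/-! ### Singular value transformation of a block-encoding by alternating phases. -/

section SingularValueTransformation

open Polynomial

variable {β : Type*} [Fintype β] [DecidableEq β]

/-- `sin` of the off-diagonal operator. -/
def sinOp (N : Op β) : Op (Bool × β) := cfc Real.sin (offDiag N)

/-- `cos` of the off-diagonal operator. -/
def cosOp (N : Op β) : Op (Bool × β) := cfc Real.cos (offDiag N)

/-- A unitary whose block on `|0⟩` is `sin^(SV)(N)`. -/
def sineUnitary (N : Op β) : Op (Bool × β) :=
  pauliX β * (sinOp N - Complex.I • cosOp N)

lemma sinOp_mul_self_add (N : Op β) : sinOp N * sinOp N + cosOp N * cosOp N = 1 := by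
  rw [sinOp, cosOp, cfc_mul_cfc, cfc_mul_cfc, cfc_add_cfc]
  have : (fun x => Real.sin x * Real.sin x + Real.cos x * Real.cos x) = fun _ => (1 : ℝ) := by
    funext x; linear_combination Real.sin_sq_add_cos_sq x
  rw [this]
  exact cfc_const_one ℝ (offDiag N) (isHermitian_offDiag N)

lemma cosOp_mul_sinOp (N : Op β) : cosOp N * sinOp N = sinOp N * cosOp N := cfc_commute_cfc _ _ _

lemma conjTranspose_sineUnitary (N : Op β) :
    (sineUnitary N)ᴴ = (sinOp N + Complex.I • cosOp N) * pauliX β := by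
  rw [sineUnitary, Matrix.conjTranspose_mul, conjTranspose_pauliX, Matrix.conjTranspose_sub,
    Matrix.conjTranspose_smul, sinOp, cosOp, conjTranspose_cfc, conjTranspose_cfc]
  simp [sub_eq_add_neg]

lemma sineUnitary_isometry (N : Op β) : (sineUnitary N)ᴴ * sineUnitary N = 1 := by
  rw [conjTranspose_sineUnitary, sineUnitary, Matrix.mul_assoc, ← Matrix.mul_assoc (pauliX β),
    pauliX_mul_self, Matrix.one_mul, ← sinOp_mul_self_add N]
  simp only [add_mul, mul_sub, smul_mul_assoc, mul_smul_comm, cosOp_mul_sinOp]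
  rw [smul_add, smul_smul, Complex.I_mul_I]
  module

lemma sineUnitary_mem (N : Op β) : sineUnitary N ∈ Matrix.unitaryGroup (Bool × β) ℂ := by
  rw [Matrix.mem_unitaryGroup_iff']
  exact sineUnitary_isometry N

/-- `X` turns the row `⟨0|` into `⟨1|`. The cosine is even and has no entry from `|0⟩` to `|1⟩`,
while the sine is odd and yields the singular value transform. -/
lemma sineUnitary_block (N : Op β) :
    (ketQubit β false)ᴴ * sineUnitary N * ketQubit β false = svMap Real.sin N := by
  have hc : (ketQubit β true)ᴴ * cosOp N * ketQubit β false = 0 := by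
    have h1 : (ketQubit β true)ᴴ * (pauliZ β * cosOp N) * ketQubit β false =
        (ketQubit β true)ᴴ * (cosOp N * pauliZ β) * ketQubit β false := by
      rw [cosOp, pauliZ_mul_cfc]; simp only [Real.cos_neg]
    rw [← Matrix.mul_assoc, ketQubit_true_mul_pauliZ, ← Matrix.mul_assoc,
      Matrix.mul_assoc _ (pauliZ β), pauliZ_mul_ketQubit_false, Matrix.neg_mul, Matrix.neg_mul] at h1
    exact eq_zero_of_eq_neg h1.symm
  rw [sineUnitary, ← Matrix.mul_assoc, ketQubit_false_mul_pauliX, Matrix.mul_sub, Matrix.sub_mul,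
    Matrix.mul_smul, Matrix.smul_mul, hc, smul_zero, sub_zero, sinOp,
    ketQubit_cfc_offDiag Real.sin_neg]

/-- The phase gate `e^{iφZ}`. -/
def phaseZ (β : Type*) [DecidableEq β] (φ : ℝ) : Op (Bool × β) :=
  Matrix.diagonal fun x => Complex.exp (Complex.I * φ * (if x.1 then -1 else 1))

lemma phaseZ_mul_of_even {γ : Type*} (φ : ℝ) {v : Matrix (Bool × β) γ ℂ} (h : pauliZ β * v = v) :
    phaseZ β φ * v = Complex.exp (Complex.I * φ) • v := by
  ext ⟨c, x⟩ y
  have := congrFun (congrFun h (c, x)) y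
  cases c
  · simp [phaseZ]
  · simp only [pauliZ, Matrix.diagonal_mul] at this
    have h0 : v (true, x) y = 0 := by simpa using self_eq_neg.mp (by simpa using this.symm)
    simp [phaseZ, h0]

lemma phaseZ_mul_of_odd {γ : Type*} (φ : ℝ) {v : Matrix (Bool × β) γ ℂ} (h : pauliZ β * v = -v) :
    phaseZ β φ * v = Complex.exp (-(Complex.I * φ)) • v := by
  ext ⟨c, x⟩ y
  have := congrFun (congrFun h (c, x)) y
  cases c
  · simp only [pauliZ, Matrix.diagonal_mul] at this
    have h0 : v (false, x) y = 0 := by simpa using self_eq_neg.mp (by simpa using this)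
    simp [phaseZ, h0]
  · simp [phaseZ]

lemma pauliZ_mul_sinOp (N : Op β) : pauliZ β * sinOp N = -sinOp N * pauliZ β := by
  rw [sinOp, pauliZ_mul_cfc]
  have : cfc (fun x => Real.sin (-x)) (offDiag N) = -cfc Real.sin (offDiag N) := by
    simp only [Real.sin_neg]; exact cfc_neg _ _
  rw [this]

lemma pauliZ_mul_cosOp (N : Op β) : pauliZ β * cosOp N = cosOp N * pauliZ β := by
  rw [cosOp, pauliZ_mul_cfc]; simp only [Real.cos_neg]

/-- A polynomial is even (`b = false`) or odd (`b = true`). -/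
def HasParity (b : Bool) (P : ℂ[X]) : Prop := P.comp (-X) = if b then -P else P

lemma pauliZ_mul_aeval (N : Op β) {b : Bool} {P : ℂ[X]} (hP : HasParity b P) :
    pauliZ β * (aeval (sinOp N) P * ketQubit β false) =
      (if b then (-1 : ℂ) else 1) • (aeval (sinOp N) P * ketQubit β false) := by
  have h1 : pauliZ β * aeval (sinOp N) P = aeval (-sinOp N) P * pauliZ β :=
    mul_aeval_of_intertwine (pauliZ_mul_sinOp N) P
  have h2 : aeval (-sinOp N) P = aeval (sinOp N) (P.comp (-X)) := by
    rw [aeval_comp]; simp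
  rw [← Matrix.mul_assoc, h1, Matrix.mul_assoc, pauliZ_mul_ketQubit_false, h2, hP]
  cases b <;> simp

lemma cosOp_mul_aeval (N : Op β) (P : ℂ[X]) :
    cosOp N * aeval (sinOp N) P = aeval (sinOp N) P * cosOp N := by
  exact mul_aeval_of_intertwine (cosOp_mul_sinOp N) P

lemma pauliZ_mul_cosOp_mul_aeval (N : Op β) {b : Bool} {P : ℂ[X]} (hP : HasParity b P) :
    pauliZ β * (cosOp N * aeval (sinOp N) P * ketQubit β false) =
      (if b then (-1 : ℂ) else 1) • (cosOp N * aeval (sinOp N) P * ketQubit β false) := by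
  rw [Matrix.mul_assoc, ← Matrix.mul_assoc (pauliZ β), pauliZ_mul_cosOp, Matrix.mul_assoc,
    pauliZ_mul_aeval N hP, Matrix.mul_smul]

lemma HasParity.qspStep {b : Bool} {S : ℂ[X] × ℂ[X]} (h1 : HasParity b S.1)
    (h2 : HasParity (!b) S.2) :
    HasParity (!b) (X * S.1 + (1 - X ^ 2) * S.2) ∧ HasParity b (S.1 - X * S.2) := by
  unfold HasParity at *
  simp only [add_comp, mul_comp, sub_comp, X_comp, one_comp, pow_comp, h1, h2]
  cases b <;> simp <;> ring

lemma HasParity.C_mul {b : Bool} {P : ℂ[X]} (h : HasParity b P) (c : ℂ) : HasParity b (C c * P) := by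
  unfold HasParity at *
  rw [mul_comp, C_comp, h]
  cases b <;> simp

/-- The first column of the circuit after an even (`b = false`) or odd number of steps. -/
def qsvtColumn (N : Op β) (b : Bool) (S : ℂ[X] × ℂ[X]) : Matrix (Bool × β) β ℂ :=
  if b then pauliX β * (aeval (sinOp N) S.1 * ketQubit β false) -
    Complex.I • (pauliX β * (cosOp N * aeval (sinOp N) S.2 * ketQubit β false))
  else aeval (sinOp N) S.1 * ketQubit β false +
    Complex.I • (cosOp N * aeval (sinOp N) S.2 * ketQubit β false)

/-- `U` or `U†`. -/
def adjIf (U : Op (Bool × β)) (b : Bool) : Op (Bool × β) := if b then Uᴴ else U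

/-- Write `s`, `c` for the commuting sine and cosine, with `s² + c² = 1`. Then `(s - i c)(P(s) + i c
R(s)) = P₁(s) - i c R₁(s)`, where `P₁ = X P + (1 - X²) R` and `R₁ = P - X R` as in a signal
processing step. By parity each of the two parts is an eigenspace of `Z`, so the phase gate is a
scalar on it. -/
lemma qsvtColumn_step (N : Op β) {b : Bool} {S : ℂ[X] × ℂ[X]} (h1 : HasParity b S.1)
    (h2 : HasParity (!b) S.2) (φ : ℝ) :
    phaseZ β φ * adjIf (sineUnitary N) b * qsvtColumn N b S = qsvtColumn N (!b) (qspStep S φ) := by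
  obtain ⟨P, R⟩ := S
  obtain ⟨p1, p2⟩ := HasParity.qspStep h1 h2
  simp only at p1 p2
  set s := sinOp N with hs
  set c := cosOp N with hc
  set E := ketQubit β false with hE
  set P1 := X * P + (1 - X ^ 2) * R with hP1
  set R1 := P - X * R with hR1
  have hcc : c * c = 1 - s * s := by rw [eq_sub_iff_add_eq, add_comm]; exact sinOp_mul_self_add N
  have hcP : ∀ Q : ℂ[X], aeval s Q * c = c * aeval s Q := fun Q => (cosOp_mul_aeval N Q).symm
  have a1 : aeval s P1 = s * aeval s P + c * c * aeval s R := by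
    rw [hP1, hcc]; simp [sq]
  have a2 : aeval s R1 = aeval s P - s * aeval s R := by rw [hR1]; simp
  have hsc : s * c = c * s := (cosOp_mul_sinOp N).symm
  have m1 : (s - Complex.I • c) * (aeval s P + Complex.I • (c * aeval s R)) =
      aeval s P1 - Complex.I • (c * aeval s R1) := by
    rw [a1, a2]
    simp only [sub_mul, mul_add, mul_sub, smul_mul_assoc, mul_smul_comm, smul_smul,
      Complex.I_mul_I, ← mul_assoc, hsc, smul_sub, neg_smul, one_smul]
    module
  have m2 : (s + Complex.I • c) * (aeval s P - Complex.I • (c * aeval s R)) =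
      aeval s P1 + Complex.I • (c * aeval s R1) := by
    have a1' : aeval s P1 = s * aeval s P - (Complex.I * Complex.I) • (c * c * aeval s R) := by
      rw [a1, Complex.I_mul_I]; module
    rw [a1', a2]
    simp only [add_mul, mul_sub, smul_mul_assoc, mul_smul_comm, ← mul_assoc, hsc, smul_sub]
    module
  have z1 := pauliZ_mul_aeval N p1
  have z2 := pauliZ_mul_cosOp_mul_aeval N p2
  have hq1 : aeval s (qspStep (P, R) φ).1 = Complex.exp (Complex.I * φ) • aeval s P1 := by
    simp [qspStep, hP1, Algebra.smul_def]
  have hq2 : aeval s (qspStep (P, R) φ).2 = Complex.exp (-(Complex.I * φ)) • aeval s R1 := by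
    simp [qspStep, hR1, Algebra.smul_def]
  have hZX : ∀ v : Matrix (Bool × β) β ℂ, pauliZ β * (pauliX β * v) = -(pauliX β * (pauliZ β * v)) :=
    fun v => by rw [← Matrix.mul_assoc, pauliZ_mul_pauliX, Matrix.neg_mul, Matrix.mul_assoc]
  cases b
  · have e1 : sineUnitary N * qsvtColumn N false (P, R) =
        pauliX β * (aeval s P1 * E) - Complex.I • (pauliX β * (c * aeval s R1 * E)) := by
      simp only [qsvtColumn, Bool.false_eq_true, if_false, sineUnitary]
      rw [← Matrix.smul_mul, ← Matrix.add_mul, Matrix.mul_assoc, ← Matrix.mul_assoc _ _ E, m1,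
        Matrix.sub_mul, Matrix.mul_sub, Matrix.smul_mul, Matrix.mul_smul]
    simp only [Bool.not_false, if_true, Bool.false_eq_true, if_false] at z1 z2
    have y1 := phaseZ_mul_of_even φ (v := pauliX β * (aeval s P1 * E)) (by
      rw [hZX, z1]; simp; rfl)
    have y2 := phaseZ_mul_of_odd φ (v := pauliX β * (c * aeval s R1 * E)) (by
      rw [hZX, z2]; simp; rfl)
    simp only [adjIf, Bool.false_eq_true, if_false]
    rw [Matrix.mul_assoc, e1, Matrix.mul_sub, Matrix.mul_smul, y1, y2]
    simp only [qsvtColumn, Bool.not_false, if_true]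
    rw [hq1, hq2]
    simp only [Matrix.smul_mul, Matrix.mul_smul, mul_smul_comm]
    rw [← hc]
  · have e1 : (sineUnitary N)ᴴ * qsvtColumn N true (P, R) =
        aeval s P1 * E + Complex.I • (c * aeval s R1 * E) := by
      simp only [qsvtColumn, if_true, conjTranspose_sineUnitary]
      rw [← Matrix.mul_smul, ← Matrix.mul_sub, ← Matrix.smul_mul, ← Matrix.sub_mul,
        Matrix.mul_assoc, ← Matrix.mul_assoc (pauliX β), pauliX_mul_self, Matrix.one_mul,
        ← Matrix.mul_assoc, m2, Matrix.add_mul, Matrix.smul_mul]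
    simp only [Bool.not_true, if_true, Bool.false_eq_true, if_false] at z1 z2
    have y1 := phaseZ_mul_of_even φ (v := aeval s P1 * E) (by rw [z1]; simp; rfl)
    have y2 := phaseZ_mul_of_odd φ (v := c * aeval s R1 * E) (by rw [z2]; simp; rfl)
    simp only [adjIf, if_true]
    rw [Matrix.mul_assoc, e1, Matrix.mul_add, Matrix.mul_smul, y1, y2]
    simp only [qsvtColumn, Bool.not_true, Bool.false_eq_true, if_false]
    rw [hq1, hq2]
    simp only [Matrix.smul_mul, mul_smul_comm]
    rw [← hc]

/-- The alternating phase modulation sequence, as an operator. -/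
def alternateOp (U U' : Op (Bool × β)) : List ℝ → Op (Bool × β)
  | [] => 1
  | φ :: l => alternateOp U' U l * (phaseZ β φ * U)

lemma alternateOp_mul_qsvtColumn (N : Op β) (Φ : List ℝ) {b : Bool} {S : ℂ[X] × ℂ[X]}
    (h1 : HasParity b S.1) (h2 : HasParity (!b) S.2) :
    alternateOp (adjIf (sineUnitary N) b) (adjIf (sineUnitary N) (!b)) Φ * qsvtColumn N b S =
      qsvtColumn N (b ^^ decide (Odd Φ.length)) (Φ.foldl qspStep S) ∧
    HasParity (b ^^ decide (Odd Φ.length)) (Φ.foldl qspStep S).1 ∧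
    HasParity (!(b ^^ decide (Odd Φ.length))) (Φ.foldl qspStep S).2 := by
  induction Φ generalizing b S with
  | nil => simpa [alternateOp] using ⟨h1, h2⟩
  | cons φ Φ ih =>
    obtain ⟨p1, p2⟩ := HasParity.qspStep h1 h2
    have q1 : HasParity (!b) (qspStep S φ).1 := p1.C_mul _
    have q2 : HasParity (!(!b)) (qspStep S φ).2 := by rw [Bool.not_not]; exact p2.C_mul _
    have hx : (b ^^ decide (Odd (φ :: Φ).length)) = ((!b) ^^ decide (Odd Φ.length)) := by
      rw [List.length_cons]
      by_cases h : Odd Φ.length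
      · simp [h, Nat.odd_add_one]
      · simp [h, Nat.odd_add_one]
    obtain ⟨i1, i2, i3⟩ := ih q1 q2
    rw [hx, List.foldl_cons]
    refine ⟨?_, i2, i3⟩
    rw [alternateOp, Matrix.mul_assoc, qsvtColumn_step N h1 h2, ← i1, Bool.not_not]

/-- The block on `|0⟩` of the quantum signal processing circuit. -/
theorem alternateOp_block (N : Op β) {Φ : List ℝ} (hodd : Odd Φ.length) :
    (ketQubit β false)ᴴ * alternateOp (sineUnitary N) (sineUnitary N)ᴴ Φ * ketQubit β false =
      (ketQubit β true)ᴴ * aeval (sinOp N) (qspPoly Φ).1 * ketQubit β false := by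
  have h := alternateOp_mul_qsvtColumn N Φ (b := false) (S := (1, 0)) (by simp [HasParity])
    (by simp [HasParity])
  simp only [hodd, decide_true, Bool.false_bne, Bool.not_true] at h
  obtain ⟨h1, h2, h3⟩ := h
  have e : qsvtColumn N false (1, 0) = ketQubit β false := by simp [qsvtColumn]
  rw [e] at h1
  simp only [adjIf, Bool.false_eq_true, if_false, Bool.not_false, if_true] at h1
  rw [Matrix.mul_assoc, h1]
  simp only [qsvtColumn, if_true]
  -- After an odd number of steps the second polynomial is even. Its part of the column lies in the
  -- `|0⟩` sector before the final `X` and does not contribute to the block.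
  have hz := pauliZ_mul_cosOp_mul_aeval N (b := false) (P := (qspPoly Φ).2) h3
  simp only [Bool.false_eq_true, if_false, one_smul] at hz
  have hzero : (ketQubit β true)ᴴ * (cosOp N * aeval (sinOp N) (qspPoly Φ).2 * ketQubit β false)
      = 0 := by
    refine eq_zero_of_eq_neg ?_
    conv_lhs => rw [← hz, ← Matrix.mul_assoc, ketQubit_true_mul_pauliZ, Matrix.neg_mul]
  have hzero' := hzero
  rw [qspPoly] at hzero'
  rw [Matrix.mul_sub, Matrix.mul_smul, ← Matrix.mul_assoc, ketQubit_false_mul_pauliX,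
    ← Matrix.mul_assoc ((ketQubit β false)ᴴ), ketQubit_false_mul_pauliX, hzero', smul_zero,
    sub_zero, ← Matrix.mul_assoc]
  rfl

lemma aeval_sinOp_map (N : Op β) (p : ℝ[X]) :
    aeval (sinOp N) (p.map (algebraMap ℝ ℂ)) = cfc (fun x => p.eval (Real.sin x)) (offDiag N) := by
  rw [aeval_map_algebraMap, sinOp]
  have hS := isHermitian_offDiag N
  have h1 : cfc (fun x => p.eval x) (cfc Real.sin (offDiag N)) = aeval (cfc Real.sin (offDiag N)) p :=
    cfc_polynomial p _ (conjTranspose_cfc _ _)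
  rw [← h1]
  exact (cfc_comp' (fun x => p.eval x) Real.sin (offDiag N)
    ((Matrix.finite_real_spectrum.image _).continuousOn _) (continuousOn_spectrum _ _) hS).symm

/-- The block of the linear combination of the two conjugate circuits is the singular value
transformation by the real part of the polynomial. -/
theorem alternateOp_add_block (N : Op β) {Φ : List ℝ} (hodd : Odd Φ.length) {p : ℝ[X]}
    (hp : (qspPoly Φ).1 + conjPoly (qspPoly Φ).1 = 2 * p.map (algebraMap ℝ ℂ))
    (hpodd : ∀ x, p.eval (-x) = -p.eval x) :
    (1 / 2 : ℂ) • ((ketQubit β false)ᴴ * (alternateOp (sineUnitary N) (sineUnitary N)ᴴ Φ +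
      alternateOp (sineUnitary N) (sineUnitary N)ᴴ (Φ.map Neg.neg)) * ketQubit β false) =
      svMap (fun x => p.eval (Real.sin x)) N := by
  rw [Matrix.mul_add, Matrix.add_mul, alternateOp_block N hodd,
    alternateOp_block N (by simpa using hodd), qspPoly_neg, ← Matrix.add_mul, ← Matrix.mul_add,
    ← map_add, hp, map_mul, aeval_sinOp_map]
  have h2 : aeval (sinOp N) (2 : ℂ[X]) = (2 : ℂ) • (1 : Op (Bool × β)) := by
    rw [map_ofNat, ofNat_smul_eq_nsmul, nsmul_one, Nat.cast_ofNat]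
  rw [h2, smul_mul_assoc, one_mul, Matrix.mul_smul, Matrix.smul_mul, smul_smul,
    ketQubit_cfc_offDiag (fun x => by rw [Real.sin_neg, hpodd])]
  norm_num

end SingularValueTransformation

/-! ### Singular value transforms under isometries. -/

section SvMap

variable {α β γ : Type*} [Fintype α] [DecidableEq α] [Fintype β] [DecidableEq β]
  [Fintype γ] [DecidableEq γ]

/-- `L†` intertwines the Gram matrix of `K M L†` with that of `M`. Applied to `|ρ⟩⟨σ| ⊗ M`, it
leaves the rank-one factor untouched. -/
lemma svMap_sandwich (f : ℝ → ℝ) (M : Op β) {K L : Matrix γ β ℂ} (hK : Kᴴ * K = 1)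
    (hL : Lᴴ * L = 1) : svMap f (K * M * Lᴴ) = K * svMap f M * Lᴴ := by
  have e : (K * M * Lᴴ)ᴴ * (K * M * Lᴴ) = L * (Mᴴ * M) * Lᴴ := by
    simp only [Matrix.conjTranspose_mul, Matrix.conjTranspose_conjTranspose, Matrix.mul_assoc]
    rw [← Matrix.mul_assoc Kᴴ, hK, Matrix.one_mul]
  have h : Lᴴ * ((K * M * Lᴴ)ᴴ * (K * M * Lᴴ)) = Mᴴ * M * Lᴴ := by
    rw [e, ← Matrix.mul_assoc, ← Matrix.mul_assoc, hL, Matrix.one_mul]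
  rw [svMap, svMap, Matrix.mul_assoc, mul_cfc_of_intertwine (isHermitian_gram _)
    (isHermitian_gram M) h, ← Matrix.mul_assoc, Matrix.mul_assoc K]

/-- The isometry `|y⟩ ↦ |ψ⟩ ⊗ |y⟩`. -/
def prependVec (β : Type*) [DecidableEq β] (ψ : α → ℂ) : Matrix (α × β) β ℂ :=
  fun x y => if x.2 = y then ψ x.1 else 0

lemma sum_star_mul_self {ψ : α → ℂ} (h : IsPureState ψ) : ∑ i, star (ψ i) * ψ i = 1 := by
  have : ∑ i, star (ψ i) * ψ i = ((∑ i, ‖ψ i‖ ^ 2 : ℝ) : ℂ) := by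
    push_cast
    exact Finset.sum_congr rfl fun i _ => by rw [RCLike.star_def, Complex.conj_mul']
  rw [this, h]; simp

lemma prependVec_isometry {ψ : α → ℂ} (h : IsPureState ψ) :
    (prependVec β ψ)ᴴ * prependVec β ψ = 1 := by
  ext i j
  simp only [Matrix.mul_apply, Matrix.conjTranspose_apply, prependVec, Fintype.sum_prod_type,
    Matrix.one_apply]
  rw [← sum_star_mul_self h, Finset.sum_congr rfl fun x _ => Finset.sum_eq_single i ?_ ?_]
  · by_cases h : i = j <;> simp [h]
  · intro k _ hk; simp [hk]
  · simp

lemma ketbra_kronecker (X : Op β) (v w : α → ℂ) :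
    ketbra v w ⊗ₖ X = prependVec β v * X * (prependVec β w)ᴴ := by
  ext ⟨k, i⟩ ⟨l, j⟩
  simp only [Matrix.kroneckerMap_apply, ketbra, Matrix.vecMulVec_apply, Pi.star_apply,
    Matrix.mul_apply, prependVec, Matrix.conjTranspose_apply, ite_mul, zero_mul,
    Finset.sum_ite_eq, Finset.mem_univ, if_true]
  rw [Finset.sum_eq_single j]
  · simp; ring
  · intro b _ hb; simp [hb.symm]
  · simp

lemma svMap_ketbra_kronecker (f : ℝ → ℝ) (M : Op β) {v w : α → ℂ} (hv : IsPureState v)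
    (hw : IsPureState w) : svMap f (ketbra v w ⊗ₖ M) = ketbra v w ⊗ₖ svMap f M := by
  rw [ketbra_kronecker, svMap_sandwich f M (prependVec_isometry hv) (prependVec_isometry hw),
    ← ketbra_kronecker]

end SvMap

/-! ### Replacement channels and the norm of positive matrices. -/

section Densities

variable {α β γ : Type*} [Fintype α] [DecidableEq α] [Fintype β] [DecidableEq β]
  [Fintype γ] [DecidableEq γ]

lemma DiamondBound.sum {ι : Type*} (s : Finset ι) {T : ι → Op α →ₗ[ℂ] Op β} {c : ι → ℝ}
    (h : ∀ i, DiamondBound (T i) (c i)) : DiamondBound (∑ i ∈ s, T i) (∑ i ∈ s, c i) := by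
  classical
  induction s using Finset.induction_on with
  | empty =>
    intro R _ _ X
    have : UhlmannSample.idTensor R (∑ i ∈ (∅ : Finset ι), T i) X = (0 : ℂ) • (0 : Op (R × β)) := by
      ext; simp [idTensor_apply]; rfl
    rw [this]
    refine (traceNorm_smul_le _ _).trans ?_
    simp
  | insert i s hi ih =>
    rw [Finset.sum_insert hi, Finset.sum_insert hi]
    exact (h i).add ih

/-- `W W†` is the sum of the rank-one operators of the columns of `W`, whose replacement maps are
already bounded by the squared norms. -/
lemma diamondBound_replaceBy_mul_conjTranspose (W : Matrix β γ ℂ) :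
    DiamondBound (replaceBy (α := α) (W * Wᴴ)) (∑ k, ∑ i, ‖W i k‖ ^ 2) := by
  have : replaceBy (α := α) (W * Wᴴ) = ∑ k, replaceBy (ketbra (fun i => W i k) fun i => W i k) := by
    ext X i j
    simp [replaceBy, ketbra, Matrix.vecMulVec_apply, Matrix.mul_apply, LinearMap.sum_apply,
      Matrix.sum_apply, Finset.mul_sum]
  rw [this]
  exact DiamondBound.sum _ fun k => diamondBound_replaceBy_ketbra _

open scoped Matrix.Norms.L2Operator in
lemma norm_le_trace_of_posSemidef {H : Op α} (hH : H.PosSemidef) : ‖H‖ ≤ H.trace.re := by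
  have e2 : H.trace.re = ∑ i, hH.1.eigenvalues i := by
    rw [hH.1.trace_eq_sum_eigenvalues]; simp
  have h0 : ∀ i ∈ Finset.univ, 0 ≤ hH.1.eigenvalues i := fun i _ => hH.eigenvalues_nonneg i
  conv_lhs => rw [← cfc_fun_id hH.1]
  refine norm_cfc_le_of_le (e2 ▸ Finset.sum_nonneg h0) fun x hx => ?_
  rw [abs_of_nonneg (spectrum_nonneg_of_posSemidef hH hx), e2]
  rw [hH.1.spectrum_real_eq_range_eigenvalues] at hx
  obtain ⟨i, rfl⟩ := hx
  exact Finset.single_le_sum h0 (Finset.mem_univ i)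

end Densities

/-! ### The program state Υ and the block-encoding of the sine. -/

section Program

variable {A B : Type*} [Fintype A] [DecidableEq A] [Fintype B] [DecidableEq B]

lemma pauliZ_mul_self (τ : Type*) [Fintype τ] [DecidableEq τ] : pauliZ τ * pauliZ τ = 1 := by
  rw [pauliZ, Matrix.diagonal_mul_diagonal, ← Matrix.diagonal_one]
  congr 1; funext x; cases x.1 <;> simp

lemma conjTranspose_pauliZ (τ : Type*) [Fintype τ] [DecidableEq τ] : (pauliZ τ)ᴴ = pauliZ τ := by
  rw [pauliZ, Matrix.diagonal_conjTranspose]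
  congr 1; funext x; cases h : x.1 <;> simp [h]

/-- The vector `xiVec` as an operator from `A₂` to the other systems. -/
def xiMat (ρ σ : A × B → ℂ) : Matrix (Tgt A B) A ℂ := fun x k => xiVec ρ σ (k, x)

lemma xi_eq (ρ σ : A × B → ℂ) : xi ρ σ = xiMat ρ σ * (xiMat ρ σ)ᴴ := by
  ext x y
  simp [xi, traceFst, xiMat, ketbra, Matrix.vecMulVec_apply, Matrix.mul_apply]

lemma sum_norm_xiVec {ρ σ : A × B → ℂ} (hρ : IsPureState ρ) (hσ : IsPureState σ) :
    ∑ k, ∑ x, ‖xiMat ρ σ x k‖ ^ 2 = 1 := by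
  have h2 : (√2 : ℝ)⁻¹ ^ 2 = 1 / 2 := by rw [inv_pow, Real.sq_sqrt (by norm_num)]; norm_num
  have hf : ∀ (c : Bool) (k : A) (p : A × B) (b : B), ‖xiMat ρ σ (c, (p, b)) k‖ ^ 2 =
      1 / 2 * (if c then ‖ρ p‖ ^ 2 * ‖σ (k, b)‖ ^ 2 else ‖σ p‖ ^ 2 * ‖ρ (k, b)‖ ^ 2) := by
    intro c k p b
    cases c <;> simp [xiMat, xiVec, mul_pow, abs_of_nonneg, Real.sqrt_nonneg, h2]
  have hs : ∀ φ ψ : A × B → ℂ, IsPureState φ → IsPureState ψ →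
      ∑ k, ∑ p, ∑ b, ‖φ p‖ ^ 2 * ‖ψ (k, b)‖ ^ 2 = 1 := by
    intro φ ψ h1 h2
    rw [Finset.sum_comm]
    simp only [← Finset.mul_sum, ← Fintype.sum_prod_type (f := fun x : A × B => ‖ψ x‖ ^ 2)]
    rw [← Finset.sum_mul, h1, h2, one_mul]
  have hx : ∀ k, ∑ x, ‖xiMat ρ σ x k‖ ^ 2 =
      1 / 2 * (∑ p, ∑ b, ‖ρ p‖ ^ 2 * ‖σ (k, b)‖ ^ 2 + ∑ p, ∑ b, ‖σ p‖ ^ 2 * ‖ρ (k, b)‖ ^ 2) := by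
    intro k
    rw [Fintype.sum_prod_type, Fintype.sum_bool, mul_add]
    congr 1 <;> rw [Fintype.sum_prod_type, Finset.mul_sum] <;>
      simp only [hf, if_true, Bool.false_eq_true, if_false, Finset.mul_sum]
  simp only [hx]
  rw [← Finset.mul_sum, Finset.sum_add_distrib, hs ρ σ hρ hσ, hs σ ρ hσ hρ]
  norm_num

lemma trace_xi {ρ σ : A × B → ℂ} (hρ : IsPureState ρ) (hσ : IsPureState σ) :
    (xi ρ σ).trace = 1 := by
  have := sum_norm_xiVec hρ hσ
  rw [Finset.sum_comm] at this
  rw [xi_eq, Matrix.trace]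
  simp only [Matrix.diag_apply, Matrix.mul_apply, Matrix.conjTranspose_apply, RCLike.star_def,
    Complex.mul_conj']
  exact_mod_cast this

lemma qubitBlock_upsilon_false (ρ σ : A × B → ℂ) :
    qubitBlock (upsilon ρ σ) false = (1 / 2 : ℂ) • xi ρ σ := by
  ext x y
  simp [qubitBlock, upsilon]

lemma qubitBlock_upsilon_true (ρ σ : A × B → ℂ) :
    qubitBlock (upsilon ρ σ) true = (1 / 2 : ℂ) • (pauliZ _ * xi ρ σ * pauliZ _) := by
  ext x y
  simp [qubitBlock, upsilon]

lemma trace_upsilon {ρ σ : A × B → ℂ} (hρ : IsPureState ρ) (hσ : IsPureState σ) :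
    (upsilon ρ σ).trace = 1 := by
  rw [upsilon, Matrix.trace_smul, Matrix.trace_add, Matrix.trace_kronecker, Matrix.trace_kronecker,
    Matrix.trace_mul_comm, ← Matrix.mul_assoc, pauliZ_mul_self, Matrix.one_mul, trace_xi hρ hσ]
  simp
  norm_num

lemma diamondBound_replaceBy_upsilon {α : Type*} [Fintype α] [DecidableEq α] {ρ σ : A × B → ℂ}
    (hρ : IsPureState ρ) (hσ : IsPureState σ) :
    DiamondBound (replaceBy (α := α) (qubitBlock (upsilon ρ σ) false +
      qubitBlock (upsilon ρ σ) true)) 1 := by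
  set Z := pauliZ ((A × B) × B) with hZ
  have h1 := (diamondBound_replaceBy_mul_conjTranspose (α := α) (xiMat ρ σ)).smul (1 / 2)
  have h2 := (diamondBound_replaceBy_mul_conjTranspose (α := α)
    (Z * xiMat ρ σ)).smul (1 / 2)
  have e : ∀ x k, ‖(Z * xiMat ρ σ) x k‖ = ‖xiMat ρ σ x k‖ := fun x k => by
    rw [hZ, pauliZ, Matrix.diagonal_mul]; cases x.1 <;> simp
  simp only [e, sum_norm_xiVec hρ hσ] at h1 h2
  have h3 := h1.add h2
  rw [qubitBlock_upsilon_false, qubitBlock_upsilon_true, xi_eq]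
  have e2 : (1 / 2 : ℂ) • replaceBy (α := α) (xiMat ρ σ * (xiMat ρ σ)ᴴ) + (1 / 2 : ℂ) •
      replaceBy (α := α) (Z * xiMat ρ σ * (Z * xiMat ρ σ)ᴴ) =
      replaceBy ((1 / 2 : ℂ) • (xiMat ρ σ * (xiMat ρ σ)ᴴ) +
        (1 / 2 : ℂ) • (Z * (xiMat ρ σ * (xiMat ρ σ)ᴴ) * Z)) := by
    rw [Matrix.conjTranspose_mul, hZ, conjTranspose_pauliZ]
    ext1 X
    simp only [replaceBy, LinearMap.add_apply, LinearMap.smul_apply, LinearMap.coe_mk,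
      AddHom.coe_mk, Matrix.mul_assoc]
    module
  rw [e2] at h3
  exact h3.mono (by norm_num)

/-- The operator `|ρ⟩⟨σ| ⊗ M` whose singular values are transformed. -/
def overlapOp (ρ σ : A × B → ℂ) : Op ((A × B) × B) := ketbra ρ σ ⊗ₖ overlap ρ σ

/-- The generator `½ (|1⟩⟨0| ⊗ |ρ⟩⟨σ| ⊗ M + h.c.)` of the simulated evolution. -/
lemma qubitBlock_upsilon_sub (ρ σ : A × B → ℂ) :
    qubitBlock (upsilon ρ σ) false - qubitBlock (upsilon ρ σ) true =
      (1 / 2 : ℂ) • offDiag (overlapOp ρ σ) := by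
  rw [qubitBlock_upsilon_false, qubitBlock_upsilon_true, ← smul_sub]
  congr 1
  have h2 : (((√2 : ℝ) : ℂ))⁻¹ * ((√2 : ℝ) : ℂ)⁻¹ = 1 / 2 := by
    rw [← mul_inv, ← Complex.ofReal_mul, Real.mul_self_sqrt (by norm_num)]; norm_num
  have key : ∀ (z w : ℂ), (((√2 : ℝ) : ℂ))⁻¹ * z * (((√2 : ℝ) : ℂ)⁻¹ * w) = 1 / 2 * (z * w) := by
    intro z w; rw [← h2]; ring
  ext ⟨c, p, b⟩ ⟨d, q, b'⟩
  cases c <;> cases d <;>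
    simp [pauliZ, offDiag, overlapOp, xi, traceFst, ketbra, Matrix.vecMulVec_apply, xiVec,
      overlap, Finset.mul_sum, ← Finset.sum_add_distrib, key]
  · refine Finset.sum_congr rfl fun k _ => by ring
  · refine Finset.sum_congr rfl fun k _ => by ring

open scoped Matrix.Norms.L2Operator in
lemma norm_half_offDiag_le {ρ σ : A × B → ℂ} (hρ : IsPureState ρ) (hσ : IsPureState σ) :
    ‖(1 / 2 : ℂ) • offDiag (overlapOp ρ σ)‖ ≤ 1 := by
  have h1 : ‖xi ρ σ‖ ≤ 1 := by
    have := norm_le_trace_of_posSemidef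
      (H := xi ρ σ) (by rw [xi_eq]; exact Matrix.posSemidef_self_mul_conjTranspose _)
    rwa [trace_xi hρ hσ, Complex.one_re] at this
  have hz : ‖pauliZ ((A × B) × B)‖ ≤ 1 :=
    norm_le_one_of_isometry (by rw [conjTranspose_pauliZ, pauliZ_mul_self])
  have h2 : ‖pauliZ _ * xi ρ σ * pauliZ _‖ ≤ 1 :=
    calc _ ≤ ‖pauliZ ((A × B) × B)‖ * ‖xi ρ σ‖ * ‖pauliZ ((A × B) × B)‖ :=
        (norm_mul_le _ _).trans (mul_le_mul_of_nonneg_right (norm_mul_le _ _) (norm_nonneg _))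
      _ ≤ 1 * 1 * 1 := by gcongr
      _ = 1 := by norm_num
  rw [← qubitBlock_upsilon_sub, qubitBlock_upsilon_false, qubitBlock_upsilon_true, ← smul_sub,
    norm_smul]
  have := norm_sub_le (xi ρ σ) (pauliZ _ * xi ρ σ * pauliZ _)
  norm_num
  linarith

/-- The evolution time 2 compensates the factor ½ in the generator, so that sine and cosine are
evaluated at the singular values themselves. -/
lemma expI_half_offDiag (N : Op (Bool × B)) (hN : N.IsHermitian) :
    expI ((1 / 2 : ℂ) • N) 2 = cfc Real.cos N + Complex.I • cfc Real.sin N := by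
  have e : (1 / 2 : ℂ) • N = (1 / 2 : ℝ) • N := by
    ext i j; simp
  have h : ∀ f : ℝ → ℝ, cfc (fun x => f (2 * x)) ((1 / 2 : ℂ) • N) = cfc f N := by
    intro f
    rw [e]
    refine (cfc_comp_const_mul (1 / 2 : ℝ) (fun x => f (2 * x)) N
      ((Matrix.finite_real_spectrum.image _).continuousOn _) hN).symm.trans ?_
    refine cfc_congr fun x _ => ?_
    simp
  rw [expI, h, h]

lemma conjBy_smul {α : Type*} [Fintype α] [DecidableEq α] {c : ℂ} (hc : c * star c = 1)
    (K : Op α) : conjBy (c • K) = conjBy K := by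
  ext1 X
  rw [conjBy_apply, conjBy_apply, Matrix.conjTranspose_smul, Matrix.smul_mul, Matrix.smul_mul,
    Matrix.mul_smul, smul_smul, hc, one_smul]

/-- The remaining factor `i` is a global phase, invisible to conjugation. -/
lemma pauliX_mul_expI (N : Op B) :
    pauliX B * expI ((1 / 2 : ℂ) • offDiag N) 2 = Complex.I • sineUnitary N := by
  rw [expI_half_offDiag _ (isHermitian_offDiag N), sineUnitary, sinOp, cosOp, ← Matrix.mul_smul,
    smul_sub, smul_smul, Complex.I_mul_I]
  congr 1
  module

lemma pauliX_isometry (τ : Type*) [Fintype τ] [DecidableEq τ] : (pauliX τ)ᴴ * pauliX τ = 1 := by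
  rw [conjTranspose_pauliX, pauliX_mul_self]

lemma isHermitian_half_offDiag (N : Op B) : ((1 / 2 : ℂ) • offDiag N).IsHermitian := by
  rw [Matrix.IsHermitian, Matrix.conjTranspose_smul, (isHermitian_offDiag N).eq]
  simp

lemma diamondBound_chanG_sub {ρ σ : A × B → ℂ} (hρ : IsPureState ρ) (hσ : IsPureState σ) {m : ℕ}
    (hm : 52 ≤ m) :
    DiamondBound (chanG ρ σ m - conjBy (sineUnitary (overlapOp ρ σ))) (104 / m) := by
  have h := diamondBound_dmesub_sub (trace_upsilon hρ hσ) (diamondBound_replaceBy_upsilon hρ hσ)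
    (qubitBlock_upsilon_sub ρ σ) (isHermitian_half_offDiag _) (norm_half_offDiag_le hρ hσ)
    (t := 2) (by norm_num) hm
  have h2 := (diamondBound_conjBy (pauliX_isometry ((A × B) × B))).comp zero_le_one h
  rw [one_mul, LinearMap.comp_sub, conjBy_comp, pauliX_mul_expI, conjBy_smul (by simp)] at h2
  exact h2

lemma diamondBound_chanGinv_sub {ρ σ : A × B → ℂ} (hρ : IsPureState ρ) (hσ : IsPureState σ) {m : ℕ}
    (hm : 52 ≤ m) :
    DiamondBound (chanGinv ρ σ m - conjBy (sineUnitary (overlapOp ρ σ))ᴴ) (104 / m) := by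
  have h := diamondBound_dmesub_sub (trace_upsilon hρ hσ) (diamondBound_replaceBy_upsilon hρ hσ)
    (qubitBlock_upsilon_sub ρ σ) (isHermitian_half_offDiag _) (norm_half_offDiag_le hρ hσ)
    (t := -2) (by norm_num) hm
  have h2 := h.comp (by positivity) (diamondBound_conjBy (pauliX_isometry ((A × B) × B)))
  rw [mul_one, LinearMap.sub_comp, conjBy_comp, ← conjTranspose_expI] at h2
  have e : (expI ((1 / 2 : ℂ) • offDiag (overlapOp ρ σ)) 2)ᴴ * pauliX _ =
      (-Complex.I) • (sineUnitary (overlapOp ρ σ))ᴴ := by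
    conv_lhs => rw [← conjTranspose_pauliX (β := (A × B) × B), ← Matrix.conjTranspose_mul,
      pauliX_mul_expI, Matrix.conjTranspose_smul]
    simp
  rw [e, conjBy_smul (by simp)] at h2
  exact h2

lemma submatrix_blockC (U : Op (Tgt A B)) : U.submatrix blockC blockC =
    (ketQubit ((A × B) × B) false)ᴴ * U * ketQubit ((A × B) × B) false := by
  ext x y
  rw [mul_ketQubit_apply, ketQubit_mul_apply]
  rfl

lemma sineBlockEncoding {ρ σ : A × B → ℂ} (hρ : IsPureState ρ) (hσ : IsPureState σ) {m : ℕ}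
    (hm : 52 ≤ m) {ε : ℝ} (hε : 104 / m ≤ 2 * ε) : SineBlockEncoding ρ σ m ε := by
  have h0 : 0 ≤ ε := by
    have : (0 : ℝ) ≤ 104 / m := by positivity
    linarith
  refine ⟨sineUnitary (overlapOp ρ σ), ⟨sineUnitary_mem _, ?_⟩,
    ((diamondBound_chanG_sub hρ hσ hm).mono hε).diamondClose h0,
    ((diamondBound_chanGinv_sub hρ hσ hm).mono hε).diamondClose h0⟩
  rw [submatrix_blockC, sineUnitary_block, overlapOp, svMap_ketbra_kronecker _ _ hρ hσ]

end Program

/-! ### The full circuit with ideal unitaries, and its distance to the channel version. -/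

section Qsvt

variable {A B : Type*} [Fintype A] [DecidableEq A] [Fintype B] [DecidableEq B]

/-- The operator on `B H Â B̂` that acts as `F d` on `C Â B̂ B` if the qubit `D` is in `|d⟩`. -/
def sysOp (F : Bool → Op (Tgt A B)) : Op (Sys A B) := fun x y =>
  if x.2.1.2 = y.2.1.2 then F x.2.1.2 (sysEquivTgt A B x).2 (sysEquivTgt A B y).2 else 0

/-- Operators controlled by `D` are block diagonal, so products and adjoints are computed blockwise.
-/
lemma sysOp_eq (F : Bool → Op (Tgt A B)) : sysOp F =
    (Matrix.blockDiagonal F).submatrix ((sysEquivTgt A B).trans (Equiv.prodComm _ _))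
      ((sysEquivTgt A B).trans (Equiv.prodComm _ _)) := by
  ext x y
  simp only [sysOp, Matrix.submatrix_apply, Matrix.blockDiagonal_apply]
  rfl

lemma sysOp_mul (F G : Bool → Op (Tgt A B)) : sysOp F * sysOp G = sysOp fun d => F d * G d := by
  rw [sysOp_eq, sysOp_eq, sysOp_eq, Matrix.submatrix_mul_equiv, Matrix.blockDiagonal_mul]

lemma conjTranspose_sysOp (F : Bool → Op (Tgt A B)) : (sysOp F)ᴴ = sysOp fun d => (F d)ᴴ := by
  rw [sysOp_eq, sysOp_eq, Matrix.conjTranspose_submatrix, Matrix.blockDiagonal_conjTranspose]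

lemma sysOp_one : sysOp (fun _ => (1 : Op (Tgt A B))) = 1 := by
  rw [sysOp_eq]
  have : Matrix.blockDiagonal (fun _ : Bool => (1 : Op (Tgt A B))) = 1 := Matrix.blockDiagonal_one
  rw [this, Matrix.submatrix_one_equiv]

lemma onSys_conjBy (U : Op (Tgt A B)) : onSys (conjBy U) = conjBy (sysOp fun _ => U) := by
  have e : sysOp (fun _ => U) = ((1 : Op Bool) ⊗ₖ U).submatrix (sysEquivTgt A B)
      (sysEquivTgt A B) := by
    ext x y
    simp only [sysOp, Matrix.submatrix_apply, Matrix.kroneckerMap_apply, Matrix.one_apply, ite_mul,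
      one_mul, zero_mul]
    rfl
  ext1 X
  have h := idTensor_sandwich Bool U Uᴴ (relabel (sysEquivTgt A B) X)
  rw [← conjBy_eq_sandwich] at h
  simp only [onSys, LinearMap.comp_apply]
  rw [h, conjBy_apply, e]
  have hX : X = (relabel (sysEquivTgt A B) X).submatrix (sysEquivTgt A B) (sysEquivTgt A B) := by
    ext x y; simp [relabel]
  conv_rhs => rw [hX]
  rw [Matrix.conjTranspose_submatrix, Matrix.submatrix_mul_equiv, Matrix.submatrix_mul_equiv,
    Matrix.conjTranspose_kronecker, Matrix.conjTranspose_one]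
  rfl

lemma phaseGate_eq (φ : ℝ) :
    phaseGate A B φ = sysOp fun d => phaseZ _ (if d then -φ else φ) := by
  ext ⟨b, ⟨c, d⟩, p⟩ ⟨b', ⟨c', d'⟩, p'⟩
  have h : ((b, ((c, d), p)) : Sys A B) = (b', ((c', d'), p')) ↔
      d = d' ∧ ((c, (p, b)) : Tgt A B) = (c', (p', b')) := by
    simp only [Prod.mk.injEq]; tauto
  by_cases hd : d = d'
  · by_cases hx : ((c, (p, b)) : Tgt A B) = (c', (p', b'))
    · obtain ⟨rfl, rfl, rfl⟩ : c = c' ∧ p = p' ∧ b = b' := by simpa using hx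
      subst hd
      cases c <;> cases d <;> simp [phaseGate, sysOp, phaseZ, sysEquivTgt]
    · rw [phaseGate, Matrix.diagonal_apply_ne _ (fun hh => hx (h.mp hh).2)]
      simp only [sysOp, sysEquivTgt, Equiv.coe_fn_mk, phaseZ]
      rw [if_pos hd, Matrix.diagonal_apply_ne _ hx]
  · rw [phaseGate, Matrix.diagonal_apply_ne _ (fun hh => hd (h.mp hh).1)]
    simp only [sysOp]
    rw [if_neg hd]

/-- The gate `e^{iφ Z⊗Z}` is `e^{iφZ}` on `C` for `D` in `|0⟩` and `e^{-iφZ}` for `D` in `|1⟩`; the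
second branch runs the same sequence with all phases negated. -/
lemma alternate_conjBy (U U' : Op (Tgt A B)) (Φ : List ℝ) :
    alternate (onSys (conjBy U)) (onSys (conjBy U')) Φ =
      conjBy (sysOp fun d => alternateOp U U' (if d then Φ.map Neg.neg else Φ)) := by
  induction Φ generalizing U U' with
  | nil =>
    have : (fun d : Bool => alternateOp U U' (if d then List.map Neg.neg [] else [])) =
        fun _ => 1 := by funext d; cases d <;> rfl
    rw [this, sysOp_one]
    ext1 X
    simp [alternate, conjBy_apply]
  | cons φ Φ ih =>
    rw [alternate, ih, phaseGate_eq, onSys_conjBy, conjBy_comp, conjBy_comp, sysOp_mul, sysOp_mul]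
    congr 2
    funext d
    cases d <;> simp [alternateOp]

/-- The unitary of the singular value transformation circuit. -/
def qsvtUnitary (U : Op (Tgt A B)) (Φ : List ℝ) : Op (Sys A B) :=
  hadamardD A B * sysOp (fun d => alternateOp U Uᴴ (if d then Φ.map Neg.neg else Φ)) * hadamardD A B

lemma qsvt_conjBy (U : Op (Tgt A B)) (Φ : List ℝ) :
    qsvt (conjBy U) (conjBy Uᴴ) Φ = conjBy (qsvtUnitary U Φ) := by
  rw [qsvt, alternate_conjBy, conjBy_comp, conjBy_comp, qsvtUnitary, Matrix.mul_assoc]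

lemma hadamardD_mul_apply {γ : Type*} (Y : Matrix (Sys A B) γ ℂ) (b : B) (c d : Bool) (p : A × B)
    (y : γ) : (hadamardD A B * Y) (b, ((c, d), p)) y = ((1 / √2 : ℝ) : ℂ) *
      (Y (b, ((c, false), p)) y + (if d then -1 else 1) * Y (b, ((c, true), p)) y) := by
  rw [Matrix.mul_apply, Fintype.sum_prod_type, Finset.sum_eq_single b, Fintype.sum_prod_type,
    Fintype.sum_prod_type, Finset.sum_eq_single c, Fintype.sum_bool, Finset.sum_eq_single p,
    Finset.sum_eq_single p]
  · cases d <;> simp [hadamardD] <;> ring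
  · intro q _ hq; simp [hadamardD, hq.symm]
  · simp
  · intro q _ hq; simp [hadamardD, hq.symm]
  · simp
  · intro q _ hq; simp [hadamardD, hq.symm]
  · simp
  · intro q _ hq; simp [hadamardD, hq.symm]
  · simp

lemma conjTranspose_hadamardD : (hadamardD A B)ᴴ = hadamardD A B := by
  ext ⟨b, ⟨c, d⟩, p⟩ ⟨b', ⟨c', d'⟩, p'⟩
  have : (b' = b ∧ c' = c ∧ p' = p) ↔ (b = b' ∧ c = c' ∧ p = p') := by
    simp only [eq_comm]
  simp only [Matrix.conjTranspose_apply, hadamardD, this, Bool.and_comm d']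
  split_ifs <;> simp

lemma mul_hadamardD_apply {γ : Type*} (Y : Matrix γ (Sys A B) ℂ) (b : B) (c d : Bool) (p : A × B)
    (x : γ) : (Y * hadamardD A B) x (b, ((c, d), p)) = ((1 / √2 : ℝ) : ℂ) *
      (Y x (b, ((c, false), p)) + (if d then -1 else 1) * Y x (b, ((c, true), p))) := by
  have h := hadamardD_mul_apply Yᴴ b c d p x
  have h2 : hadamardD A B * Yᴴ = (Y * hadamardD A B)ᴴ := by
    rw [Matrix.conjTranspose_mul, conjTranspose_hadamardD]
  rw [h2, Matrix.conjTranspose_apply] at h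
  have h3 := congrArg star h
  rw [star_star] at h3
  rw [h3]
  cases d <;> simp

lemma inv_sqrt_two_mul_self : (((1 / √2 : ℝ) : ℂ)) * ((1 / √2 : ℝ) : ℂ) = 1 / 2 := by
  rw [← Complex.ofReal_mul, div_mul_div_comm, Real.mul_self_sqrt (by norm_num)]; norm_num

lemma hadamardD_mul_self : hadamardD A B * hadamardD A B = 1 := by
  ext ⟨b, ⟨c, d⟩, p⟩ ⟨b', ⟨c', d'⟩, p'⟩
  rw [hadamardD_mul_apply, Matrix.one_apply]
  by_cases h : b = b' ∧ c = c' ∧ p = p'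
  · obtain ⟨rfl, rfl, rfl⟩ := h
    have := inv_sqrt_two_mul_self
    cases d <;> cases d' <;> simp [hadamardD] at this ⊢ <;> linear_combination 2 * this
  · have : ¬(((b, ((c, d), p)) : Sys A B) = (b', ((c', d'), p'))) := by
      simp only [Prod.mk.injEq]; tauto
    simp [hadamardD, h, this]

lemma hadamardD_isometry : (hadamardD A B)ᴴ * hadamardD A B = 1 := by
  rw [conjTranspose_hadamardD, hadamardD_mul_self]

lemma phaseZ_isometry {β : Type*} [Fintype β] [DecidableEq β] (φ : ℝ) :
    (phaseZ β φ)ᴴ * phaseZ β φ = 1 := by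
  rw [phaseZ, Matrix.diagonal_conjTranspose, Matrix.diagonal_mul_diagonal, ← Matrix.diagonal_one]
  congr 1
  funext x
  rw [Pi.star_apply, RCLike.star_def, ← Complex.exp_conj, ← Complex.exp_add]
  cases x.1 <;> simp

lemma isometry_mul {α β γ : Type*} [Fintype α] [DecidableEq α] [Fintype β] [DecidableEq β]
    [Fintype γ] {K : Matrix γ β ℂ} {L : Matrix β α ℂ} (hK : Kᴴ * K = 1) (hL : Lᴴ * L = 1) : (K * L)ᴴ * (K * L) = 1 := by
  rw [Matrix.conjTranspose_mul, Matrix.mul_assoc, ← Matrix.mul_assoc Kᴴ, hK, Matrix.one_mul, hL]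

lemma alternateOp_isometry {β : Type*} [Fintype β] [DecidableEq β] {U U' : Op (Bool × β)}
    (hU : Uᴴ * U = 1) (hU' : U'ᴴ * U' = 1) (Φ : List ℝ) :
    (alternateOp U U' Φ)ᴴ * alternateOp U U' Φ = 1 := by
  induction Φ generalizing U U' with
  | nil => simp [alternateOp]
  | cons φ Φ ih => exact isometry_mul (ih hU' hU) (isometry_mul (phaseZ_isometry φ) hU)

lemma sysOp_isometry {F : Bool → Op (Tgt A B)} (h : ∀ d, (F d)ᴴ * F d = 1) :
    (sysOp F)ᴴ * sysOp F = 1 := by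
  rw [conjTranspose_sysOp, sysOp_mul, funext h, sysOp_one]

lemma qsvtUnitary_isometry {U : Op (Tgt A B)} (hU : Uᴴ * U = 1) (Φ : List ℝ) :
    (qsvtUnitary U Φ)ᴴ * qsvtUnitary U Φ = 1 := by
  refine isometry_mul (isometry_mul hadamardD_isometry (sysOp_isometry fun d => ?_))
    hadamardD_isometry
  refine alternateOp_isometry hU ?_ _
  rw [Matrix.conjTranspose_conjTranspose]
  exact mul_eq_one_comm.mp hU

/-- Preparing and testing `D` by Hadamard gates produces the mean of the two branches. -/
lemma qsvtUnitary_submatrix (U : Op (Tgt A B)) (Φ : List ℝ) :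
    (qsvtUnitary U Φ).submatrix blockH blockH = (1 / 2 : ℂ) •
      ((ketQubit ((A × B) × B) false)ᴴ * (alternateOp U Uᴴ Φ + alternateOp U Uᴴ (Φ.map Neg.neg)) *
        ketQubit ((A × B) × B) false) := by
  rw [← submatrix_blockC]
  ext ⟨p, b⟩ ⟨p', b'⟩
  simp only [Matrix.submatrix_apply, blockH, qsvtUnitary, Matrix.smul_apply, Matrix.add_apply]
  rw [mul_hadamardD_apply, hadamardD_mul_apply, hadamardD_mul_apply]
  simp only [sysOp, sysEquivTgt, Equiv.coe_fn_mk, Bool.false_eq_true, if_false, if_true, one_mul,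
    Bool.true_eq_false, blockC, smul_eq_mul]
  linear_combination (alternateOp U Uᴴ Φ (false, p, b) (false, p', b') +
    alternateOp U Uᴴ (Φ.map Neg.neg) (false, p, b) (false, p', b')) * inv_sqrt_two_mul_self

open Polynomial in
lemma qsvtUnitary_block {ρ σ : A × B → ℂ} (hρ : IsPureState ρ) (hσ : IsPureState σ) {Φ : List ℝ}
    (hodd : Odd Φ.length) {p : ℝ[X]}
    (hp : (qspPoly Φ).1 + conjPoly (qspPoly Φ).1 = 2 * p.map (algebraMap ℝ ℂ))
    (hpodd : ∀ x, p.eval (-x) = -p.eval x) :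
    (qsvtUnitary (sineUnitary (overlapOp ρ σ)) Φ).submatrix blockH blockH =
      ketbra ρ σ ⊗ₖ svMap (fun x => p.eval (Real.sin x)) (overlap ρ σ) := by
  rw [qsvtUnitary_submatrix, alternateOp_add_block _ hodd hp hpodd, overlapOp,
    svMap_ketbra_kronecker _ _ hρ hσ]

lemma DiamondBound.onSys {T : Op (Tgt A B) →ₗ[ℂ] Op (Tgt A B)} {c : ℝ} (hc : 0 ≤ c)
    (h : DiamondBound T c) : DiamondBound (onSys T) c :=
  ((h.idTensor hc).comp_relabel hc _).relabel_comp _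

lemma diamondBound_alternate {G G' : Op (Sys A B) →ₗ[ℂ] Op (Sys A B)} (hG : DiamondBound G 1)
    (hG' : DiamondBound G' 1) (Φ : List ℝ) : DiamondBound (alternate G G' Φ) 1 := by
  induction Φ generalizing G G' with
  | nil => exact DiamondBound.id
  | cons φ Φ ih =>
    have hφ : (phaseGate A B φ)ᴴ * phaseGate A B φ = 1 := by
      rw [phaseGate_eq]; exact sysOp_isometry fun d => phaseZ_isometry _
    have := (ih hG' hG).comp zero_le_one ((diamondBound_conjBy hφ).comp zero_le_one hG)
    simpa [alternate] using this

lemma diamondBound_alternate_sub {G G' K K' : Op (Sys A B) →ₗ[ℂ] Op (Sys A B)} {e : ℝ} (he : 0 ≤ e)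
    (hK : DiamondBound K 1) (hK' : DiamondBound K' 1) (hG : DiamondBound (G - K) e)
    (hG' : DiamondBound (G' - K') e) (Φ : List ℝ) :
    DiamondBound (alternate G G' Φ - alternate K K' Φ) ((1 + e) ^ Φ.length - 1) := by
  induction Φ generalizing G G' K K' with
  | nil =>
    simp only [alternate, sub_self, List.length_nil, pow_zero]
    simpa using DiamondBound.sum (α := Sys A B) (β := Sys A B) (∅ : Finset Unit)
      (T := fun _ => LinearMap.id) (c := fun _ => 1) fun _ => DiamondBound.id
  | cons φ Φ ih =>
    have hφ : (phaseGate A B φ)ᴴ * phaseGate A B φ = 1 := by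
      rw [phaseGate_eq]; exact sysOp_isometry fun d => phaseZ_isometry _
    have h1 := (diamondBound_conjBy hφ).comp zero_le_one hG
    have h2 := (diamondBound_conjBy hφ).comp zero_le_one hK
    rw [LinearMap.comp_sub, one_mul] at h1
    rw [one_mul] at h2
    have := DiamondBound.comp_sub_comp_of_one_le (one_le_pow₀ (by linarith))
      (diamondBound_alternate hK' hK Φ) (ih hK' hK hG' hG) h2
      (T := conjBy (phaseGate A B φ) ∘ₗ G) (b := 1 + e) (by rwa [add_sub_cancel_left])
    rw [List.length_cons, pow_succ]
    exact this

lemma onSys_sub (S T : Op (Tgt A B) →ₗ[ℂ] Op (Tgt A B)) : onSys S - onSys T = onSys (S - T) := rfl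

/-- Error of the singular value transformation when the unitaries are replaced by channels. -/
lemma diamondBound_qsvt_sub {G G' : Op (Tgt A B) →ₗ[ℂ] Op (Tgt A B)} {U : Op (Tgt A B)}
    (hU : Uᴴ * U = 1) {e : ℝ} (he : 0 ≤ e) (hG : DiamondBound (G - conjBy U) e)
    (hG' : DiamondBound (G' - conjBy Uᴴ) e) (Φ : List ℝ) :
    DiamondBound (qsvt G G' Φ - conjBy (qsvtUnitary U Φ)) ((1 + e) ^ Φ.length - 1) := by
  have hU' : Uᴴᴴ * Uᴴ = 1 := by
    rw [Matrix.conjTranspose_conjTranspose]; exact mul_eq_one_comm.mp hU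
  have h := diamondBound_alternate_sub he ((diamondBound_conjBy hU).onSys zero_le_one)
    ((diamondBound_conjBy hU').onSys zero_le_one) (G := onSys G) (G' := onSys G')
    (by rw [onSys_sub]; exact hG.onSys he) (by rw [onSys_sub]; exact hG'.onSys he) Φ
  have h0 : 0 ≤ (1 + e) ^ Φ.length - 1 := by linarith [one_le_pow₀ (n := Φ.length) (by linarith : 1 ≤ 1 + e)]
  have hH := diamondBound_conjBy (hadamardD_isometry (A := A) (B := B))
  have h2 := hH.comp zero_le_one (h.comp h0 hH)
  rw [mul_one, one_mul, LinearMap.sub_comp, LinearMap.comp_sub] at h2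
  rw [← qsvt_conjBy]
  exact h2

end Qsvt

/-! ### Extension of isometries and products of singular value transforms. -/

section UnitaryExtension

variable {α β : Type*} [Fintype α] [DecidableEq α] [Fintype β] [DecidableEq β]

/-- An isometry defined on the span of some of the basis vectors extends to a unitary. -/
lemma exists_unitary_extension {e : β → α} (he : Function.Injective e) {J : Matrix α β ℂ}
    (hJ : Jᴴ * J = 1) : ∃ U ∈ Matrix.unitaryGroup α ℂ, U.submatrix id e = J := by
  classical
  let v : α → EuclideanSpace ℂ α := fun x =>
    if h : ∃ y, e y = x then WithLp.toLp 2 (fun i => J i h.choose) else 0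
  have hv : ∀ y, v (e y) = WithLp.toLp 2 (fun i => J i y) := by
    intro y
    have h : ∃ z, e z = e y := ⟨y, rfl⟩
    have h2 : h.choose = y := he h.choose_spec
    simp only [v, dif_pos h, h2]
  have horth : Orthonormal ℂ ((Set.range e).domRestrict v) := by
    rw [orthonormal_iff_ite]
    rintro ⟨x, hx⟩ ⟨x', hx'⟩
    obtain ⟨y, rfl⟩ := hx
    obtain ⟨z, rfl⟩ := hx'
    have h := congrFun (congrFun hJ y) z
    have hin : inner ℂ (v (e y)) (v (e z)) = (1 : Op β) y z := by
      rw [← h, Matrix.mul_apply, PiLp.inner_apply, hv, hv]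
      refine Finset.sum_congr rfl fun i _ => ?_
      simp [mul_comm]
    refine Eq.trans (show _ = inner ℂ (v (e y)) (v (e z)) from rfl) ?_
    rw [hin]
    by_cases hyz : y = z
    · subst hyz
      rw [if_pos rfl, Matrix.one_apply_eq]
    · rw [if_neg fun h => hyz (he (congrArg Subtype.val h)), Matrix.one_apply_ne hyz]
  obtain ⟨b, hb⟩ := horth.exists_orthonormalBasis_extension_of_card_eq (by simp)
  refine ⟨Matrix.of fun i j => b j i, ?_, ?_⟩
  · rw [Matrix.mem_unitaryGroup_iff']
    ext i j
    have h := orthonormal_iff_ite.mp b.orthonormal i j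
    rw [Matrix.one_apply, ← h, Matrix.mul_apply, PiLp.inner_apply]
    refine Finset.sum_congr rfl fun k _ => ?_
    simp [Matrix.star_apply, mul_comm]
  · ext i y
    have := hb (e y) ⟨y, rfl⟩
    simp only [Matrix.submatrix_apply, id_eq, Matrix.of_apply]
    rw [this, hv]

lemma submatrix_id_eq_mul (W : Op α) (e : β → α) :
    W.submatrix id e = W * (1 : Op α).submatrix id e := by
  ext i j
  simp [Matrix.mul_apply, Matrix.one_apply]

lemma submatrix_eq_mul {γ : Type*} (W : Matrix α γ ℂ) (e : β → α) :
    W.submatrix e id = ((1 : Op α).submatrix id e)ᴴ * W := by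
  ext i j
  simp [Matrix.mul_apply, Matrix.one_apply]

lemma conjTranspose_embed_mul {e : β → α} (he : Function.Injective e) :
    ((1 : Op α).submatrix id e)ᴴ * (1 : Op α).submatrix id e = 1 := by
  rw [← submatrix_eq_mul]
  ext i j
  simp [Matrix.one_apply, he.eq_iff]

/-- The two divisions by `√x` cancel the factor `x = √x √x`. On the kernel the left side vanishes,
which agrees with the right side because `f 0 = 0`. -/
lemma conjTranspose_svMap_mul_svMap {f : ℝ → ℝ} (hf : f 0 = 0) (g : ℝ → ℝ) (M : Op α) :
    (svMap f M)ᴴ * svMap g M = cfc (fun x => f (√x) * g (√x)) (Mᴴ * M) := by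
  rw [svMap, svMap, Matrix.conjTranspose_mul, conjTranspose_cfc, Matrix.mul_assoc,
    ← Matrix.mul_assoc Mᴴ, cfc_id_mul (isHermitian_gram M), cfc_mul_cfc]
  refine cfc_congr fun x hx => ?_
  have hx0 := spectrum_gram_nonneg M hx
  rcases hx0.eq_or_lt with h | h
  · simp [← h, hf]
  · have h1 : √x ≠ 0 := (Real.sqrt_pos.mpr h).ne'
    have h2 : x = √x * √x := (Real.mul_self_sqrt hx0).symm
    calc f (√x) / √x * (x * (g (√x) / √x)) = f (√x) / √x * (√x * √x * (g (√x) / √x)) := by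
          rw [← h2]
      _ = _ := by field_simp

lemma svMap_mul_cfc (f h : ℝ → ℝ) (M : Op α) :
    svMap f M * cfc h (Mᴴ * M) = M * cfc (fun x => f (√x) / √x * h x) (Mᴴ * M) := by
  rw [svMap, Matrix.mul_assoc, cfc_mul_cfc]

end UnitaryExtension

/-! ### Rounding a unitary to an exact block-encoding of the Uhlmann isometry. -/

section IdealUnitary

variable {A B : Type*} [Fintype A] [DecidableEq A] [Fintype B] [DecidableEq B]

lemma blockH_injective : Function.Injective (blockH : (A × B) × B → Sys A B) := by
  rintro ⟨p, b⟩ ⟨p', b'⟩ h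
  simp only [blockH, Prod.mk.injEq] at h
  exact Prod.ext h.2.2 h.1

/-- The vector `|00⟩|σ⟩` on `H Â B̂`. -/
def zeroKet (σ : A × B → ℂ) : (Bool × Bool) × (A × B) → ℂ := fun x =>
  if x.1 = (false, false) then σ x.2 else 0

lemma prep_eq (σ : A × B → ℂ) :
    prep σ = sandwich (appendVec B (zeroKet σ)) (appendVec B (zeroKet σ))ᴴ := by
  rw [prep, ← append_ketbra]
  congr 1
  ext ⟨c, p⟩ ⟨c', p'⟩
  simp only [Matrix.kroneckerMap_apply, ketbra, Matrix.vecMulVec_apply, zeroKet, Pi.star_apply,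
    Matrix.single_apply]
  by_cases h : c = (false, false) <;> by_cases h' : c' = (false, false) <;>
    simp [h, h', eq_comm]

/-- The prepared state lies in the block subspace, so only the columns `W.submatrix id blockH` of a
unitary `W` matter after the preparation. -/
lemma appendVec_zeroKet (σ : A × B → ℂ) : appendVec B (zeroKet σ) =
    (1 : Op (Sys A B)).submatrix id blockH * prependVec B σ := by
  ext ⟨b, c, p⟩ y
  rw [Matrix.mul_apply, Fintype.sum_prod_type, Finset.sum_eq_single p, Finset.sum_eq_single b]
  · by_cases hc : c = (false, false) <;> by_cases hb : b = y <;>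
      simp [appendVec, zeroKet, prependVec, Matrix.one_apply, blockH, hc, hb]
  · intro b' _ hb'; simp [Matrix.one_apply, blockH, hb'.symm]
  · simp
  · intro p' _ hp'
    refine Finset.sum_eq_zero fun b' _ => ?_
    simp [Matrix.one_apply, blockH, hp'.symm]
  · simp

lemma conjBy_comp_prep (W : Op (Sys A B)) (σ : A × B → ℂ) :
    conjBy W ∘ₗ prep σ = sandwich (W.submatrix id blockH * prependVec B σ)
      (W.submatrix id blockH * prependVec B σ)ᴴ := by
  rw [prep_eq, submatrix_id_eq_mul, Matrix.mul_assoc, ← appendVec_zeroKet]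
  ext1 X
  simp only [LinearMap.comp_apply, conjBy_apply, sandwich_apply, Matrix.conjTranspose_mul,
    Matrix.mul_assoc]

lemma diamondBound_prep {σ : A × B → ℂ} (hσ : IsPureState σ) : DiamondBound (prep σ) 1 := by
  have h := conjBy_comp_prep 1 σ
  have h1 : conjBy (1 : Op (Sys A B)) ∘ₗ prep σ = prep σ := by
    ext1 X; simp [conjBy_apply]
  rw [h1] at h
  rw [h]
  refine (diamondBound_sandwich _ _).mono ?_
  open scoped Matrix.Norms.L2Operator in
  have : ‖(1 : Op (Sys A B)).submatrix id blockH * prependVec B σ‖ ≤ 1 := by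
    exact norm_le_one_of_isometry
      (isometry_mul (conjTranspose_embed_mul blockH_injective) (prependVec_isometry hσ))
  rw [Matrix.l2_opNorm_conjTranspose]
  nlinarith [norm_nonneg ((1 : Op (Sys A B)).submatrix id blockH * prependVec B σ)]

lemma sign_mul_sign_sqrt {x : ℝ} (hx : 0 < x) : Real.sign (√x) = 1 :=
  Real.sign_of_pos (Real.sqrt_pos.mpr hx)

/-- A unitary whose block is close to the Uhlmann partial isometry is close, on the block, to a
unitary whose block is equal to it. -/
lemma exists_ideal_unitary {ρ σ : A × B → ℂ} (hρ : IsPureState ρ) (hσ : IsPureState σ)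
    {W : Op (Sys A B)} (hW : Wᴴ * W = 1) {f : ℝ → ℝ}
    (hblock : W.submatrix blockH blockH = ketbra ρ σ ⊗ₖ svMap f (overlap ρ σ)) {η : ℝ}
    (hη : 0 ≤ η) (hf : ∀ x ∈ spectrum ℝ ((overlap ρ σ)ᴴ * overlap ρ σ), x ≠ 0 →
      |1 - f (√x)| ≤ η ^ 2 / 2) :
    ∃ U : Op (Sys A B), IsBlockEncoding blockH U (ketbra ρ σ ⊗ₖ uhlmannIsometry ρ σ) ∧
      DiamondBound (conjBy W ∘ₗ prep σ - conjBy U ∘ₗ prep σ) (2 * η) := by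
  set M := overlap ρ σ with hM
  set K : Matrix (Sys A B) ((A × B) × B) ℂ := (1 : Op (Sys A B)).submatrix id blockH with hK
  set S := prependVec B σ with hS
  set T := prependVec B ρ with hT
  set V := svMap Real.sign M with hV
  set P := cfc (fun x => Real.sign (√x) * Real.sign (√x)) (Mᴴ * M) with hP
  have hKK : Kᴴ * K = 1 := conjTranspose_embed_mul blockH_injective
  have hSS : Sᴴ * S = 1 := prependVec_isometry hσ
  have hTT : Tᴴ * T = 1 := prependVec_isometry hρ
  have hVV : Vᴴ * V = P := conjTranspose_svMap_mul_svMap Real.sign_zero _ _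
  have hPH : Pᴴ = P := conjTranspose_cfc _ _
  have hPP : P * P = P := by
    rw [hP, cfc_mul_cfc]
    refine cfc_congr fun x hx => ?_
    rcases (spectrum_gram_nonneg M hx).eq_or_lt with h | h
    · simp [← h]
    · simp [sign_mul_sign_sqrt h]
  have hVP : V * P = V := by
    rw [hP, hV, svMap_mul_cfc, svMap]
    congr 1
    refine cfc_congr fun x hx => ?_
    rcases (spectrum_gram_nonneg M hx).eq_or_lt with h | h
    · simp [← h]
    · simp [sign_mul_sign_sqrt h]
  have hfP : svMap f M * P = svMap f M := by
    rw [hP, svMap_mul_cfc, svMap]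
    congr 1
    refine cfc_congr fun x hx => ?_
    rcases (spectrum_gram_nonneg M hx).eq_or_lt with h | h
    · simp [← h]
    · simp [sign_mul_sign_sqrt h]
  have hb : Kᴴ * (W * K) = T * svMap f M * Sᴴ := by
    rw [← ketbra_kronecker, ← hblock, hK, ← submatrix_id_eq_mul, ← submatrix_eq_mul]
    rfl
  have hVf : Vᴴ * svMap f M = cfc (fun x => Real.sign (√x) * f (√x)) (Mᴴ * M) :=
    conjTranspose_svMap_mul_svMap Real.sign_zero _ _
  -- the corrected isometry
  set Q : Op ((A × B) × B) := S * P * Sᴴ with hQ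
  set J : Matrix (Sys A B) ((A × B) × B) ℂ := K * (T * V * Sᴴ) + W * K * (1 - Q) with hJ
  -- `Q` projects onto `|σ⟩` tensored with the support of `M`. Off `Q` the block of `W` vanishes, so
  -- there `W` maps out of the block subspace and is orthogonal to the prescribed part. Hence `J`,
  -- which is ideal on `Q` and equals `W` off `Q`, is an isometry with the required block.
  have hbQ : Kᴴ * (W * K) * (1 - Q) = 0 := by
    rw [hb, hQ, Matrix.mul_sub, Matrix.mul_one]
    have : T * svMap f M * Sᴴ * (S * P * Sᴴ) = T * (svMap f M * ((Sᴴ * S) * P)) * Sᴴ := by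
      simp only [Matrix.mul_assoc]
    rw [this, hSS, Matrix.one_mul, hfP, sub_self]
  have hKJ : Kᴴ * J = T * V * Sᴴ := by
    rw [hJ, Matrix.mul_add, ← Matrix.mul_assoc, hKK, Matrix.one_mul, ← Matrix.mul_assoc, hbQ,
      add_zero]
  have hQH : Qᴴ = Q := by
    rw [hQ]; simp only [Matrix.conjTranspose_mul, Matrix.conjTranspose_conjTranspose, hPH,
      Matrix.mul_assoc]
  have hQQ : Q * Q = Q := by
    have : Q * Q = S * (P * ((Sᴴ * S) * P)) * Sᴴ := by
      rw [hQ]; simp only [Matrix.mul_assoc]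
    rw [this, hSS, Matrix.one_mul, hPP]
  have hXX : (T * V * Sᴴ)ᴴ * (T * V * Sᴴ) = Q := by
    have : (T * V * Sᴴ)ᴴ * (T * V * Sᴴ) = S * (Vᴴ * ((Tᴴ * T) * V)) * Sᴴ := by
      simp only [Matrix.conjTranspose_mul, Matrix.conjTranspose_conjTranspose, Matrix.mul_assoc]
    rw [this, hTT, Matrix.one_mul, hVV]
  have hWK : (W * K)ᴴ * (W * K) = 1 := by
    exact isometry_mul hW hKK
  set X := T * V * Sᴴ with hX
  have hcross : (K * X)ᴴ * (W * K * (1 - Q)) = 0 := by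
    have : (K * X)ᴴ * (W * K * (1 - Q)) = Xᴴ * (Kᴴ * (W * K) * (1 - Q)) := by
      simp only [Matrix.conjTranspose_mul, Matrix.mul_assoc]
    rw [this, hbQ, Matrix.mul_zero]
  have hJJ : Jᴴ * J = 1 := by
    have h1 : (K * X)ᴴ * (K * X) = Q := by
      rw [Matrix.conjTranspose_mul, Matrix.mul_assoc, ← Matrix.mul_assoc Kᴴ, hKK, Matrix.one_mul, hXX]
    have h2 : (W * K * (1 - Q))ᴴ * (W * K * (1 - Q)) = 1 - Q := by
      rw [Matrix.conjTranspose_mul, Matrix.mul_assoc, ← Matrix.mul_assoc (W * K)ᴴ, hWK,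
        Matrix.one_mul, Matrix.conjTranspose_sub, Matrix.conjTranspose_one, hQH, Matrix.mul_sub,
        Matrix.sub_mul, Matrix.sub_mul, hQQ]
      simp
    have h3 : (W * K * (1 - Q))ᴴ * (K * X) = 0 := by
      have := congrArg Matrix.conjTranspose hcross
      rwa [Matrix.conjTranspose_mul, Matrix.conjTranspose_conjTranspose,
        Matrix.conjTranspose_zero] at this
    rw [hJ, Matrix.conjTranspose_add, Matrix.add_mul, Matrix.mul_add, Matrix.mul_add, h1, h2, h3,
      hcross]
    simp
  obtain ⟨U, hU, hUJ⟩ := exists_unitary_extension blockH_injective hJJ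
  refine ⟨U, ⟨hU, ?_⟩, ?_⟩
  · rw [uhlmannIsometry, ketbra_kronecker, ← hM, ← hS, ← hT, ← hV, ← hX, ← hKJ, ← hUJ, hK,
      ← submatrix_eq_mul]
    rfl
  · rw [conjBy_comp_prep, conjBy_comp_prep, hUJ, submatrix_id_eq_mul W, ← hK, ← hS]
    open scoped Matrix.Norms.L2Operator in
    have hSn : ‖S‖ ≤ 1 := norm_le_one_of_isometry hSS
    have hiso : ∀ Y : Matrix (Sys A B) ((A × B) × B) ℂ, Yᴴ * Y = 1 → (Y * S)ᴴ * (Y * S) = 1 := by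
      intro Y hY
      exact isometry_mul hY hSS
    refine diamondBound_sandwich_sub (norm_le_one_of_isometry (hiso _ hWK))
      (norm_le_one_of_isometry (hiso _ hJJ)) ?_
    rw [← Matrix.sub_mul]
    have hD : (W * K - J) * S = (W * K) * (S * P) - K * (T * V) := by
      have e1 : W * K - J = W * K * Q - K * X := by
        rw [hJ, Matrix.mul_sub, Matrix.mul_one]; abel
      have e2 : Q * S = S * P := by
        rw [hQ, Matrix.mul_assoc, hSS, Matrix.mul_one]
      have e3 : X * S = T * V := by rw [hX, Matrix.mul_assoc, hSS, Matrix.mul_one]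
      rw [e1, Matrix.sub_mul, Matrix.mul_assoc _ Q, e2, Matrix.mul_assoc K, e3]
    -- Both parts of the difference have Gram matrix `P` and both cross terms are `V† f(M)`. The
    -- squared norm of the error is thus the largest `2 (1 - f)` over the nonzero singular values,
    -- at most `η²`; this is why `f` must be accurate to second order in `η`.
    have hgram : ((W * K - J) * S)ᴴ * ((W * K - J) * S) =
        cfc (fun x => 2 * (Real.sign (√x) * Real.sign (√x)) - 2 * (Real.sign (√x) * f (√x)))
          (Mᴴ * M) := by
      have g1 : (W * K * (S * P))ᴴ * (W * K * (S * P)) = P := by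
        rw [Matrix.conjTranspose_mul, Matrix.mul_assoc, ← Matrix.mul_assoc (W * K)ᴴ, hWK,
          Matrix.one_mul, Matrix.conjTranspose_mul, Matrix.mul_assoc, ← Matrix.mul_assoc Sᴴ, hSS,
          Matrix.one_mul, hPH, hPP]
      have g2 : (K * (T * V))ᴴ * (K * (T * V)) = P := by
        rw [Matrix.conjTranspose_mul, Matrix.mul_assoc, ← Matrix.mul_assoc Kᴴ, hKK,
          Matrix.one_mul, Matrix.conjTranspose_mul, Matrix.mul_assoc, ← Matrix.mul_assoc Tᴴ, hTT,
          Matrix.one_mul, hVV]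
      have g3 : (K * (T * V))ᴴ * (W * K * (S * P)) = Vᴴ * svMap f M := by
        have : (K * (T * V))ᴴ * (W * K * (S * P)) = Vᴴ * Tᴴ * (Kᴴ * (W * K)) * (S * P) := by
          simp only [Matrix.conjTranspose_mul, Matrix.mul_assoc]
        rw [this, hb]
        have : Vᴴ * Tᴴ * (T * svMap f M * Sᴴ) * (S * P) =
            Vᴴ * ((Tᴴ * T) * (svMap f M * ((Sᴴ * S) * P))) := by
          simp only [Matrix.mul_assoc]
        rw [this, hTT, hSS, Matrix.one_mul, Matrix.one_mul, hfP]
      have g4 : (W * K * (S * P))ᴴ * (K * (T * V)) = Vᴴ * svMap f M := by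
        have h4 := congrArg Matrix.conjTranspose g3
        rw [Matrix.conjTranspose_mul, Matrix.conjTranspose_conjTranspose] at h4
        rw [h4, hVf, conjTranspose_cfc]
      rw [hD, Matrix.conjTranspose_sub, Matrix.sub_mul, Matrix.mul_sub, Matrix.mul_sub, g1, g2, g3,
        g4, hVf, hP]
      simp only [cfc_sub_cfc]
      refine cfc_congr fun x _ => ?_
      ring
    have hn : ‖((W * K - J) * S)ᴴ * ((W * K - J) * S)‖ ≤ η ^ 2 := by
      rw [hgram]
      refine norm_cfc_le_of_le (by positivity) fun x hx => ?_
      rcases (spectrum_gram_nonneg M hx).eq_or_lt with h | h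
      · simp [← h]; positivity
      · have := hf x hx h.ne'
        rw [sign_mul_sign_sqrt h]
        rw [show (2 * (1 * 1) - 2 * (1 * f (√x)) : ℝ) = 2 * (1 - f (√x)) by ring, abs_mul]
        norm_num
        linarith
    rw [Matrix.l2_opNorm_conjTranspose_mul_self] at hn
    exact abs_le_of_sq_le_sq' (by nlinarith) hη |>.2

end IdealUnitary

/-! ### Comparison of nonzero spectra through traces of powers. -/

section SpectralTransfer

variable {α β : Type*} [Fintype α] [DecidableEq α] [Fintype β] [DecidableEq β]

lemma sqrt_mem_nonzeroSingularValues {A : Op α} {x : ℝ} (hx : x ∈ spectrum ℝ (Aᴴ * A))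
    (h0 : x ≠ 0) : √x ∈ nonzeroSingularValues A := by
  have hx0 : 0 < x := lt_of_le_of_ne (spectrum_gram_nonneg A hx) h0.symm
  refine ⟨(Real.sqrt_pos.mpr hx0).ne', ?_⟩
  set T := Matrix.toEuclideanLin A with hT
  have h1 : (algebraMap ℝ ℂ x) ∈ spectrum ℂ (Aᴴ * A) := (spectrum.algebraMap_mem_iff ℂ).mpr hx
  rw [← Matrix.spectrum_toLpLin 2] at h1
  have h2 : Matrix.toEuclideanLin (Aᴴ * A) = LinearMap.adjoint T ∘ₗ T := by
    rw [hT, ← Matrix.toEuclideanLin_conjTranspose_eq_adjoint]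
    exact Matrix.toLpLin_mul _ _ _ _ _
  rw [h2] at h1
  have h3 := Module.End.hasEigenvalue_iff_mem_spectrum.mpr h1
  obtain ⟨i, hi⟩ := T.isSymmetric_adjoint_comp_self.exists_eigenvalues_eq rfl h3
  refine ⟨i, ?_⟩
  rw [T.singularValues_fin rfl]
  congr 1
  exact (Complex.ofReal_injective hi).symm

lemma mul_pow_succ_mul (X : Matrix α β ℂ) (Y : Matrix β α ℂ) (k : ℕ) :
    (X * Y) ^ (k + 1) = X * ((Y * X) ^ k * Y) := by
  induction k with
  | zero => simp
  | succ k ih => rw [pow_succ', ih, pow_succ' (Y * X) k]; simp only [Matrix.mul_assoc]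

lemma trace_mul_pow_comm (X : Matrix α β ℂ) (Y : Matrix β α ℂ) (k : ℕ) :
    ((X * Y) ^ (k + 1)).trace = ((Y * X) ^ (k + 1)).trace := by
  rw [mul_pow_succ_mul, Matrix.trace_mul_comm, pow_succ, Matrix.mul_assoc]

/-- For the indicator function of `x` the trace counts the multiplicity of the eigenvalue `x`, and
`x ≠ 0` makes this function vanish at zero. -/
lemma mem_spectrum_of_trace_pow_eq {H : Op α} {H' : Op β} (hH : H.IsHermitian)
    (hH' : H'.IsHermitian) (h : ∀ k : ℕ, (H ^ (k + 1)).trace = (H' ^ (k + 1)).trace) {x : ℝ}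
    (hx : x ∈ spectrum ℝ H) (h0 : x ≠ 0) : x ∈ spectrum ℝ H' := by
  classical
  have h1 := trace_cfc_eq_of_trace_pow_eq hH hH' h (f := fun y => if y = x then 1 else 0)
    (if_neg h0.symm)
  have h2 := congrArg Complex.re h1
  rw [trace_cfc_re hH, trace_cfc_re hH'] at h2
  rw [hH.spectrum_real_eq_range_eigenvalues] at hx
  obtain ⟨i, hi⟩ := hx
  by_contra hne
  have h3 : ∑ j, (if hH'.eigenvalues j = x then (1 : ℝ) else 0) = 0 :=
    Finset.sum_eq_zero fun j _ => if_neg fun hj => hne (by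
      rw [← hj]; exact hH'.eigenvalues_mem_spectrum_real j)
  rw [h3] at h2
  have h4 : (1 : ℝ) ≤ ∑ j, (if hH.eigenvalues j = x then (1 : ℝ) else 0) := by
    have := Finset.single_le_sum (s := Finset.univ)
      (f := fun j => if hH.eigenvalues j = x then (1 : ℝ) else 0)
      (fun j _ => by split_ifs <;> norm_num) (Finset.mem_univ i)
    simpa [hi] using this
  linarith

lemma sqrt_mul_sqrt_of_posSemidef {H : Op α} (hH : H.PosSemidef) :
    cfc Real.sqrt H * cfc Real.sqrt H = H := by
  conv_rhs => rw [← cfc_fun_id hH.1]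
  rw [cfc_mul_cfc]
  exact cfc_congr fun x hx => Real.mul_self_sqrt (spectrum_nonneg_of_posSemidef hH hx)

lemma trace_cfc_ne_zero_eq_rank {H : Op α} (hH : H.IsHermitian) :
    (cfc (fun x => if x = 0 then (0 : ℝ) else 1) H).trace.re = H.rank := by
  rw [trace_cfc_re hH, hH.rank_eq_card_non_zero_eigs, Fintype.card_subtype]
  simp [Finset.sum_ite]

end SpectralTransfer

/-! ### The overlap operator on B against `√σ √ρ` on A. -/

section Overlap

variable {A B : Type*} [Fintype A] [DecidableEq A] [Fintype B] [DecidableEq B]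

/-- The amplitudes of a bipartite pure state as a matrix. -/
def stateMat (ψ : A × B → ℂ) : Matrix A B ℂ := fun a b => ψ (a, b)

lemma reduced_eq (ψ : A × B → ℂ) : reduced ψ = stateMat ψ * (stateMat ψ)ᴴ := by
  ext i j
  simp [reduced, traceSnd, ketbra, Matrix.vecMulVec_apply, Matrix.mul_apply, stateMat]

lemma posSemidef_reduced (ψ : A × B → ℂ) : (reduced ψ).PosSemidef := by
  rw [reduced_eq]; exact Matrix.posSemidef_self_mul_conjTranspose _

lemma overlap_eq (ρ σ : A × B → ℂ) : overlap ρ σ = ((stateMat ρ)ᴴ * stateMat σ)ᵀ := by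
  ext i j
  simp [overlap, traceFst, ketbra, Matrix.vecMulVec_apply, Matrix.mul_apply, stateMat, mul_comm]

/-- In terms of the amplitude matrices `R`, `S` of the two states, `M` is the transpose of `R† S`
and the reduced states are `R R†`, `S S†`. Transposition and cyclic shifts do not change the traces
of powers. -/
lemma trace_gram_overlap_pow (ρ σ : A × B → ℂ) (k : ℕ) :
    (((overlap ρ σ)ᴴ * overlap ρ σ) ^ (k + 1)).trace =
      ((reduced σ * reduced ρ) ^ (k + 1)).trace := by
  have h : (overlap ρ σ)ᴴ * overlap ρ σ =
      ((stateMat ρ)ᴴ * (reduced σ * stateMat ρ))ᵀ := by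
    have ht : ∀ X : Op B, Xᵀᴴ = Xᴴᵀ := fun _ => rfl
    rw [overlap_eq, reduced_eq, ht, ← Matrix.transpose_mul, Matrix.conjTranspose_mul, Matrix.conjTranspose_conjTranspose]
    simp only [Matrix.mul_assoc]
  rw [h, ← Matrix.transpose_pow, Matrix.trace_transpose, trace_mul_pow_comm, Matrix.mul_assoc,
    ← reduced_eq]

lemma trace_gram_sqrt_mul_sqrt_pow {α : Type*} [Fintype α] [DecidableEq α] {H K : Op α}
    (hH : H.PosSemidef) (hK : K.PosSemidef) (k : ℕ) :
    (((cfc Real.sqrt H * cfc Real.sqrt K)ᴴ * (cfc Real.sqrt H * cfc Real.sqrt K)) ^ (k + 1)).trace =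
      ((H * K) ^ (k + 1)).trace := by
  have h : (cfc Real.sqrt H * cfc Real.sqrt K)ᴴ * (cfc Real.sqrt H * cfc Real.sqrt K) =
      cfc Real.sqrt K * (H * cfc Real.sqrt K) := by
    conv_rhs => rw [← sqrt_mul_sqrt_of_posSemidef hH]
    rw [Matrix.conjTranspose_mul, conjTranspose_cfc, conjTranspose_cfc]
    simp only [Matrix.mul_assoc]
  rw [h, trace_mul_pow_comm, Matrix.mul_assoc, sqrt_mul_sqrt_of_posSemidef hK]

/-- Both sides are traces of powers of `σ^A ρ^A`. The bound on singular values and the rank of `√σ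
√ρ` pass to `M` through this identity. -/
lemma trace_gram_rootProduct_pow (ρ σ : A × B → ℂ) (k : ℕ) :
    (((overlap ρ σ)ᴴ * overlap ρ σ) ^ (k + 1)).trace =
      (((rootProduct ρ σ)ᴴ * rootProduct ρ σ) ^ (k + 1)).trace := by
  rw [trace_gram_overlap_pow, rootProduct, trace_gram_sqrt_mul_sqrt_pow (posSemidef_reduced _)
    (posSemidef_reduced _)]

lemma le_sqrt_of_mem_spectrum_overlap {ρ σ : A × B → ℂ} {s : ℝ}
    (hs : s ∈ lowerBounds (nonzeroSingularValues (rootProduct ρ σ))) {x : ℝ}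
    (hx : x ∈ spectrum ℝ ((overlap ρ σ)ᴴ * overlap ρ σ)) (h0 : x ≠ 0) : s ≤ √x :=
  hs (sqrt_mem_nonzeroSingularValues (mem_spectrum_of_trace_pow_eq (isHermitian_gram _)
    (isHermitian_gram _) (trace_gram_rootProduct_pow ρ σ) hx h0) h0)

lemma trace_support_overlap (ρ σ : A × B → ℂ) :
    (cfc (fun x => if x = 0 then (0 : ℝ) else 1) ((overlap ρ σ)ᴴ * overlap ρ σ)).trace.re =
      (rootProduct ρ σ).rank := by
  rw [trace_cfc_eq_of_trace_pow_eq (isHermitian_gram _) (isHermitian_gram _)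
    (trace_gram_rootProduct_pow ρ σ) (f := fun x => if x = 0 then (0 : ℝ) else 1) (if_pos rfl), trace_cfc_ne_zero_eq_rank (isHermitian_gram _),
    Matrix.rank_conjTranspose_mul_self]

lemma fidelity_reduced_eq (ρ σ : A × B → ℂ) :
    fidelity (reduced ρ) (reduced σ) = traceNorm (overlap ρ σ) ^ 2 := by
  rw [fidelity, traceNorm, traceNorm]
  congr 2
  refine trace_cfc_eq_of_trace_pow_eq (isHermitian_gram _) (isHermitian_gram _) (fun k => ?_)
    Real.sqrt_zero
  rw [trace_gram_overlap_pow, trace_gram_sqrt_mul_sqrt_pow (posSemidef_reduced _)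
    (posSemidef_reduced _), trace_mul_pow_comm]

lemma traceNorm_ketbra_le {α : Type*} [Fintype α] [DecidableEq α] {v w : α → ℂ}
    (hv : IsPureState v) (hw : IsPureState w) : traceNorm (ketbra v w) ≤ 1 := by
  have e : ketbra v w = relabel (Equiv.prodUnique α Unit) (ketbra v w ⊗ₖ (1 : Op Unit)) := by
    ext i j
    simp [relabel, Equiv.prodUnique]
  have h1 : traceNorm (1 : Op Unit) = 1 := by
    rw [traceNorm, Matrix.conjTranspose_one, Matrix.one_mul]
    have : cfc Real.sqrt (1 : Op Unit) = 1 := by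
      rw [cfc_apply_one]; simp
    rw [this]; simp
  rw [e, ketbra_kronecker]
  refine (traceNorm_relabel_le _ _).trans ((traceNorm_sandwich_le _ _ _).trans ?_)
  rw [h1, mul_one, Matrix.l2_opNorm_conjTranspose]
  open scoped Matrix.Norms.L2Operator in
  exact mul_le_one₀ (norm_le_one_of_isometry (prependVec_isometry hv))
    (norm_nonneg (prependVec Unit w)) (norm_le_one_of_isometry (prependVec_isometry hw))

/-- `M` is a partial trace of a rank-one operator of trace norm at most one. Its singular values
therefore lie in `[0, 1]`, where `y / 2 ≤ sin y`. -/
lemma traceNorm_overlap_le {ρ σ : A × B → ℂ} (hρ : IsPureState ρ) (hσ : IsPureState σ) :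
    traceNorm (overlap ρ σ) ≤ 1 := by
  have e : overlap ρ σ = traceSnd (relabel (Equiv.prodComm A B) (ketbra σ ρ)) := rfl
  rw [e]
  exact (traceNorm_traceSnd_le _).trans ((traceNorm_relabel_le _ _).trans (traceNorm_ketbra_le hσ hρ))

lemma sqrt_le_one_of_mem_spectrum_overlap {ρ σ : A × B → ℂ} (hρ : IsPureState ρ)
    (hσ : IsPureState σ) {x : ℝ} (hx : x ∈ spectrum ℝ ((overlap ρ σ)ᴴ * overlap ρ σ)) :
    √x ≤ 1 := by
  have h := traceNorm_overlap_le hρ hσ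
  rw [traceNorm, trace_cfc_re (isHermitian_gram _)] at h
  rw [(isHermitian_gram (overlap ρ σ)).spectrum_real_eq_range_eigenvalues] at hx
  obtain ⟨i, rfl⟩ := hx
  exact (Finset.single_le_sum (fun j _ => Real.sqrt_nonneg _) (Finset.mem_univ i)).trans h

end Overlap

/-! ### Fidelity with a pure target state. -/

section Fidelity

variable {α β : Type*} [Fintype α] [DecidableEq α] [Fintype β] [DecidableEq β]

lemma trace_gram_le_traceNorm_sq (A : Op α) : (Aᴴ * A).trace.re ≤ traceNorm A ^ 2 := by
  have hG := isHermitian_gram A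
  have h1 : (Aᴴ * A).trace.re = ∑ i, √(hG.eigenvalues i) ^ 2 := by
    conv_lhs => rw [← cfc_fun_id hG]
    rw [trace_cfc_re hG]
    exact Finset.sum_congr rfl fun i _ =>
      (Real.sq_sqrt (spectrum_gram_nonneg A (hG.eigenvalues_mem_spectrum_real i))).symm
  rw [h1, traceNorm, trace_cfc_re hG]
  exact Finset.sum_sq_le_sq_sum_of_nonneg fun i _ => Real.sqrt_nonneg _

lemma ketbra_mul_self {v : α → ℂ} (hv : IsPureState v) : ketbra v v * ketbra v v = ketbra v v := by
  rw [ketbra, Matrix.vecMulVec_mul_vecMulVec]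
  have : star v ⬝ᵥ v = 1 := sum_star_mul_self hv
  rw [this]; simp

lemma sqrt_ketbra {v : α → ℂ} (hv : IsPureState v) :
    cfc Real.sqrt (ketbra v v) = ketbra v v := by
  conv_rhs => rw [← cfc_fun_id (isHermitian_ketbra v)]
  refine cfc_congr fun x hx => ?_
  have h := IsIdempotentElem.spectrum_subset ℝ (show IsIdempotentElem (ketbra v v) from
    ketbra_mul_self hv) hx
  rcases h with rfl | rfl <;> simp

/-- The fidelity with a pure state is at least the expectation of the projection onto it. -/
lemma trace_mul_ketbra_le_fidelity {ω : Op α} (hω : ω.IsHermitian) {v : α → ℂ}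
    (hv : IsPureState v) : (ω * ketbra v v).trace.re ≤ fidelity ω (ketbra v v) := by
  set P := ketbra v v with hP
  have hPH : Pᴴ = P := isHermitian_ketbra v
  have hPP : P * P = P := ketbra_mul_self hv
  rw [fidelity, sqrt_ketbra hv]
  refine le_trans ?_ (trace_gram_le_traceNorm_sq _)
  have e1 : (cfc Real.sqrt ω * P)ᴴ * (cfc Real.sqrt ω * P) =
      P * (cfc (fun x => √x * √x) ω) * P := by
    rw [← cfc_mul_cfc, Matrix.conjTranspose_mul, conjTranspose_cfc, hPH]
    simp only [Matrix.mul_assoc]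
  have e2 : (ω * P).trace = (P * cfc (fun x : ℝ => x) ω * P).trace := by
    rw [cfc_fun_id hω, Matrix.trace_mul_comm (P * ω) P, ← Matrix.mul_assoc, hPP,
      Matrix.trace_mul_comm]
  rw [e1, e2, ← sub_nonneg, ← Complex.sub_re, ← Matrix.trace_sub, ← Matrix.sub_mul,
    ← Matrix.mul_sub, cfc_sub_cfc]
  -- The real square root is zero on negative numbers, so `√x √x ≥ x` everywhere and Hermiticity of
  -- `ω` is enough.
  have hpos : (cfc (fun x => √x * √x - x) ω).PosSemidef := posSemidef_cfc fun x _ => by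
    rcases le_total 0 x with h | h
    · rw [Real.mul_self_sqrt h, sub_self]
    · rw [Real.sqrt_eq_zero_of_nonpos h]; linarith
  have h2 := (hpos.conjTranspose_mul_mul_same P).trace_nonneg
  rw [hPH] at h2
  exact (Complex.le_def.mp h2).1

variable {A B κ : Type*} [Fintype A] [DecidableEq A] [Fintype B] [DecidableEq B]
  [Fintype κ] [DecidableEq κ]

/-- The expectation of the target projection is `∑ₖ |xₖ|²`, where `xₖ` is the amplitude of `|σ⟩`
with the discarded system in `|k⟩`. By Cauchy–Schwarz it dominates `|⟨v, x⟩|²` for each unit vector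
`v`, and `⟨v, x⟩` is the trace on the left. -/
lemma le_trace_traceSnd_sandwich {ρ σ : A × B → ℂ} (L : Matrix (B × κ) B ℂ) {v : κ → ℂ}
    (hv : IsPureState v) :
    ‖((overlap ρ σ)ᴴ * ((appendVec B v)ᴴ * L)).trace‖ ^ 2 ≤
      (idTensor A (traceSnd ∘ₗ sandwich L Lᴴ) (ketbra ρ ρ) * ketbra σ σ).trace.re := by
  set y : κ → A × B → ℂ := fun k i => ∑ c, L (i.2, k) c * ρ (i.1, c) with hy
  set x : κ → ℂ := fun k => ∑ i, star (σ i) * y k i with hx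
  have h1 : (idTensor A (traceSnd ∘ₗ sandwich L Lᴴ) (ketbra ρ ρ) * ketbra σ σ).trace =
      ∑ k, x k * star (x k) := by
    have hω : ∀ i j, idTensor A (traceSnd ∘ₗ sandwich L Lᴴ) (ketbra ρ ρ) i j =
        ∑ k, y k i * star (y k j) := by
      intro i j
      set R : Op B := Matrix.of fun k l => ρ (i.1, k) * star (ρ (j.1, l)) with hR
      have e : idTensor A (traceSnd ∘ₗ sandwich L Lᴴ) (ketbra ρ ρ) i j =
        ∑ k, (L * R * Lᴴ) (i.2, k) (j.2, k) := rfl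
      rw [e]
      refine Finset.sum_congr rfl fun k _ => ?_
      simp only [Matrix.mul_apply, Matrix.conjTranspose_apply, hR, Matrix.of_apply, hy,
        star_sum, star_mul']
      rw [Finset.mul_sum]
      refine Finset.sum_congr rfl fun c _ => ?_
      rw [Finset.sum_mul, Finset.sum_mul]
      refine Finset.sum_congr rfl fun d _ => ?_
      ring
    have hσσ : ∀ j i, ketbra σ σ j i = σ j * star (σ i) := fun _ _ => rfl
    simp only [Matrix.trace, Matrix.diag_apply, Matrix.mul_apply, hω, hσσ]
    have : ∀ k, x k * star (x k) = ∑ i, ∑ j, y k i * star (y k j) * (σ j * star (σ i)) := by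
      intro k
      simp only [hx, star_sum, star_mul', star_star]
      rw [Finset.sum_mul_sum]
      refine Finset.sum_congr rfl fun i _ => Finset.sum_congr rfl fun j _ => ?_
      ring
    simp only [this, Finset.sum_mul]
    symm
    rw [Finset.sum_comm]
    exact Finset.sum_congr rfl fun i _ => Finset.sum_comm
  have h2 : ((overlap ρ σ)ᴴ * ((appendVec B v)ᴴ * L)).trace = ∑ k, star (v k) * x k := by
    have hL : ∀ b c, ((appendVec B v)ᴴ * L) b c = ∑ k, star (v k) * L (b, k) c := by
      intro b c
      rw [Matrix.mul_apply, Fintype.sum_prod_type, Finset.sum_eq_single b]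
      · simp [appendVec, Matrix.conjTranspose_apply]
      · intro b' _ hb'; simp [appendVec, Matrix.conjTranspose_apply, hb']
      · simp
    have hO : ∀ c b, (overlap ρ σ)ᴴ c b = ∑ a, star (σ (a, b)) * ρ (a, c) := by
      intro c b
      simp [overlap, traceFst, ketbra, Matrix.vecMulVec_apply]
    simp only [Matrix.trace, Matrix.diag_apply]
    simp only [Matrix.mul_apply (M := (overlap ρ σ)ᴴ), hL, hO, hx, hy, Fintype.sum_prod_type,
      Finset.mul_sum, Finset.sum_mul]
    have e1 : ∀ F : κ → A → B → B → ℂ, ∑ k, ∑ a, ∑ b, ∑ c, F k a b c =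
        ∑ c, ∑ b, ∑ k, ∑ a, F k a b c := by
      intro F
      calc ∑ k, ∑ a, ∑ b, ∑ c, F k a b c = ∑ k, ∑ b, ∑ c, ∑ a, F k a b c :=
            Finset.sum_congr rfl fun k _ => by
              rw [Finset.sum_comm]; exact Finset.sum_congr rfl fun b _ => Finset.sum_comm
        _ = ∑ b, ∑ c, ∑ k, ∑ a, F k a b c := by
              rw [Finset.sum_comm]; exact Finset.sum_congr rfl fun b _ => Finset.sum_comm
        _ = _ := Finset.sum_comm
    rw [e1]
    refine Finset.sum_congr rfl fun c _ => Finset.sum_congr rfl fun b _ =>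
      Finset.sum_congr rfl fun k _ => Finset.sum_congr rfl fun a _ => ?_
    ring
  have h3 : (∑ k, x k * star (x k)).re = ∑ k, ‖x k‖ ^ 2 := by
    have : ∑ k, x k * star (x k) = ((∑ k, ‖x k‖ ^ 2 : ℝ) : ℂ) := by
      push_cast
      exact Finset.sum_congr rfl fun k _ => by rw [RCLike.star_def, Complex.mul_conj']
    rw [this, Complex.ofReal_re]
  rw [h1, h2, h3]
  calc ‖∑ k, star (v k) * x k‖ ^ 2 ≤ (∑ k, ‖v k‖ * ‖x k‖) ^ 2 := by
        gcongr
        refine (norm_sum_le _ _).trans (le_of_eq (Finset.sum_congr rfl fun k _ => ?_))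
        rw [norm_mul, norm_star]
    _ ≤ (∑ k, ‖v k‖ ^ 2) * ∑ k, ‖x k‖ ^ 2 := Finset.sum_mul_sq_le_sq_mul_sq _ _ _
    _ = ∑ k, ‖x k‖ ^ 2 := by rw [hv, one_mul]

end Fidelity

/-! ### Choice of parameters and the accuracy in diamond norm. -/

section Accuracy

open Polynomial

variable {A B : Type*} [Fintype A] [DecidableEq A] [Fintype B] [DecidableEq B]

lemma isHermitian_upsilon (ρ σ : A × B → ℂ) : (upsilon ρ σ).IsHermitian := by
  have hx : (xi ρ σ)ᴴ = xi ρ σ := by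
    rw [xi_eq, Matrix.conjTranspose_mul, Matrix.conjTranspose_conjTranspose]
  have hs : ∀ c : Bool, (Matrix.single c c (1 : ℂ))ᴴ = Matrix.single c c 1 := fun c => by
    rw [Matrix.conjTranspose_single, star_one]
  rw [Matrix.IsHermitian, upsilon, Matrix.conjTranspose_smul, Matrix.conjTranspose_add,
    Matrix.conjTranspose_kronecker, Matrix.conjTranspose_kronecker, Matrix.conjTranspose_mul,
    Matrix.conjTranspose_mul, conjTranspose_pauliZ, hx, hs, hs, Matrix.mul_assoc]
  simp

lemma hermPreserving_dmesub {τ : Type*} [Fintype τ] [DecidableEq τ] {Υ : Op (Bool × τ)}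
    (h : Υ.IsHermitian) (m : ℕ) (t : ℝ) : HermPreserving (dmesub Υ m t) :=
  (hermPreserving_traceFst.comp ((hermPreserving_conjBy _).comp (hermPreserving_prepend h))).pow m

lemma HermPreserving.onSys {T : Op (Tgt A B) →ₗ[ℂ] Op (Tgt A B)} (h : HermPreserving T) :
    HermPreserving (onSys T) :=
  (hermPreserving_relabel _).comp ((h.idTensor Bool).comp (hermPreserving_relabel _))

lemma hermPreserving_alternate {G G' : Op (Sys A B) →ₗ[ℂ] Op (Sys A B)} (hG : HermPreserving G)
    (hG' : HermPreserving G') (Φ : List ℝ) : HermPreserving (alternate G G' Φ) := by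
  induction Φ generalizing G G' with
  | nil => exact hermPreserving_id
  | cons φ Φ ih => exact (ih hG' hG).comp ((hermPreserving_conjBy _).comp hG)

lemma hermPreserving_uhlmannPurifiedSample (ρ σ : A × B → ℂ) (m : ℕ) (Φ : List ℝ) :
    HermPreserving (uhlmannPurifiedSample ρ σ m Φ) := by
  have hΥ := isHermitian_upsilon ρ σ
  refine (hermPreserving_conjBy _).comp (HermPreserving.comp ?_ (hermPreserving_conjBy _))
  exact hermPreserving_alternate
    ((hermPreserving_conjBy _).comp (hermPreserving_dmesub hΥ m _)).onSys
    ((hermPreserving_dmesub hΥ m _).comp (hermPreserving_conjBy _)).onSys Φ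

lemma hermPreserving_prep (σ : A × B → ℂ) : HermPreserving (prep σ) := by
  refine hermPreserving_append ?_
  rw [Matrix.IsHermitian, Matrix.conjTranspose_kronecker, Matrix.conjTranspose_single, star_one,
    (isHermitian_ketbra σ).eq]

/-- The parameters of the algorithm: the phases `Φ` implement the polynomial `p`, which approximates
the sign function on `[t/2, 1]`. -/
structure GoodParameters (δ t : ℝ) (m : ℕ) (Φ : List ℝ) (p : ℝ[X]) : Prop where
  le_m : 52 ≤ m
  odd_length : Odd Φ.length
  qsp : (qspPoly Φ).1 + conjPoly (qspPoly Φ).1 = 2 * p.map (algebraMap ℝ ℂ)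
  odd_poly : ∀ x, p.eval (-x) = -p.eval x
  abs_le_one : ∀ x ∈ Set.Icc (-1 : ℝ) 1, |p.eval x| ≤ 1
  nonneg : ∀ x ∈ Set.Icc (0 : ℝ) 1, 0 ≤ p.eval x
  approx : ∀ x ∈ Set.Icc (t / 2) 1, 1 - δ ^ 2 / 8 ≤ p.eval x
  error : (104 / m : ℝ) ≤ δ / (4 * Φ.length)

/-- Let `u` be the number of phases. Then `u ≤ (1920/t) log (2/δ)`, and `m = ⌈416 u / δ⌉` is the
least integer with `104/m ≤ δ/(4u)`. The sample count `2 m u + 1` is at most `835 u²/δ`, and `835 ·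
1920² = 3078144000`. -/
lemma exists_goodParameters {δ t : ℝ} (hδ : 0 < δ) (hδ1 : δ < 1) (ht : 0 < t) (ht1 : t ≤ 1) :
    ∃ (m : ℕ) (Φ : List ℝ) (p : ℝ[X]), GoodParameters δ t m Φ p ∧
      (2 * m * Φ.length + 1 : ℝ) ≤ 3078144000 * (1 / (δ * t ^ 2)) * Real.log (2 / δ) ^ 2 := by
  -- The polynomial acts on `sin y ≥ y / 2`, whence the threshold `t / 2`. The precision `δ²/8` is
  -- `η²/2` for `η = δ/2`, as needed to round the unitary.
  obtain ⟨k, p, hk, hdeg, hodd, hb, hnn, happ⟩ := exists_sign_polynomial (t := t / 2)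
    (ε := δ ^ 2 / 8) (by linarith) (by linarith) (by positivity) (by nlinarith)
  obtain ⟨Φ, hlen, hΦ⟩ := exists_phases_of_odd hdeg
    (fun j hj => coeff_eq_zero_of_eval_neg hodd hj) hb
  have hu : (Φ.length : ℝ) = 2 * k + 1 := by rw [hlen]; push_cast; ring
  have hu1 : (1 : ℝ) ≤ Φ.length := by
    rw [hu]; have : (0 : ℝ) ≤ k := by positivity
    linarith
  have hlog : Real.log (2 / (δ ^ 2 / 8)) ≤ 4 * Real.log (2 / δ) := by
    rw [show (4 : ℝ) * Real.log (2 / δ) = Real.log ((2 / δ) ^ 4) by rw [Real.log_pow]; norm_num]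
    refine Real.log_le_log (by positivity) ?_
    rw [div_pow, div_div_eq_mul_div, div_le_div_iff₀ (by positivity) (by positivity)]
    have : δ ^ 4 ≤ δ ^ 2 := pow_le_pow_of_le_one hδ.le hδ1.le (by norm_num)
    linarith
  have hl0 : 0 ≤ Real.log (2 / δ) := Real.log_nonneg (by rw [le_div_iff₀ hδ]; linarith)
  have hub : (Φ.length : ℝ) ≤ 1920 / t * Real.log (2 / δ) := by
    rw [hu]
    refine hk.trans ?_
    calc 240 / (t / 2) * Real.log (2 / (δ ^ 2 / 8)) ≤ 240 / (t / 2) * (4 * Real.log (2 / δ)) := by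
          gcongr
      _ = _ := by field_simp; ring
  set u : ℝ := (Φ.length : ℝ) with hu'
  have hm : 416 * u / δ ≤ ⌈416 * u / δ⌉₊ := Nat.le_ceil _
  have hm2 : (⌈416 * u / δ⌉₊ : ℝ) < 416 * u / δ + 1 := Nat.ceil_lt_add_one (by positivity)
  set m := ⌈416 * u / δ⌉₊ with hmdef
  have h416 : 416 * u ≤ 416 * u / δ := by rw [le_div_iff₀ hδ]; nlinarith
  have hud : u ≤ u / δ := by rw [le_div_iff₀ hδ]; nlinarith
  refine ⟨m, Φ, p, ⟨?_, ⟨k, hlen⟩, hΦ, hodd, hb, hnn, happ, ?_⟩, ?_⟩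
  · have : (52 : ℝ) ≤ m := by linarith
    exact_mod_cast this
  · rw [← hu', div_le_div_iff₀ (by linarith) (by linarith)]
    rw [div_le_iff₀ hδ] at hm
    linarith
  · have h1 : (m : ℝ) ≤ 417 * (u / δ) := by
      have : 416 * u / δ = 416 * (u / δ) := by ring
      linarith
    calc (2 * m * u + 1 : ℝ) ≤ 2 * (417 * (u / δ)) * u + u / δ * u := by
          gcongr; nlinarith
      _ = 835 * (u ^ 2 / δ) := by ring
      _ ≤ 835 * ((1920 / t * Real.log (2 / δ)) ^ 2 / δ) := by gcongr
      _ = _ := by field_simp; ring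

lemma half_le_sin {x : ℝ} (h0 : 0 ≤ x) (h1 : x ≤ 1) : x / 2 ≤ Real.sin x := by
  have := Real.mul_le_sin h0 (by linarith [Real.pi_gt_three])
  have h2 : (1 : ℝ) / 2 ≤ 2 / Real.pi := by
    rw [div_le_div_iff₀ (by norm_num) Real.pi_pos]; linarith [Real.pi_le_four]
  nlinarith

section

variable {δ t : ℝ} {m : ℕ} {Φ : List ℝ} {p : ℝ[X]}

lemma GoodParameters.approx_sin (h : GoodParameters δ t m Φ p) {y : ℝ} (hty : t ≤ y)
    (hy0 : 0 ≤ y) (hy1 : y ≤ 1) : |1 - p.eval (Real.sin y)| ≤ δ ^ 2 / 8 := by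
  have h1 := half_le_sin hy0 hy1
  have h2 := Real.sin_le_one y
  have h3 := h.approx _ ⟨by linarith, h2⟩
  have h4 := h.abs_le_one (Real.sin y) ⟨Real.neg_one_le_sin y, h2⟩
  rw [abs_le] at h4 ⊢
  exact ⟨by linarith [sq_nonneg δ], by linarith⟩

lemma GoodParameters.length_pos (h : GoodParameters δ t m Φ p) : (1 : ℝ) ≤ Φ.length := by
  exact_mod_cast h.odd_length.pos

lemma GoodParameters.diamondBound (h : GoodParameters δ t m Φ p) (hδ1 : δ < 1) {ρ σ : A × B → ℂ}
    (hρ : IsPureState ρ) (hσ : IsPureState σ) :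
    DiamondBound (uhlmannPurifiedSample ρ σ m Φ -
      conjBy (qsvtUnitary (sineUnitary (overlapOp ρ σ)) Φ)) (δ / 2) := by
  have hu := h.length_pos
  have he : (0 : ℝ) ≤ 104 / m := by positivity
  have hue : Φ.length * (104 / m : ℝ) ≤ δ / 4 := by
    calc Φ.length * (104 / m : ℝ) ≤ Φ.length * (δ / (4 * Φ.length)) := mul_le_mul_of_nonneg_left h.error (by linarith)
      _ = δ / 4 := by field_simp
  refine (diamondBound_qsvt_sub (sineUnitary_isometry _) he (diamondBound_chanG_sub hρ hσ h.le_m)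
    (diamondBound_chanGinv_sub hρ hσ h.le_m) Φ).mono ?_
  have := one_add_pow_sub_one_le he (m := Φ.length) (by linarith)
  linarith

lemma GoodParameters.sineBlockEncoding (h : GoodParameters δ t m Φ p) (hδ : 0 < δ)
    {ρ σ : A × B → ℂ} (hρ : IsPureState ρ) (hσ : IsPureState σ) :
    SineBlockEncoding ρ σ m (δ / (2 * Φ.length)) := by
  refine UhlmannSample.sineBlockEncoding hρ hσ h.le_m (h.error.trans ?_)
  have hu := h.length_pos
  rw [← mul_div_assoc, div_le_div_iff₀ (by linarith) (by linarith)]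
  nlinarith

lemma GoodParameters.exists_ideal (h : GoodParameters δ t m Φ p) (hδ : 0 < δ) (hδ1 : δ < 1)
    {ρ σ : A × B → ℂ} (hρ : IsPureState ρ) (hσ : IsPureState σ)
    (ht : t ∈ lowerBounds (nonzeroSingularValues (rootProduct ρ σ))) :
    ∃ U : Op (Sys A B), IsBlockEncoding blockH U (ketbra ρ σ ⊗ₖ uhlmannIsometry ρ σ) ∧
      DiamondClose (uhlmannPurifiedSample ρ σ m Φ ∘ₗ prep σ) (conjBy U ∘ₗ prep σ) δ := by
  set W := qsvtUnitary (sineUnitary (overlapOp ρ σ)) Φ with hW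
  -- Rounding costs `2 η = δ` and the channel version of the circuit `δ/2`; the sum is below `2 δ`,
  -- which is the bound behind half a diamond norm of `δ`.
  obtain ⟨U, hU, hd⟩ := exists_ideal_unitary hρ hσ (W := W)
    (qsvtUnitary_isometry (sineUnitary_isometry _) Φ)
    (qsvtUnitary_block hρ hσ h.odd_length h.qsp h.odd_poly) (η := δ / 2) (by linarith)
    (fun x hx h0 => (h.approx_sin (le_sqrt_of_mem_spectrum_overlap ht hx h0) (Real.sqrt_nonneg x)
      (sqrt_le_one_of_mem_spectrum_overlap hρ hσ hx)).trans (by linarith))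
  refine ⟨U, hU, DiamondBound.diamondClose hδ.le ?_⟩
  have h1 := (h.diamondBound hδ1 hρ hσ).comp (by linarith) (diamondBound_prep hσ)
  have h2 := h1.add hd
  have e : (uhlmannPurifiedSample ρ σ m Φ - conjBy W) ∘ₗ prep σ +
      (conjBy W ∘ₗ prep σ - conjBy U ∘ₗ prep σ) =
      uhlmannPurifiedSample ρ σ m Φ ∘ₗ prep σ - conjBy U ∘ₗ prep σ := by
    rw [LinearMap.sub_comp]; abel
  rw [e] at h2
  exact h2.mono (by linarith)

end

lemma isPureState_zeroKet {ρ : A × B → ℂ} (hρ : IsPureState ρ) : IsPureState (zeroKet ρ) := by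
  rw [IsPureState, Fintype.sum_prod_type, Finset.sum_eq_single (false, false)]
  · rw [← show ∑ i, ‖ρ i‖ ^ 2 = 1 from hρ]
    simp [zeroKet]
  · intro c _ hc; simp [zeroKet, hc]
  · simp

/-- The amplitude of the target state in the output of the unitary circuit. -/
lemma trace_overlap_mul_block {ρ σ : A × B → ℂ} (hρ : IsPureState ρ) (hσ : IsPureState σ)
    {W : Op (Sys A B)} {f : ℝ → ℝ}
    (hblock : W.submatrix blockH blockH = ketbra ρ σ ⊗ₖ svMap f (overlap ρ σ)) :
    ((overlap ρ σ)ᴴ * ((appendVec B (zeroKet ρ))ᴴ *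
      (W.submatrix id blockH * prependVec B σ))).trace =
      (cfc (fun x => x * (f (√x) / √x)) ((overlap ρ σ)ᴴ * overlap ρ σ)).trace := by
  set K : Matrix (Sys A B) ((A × B) × B) ℂ := (1 : Op (Sys A B)).submatrix id blockH with hK
  have hb : Kᴴ * W.submatrix id blockH =
      prependVec B ρ * svMap f (overlap ρ σ) * (prependVec B σ)ᴴ := by
    rw [← ketbra_kronecker, ← hblock, hK, ← submatrix_eq_mul]
    rfl
  have e : (appendVec B (zeroKet ρ))ᴴ * (W.submatrix id blockH * prependVec B σ) =
      svMap f (overlap ρ σ) := by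
    rw [appendVec_zeroKet, ← hK, Matrix.conjTranspose_mul, Matrix.mul_assoc, ← Matrix.mul_assoc Kᴴ,
      hb, ← Matrix.mul_assoc, ← Matrix.mul_assoc, ← Matrix.mul_assoc, prependVec_isometry hρ,
      Matrix.one_mul, Matrix.mul_assoc, prependVec_isometry hσ, Matrix.mul_one]
  rw [e, svMap, ← Matrix.mul_assoc, cfc_id_mul (isHermitian_gram _)]

variable {δ t : ℝ} {m : ℕ} {Φ : List ℝ} {p : ℝ[X]}

/-- The trace norm of the overlap is almost attained by the transformed singular values. -/
lemma GoodParameters.traceNorm_le (h : GoodParameters δ t m Φ p) (hδ : 0 < δ) (hδ1 : δ < 1)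
    {ρ σ : A × B → ℂ} (hρ : IsPureState ρ) (hσ : IsPureState σ) {s : ℝ} {r : ℕ} (hr : 1 ≤ r)
    (hs : s ∈ lowerBounds (nonzeroSingularValues (rootProduct ρ σ)))
    (hrank : (rootProduct ρ σ).rank ≤ r) (ht : t = max s (δ / (8 * r))) :
    traceNorm (overlap ρ σ) ≤ (cfc (fun x => x * (p.eval (Real.sin (√x)) / √x))
      ((overlap ρ σ)ᴴ * overlap ρ σ)).trace.re + δ / 4 := by
  set G := (overlap ρ σ)ᴴ * overlap ρ σ with hG
  have hGH : G.IsHermitian := isHermitian_gram _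
  have hr' : (1 : ℝ) ≤ r := by exact_mod_cast hr
  have h1 : traceNorm (overlap ρ σ) = ∑ i, √(hGH.eigenvalues i) := by
    rw [traceNorm, trace_cfc_re hGH]
  have h2 := trace_support_overlap ρ σ
  rw [← hG, trace_cfc_re hGH] at h2
  have h3 : traceNorm (overlap ρ σ) ≤ 1 := traceNorm_overlap_le hρ hσ
  -- Singular values above `t` lose at most the fraction `δ²/8`. Since every nonzero one is at least
  -- `s`, those below `t` are smaller than `δ/(8r)` and may be lost completely. Summed over at most
  -- `r` nonzero values and a trace norm of at most one, each of the two losses is at most `δ/8`.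
  have key : ∀ x ∈ spectrum ℝ G, √x ≤ x * (p.eval (Real.sin (√x)) / √x) + δ ^ 2 / 8 * √x +
      δ / (8 * r) * (if x = 0 then 0 else 1) := by
    intro x hx
    by_cases h0 : x = 0
    · simp [h0]
    have hx0 : 0 ≤ x := spectrum_gram_nonneg _ hx
    have hy0 : √x ≠ 0 := (Real.sqrt_pos.mpr (lt_of_le_of_ne hx0 (Ne.symm h0))).ne'
    have hy1 : √x ≤ 1 := sqrt_le_one_of_mem_spectrum_overlap hρ hσ hx
    have hsy : s ≤ √x := le_sqrt_of_mem_spectrum_overlap hs hx h0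
    have e : x * (p.eval (Real.sin (√x)) / √x) = √x * p.eval (Real.sin (√x)) := by
      rw [mul_div_left_comm, Real.div_sqrt, mul_comm]
    rw [e, if_neg h0, mul_one]
    have hd0 : 0 < δ / (8 * r) := by positivity
    by_cases hty : t ≤ √x
    · have := h.approx_sin hty (Real.sqrt_nonneg x) hy1
      rw [abs_le] at this
      nlinarith [Real.sqrt_nonneg x]
    · have hlt : √x < δ / (8 * r) := by
        rw [not_le, ht, lt_max_iff] at hty
        rcases hty with h' | h'
        · linarith
        · exact h'
      have hsin := half_le_sin (Real.sqrt_nonneg x) hy1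
      have hx1 := Real.sqrt_nonneg x
      have hnn := h.nonneg (Real.sin (√x)) ⟨by linarith, Real.sin_le_one _⟩
      have : 0 ≤ √x * p.eval (Real.sin (√x)) := mul_nonneg (Real.sqrt_nonneg x) hnn
      have : 0 ≤ δ ^ 2 / 8 * √x := by positivity
      linarith
  have hsum : ∑ i, √(hGH.eigenvalues i) ≤
      ∑ i, (hGH.eigenvalues i * (p.eval (Real.sin (√(hGH.eigenvalues i))) / √(hGH.eigenvalues i)) +
        δ ^ 2 / 8 * √(hGH.eigenvalues i) +
        δ / (8 * r) * (if hGH.eigenvalues i = 0 then 0 else 1)) :=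
    Finset.sum_le_sum fun i _ => key _ (hGH.eigenvalues_mem_spectrum_real i)
  rw [Finset.sum_add_distrib, Finset.sum_add_distrib, ← Finset.mul_sum, ← Finset.mul_sum, h2,
    ← h1] at hsum
  rw [trace_cfc_re hGH]
  have h5 : δ / (8 * r) * ((rootProduct ρ σ).rank : ℝ) ≤ δ / 8 := by
    calc δ / (8 * r) * ((rootProduct ρ σ).rank : ℝ) ≤ δ / (8 * r) * r := by gcongr
      _ = δ / 8 := by field_simp
  have h6 : δ ^ 2 / 8 * traceNorm (overlap ρ σ) ≤ δ / 8 := by nlinarith [traceNorm_nonneg (overlap ρ σ)]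
  linarith

lemma trace_ketbra {v : A → ℂ} (hv : IsPureState v) : (ketbra v v).trace = 1 := by
  rw [ketbra, Matrix.trace_vecMulVec, dotProduct_comm]
  exact sum_star_mul_self hv

end Accuracy

/-! ### Accuracy in the fidelity. -/

section FidelityAccuracy

open Polynomial

variable {A B : Type} [Fintype A] [DecidableEq A] [Fintype B] [DecidableEq B]
  {δ t : ℝ} {m : ℕ} {Φ : List ℝ} {p : ℝ[X]}

/-- Of the allowed loss `δ`, one half pays for replacing the channel by its unitary idealization.
The other half pays for the amplitude deficit `δ/4`, doubled by squaring. The test vector on the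
discarded systems is `|00⟩|ρ⟩`, since the block-encoding turns `|σ⟩` into `|ρ⟩`. -/
lemma GoodParameters.fidelity_ge (h : GoodParameters δ t m Φ p) (hδ : 0 < δ) (hδ1 : δ < 1)
    {ρ σ : A × B → ℂ} (hρ : IsPureState ρ) (hσ : IsPureState σ) {s : ℝ} {r : ℕ} (hr : 1 ≤ r)
    (hs : s ∈ lowerBounds (nonzeroSingularValues (rootProduct ρ σ)))
    (hrank : (rootProduct ρ σ).rank ≤ r) (ht : t = max s (δ / (8 * r))) :
    fidelity (reduced ρ) (reduced σ) - δ ≤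
      fidelity (idTensor A (traceSnd ∘ₗ uhlmannPurifiedSample ρ σ m Φ ∘ₗ prep σ) (ketbra ρ ρ))
        (ketbra σ σ) := by
  set W := qsvtUnitary (sineUnitary (overlapOp ρ σ)) Φ with hW
  set ω := idTensor A (traceSnd ∘ₗ uhlmannPurifiedSample ρ σ m Φ ∘ₗ prep σ) (ketbra ρ ρ) with hω
  set ω' := idTensor A (traceSnd ∘ₗ conjBy W ∘ₗ prep σ) (ketbra ρ ρ) with hω'
  have hblock := qsvtUnitary_block hρ hσ h.odd_length h.qsp h.odd_poly
  have hherm : ω.IsHermitian := by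
    have := (hermPreserving_traceSnd.comp ((hermPreserving_uhlmannPurifiedSample ρ σ m Φ).comp
      (hermPreserving_prep σ))).idTensor A (ketbra ρ ρ)
    rw [(isHermitian_ketbra ρ).eq] at this
    exact this.symm
  have h1 := trace_mul_ketbra_le_fidelity hherm hσ
  have h2 : ‖(ketbra σ σ * (ω - ω')).trace‖ ≤ δ / 2 := by
    have hd := (diamondBound_traceSnd (α := B) (β := (Bool × Bool) × (A × B))).comp zero_le_one
      ((h.diamondBound hδ1 hρ hσ).comp (by linarith) (diamondBound_prep hσ))
    have hd2 := hd A (ketbra ρ ρ)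
    have e : idTensor A (traceSnd ∘ₗ (uhlmannPurifiedSample ρ σ m Φ -
        conjBy (qsvtUnitary (sineUnitary (overlapOp ρ σ)) Φ)) ∘ₗ prep σ) (ketbra ρ ρ) = ω - ω' := by
      rw [LinearMap.sub_comp, LinearMap.comp_sub]
      rfl
    rw [e] at hd2
    have hd3 : traceNorm (ω - ω') ≤ δ / 2 := by
      refine hd2.trans ?_
      have := traceNorm_ketbra_le hρ hρ
      rw [one_mul, mul_one]
      exact mul_le_of_le_one_right (by linarith) this
    open scoped Matrix.Norms.L2Operator in
    have hn : ‖ketbra σ σ‖ ≤ 1 := by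
      have := norm_le_trace_of_posSemidef (H := ketbra σ σ) (Matrix.posSemidef_vecMulVec_self_star σ)
      rwa [trace_ketbra hσ, Complex.one_re] at this
    refine (norm_trace_mul_le _ _).trans ?_
    exact (mul_le_of_le_one_left (traceNorm_nonneg _) hn).trans hd3
  have h3 : (ω' * ketbra σ σ).trace.re ≤ (ω * ketbra σ σ).trace.re + δ / 2 := by
    have := (abs_le.mp ((Complex.abs_re_le_norm _).trans h2)).1
    rw [Matrix.mul_sub, Matrix.trace_sub, Complex.sub_re, Matrix.trace_mul_comm _ ω,
      Matrix.trace_mul_comm _ ω'] at this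
    linarith
  have h4 := le_trace_traceSnd_sandwich (ρ := ρ) (σ := σ)
    (W.submatrix id blockH * prependVec B σ) (isPureState_zeroKet hρ)
  rw [← conjBy_comp_prep, trace_overlap_mul_block hρ hσ hblock, ← hω'] at h4
  have h5 := h.traceNorm_le hδ hδ1 hρ hσ hr hs hrank ht
  have h6 := traceNorm_overlap_le hρ hσ
  have h7 := traceNorm_nonneg (overlap ρ σ)
  rw [fidelity_reduced_eq]
  set z := (cfc (fun x => x * (p.eval (Real.sin (√x)) / √x))
    ((overlap ρ σ)ᴴ * overlap ρ σ)).trace with hz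
  have h8 : z.re ≤ ‖z‖ := Complex.re_le_norm z
  -- Writing `T ≤ 1` for the trace norm: if `T ≥ δ/4`, then `(T - δ/4)² ≥ T² - δ/2`; otherwise `T² ≤
  -- δ/2` already.
  have h9 : traceNorm (overlap ρ σ) ^ 2 - δ / 2 ≤ ‖z‖ ^ 2 := by
    by_cases hc : traceNorm (overlap ρ σ) ≤ δ / 4
    · nlinarith [sq_nonneg ‖z‖]
    · nlinarith [norm_nonneg z]
  linarith

end FidelityAccuracy

/-! ### Gates as maps on amplitudes. -/

section Gates

variable {ι κ : Type} [Fintype ι] [DecidableEq ι] [Fintype κ] [DecidableEq κ]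

lemma extend_comp_embedding (e : κ ↪ ι) (z : κ → Bool) (x : ι → Bool) :
    Function.extend e z x ∘ e = z := by
  funext k; exact e.injective.extend_apply z x k

lemma extend_apply_of_notMem (e : κ ↪ ι) (z : κ → Bool) (x : ι → Bool) {i : ι}
    (hi : i ∉ Set.range e) : Function.extend e z x i = x i :=
  Function.extend_apply' _ _ _ fun ⟨k, hk⟩ => hi ⟨k, hk⟩

/-- Only basis states that agree with `x` off the chosen qubits contribute, and they are
parametrized by their values `z` on these qubits. -/
lemma actOn_mulVec (e : κ ↪ ι) (U : Op (κ → Bool)) (ψ : (ι → Bool) → ℂ) (x : ι → Bool) :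
    (actOn e U *ᵥ ψ) x = ∑ z, U (x ∘ e) z * ψ (Function.extend e z x) := by
  classical
  have hinj : Function.Injective fun z => Function.extend e z x := fun z z' h => by
    have := congrArg (fun f : ι → Bool => f ∘ e) h
    simpa only [extend_comp_embedding] using this
  have h1 : ∑ z, U (x ∘ e) z * ψ (Function.extend e z x) =
      ∑ y ∈ Finset.univ.image (fun z => Function.extend e z x), actOn e U x y * ψ y := by
    rw [Finset.sum_image fun z _ z' _ h => hinj h]
    refine Finset.sum_congr rfl fun z _ => ?_
    rw [actOn, if_pos fun i hi => (extend_apply_of_notMem e z x hi).symm, extend_comp_embedding]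
  rw [h1, Matrix.mulVec, dotProduct]
  refine (Finset.sum_subset (Finset.subset_univ _) fun y _ hy => ?_).symm
  rw [actOn, if_neg, zero_mul]
  intro h
  refine hy (Finset.mem_image.mpr ⟨y ∘ e, Finset.mem_univ _, ?_⟩)
  funext i
  by_cases hi : i ∈ Set.range e
  · obtain ⟨k, rfl⟩ := hi; exact e.injective.extend_apply _ _ k
  · rw [extend_apply_of_notMem e _ _ hi, h i hi]

variable {a b : ℕ}

/-- The one-element embedding. -/
def emb1 (i : ι) : Fin 1 ↪ ι := ⟨fun _ => i, fun _ _ _ => Subsingleton.elim _ _⟩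

/-- The embedding of a pair of distinct elements. -/
def emb2 (i j : ι) (h : i ≠ j) : Fin 2 ↪ ι :=
  ⟨![i, j], by
    intro p q hpq
    fin_cases p <;> fin_cases q <;> simp_all [eq_comm]⟩

lemma submatrix_mem_unitaryGroup {α β : Type*} [Fintype α] [DecidableEq α] [Fintype β]
    [DecidableEq β] {U : Op β} (hU : U ∈ Matrix.unitaryGroup β ℂ) (e : α ≃ β) :
    U.submatrix e e ∈ Matrix.unitaryGroup α ℂ := by
  rw [Matrix.mem_unitaryGroup_iff] at hU ⊢
  rw [Matrix.star_eq_conjTranspose] at hU ⊢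
  rw [Matrix.conjTranspose_submatrix, Matrix.submatrix_mul_equiv, hU, Matrix.submatrix_one_equiv]

/-- A one-qubit gate. -/
def gate1 (i : ι) (U : Matrix.unitaryGroup Bool ℂ) : Instr a b ι :=
  .gate 1 (Or.inl rfl) (emb1 i)
    ⟨(U : Op Bool).submatrix (Equiv.funUnique (Fin 1) Bool) (Equiv.funUnique (Fin 1) Bool),
      submatrix_mem_unitaryGroup U.2 _⟩

/-- A two-qubit gate on the qubits `i ≠ j`. -/
def gate2 (i j : ι) (U : Matrix.unitaryGroup (Bool × Bool) ℂ) : Instr a b ι :=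
  -- A default value that makes the definition total; the lemmas on its action assume `i ≠ j`.
  if h : i = j then .reset i else
  .gate 2 (Or.inr rfl) (emb2 i j h)
    ⟨(U : Op (Bool × Bool)).submatrix (finTwoArrowEquiv Bool) (finTwoArrowEquiv Bool),
      submatrix_mem_unitaryGroup U.2 _⟩

lemma samples_gate1 (i : ι) (U : Matrix.unitaryGroup Bool ℂ) :
    (gate1 i U : Instr a b ι).samples = 0 := rfl

lemma gates_gate1 (i : ι) (U : Matrix.unitaryGroup Bool ℂ) :
    (gate1 i U : Instr a b ι).gates = 1 := rfl

lemma samples_gate2 (i j : ι) (U : Matrix.unitaryGroup (Bool × Bool) ℂ) :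
    (gate2 i j U : Instr a b ι).samples = 0 := by
  unfold gate2; split_ifs <;> rfl

lemma gates_gate2 (i j : ι) (U : Matrix.unitaryGroup (Bool × Bool) ℂ) :
    (gate2 i j U : Instr a b ι).gates = 1 := by
  unfold gate2; split_ifs <;> rfl

lemma evalCircuit_append (ρ σ : Q a × Q b → ℂ) (l l' : List (Instr a b ι)) :
    evalCircuit ρ σ (l ++ l') = evalCircuit ρ σ l' ∘ₗ evalCircuit ρ σ l := by
  induction l with
  | nil => rfl
  | cons c l ih => rw [List.cons_append, evalCircuit, ih, evalCircuit, LinearMap.comp_assoc]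

lemma sampleCount_append (l l' : List (Instr a b ι)) :
    sampleCount (l ++ l') = sampleCount l + sampleCount l' := by
  simp [sampleCount]

lemma gateCount_append (l l' : List (Instr a b ι)) :
    gateCount (l ++ l') = gateCount l + gateCount l' := by
  simp [gateCount]

/-- The circuit `l` consists of unitary gates whose product maps the vector `ψ` to `T ψ`. -/
def Realizes (l : List (Instr a b ι)) (T : ((ι → Bool) → ℂ) → (ι → Bool) → ℂ) : Prop :=
  ∃ U : Op (ι → Bool), (∀ ρ σ, evalCircuit ρ σ l = conjBy U) ∧ ∀ ψ x, (U *ᵥ ψ) x = T ψ x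

lemma Realizes.nil : Realizes ([] : List (Instr a b ι)) id :=
  ⟨1, fun _ _ => by ext1 X; simp [evalCircuit, conjBy_apply], fun ψ x => by simp⟩

lemma Realizes.append {l l' : List (Instr a b ι)} {T T' : ((ι → Bool) → ℂ) → (ι → Bool) → ℂ}
    (h : Realizes l T) (h' : Realizes l' T') : Realizes (l ++ l') (T' ∘ T) := by
  obtain ⟨U, hU, hT⟩ := h
  obtain ⟨U', hU', hT'⟩ := h'
  refine ⟨U' * U, fun ρ σ => ?_, fun ψ x => ?_⟩
  · rw [evalCircuit_append, hU, hU', conjBy_comp]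
  · rw [← Matrix.mulVec_mulVec, hT', Function.comp_apply, funext (hT ψ)]

lemma Realizes.cons {c : Instr a b ι} {l : List (Instr a b ι)}
    {T T' : ((ι → Bool) → ℂ) → (ι → Bool) → ℂ} (h : Realizes [c] T) (h' : Realizes l T') :
    Realizes (c :: l) (T' ∘ T) :=
  h.append h'

lemma Realizes.congr {l : List (Instr a b ι)} {T T' : ((ι → Bool) → ℂ) → (ι → Bool) → ℂ}
    (h : Realizes l T) (hT : ∀ ψ x, T ψ x = T' ψ x) : Realizes l T' := by
  obtain ⟨U, hU, hU'⟩ := h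
  exact ⟨U, hU, fun ψ x => (hU' ψ x).trans (hT ψ x)⟩

lemma realizes_gate {k : ℕ} (hk : k = 1 ∨ k = 2) (e : Fin k ↪ ι) (U : Matrix.unitaryGroup (Q k) ℂ) :
    Realizes [(.gate k hk e U : Instr a b ι)]
      fun ψ x => ∑ z, (U : Op (Q k)) (x ∘ e) z * ψ (Function.extend e z x) :=
  ⟨actOn e U, fun _ _ => by ext1 X; rfl, actOn_mulVec e _⟩

lemma realizes_gate1 (i : ι) (U : Matrix.unitaryGroup Bool ℂ) :
    Realizes [(gate1 i U : Instr a b ι)]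
      fun ψ x => ∑ c, (U : Op Bool) (x i) c * ψ (Function.update x i c) := by
  refine (realizes_gate _ _ _).congr fun ψ x => ?_
  rw [← (Equiv.funUnique (Fin 1) Bool).symm.sum_comp]
  refine Finset.sum_congr rfl fun c _ => ?_
  have h : Function.extend (emb1 i) ((Equiv.funUnique (Fin 1) Bool).symm c) x =
      Function.update x i c := by
    funext j
    by_cases hj : j = i
    · subst hj
      rw [Function.update_self]
      exact (emb1 j).injective.extend_apply _ _ 0
    · rw [Function.update_of_ne hj, extend_apply_of_notMem]
      rintro ⟨k, hk⟩
      exact hj hk.symm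
  rw [h]
  rfl

lemma realizes_gate2 {i j : ι} (hij : i ≠ j) (U : Matrix.unitaryGroup (Bool × Bool) ℂ) :
    Realizes [(gate2 i j U : Instr a b ι)]
      fun ψ x => ∑ c, (U : Op (Bool × Bool)) (x i, x j) c *
        ψ (Function.update (Function.update x i c.1) j c.2) := by
  rw [gate2, dif_neg hij]
  refine (realizes_gate _ _ _).congr fun ψ x => ?_
  rw [← (finTwoArrowEquiv Bool).symm.sum_comp]
  refine Finset.sum_congr rfl fun c _ => ?_
  have h : Function.extend (emb2 i j hij) ((finTwoArrowEquiv Bool).symm c) x =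
      Function.update (Function.update x i c.1) j c.2 := by
    funext k
    by_cases hj : k = j
    · subst hj
      rw [Function.update_self]
      exact (emb2 i k hij).injective.extend_apply _ _ 1
    · rw [Function.update_of_ne hj]
      by_cases hi : k = i
      · subst hi
        rw [Function.update_self]
        exact (emb2 k j hij).injective.extend_apply _ _ 0
      · rw [Function.update_of_ne hi, extend_apply_of_notMem]
        rintro ⟨p, hp⟩
        fin_cases p
        · exact hi hp.symm
        · exact hj hp.symm
  rw [h]
  rfl

/-- Pauli `X`, as a one-qubit gate. -/
def xGate : Matrix.unitaryGroup Bool ℂ :=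
  ⟨Matrix.of fun c d => if c = d then 0 else 1, by
    rw [Matrix.mem_unitaryGroup_iff]
    ext c d
    cases c <;> cases d <;> simp [Matrix.mul_apply, Matrix.star_apply]⟩

/-- The Hadamard gate. -/
def hGate : Matrix.unitaryGroup Bool ℂ :=
  ⟨Matrix.of fun c d => ((1 / √2 : ℝ) : ℂ) * (if c && d then -1 else 1), by
    rw [Matrix.mem_unitaryGroup_iff]
    have := inv_sqrt_two_mul_self
    ext c d
    cases c <;> cases d <;> simp [Matrix.mul_apply, Matrix.star_apply] at this ⊢ <;>
      linear_combination 2 * this⟩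

/-- The two-qubit gate that applies `u + v X` to the second qubit if the first one is `|1⟩`. -/
def ctrlMat (u v : ℂ) : Op (Bool × Bool) := fun p q =>
  if p.1 = q.1 then (if p.1 then (if p.2 = q.2 then u else v) else if p.2 = q.2 then 1 else 0) else 0

lemma ctrlMat_mem {u v : ℂ} (h1 : u * star u + v * star v = 1) (h2 : u * star v + v * star u = 0) :
    ctrlMat u v ∈ Matrix.unitaryGroup (Bool × Bool) ℂ := by
  rw [Matrix.mem_unitaryGroup_iff]
  simp only [RCLike.star_def] at h1 h2
  ext ⟨c, d⟩ ⟨c', d'⟩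
  cases c <;> cases d <;> cases c' <;> cases d' <;>
    simp [Matrix.mul_apply, Matrix.star_apply, ctrlMat, Fintype.sum_prod_type] <;>
    first | linear_combination h1 | linear_combination h2

/-- A diagonal two-qubit gate. -/
def diagGate (f : Bool × Bool → ℂ) (h : ∀ p, f p * star (f p) = 1) :
    Matrix.unitaryGroup (Bool × Bool) ℂ :=
  ⟨Matrix.diagonal f, by
    rw [Matrix.mem_unitaryGroup_iff, Matrix.star_eq_conjTranspose, Matrix.diagonal_conjTranspose,
      Matrix.diagonal_mul_diagonal, ← Matrix.diagonal_one]
    congr 1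
    funext p
    exact h p⟩

lemma realizes_xGate (i : ι) : Realizes [(gate1 i xGate : Instr a b ι)]
    fun ψ x => ψ (Function.update x i (!x i)) :=
  (realizes_gate1 i xGate).congr fun ψ x => by
    cases h : x i <;> simp [xGate]

lemma realizes_hGate (i : ι) : Realizes [(gate1 i hGate : Instr a b ι)]
    fun ψ x => ((1 / √2 : ℝ) : ℂ) * (ψ (Function.update x i false) +
      (if x i then -1 else 1) * ψ (Function.update x i true)) :=
  (realizes_gate1 i hGate).congr fun ψ x => by
    cases h : x i <;> simp [hGate] <;> ring

lemma realizes_diagGate {i j : ι} (hij : i ≠ j) (f : Bool × Bool → ℂ)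
    (h : ∀ p, f p * star (f p) = 1) : Realizes [(gate2 i j (diagGate f h) : Instr a b ι)]
    fun ψ x => f (x i, x j) * ψ x :=
  (realizes_gate2 hij _).congr fun ψ x => by
    rw [Finset.sum_eq_single (x i, x j)]
    · simp [diagGate]
    · intro c _ hc
      simp [diagGate, Matrix.diagonal_apply_ne _ hc.symm]
    · simp

lemma realizes_ctrl {i j : ι} (hij : i ≠ j) {u v : ℂ} (h : ctrlMat u v ∈ _) :
    Realizes [(gate2 i j ⟨ctrlMat u v, h⟩ : Instr a b ι)]
      fun ψ x => if x i then u * ψ x + v * ψ (Function.update x j (!x j)) else ψ x :=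
  (realizes_gate2 hij _).congr fun ψ x => by
    cases h1 : x i <;> cases h2 : x j
    all_goals
      have e1 := Function.update_eq_self i x
      have e2 := Function.update_eq_self j x
      rw [h1] at e1
      rw [h2] at e2
      simp [Fintype.sum_prod_type, ctrlMat, e1, e2]
    ring

end Gates

/-! ### The controlled swap from two-qubit gates. -/

section ControlledSwap

variable {ι : Type} [Fintype ι] [DecidableEq ι] {a b : ℕ}

/-- Controlled `X`. -/
def cxGate : Matrix.unitaryGroup (Bool × Bool) ℂ :=
  ⟨ctrlMat 0 1, ctrlMat_mem (by simp) (by simp)⟩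

/-- Controlled square root of `X`. -/
def cvGate : Matrix.unitaryGroup (Bool × Bool) ℂ :=
  ⟨ctrlMat ((1 + Complex.I) / 2) ((1 - Complex.I) / 2), ctrlMat_mem
    (by simp; linear_combination (-1 / 2 : ℂ) * Complex.I_mul_I)
    (by simp; linear_combination (1 / 2 : ℂ) * Complex.I_mul_I)⟩

/-- The inverse of the controlled square root of `X`. -/
def cvInvGate : Matrix.unitaryGroup (Bool × Bool) ℂ :=
  ⟨ctrlMat ((1 - Complex.I) / 2) ((1 + Complex.I) / 2), ctrlMat_mem
    (by simp; linear_combination (-1 / 2 : ℂ) * Complex.I_mul_I)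
    (by simp; linear_combination (1 / 2 : ℂ) * Complex.I_mul_I)⟩

/-- Exchange of the qubits `x` and `y`, controlled by the qubit `h`. -/
def cswap (h x y : ι) : List (Instr a b ι) :=
  -- The outer two gates reduce the controlled swap to a Toffoli gate with controls `h`, `y` and
  -- target `x`. The middle five are its standard decomposition with square roots of `X`.
  [gate2 x y cxGate, gate2 h x cvGate, gate2 h y cxGate, gate2 y x cvInvGate, gate2 h y cxGate,
    gate2 y x cvGate, gate2 x y cxGate]

lemma sampleCount_cswap (h x y : ι) : sampleCount (cswap h x y : List (Instr a b ι)) = 0 := by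
  simp [sampleCount, cswap, samples_gate2]

lemma gateCount_cswap (h x y : ι) : gateCount (cswap h x y : List (Instr a b ι)) = 7 := by
  simp [gateCount, cswap, gates_gate2]

lemma realizes_cswap {h x y : ι} (hx : h ≠ x) (hy : h ≠ y) (hxy : x ≠ y) :
    Realizes (cswap h x y : List (Instr a b ι))
      fun ψ w => if w h then ψ (w ∘ Equiv.swap x y) else ψ w := by
  refine ((realizes_ctrl hxy _).cons ((realizes_ctrl hx _).cons ((realizes_ctrl hy _).cons
    ((realizes_ctrl hxy.symm _).cons ((realizes_ctrl hy _).cons ((realizes_ctrl hxy.symm _).cons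
    (realizes_ctrl hxy _))))))).congr fun ψ w => ?_
  set W : Bool → Bool → ι → Bool := fun p q => Function.update (Function.update w x p) y q with hW
  have e1 : w = W (w x) (w y) := by simp [hW]
  have e2 : w ∘ Equiv.swap x y = W (w y) (w x) := by
    funext i
    by_cases h1 : i = x
    · subst h1; simp [hW, hxy]
    · by_cases h2 : i = y
      · subst h2; simp [hW]
      · simp [hW, h1, h2, Equiv.swap_apply_of_ne_of_ne]
  have fx : ∀ p q, W p q x = p := fun p q => by simp [hW, hxy]
  have fy : ∀ p q, W p q y = q := fun p q => by simp [hW]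
  have fh : ∀ p q, W p q h = w h := fun p q => by simp [hW, hx, hy]
  have ux : ∀ p q c, Function.update (W p q) x c = W c q := fun p q c => by
    simp only [hW]; rw [Function.update_comm hxy, Function.update_idem, Function.update_comm hxy.symm]
  have uy : ∀ p q c, Function.update (W p q) y c = W p c := fun p q c => by
    simp only [hW]; rw [Function.update_idem]
  rw [e2]
  conv_lhs => rw [e1]
  conv_rhs => rw [show ψ w = ψ (W (w x) (w y)) by rw [← e1]]
  simp only [Function.comp_apply, fx, fy, fh, ux, uy]
  cases w h <;> cases w x <;> cases w y <;> simp
  all_goals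
    ring_nf
    simp only [Complex.I_sq]
    ring

end ControlledSwap

/-! ### Circuits for the partial swap and for the program state. -/

section PartialSwapCircuit

variable {ι : Type} [Fintype ι] [DecidableEq ι] {a b : ℕ}

/-- The composition of the exchanges of the given pairs. -/
def swaps : List (ι × ι) → Equiv.Perm ι
  | [] => 1
  | p :: ps => swaps ps * Equiv.swap p.1 p.2

/-- The exchange of all pairs of a list, controlled by the qubit `h`. -/
def cswaps (h : ι) (ps : List (ι × ι)) : List (Instr a b ι) := ps.flatMap fun p => cswap h p.1 p.2

lemma sampleCount_cswaps (h : ι) (ps : List (ι × ι)) :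
    sampleCount (cswaps h ps : List (Instr a b ι)) = 0 := by
  induction ps with
  | nil => rfl
  | cons p ps ih =>
    rw [cswaps, List.flatMap_cons, sampleCount_append, sampleCount_cswap, zero_add]; exact ih

lemma gateCount_cswaps (h : ι) (ps : List (ι × ι)) :
    gateCount (cswaps h ps : List (Instr a b ι)) = 7 * ps.length := by
  induction ps with
  | nil => rfl
  | cons p ps ih =>
    rw [cswaps, List.flatMap_cons, gateCount_append, gateCount_cswap, List.length_cons, mul_add,
      mul_one, add_comm]
    exact congrArg (· + 7) ih

lemma swaps_apply_of_forall_ne {ps : List (ι × ι)} {i : ι} (h : ∀ p ∈ ps, i ≠ p.1 ∧ i ≠ p.2) :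
    swaps ps i = i := by
  induction ps with
  | nil => rfl
  | cons p ps ih =>
    have hp := h p List.mem_cons_self
    rw [swaps, Equiv.Perm.mul_apply, Equiv.swap_apply_of_ne_of_ne hp.1 hp.2,
      ih fun q hq => h q (List.mem_cons_of_mem _ hq)]

lemma realizes_cswaps {h : ι} {ps : List (ι × ι)}
    (hps : ∀ p ∈ ps, h ≠ p.1 ∧ h ≠ p.2 ∧ p.1 ≠ p.2) :
    Realizes (cswaps h ps : List (Instr a b ι))
      fun ψ w => if w h then ψ (w ∘ swaps ps) else ψ w := by
  induction ps with
  | nil => exact Realizes.nil.congr fun ψ w => by simp [swaps]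
  | cons p ps ih =>
    have hp := hps p List.mem_cons_self
    have hq := fun q hq => hps q (List.mem_cons_of_mem _ hq)
    have hfix : swaps ps h = h :=
      swaps_apply_of_forall_ne fun q h' => ⟨(hq q h').1, (hq q h').2.1⟩
    rw [cswaps, List.flatMap_cons]
    refine ((realizes_cswap hp.1 hp.2.1 hp.2.2).append (ih hq)).congr fun ψ w => ?_
    by_cases hw : w h
    · simp only [Function.comp_apply, hw, if_true, hfix]; rfl
    · simp only [Function.comp_apply, hw, if_false, Bool.false_eq_true]

/-- The list of all pairs `(f j, g j)`. -/
def pairs {J : Type} [Fintype J] (f g : J → ι) : List (ι × ι) :=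
  Finset.univ.toList.map fun j => (f j, g j)

lemma length_pairs {J : Type} [Fintype J] (f g : J → ι) : (pairs f g).length = Fintype.card J := by
  simp [pairs]

section Pairs

variable {J : Type} {f g : J → ι}

lemma swaps_map (hfg : Function.Injective (Sum.elim f g)) {L : List J} (hL : L.Nodup) {j : J}
    (hj : j ∈ L) : swaps (L.map fun j => (f j, g j)) (f j) = g j ∧
      swaps (L.map fun j => (f j, g j)) (g j) = f j := by
  have hf : ∀ i j, f i = f j → i = j := fun i j h => Sum.inl_injective (hfg (a₁ := .inl i) (a₂ := .inl j) h)
  have hg : ∀ i j, g i = g j → i = j := fun i j h => Sum.inr_injective (hfg (a₁ := .inr i) (a₂ := .inr j) h)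
  have hne : ∀ i j, f i ≠ g j := fun i j h => Sum.inl_ne_inr (hfg (a₁ := .inl i) (a₂ := .inr j) h)
  induction L with
  | nil => simp at hj
  | cons i L ih =>
    rw [List.nodup_cons] at hL
    rw [List.map_cons, swaps, Equiv.Perm.mul_apply, Equiv.Perm.mul_apply]
    by_cases hij : j = i
    · subst hij
      rw [Equiv.swap_apply_left, Equiv.swap_apply_right]
      constructor <;> refine swaps_apply_of_forall_ne fun p hp => ?_ <;>
        obtain ⟨k, hk, rfl⟩ := List.mem_map.mp hp
      · exact ⟨(hne k j).symm, fun h => hL.1 (hg _ _ h ▸ hk)⟩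
      · exact ⟨fun h => hL.1 (hf _ _ h ▸ hk), hne j k⟩
    · rw [Equiv.swap_apply_of_ne_of_ne (fun h => hij (hf _ _ h)) (hne _ _),
        Equiv.swap_apply_of_ne_of_ne (hne _ _).symm (fun h => hij (hg _ _ h))]
      exact ih hL.2 ((List.mem_cons.mp hj).resolve_left hij)

variable [Fintype J]

lemma swaps_pairs_left (hfg : Function.Injective (Sum.elim f g)) (j : J) :
    swaps (pairs f g) (f j) = g j :=
  (swaps_map hfg (Finset.nodup_toList _) (Finset.mem_toList.mpr (Finset.mem_univ j))).1

lemma swaps_pairs_right (hfg : Function.Injective (Sum.elim f g)) (j : J) :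
    swaps (pairs f g) (g j) = f j :=
  (swaps_map hfg (Finset.nodup_toList _) (Finset.mem_toList.mpr (Finset.mem_univ j))).2

lemma swaps_pairs_of_ne {i : ι} (h : ∀ j, i ≠ f j ∧ i ≠ g j) : swaps (pairs f g) i = i :=
  swaps_apply_of_forall_ne fun p hp => by
    obtain ⟨j, -, rfl⟩ := List.mem_map.mp hp
    exact h j

lemma swaps_pairs_involutive (hfg : Function.Injective (Sum.elim f g)) (i : ι) :
    swaps (pairs f g) (swaps (pairs f g) i) = i := by
  by_cases h : ∀ j, i ≠ f j ∧ i ≠ g j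
  · rw [swaps_pairs_of_ne h, swaps_pairs_of_ne h]
  · push Not at h
    obtain ⟨j, hj⟩ := h
    by_cases h1 : i = f j
    · rw [h1, swaps_pairs_left hfg, swaps_pairs_right hfg]
    · rw [hj h1, swaps_pairs_right hfg, swaps_pairs_left hfg]

lemma pairs_ne (hfg : Function.Injective (Sum.elim f g)) {h : ι} (hh : ∀ j, h ≠ f j ∧ h ≠ g j) :
    ∀ p ∈ pairs f g, h ≠ p.1 ∧ h ≠ p.2 ∧ p.1 ≠ p.2 := fun p hp => by
  obtain ⟨j, -, rfl⟩ := List.mem_map.mp hp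
  exact ⟨(hh j).1, (hh j).2, fun h => Sum.inl_ne_inr (hfg (a₁ := .inl j) (a₂ := .inr j) h)⟩

end Pairs

lemma phase_mul_star (θ : ℝ) (P : Prop) [Decidable P] :
    Complex.exp (Complex.I * θ * (if P then 1 else -1)) *
      star (Complex.exp (Complex.I * θ * (if P then 1 else -1))) = 1 := by
  rw [RCLike.star_def, ← Complex.exp_conj, ← Complex.exp_add]
  split_ifs <;> simp

/-- The gate `e^{iθ Z⊗Z}`. -/
def zzGate (θ : ℝ) : Matrix.unitaryGroup (Bool × Bool) ℂ :=
  diagGate (fun p => Complex.exp (Complex.I * θ * (if p.1 = p.2 then 1 else -1)))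
    fun _ => phase_mul_star θ _

/-- The controlled `Z` gate. -/
def czGate : Matrix.unitaryGroup (Bool × Bool) ℂ :=
  diagGate (fun p => if p.1 && p.2 then -1 else 1) fun p => by split_ifs <;> simp

/-- The partial swap by the angle `θ` or `-θ`, according to the state of the qubit `c`; the qubit `h`
is an ancilla in the state `|0⟩`. -/
def partialSwapGates (h c : ι) (ps : List (ι × ι)) (θ : ℝ) : List (Instr a b ι) :=
  [gate1 h hGate] ++ (cswaps h ps ++ ([gate1 h hGate] ++ ([gate2 h c (zzGate θ)] ++
    ([gate1 h hGate] ++ (cswaps h ps ++ [gate1 h hGate])))))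

/-- The swap `F` is an involution. The first Hadamard, controlled swap, Hadamard block writes its
eigenvalue `±1` into `h`; the phase gate then contributes `e^{±iθ}` with the sign set by `c`, and
the second block erases the record. The result is `e^{±iθF}` with `h` back in `|0⟩`. -/
lemma realizes_partialSwapGates {h c : ι} (hc : h ≠ c) {ps : List (ι × ι)}
    (hps : ∀ p ∈ ps, h ≠ p.1 ∧ h ≠ p.2 ∧ p.1 ≠ p.2) (hcp : ∀ p ∈ ps, c ≠ p.1 ∧ c ≠ p.2)
    (hinv : ∀ i, swaps ps (swaps ps i) = i) (θ : ℝ) :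
    ∃ T, Realizes (partialSwapGates h c ps θ : List (Instr a b ι)) T ∧
      ∀ ψ : (ι → Bool) → ℂ, (∀ w, w h = true → ψ w = 0) → ∀ w, T ψ w =
        if w h then 0 else
          (Real.cos θ : ℂ) * ψ w +
            Complex.I * (Real.sin (if w c then -θ else θ) : ℂ) * ψ (w ∘ swaps ps) := by
  refine ⟨_, (realizes_hGate h).append ((realizes_cswaps hps).append ((realizes_hGate h).append
    ((realizes_diagGate hc _ _).append ((realizes_hGate h).append ((realizes_cswaps hps).append
    (realizes_hGate h)))))), fun ψ hψ w => ?_⟩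
  have hh : swaps ps h = h := swaps_apply_of_forall_ne fun p hp => ⟨(hps p hp).1, (hps p hp).2.1⟩
  have hcc : swaps ps c = c := swaps_apply_of_forall_ne hcp
  have hup : ∀ (w : ι → Bool) d, Function.update w h d ∘ swaps ps =
      Function.update (w ∘ swaps ps) h d := fun w d => by
    funext i
    by_cases hi : i = h
    · subst hi; simp [hh]
    · have : swaps ps i ≠ h := fun h' => hi ((swaps ps).injective (h'.trans hh.symm))
      simp [hi, this]
  have hww : (w ∘ swaps ps) ∘ swaps ps = w := funext fun i => congrArg w (hinv i)
  have h0 : ∀ w : ι → Bool, ψ (Function.update w h true) = 0 := fun w => hψ _ (by simp)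
  have hs := inv_sqrt_two_mul_self
  have e1 : Complex.exp (Complex.I * θ) = Real.cos θ + Complex.I * Real.sin θ := by
    rw [mul_comm, Complex.exp_mul_I, Complex.ofReal_cos, Complex.ofReal_sin, mul_comm Complex.I]
  have e2 : Complex.exp (-(Complex.I * θ)) = Real.cos θ - Complex.I * Real.sin θ := by
    rw [show -(Complex.I * θ) = ((-θ : ℝ) : ℂ) * Complex.I by push_cast; ring, Complex.exp_mul_I,
      ← Complex.ofReal_cos, ← Complex.ofReal_sin, Real.cos_neg, Real.sin_neg]
    push_cast; ring
  have hw0 : w h = false → Function.update w h false = w := fun h' => by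
    rw [← h', Function.update_eq_self]
  have hw1 : w h = false → Function.update (w ∘ swaps ps) h false = w ∘ swaps ps := fun h' => by
    rw [← hup, hw0 h']
  generalize (((1 / √2 : ℝ) : ℂ)) = q at hs ⊢
  have hq : q ^ 4 = 1 / 4 := by linear_combination (q ^ 2 + 1 / 2) * hs
  simp only [Function.comp_apply, Function.update_self, Function.update_idem, hup, hww, hh, hcc, h0,
    Function.update_of_ne hc.symm]
  cases hwh : w h
  · rw [hw0 hwh, hw1 hwh]
    cases hwc : w c <;> simp [e1, e2] <;> ring_nf <;> rw [hq] <;> ring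
  · cases hwc : w c <;> simp [e1, e2] <;> exact Or.inr (by ring)

lemma sampleCount_partialSwapGates (h c : ι) (ps : List (ι × ι)) (θ : ℝ) :
    sampleCount (partialSwapGates h c ps θ : List (Instr a b ι)) = 0 := by
  simp only [partialSwapGates, sampleCount_append, sampleCount_cswaps]
  simp [sampleCount, samples_gate1, samples_gate2]

lemma gateCount_partialSwapGates (h c : ι) (ps : List (ι × ι)) (θ : ℝ) :
    gateCount (partialSwapGates h c ps θ : List (Instr a b ι)) = 5 + 14 * ps.length := by
  simp only [partialSwapGates, gateCount_append, gateCount_cswaps]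
  simp [gateCount, gates_gate1, gates_gate2]
  ring

/-- From `|0⟩|0⟩` on the qubits `c` and `d` and a product state, prepare a purification of the state
that density matrix exponentiation consumes. -/
def superposeGates (c d : ι) (ps : List (ι × ι)) : List (Instr a b ι) :=
  [gate1 c hGate] ++ ([gate1 d hGate] ++ ([gate2 c d czGate] ++ cswaps d ps))

lemma sampleCount_superposeGates (c d : ι) (ps : List (ι × ι)) :
    sampleCount (superposeGates c d ps : List (Instr a b ι)) = 0 := by
  simp only [superposeGates, sampleCount_append, sampleCount_cswaps]
  simp [sampleCount, samples_gate1, samples_gate2]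

lemma gateCount_superposeGates (c d : ι) (ps : List (ι × ι)) :
    gateCount (superposeGates c d ps : List (Instr a b ι)) = 3 + 7 * ps.length := by
  simp only [superposeGates, gateCount_append, gateCount_cswaps]
  simp [gateCount, gates_gate1, gates_gate2]
  ring

/-- The amplitudes come out as ½ times a sign. The qubit `d` selects the order of the two samples,
and the sign of the controlled `Z` implements the operator `Z` on `d` in the branch where `c` is
`|1⟩`. -/
lemma realizes_superposeGates {c d h : ι} (hcd : c ≠ d) (hch : c ≠ h) (hdh : d ≠ h)
    {ps : List (ι × ι)} (hps : ∀ p ∈ ps, d ≠ p.1 ∧ d ≠ p.2 ∧ p.1 ≠ p.2)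
    (hcp : ∀ p ∈ ps, c ≠ p.1 ∧ c ≠ p.2) (hhp : ∀ p ∈ ps, h ≠ p.1 ∧ h ≠ p.2) :
    ∃ T, Realizes (superposeGates c d ps : List (Instr a b ι)) T ∧
      ∀ g : (ι → Bool) → ℂ, (∀ w i, g (Function.update w c i) = g w) →
        (∀ w i, g (Function.update w d i) = g w) → ∀ w,
        T (fun w => if w c || w d || w h then 0 else g w) w =
          if w h then 0 else (1 / 2 : ℂ) * (if w c && w d then -1 else 1) *
            (if w d then g (w ∘ swaps ps) else g w) := by
  refine ⟨_, (realizes_hGate c).append ((realizes_hGate d).append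
    ((realizes_diagGate hcd _ _).append (realizes_cswaps hps))), fun g hc hd w => ?_⟩
  have e1 : swaps ps c = c := swaps_apply_of_forall_ne hcp
  have e2 : swaps ps h = h := swaps_apply_of_forall_ne hhp
  have e3 : swaps ps d = d :=
    swaps_apply_of_forall_ne fun p hp => ⟨(hps p hp).1, (hps p hp).2.1⟩
  have hs := inv_sqrt_two_mul_self
  generalize (((1 / √2 : ℝ) : ℂ)) = q at hs ⊢
  simp only [Function.comp_apply, Function.update_self, Function.update_of_ne hcd,
    Function.update_of_ne hcd.symm, Function.update_of_ne hch.symm, Function.update_of_ne hdh.symm,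
    hc, hd, e1, e2, e3]
  cases w c <;> cases w d <;> cases w h <;> simp <;>
    first
    | linear_combination g w * hs
    | linear_combination g (w ∘ swaps ps) * hs

/-- The unitary part of one step of density matrix exponentiation. -/
def stepGates (c d h : ι) (ps qs : List (ι × ι)) (θ : ℝ) : List (Instr a b ι) :=
  superposeGates c d ps ++ partialSwapGates h c qs θ

lemma realizes_stepGates {c d h : ι} (hcd : c ≠ d) (hch : c ≠ h) (hdh : d ≠ h)
    {ps qs : List (ι × ι)} (hps : ∀ p ∈ ps, d ≠ p.1 ∧ d ≠ p.2 ∧ p.1 ≠ p.2)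
    (hcp : ∀ p ∈ ps, c ≠ p.1 ∧ c ≠ p.2) (hhp : ∀ p ∈ ps, h ≠ p.1 ∧ h ≠ p.2)
    (hqs : ∀ p ∈ qs, h ≠ p.1 ∧ h ≠ p.2 ∧ p.1 ≠ p.2) (hcq : ∀ p ∈ qs, c ≠ p.1 ∧ c ≠ p.2)
    (hinv : ∀ i, swaps qs (swaps qs i) = i) (θ : ℝ) :
    ∃ U : Op (ι → Bool), (∀ ρ σ, evalCircuit ρ σ (stepGates c d h ps qs θ : List (Instr a b ι)) =
        conjBy U) ∧
      ∀ g G : (ι → Bool) → ℂ, (∀ w i, g (Function.update w c i) = g w) →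
        (∀ w i, g (Function.update w d i) = g w) →
        (∀ w, G w = (1 / 2 : ℂ) * (if w c && w d then -1 else 1) *
            (if w d then g (w ∘ swaps ps) else g w)) → ∀ w,
        (U *ᵥ fun w => if w c || w d || w h then 0 else g w) w =
          if w h then 0 else
            (Real.cos θ : ℂ) * G w +
              Complex.I * (Real.sin (if w c then -θ else θ) : ℂ) * G (w ∘ swaps qs) := by
  obtain ⟨T, hT, hT'⟩ := realizes_superposeGates (a := a) (b := b) hcd hch hdh hps hcp hhp
  obtain ⟨S, hS, hS'⟩ := realizes_partialSwapGates (a := a) (b := b) hch.symm hqs hcq hinv θ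
  obtain ⟨U, hU, hU'⟩ := hT.append hS
  refine ⟨U, hU, fun g G hc hd hG w => ?_⟩
  have hh : swaps qs h = h := swaps_apply_of_forall_ne fun p hp => ⟨(hqs p hp).1, (hqs p hp).2.1⟩
  rw [hU', Function.comp_apply, hS' _ fun w hw => by rw [hT' g hc hd, if_pos hw]]
  rw [hT' g hc hd, hT' g hc hd, ← hG, ← hG, Function.comp_apply, hh]
  by_cases hw : w h
  · rw [if_pos hw, if_pos hw]
  · rw [if_neg hw, if_neg hw, if_neg hw, if_neg hw]

end PartialSwapCircuit

/-! ### Kraus decomposition of one step of density matrix exponentiation. -/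

section Kraus

variable {τ A B : Type*} [Fintype τ] [DecidableEq τ] [Fintype A] [DecidableEq A] [Fintype B]
  [DecidableEq B]

/-- The Kraus operator of the partial swap with an ancilla in the state `u`, for the measurement
result `t` of the ancilla. -/
def swapKraus (θ : ℝ) (u : τ → ℂ) (t : τ) : Op τ := Matrix.of fun i j =>
  (Real.cos θ : ℂ) * (if i = j then u t else 0) +
    Complex.I * Real.sin θ * (if t = j then u i else 0)

lemma partialSwap_mul_prependVec (θ : ℝ) (u : τ → ℂ) (t i j : τ) :
    (partialSwap τ θ * prependVec τ u) (t, i) j = swapKraus θ u t i j := by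
  simp only [Matrix.mul_apply, partialSwap, prependVec, swapKraus, Matrix.of_apply, add_mul,
    Finset.sum_add_distrib]
  congr 1
  · rw [Finset.sum_eq_single (t, i)]
    · by_cases h : i = j <;> simp [h]
    · intro x _ hx
      simp [hx.symm]
    · simp
  · rw [Finset.sum_eq_single (i, t)]
    · by_cases h : t = j <;> simp [h]
    · intro x _ hx
      have : (t, i) ≠ x.swap := fun h => hx (by rw [← Prod.swap_swap x, ← h]; rfl)
      simp [this]
    · simp

lemma traceFst_conjBy_partialSwap_ketbra (θ : ℝ) (u : τ → ℂ) (X : Op τ) :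
    traceFst (conjBy (partialSwap τ θ) (ketbra u u ⊗ₖ X)) =
      ∑ t, conjBy (swapKraus θ u t) X := by
  have h : conjBy (partialSwap τ θ) (ketbra u u ⊗ₖ X) =
      (partialSwap τ θ * prependVec τ u) * X * (partialSwap τ θ * prependVec τ u)ᴴ := by
    rw [conjBy_apply, ketbra_kronecker, Matrix.conjTranspose_mul]
    simp only [Matrix.mul_assoc]
  rw [h]
  ext i j
  rw [Matrix.sum_apply]
  simp only [traceFst, LinearMap.coe_mk, AddHom.coe_mk, Matrix.of_apply]
  refine Finset.sum_congr rfl fun t _ => ?_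
  have hK := partialSwap_mul_prependVec θ u t
  generalize partialSwap τ θ * prependVec τ u = W at hK
  rw [conjBy_apply]
  simp only [Matrix.mul_apply, Matrix.conjTranspose_apply, hK]

/-- The amplitudes of a purification of the state that density matrix exponentiation consumes. -/
def upsilonVec (ρ σ : A × B → ℂ) (c : Bool) (x : A) (t : Tgt A B) : ℂ :=
  (1 / 2 : ℂ) * (if c && t.1 then -1 else 1) *
    (if t.1 then ρ t.2.1 * σ (x, t.2.2) else σ t.2.1 * ρ (x, t.2.2))

/-- This purification differs from `|Ξ⟩` by the extra qubit `C₂`: the factor `½ · ½` is `½ ·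
(1/√2)²`, and the signs turn `ξ` into `Z ξ Z` for `c = 1`. -/
lemma qubitBlock_upsilon (ρ σ : A × B → ℂ) (c : Bool) :
    qubitBlock (upsilon ρ σ) c = ∑ x, ketbra (upsilonVec ρ σ c x) (upsilonVec ρ σ c x) := by
  have hs := inv_sqrt_two_mul_self
  ext s t
  rw [Matrix.sum_apply]
  have key : qubitBlock (upsilon ρ σ) c s t = (1 / 2 : ℂ) *
      ((if c && s.1 then -1 else 1) * (if c && t.1 then -1 else 1)) * xi ρ σ s t := by
    cases c
    · simp [qubitBlock, upsilon]
    · obtain ⟨c1, s⟩ := s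
      obtain ⟨c2, t⟩ := t
      cases c1 <;> cases c2 <;> simp [qubitBlock, upsilon, pauliZ]
  rw [key, xi, traceFst, LinearMap.coe_mk, AddHom.coe_mk, Matrix.of_apply, Finset.mul_sum]
  refine Finset.sum_congr rfl fun x _ => ?_
  simp only [ketbra, Matrix.vecMulVec_apply, Pi.star_apply, xiVec, upsilonVec, star_mul']
  have h1 : star (((1 / √2 : ℝ) : ℂ)) = ((1 / √2 : ℝ) : ℂ) := Complex.conj_ofReal _
  have h2 : star (1 / 2 : ℂ) = 1 / 2 := by simp
  have h3 : star (if (c && t.1) = true then (-1 : ℂ) else 1) = if c && t.1 then -1 else 1 := by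
    split_ifs <;> simp
  rw [h1, h2, h3]
  linear_combination (1 / 2 : ℂ) *
      ((if c && s.1 then -1 else 1) * (if c && t.1 then -1 else 1)) *
      (if s.1 then ρ s.2.1 * σ (x, s.2.2) else σ s.2.1 * ρ (x, s.2.2)) *
      star (if t.1 then ρ t.2.1 * σ (x, t.2.2) else σ t.2.1 * ρ (x, t.2.2)) * hs

/-- The Kraus operators of one step of density matrix exponentiation. -/
def stepKraus (ρ σ : A × B → ℂ) (θ : ℝ) (y : (Bool × A) × Tgt A B) : Op (Tgt A B) :=
  swapKraus (if y.1.1 then -θ else θ) (upsilonVec ρ σ y.1.1 y.1.2) y.2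

/-- The index runs over basis states of `C₂`, `A₂` and the copy, that is, over all discarded qubits
of the circuit but the control. This permits a term-by-term comparison with the circuit. -/
lemma dmeStep_upsilon (ρ σ : A × B → ℂ) (θ : ℝ) :
    dmeStep (upsilon ρ σ) θ = ∑ y, conjBy (stepKraus ρ σ θ y) := by
  refine LinearMap.ext fun X => ?_
  have h : ∀ c θ, traceFst (conjBy (partialSwap _ θ) (qubitBlock (upsilon ρ σ) c ⊗ₖ X)) =
      ∑ x, ∑ t, conjBy (swapKraus θ (upsilonVec ρ σ c x) t) X := fun c θ => by
    have : qubitBlock (upsilon ρ σ) c ⊗ₖ X =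
        ∑ x, ketbra (upsilonVec ρ σ c x) (upsilonVec ρ σ c x) ⊗ₖ X := by
      rw [qubitBlock_upsilon]
      ext i j
      simp [Matrix.sum_apply, Finset.sum_mul]
    rw [this, map_sum, map_sum]
    exact Finset.sum_congr rfl fun x _ => traceFst_conjBy_partialSwap_ketbra _ _ _
  rw [dmeStep_apply, h, h, LinearMap.sum_apply, Fintype.sum_prod_type, Fintype.sum_prod_type,
    Fintype.sum_bool, add_comm]
  rfl

lemma idTensor_sum {α β κ : Type*} [Fintype α] [DecidableEq α] [Fintype β] [DecidableEq β]
    (R : Type*) (s : Finset κ) (T : κ → Op α →ₗ[ℂ] Op β) :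
    idTensor R (∑ k ∈ s, T k) = ∑ k ∈ s, idTensor R (T k) := by
  refine LinearMap.ext fun X => ?_
  ext i j
  rw [LinearMap.sum_apply, Matrix.sum_apply]
  have h := LinearMap.sum_apply s T (Matrix.of fun k l => X (i.1, k) (j.1, l))
  exact (congrFun (congrFun h i.2) j.2).trans (Matrix.sum_apply _ _ _ _)

lemma onSys_dmeStep_upsilon (ρ σ : A × B → ℂ) (θ : ℝ) :
    onSys (dmeStep (upsilon ρ σ) θ) = ∑ y, conjBy (sysOp fun _ => stepKraus ρ σ θ y) := by
  rw [dmeStep_upsilon, onSys, idTensor_sum]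
  refine LinearMap.ext fun X => ?_
  rw [LinearMap.comp_apply, LinearMap.comp_apply, LinearMap.sum_apply, map_sum, LinearMap.sum_apply]
  exact Finset.sum_congr rfl fun y _ => by rw [← onSys_conjBy]; rfl

end Kraus

/-! ### Attaching and discarding ancilla qubits. -/

section Ancilla

variable {S K κ : Type} [Fintype S] [DecidableEq S] [Fintype K] [DecidableEq K] [Fintype κ]
  [DecidableEq κ]

/-- Discard the qubits `K`. -/
def discard (S K : Type) [Fintype S] [DecidableEq S] [Fintype K] [DecidableEq K] :
    Op (S ⊕ K → Bool) →ₗ[ℂ] Op (S → Bool) :=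
  traceSnd ∘ₗ relabel (Equiv.sumArrowEquivProdArrow S K Bool)

lemma discard_apply (X : Op (S ⊕ K → Bool)) (s t : S → Bool) :
    discard S K X s t = ∑ k, X (Sum.elim s k) (Sum.elim t k) := rfl

/-- The isometry that puts the qubits `K` in the state `v`. -/
def attach (S : Type) [Fintype S] [DecidableEq S] (v : (K → Bool) → ℂ) :
    Matrix (S ⊕ K → Bool) (S → Bool) ℂ :=
  Matrix.of fun w s => if w ∘ Sum.inl = s then v (w ∘ Sum.inr) else 0

/-- Put the qubits `K` in the state `v`. -/
def attachState (v : (K → Bool) → ℂ) (Y : Op (S → Bool)) : Op (S ⊕ K → Bool) :=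
  Matrix.of fun x y => v (x ∘ Sum.inr) * star (v (y ∘ Sum.inr)) * Y (x ∘ Sum.inl) (y ∘ Sum.inl)

lemma attachState_eq (v : (K → Bool) → ℂ) (Y : Op (S → Bool)) :
    attachState v Y = attach S v * Y * (attach S v)ᴴ := by
  ext x y
  simp only [attachState, Matrix.mul_apply, attach, Matrix.of_apply, Matrix.conjTranspose_apply,
    ite_mul, zero_mul, Finset.sum_ite_eq, Finset.mem_univ, if_true]
  rw [Finset.sum_eq_single (y ∘ Sum.inl)]
  · simp; ring
  · intro t _ ht
    simp [ht.symm]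
  · simp

/-- Stinespring form to Kraus form: the Kraus operators are labelled by the basis states of the
discarded qubits, and their entries are amplitudes of `U` on the columns of the attaching isometry.
-/
lemma discard_conjBy_attachState (U : Op (S ⊕ K → Bool)) (v : (K → Bool) → ℂ)
    (Y : Op (S → Bool)) :
    discard S K (conjBy U (attachState v Y)) =
      ∑ k, conjBy (Matrix.of fun s t => (U *ᵥ fun w => attach S v w t) (Sum.elim s k)) Y := by
  have h : conjBy U (attachState v Y) =
      (U * attach S v) * Y * (U * attach S v)ᴴ := by
    rw [conjBy_apply, attachState_eq, Matrix.conjTranspose_mul]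
    simp only [Matrix.mul_assoc]
  have hW : ∀ w t, (U * attach S v) w t = (U *ᵥ fun w => attach S v w t) w := fun _ _ => rfl
  rw [h]
  ext s t
  rw [discard_apply, Matrix.sum_apply]
  refine Finset.sum_congr rfl fun k _ => ?_
  simp only [← hW]
  generalize U * attach S v = W
  rw [conjBy_apply]
  simp only [Matrix.mul_apply, Matrix.conjTranspose_apply, Matrix.of_apply]

/-- When all ancillas are overwritten, their former content is irrelevant, so the map factors
through the state of the remaining qubits. -/
lemma replaceOn_eq_attachState (e : κ ↪ S ⊕ K) (he : Set.range e = Set.range Sum.inr)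
    (τ : Op (κ → Bool)) (v : (K → Bool) → ℂ)
    (hv : ∀ x y : S ⊕ K → Bool, τ (x ∘ e) (y ∘ e) = v (x ∘ Sum.inr) * star (v (y ∘ Sum.inr)))
    (X : Op (S ⊕ K → Bool)) :
    replaceOn e τ X = attachState v (discard S K X) := by
  have hex : ∀ k, ∃ i, Sum.inr (α := S) i = e k := fun k =>
    (he ▸ Set.mem_range_self k : e k ∈ Set.range Sum.inr)
  choose f hf using hex
  have hbij : Function.Bijective f := by
    refine ⟨fun i j hij => e.injective (by rw [← hf, ← hf, hij]), fun i => ?_⟩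
    have : Sum.inr i ∈ Set.range e := he ▸ Set.mem_range_self i
    obtain ⟨k, hk⟩ := this
    exact ⟨k, Sum.inr_injective (β := K) (α := S) (by rw [hf, hk])⟩
  ext x y
  rw [attachState, Matrix.of_apply, discard_apply, ← hv]
  refine congrArg (τ (x ∘ e) (y ∘ e) * ·) ?_
  have hext : ∀ (k : K → Bool) (x : S ⊕ K → Bool),
      Function.extend e (k ∘ f) x = Sum.elim (x ∘ Sum.inl) k := fun k x => by
    funext i
    rcases i with i | i
    · refine extend_apply_of_notMem e _ _ ?_
      rw [he]
      simp
    · obtain ⟨j, rfl⟩ := hbij.2 i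
      rw [hf]
      exact (e.injective.extend_apply _ _ j).trans (by rw [← hf]; rfl)
  rw [← (Equiv.arrowCongr (Equiv.ofBijective f hbij).symm (Equiv.refl Bool)).sum_comp]
  refine Finset.sum_congr rfl fun k _ => ?_
  have : Equiv.arrowCongr (Equiv.ofBijective f hbij).symm (Equiv.refl Bool) k = k ∘ f := rfl
  rw [this, hext, hext]

end Ancilla

/-! ### Merging resets and sample loads on disjoint qubits. -/

section Load

variable {ι κ κ' : Type} [Fintype ι] [DecidableEq ι] [Fintype κ] [DecidableEq κ] [Fintype κ']
  [DecidableEq κ']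

/-- The tensor product of operators on two sets of qubits. -/
def tensorOp (τ : Op (κ → Bool)) (τ' : Op (κ' → Bool)) : Op (κ ⊕ κ' → Bool) :=
  Matrix.of fun x y => τ (x ∘ Sum.inl) (y ∘ Sum.inl) * τ' (x ∘ Sum.inr) (y ∘ Sum.inr)

/-- The union of two disjoint embeddings. -/
def sumEmb (e : κ ↪ ι) (f : κ' ↪ ι) (h : ∀ i j, e i ≠ f j) : κ ⊕ κ' ↪ ι :=
  ⟨Sum.elim e f, e.injective.sumElim f.injective h⟩

lemma replaceOn_replaceOn (e : κ ↪ ι) (f : κ' ↪ ι) (h : ∀ i j, e i ≠ f j) (τ : Op (κ → Bool))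
    (τ' : Op (κ' → Bool)) :
    replaceOn f τ' ∘ₗ replaceOn e τ = replaceOn (sumEmb e f h) (tensorOp τ τ') := by
  refine LinearMap.ext fun X => ?_
  ext x y
  have h1 : ∀ (z : κ' → Bool) (x : ι → Bool), Function.extend f z x ∘ e = x ∘ e := fun z x => by
    funext i
    exact extend_apply_of_notMem f _ _ fun ⟨j, hj⟩ => h i j hj.symm
  have h2 : ∀ (u : κ → Bool) (z : κ' → Bool) (x : ι → Bool),
      Function.extend (sumEmb e f h) (Sum.elim u z) x =
        Function.extend e u (Function.extend f z x) := fun u z x => by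
    funext i
    by_cases hi : i ∈ Set.range e
    · obtain ⟨j, rfl⟩ := hi
      rw [e.injective.extend_apply]
      exact (sumEmb e f h).injective.extend_apply _ _ (Sum.inl j)
    · rw [extend_apply_of_notMem e _ _ hi]
      by_cases hi' : i ∈ Set.range f
      · obtain ⟨j, rfl⟩ := hi'
        rw [f.injective.extend_apply]
        exact (sumEmb e f h).injective.extend_apply _ _ (Sum.inr j)
      · rw [extend_apply_of_notMem f _ _ hi', extend_apply_of_notMem]
        rintro ⟨j | j, hj⟩
        · exact hi ⟨j, hj⟩
        · exact hi' ⟨j, hj⟩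
  simp only [LinearMap.comp_apply, replaceOn, LinearMap.coe_mk, AddHom.coe_mk, Matrix.of_apply, h1,
    tensorOp]
  rw [← (Equiv.sumArrowEquivProdArrow κ κ' Bool).symm.sum_comp, Fintype.sum_prod_type_right,
    ← Finset.mul_sum, ← mul_assoc]
  refine congrArg₂ (· * ·) (mul_comm _ _) (Finset.sum_congr rfl fun z _ =>
    Finset.sum_congr rfl fun u _ => ?_)
  have : (Equiv.sumArrowEquivProdArrow κ κ' Bool).symm (u, z) = Sum.elim u z := rfl
  rw [this, h2, h2]

lemma replaceOn_zeroState_equiv (f : κ ≃ κ') (e : κ' ↪ ι) :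
    replaceOn e (zeroState κ') = replaceOn (f.toEmbedding.trans e) (zeroState κ) := by
  refine LinearMap.ext fun X => ?_
  ext x y
  have h0 : ∀ x : κ' → Bool, (fun _ => false) = x ↔ (fun _ => false) = x ∘ f := fun x =>
    ⟨fun h => by rw [← h]; rfl, fun h => by
      funext i
      have := congrFun h (f.symm i)
      simpa using this⟩
  have h1 : zeroState κ' (x ∘ e) (y ∘ e) =
      zeroState κ (x ∘ f.toEmbedding.trans e) (y ∘ f.toEmbedding.trans e) := by
    simp only [zeroState, Matrix.single_apply, h0]
    rfl
  have h2 : ∀ (z : κ' → Bool) (x : ι → Bool),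
      Function.extend (f.toEmbedding.trans e) (z ∘ f) x = Function.extend e z x := fun z x => by
    funext i
    by_cases hi : i ∈ Set.range e
    · obtain ⟨j, rfl⟩ := hi
      obtain ⟨k, rfl⟩ := f.surjective j
      rw [e.injective.extend_apply]
      exact (f.toEmbedding.trans e).injective.extend_apply _ _ k
    · rw [extend_apply_of_notMem e _ _ hi, extend_apply_of_notMem]
      rintro ⟨j, hj⟩
      exact hi ⟨f j, hj⟩
  simp only [replaceOn, LinearMap.coe_mk, AddHom.coe_mk, Matrix.of_apply]
  rw [h1, ← (Equiv.arrowCongr f.symm (Equiv.refl Bool)).sum_comp]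
  refine congrArg (_ * ·) (Finset.sum_congr rfl fun z _ => ?_)
  have : Equiv.arrowCongr f.symm (Equiv.refl Bool) z = z ∘ f := rfl
  rw [this, h2, h2]

/-- Resets are indexed by a one-point subtype that depends on the qubit; a fixed index type makes
them comparable with the other loads. -/
lemma eval_reset {a b : ℕ} (ρ σ : Q a × Q b → ℂ) (i : ι) :
    Instr.eval ρ σ (.reset i) = replaceOn (emb1 i) (zeroState (Fin 1)) := by
  have hb : Function.Bijective fun _ : Fin 1 => (⟨i, rfl⟩ : {j // j = i}) :=
    ⟨fun _ _ _ => Subsingleton.elim _ _, fun j => ⟨0, Subtype.ext j.2.symm⟩⟩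
  exact @replaceOn_zeroState_equiv ι (Fin 1) {j // j = i} _ _ _ _ _ _ (Equiv.ofBijective _ hb) _

lemma emb1_apply (i : ι) (k : Fin 1) : emb1 i k = i := rfl

lemma zeroState_comp_emb1 (i : ι) (x y : ι → Bool) :
    zeroState (Fin 1) (x ∘ emb1 i) (y ∘ emb1 i) =
      (if x i then 0 else 1) * (if y i then 0 else 1) := by
  have h : ∀ x : ι → Bool, (fun _ => false) = x ∘ emb1 i ↔ x i = false := fun x =>
    ⟨fun h => (congrFun h 0).symm, fun h => funext fun _ => h.symm⟩
  simp only [zeroState, Matrix.single_apply, h]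
  cases x i <;> cases y i <;> simp

end Load

/-! ### Layout of the qubits and the effect of the swaps on basis states. -/

section Wires

/-- The ancilla qubits: the qubits `C₂`, `C₃` and a control qubit, and two samples. -/
abbrev Anc (a b : ℕ) := Fin 3 ⊕ ((Fin a ⊕ Fin b) ⊕ (Fin a ⊕ Fin b))

/-- All qubits of the circuit. -/
abbrev Wires (a b : ℕ) := SysQubits a b ⊕ Anc a b

variable {a b : ℕ}

/-- The qubit `C₂`. -/
abbrev wireSign : Wires a b := .inr (.inl 0)

/-- The qubit `C₃`. -/
abbrev wireBranch : Wires a b := .inr (.inl 1)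

/-- The control qubit of the partial swap. -/
abbrev wireCtrl : Wires a b := .inr (.inl 2)

/-- The qubit `C`. -/
abbrev wireC : Wires a b := .inl (.inr (.inl 0))

/-- The qubit `D`. -/
abbrev wireD : Wires a b := .inl (.inr (.inl 1))

/-- The qubits of the first sample. -/
def wireFst : Fin a ⊕ Fin b ↪ Wires a b :=
  ⟨fun x => .inr (.inr (.inl x)), fun _ _ h => by simpa using h⟩

/-- The qubits of the second sample. -/
def wireSnd : Fin a ⊕ Fin b ↪ Wires a b :=
  ⟨fun x => .inr (.inr (.inr x)), fun _ _ h => by simpa using h⟩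

lemma wireFst_apply (x : Fin a ⊕ Fin b) : wireFst x = .inr (.inr (.inl x)) := rfl

lemma wireSnd_apply (x : Fin a ⊕ Fin b) : wireSnd x = .inr (.inr (.inr x)) := rfl

/-- The qubits of `C Â B̂ B`. -/
def wireTgt : Unit ⊕ ((Fin a ⊕ Fin b) ⊕ Fin b) → Wires a b
  | .inl _ => wireC
  | .inr (.inl x) => .inl (.inr (.inr x))
  | .inr (.inr y) => .inl (.inl y)

/-- The qubits of `C₃ A₁ B₁ B₂`. -/
def wireCopy : Unit ⊕ ((Fin a ⊕ Fin b) ⊕ Fin b) → Wires a b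
  | .inl _ => wireBranch
  | .inr (.inl x) => wireFst x
  | .inr (.inr y) => wireSnd (.inr y)

lemma injective_samples :
    Function.Injective (Sum.elim (wireFst (a := a) (b := b)) (wireSnd (a := a) (b := b))) :=
  wireFst.injective.sumElim wireSnd.injective fun i j h => by simp [wireFst_apply, wireSnd_apply] at h

lemma injective_copy_tgt :
    Function.Injective (Sum.elim (wireCopy (a := a) (b := b)) (wireTgt (a := a) (b := b))) := by
  rintro ((x | (x | x)) | (x | (x | x))) ((y | (y | y)) | (y | (y | y))) h <;>
    simp_all [wireCopy, wireTgt, wireFst_apply, wireSnd_apply]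

/-- The computational basis of the ancilla qubits. -/
def ancBasis (a b : ℕ) :
    (Anc a b → Bool) ≃ Bool × ((Bool × Q a) × Tgt (Q a) (Q b)) where
  toFun k := (k (.inl 2), ((k (.inl 0), fun i => k (.inr (.inr (.inl i)))),
    (k (.inl 1), ((fun i => k (.inr (.inl (.inl i))), fun i => k (.inr (.inl (.inr i)))),
      fun i => k (.inr (.inr (.inr i)))))))
  invFun x := Sum.elim ![x.2.1.1, x.2.2.1, x.1]
    (Sum.elim (Sum.elim x.2.2.2.1.1 x.2.2.2.1.2) (Sum.elim x.2.1.2 x.2.2.2.2))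
  left_inv k := by
    funext i
    rcases i with i | ((i | i) | (i | i))
    · fin_cases i <;> rfl
    all_goals rfl
  right_inv x := rfl

/-- A basis state of all qubits. -/
def wireVal (p : Sys (Q a) (Q b)) (x : Bool × ((Bool × Q a) × Tgt (Q a) (Q b))) :
    Wires a b → Bool :=
  Sum.elim ((sysBasis a b).symm p) ((ancBasis a b).symm x)

lemma wireVal_comp_swaps_samples (p : Sys (Q a) (Q b)) (h c : Bool) (x : Q a)
    (t : Tgt (Q a) (Q b)) :
    wireVal p (h, ((c, x), t)) ∘ swaps (pairs wireFst wireSnd) =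
      wireVal p (h, ((c, t.2.1.1), (t.1, ((x, t.2.2), t.2.1.2)))) := by
  funext i
  rw [Function.comp_apply]
  rcases i with i | i | i | i
  · rw [swaps_pairs_of_ne fun j => by simp [wireFst_apply, wireSnd_apply]]; rfl
  · rw [swaps_pairs_of_ne fun j => by simp [wireFst_apply, wireSnd_apply]]
    fin_cases i <;> rfl
  · refine (congrArg _ (swaps_pairs_left injective_samples i)).trans ?_
    rcases i with i | i <;> rfl
  · refine (congrArg _ (swaps_pairs_right injective_samples i)).trans ?_
    rcases i with i | i <;> rfl

/-- The partial swap exchanges `C Â B̂ B` with `C₃ A₁ B₁ B₂`. The qubit `D`, the control, `C₂` and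
the register `A₂` keep their values. -/
lemma wireVal_comp_swaps_copy (p : Sys (Q a) (Q b)) (h c : Bool) (x : Q a)
    (t : Tgt (Q a) (Q b)) :
    wireVal p (h, ((c, x), t)) ∘ swaps (pairs wireCopy wireTgt) =
      wireVal ((sysEquivTgt _ _).symm (p.2.1.2, t)) (h, ((c, x), (sysEquivTgt _ _ p).2)) := by
  have hL := swaps_pairs_left (injective_copy_tgt (a := a) (b := b))
  have hR := swaps_pairs_right (injective_copy_tgt (a := a) (b := b))
  have hne : ∀ i : Wires a b, (∀ j, i ≠ wireCopy j ∧ i ≠ wireTgt j) →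
    swaps (pairs wireCopy wireTgt) i = i := fun i h => swaps_pairs_of_ne h
  funext i
  rw [Function.comp_apply]
  rcases i with (i | i | i | i) | i | (i | i) | (i | i)
  · exact congrArg _ (hR (.inr (.inr i)))
  · fin_cases i
    · exact congrArg _ (hR (.inl ()))
    · exact congrArg _ (hne _ fun j => by
        rcases j with j | j | j <;> simp [wireCopy, wireTgt, wireFst_apply, wireSnd_apply])
  · exact congrArg _ (hR (.inr (.inl (.inl i))))
  · exact congrArg _ (hR (.inr (.inl (.inr i))))
  · fin_cases i
    · exact congrArg _ (hne _ fun j => by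
        rcases j with j | j | j <;> simp [wireCopy, wireTgt, wireFst_apply, wireSnd_apply])
    · exact congrArg _ (hL (.inl ()))
    · exact congrArg _ (hne _ fun j => by
        rcases j with j | j | j <;> simp [wireCopy, wireTgt, wireFst_apply, wireSnd_apply])
  · exact congrArg _ (hL (.inr (.inl (.inl i))))
  · exact congrArg _ (hL (.inr (.inl (.inr i))))
  · exact congrArg _ (hne _ fun j => by
      rcases j with j | j | j <;> simp [wireCopy, wireTgt, wireFst_apply, wireSnd_apply])
  · exact congrArg _ (hL (.inr (.inr i)))

/-- Reset of the single ancilla qubits, and loading of two fresh samples. -/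
def loadSamples (a b : ℕ) : List (Instr a b (Wires a b)) :=
  [.reset wireSign, .reset wireBranch, .reset wireCtrl, .loadSigma wireFst, .loadRho wireSnd]

/-- The state of the ancilla qubits after loading the samples. -/
def ancVec (ρ σ : Q a × Q b → ℂ) (k : Anc a b → Bool) : ℂ :=
  if k (.inl 0) || k (.inl 1) || k (.inl 2) then 0 else
    flat σ (fun i => k (.inr (.inl i))) * flat ρ (fun i => k (.inr (.inr i)))

/-- The five instructions cover every ancilla, so nothing survives from earlier steps. The same
ancillas serve all steps, which keeps the number of qubits linear in `a + b`. -/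
lemma evalCircuit_loadSamples (ρ σ : Q a × Q b → ℂ) (X : Op (Wires a b → Bool)) :
    evalCircuit ρ σ (loadSamples a b) X =
      attachState (ancVec ρ σ) (discard _ _ X) := by
  simp only [loadSamples, evalCircuit, eval_reset, LinearMap.id_comp]
  simp only [Instr.eval]
  rw [replaceOn_replaceOn _ _ (fun i j => by simp [wireFst_apply, wireSnd_apply]),
    replaceOn_replaceOn _ _ (by
      rintro i (j | j) <;> simp [sumEmb, emb1_apply, wireFst_apply, wireSnd_apply]),
    replaceOn_replaceOn _ _ (by
      rintro i (j | j | j) <;> simp [sumEmb, emb1_apply, wireFst_apply, wireSnd_apply]),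
    replaceOn_replaceOn _ _ (by
      rintro i (j | j | j | j) <;> simp [sumEmb, emb1_apply, wireFst_apply, wireSnd_apply])]
  refine replaceOn_eq_attachState _ (Set.ext fun w => ⟨?_, ?_⟩) _ _ (fun x y => ?_) X
  · rintro ⟨i | i | i | i | i, rfl⟩ <;> exact ⟨_, rfl⟩
  · rintro ⟨i | i | i, rfl⟩
    · fin_cases i
      · exact ⟨(.inl 0), rfl⟩
      · exact ⟨.inr (.inl 0), rfl⟩
      · exact ⟨.inr (.inr (.inl 0)), rfl⟩
    · exact ⟨.inr (.inr (.inr (.inl i))), rfl⟩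
    · exact ⟨.inr (.inr (.inr (.inr i))), rfl⟩
  · have e1 := zeroState_comp_emb1 (wireSign (a := a) (b := b)) x y
    have e2 := zeroState_comp_emb1 (wireBranch (a := a) (b := b)) x y
    have e3 := zeroState_comp_emb1 (wireCtrl (a := a) (b := b)) x y
    refine (congrArg₂ (· * ·) e1 (congrArg₂ (· * ·) e2 (congrArg (· * _) e3))).trans ?_
    have e4 : (ketbra (flat σ) (flat σ)) (x ∘ wireFst) (y ∘ wireFst) *
        (ketbra (flat ρ) (flat ρ)) (x ∘ wireSnd) (y ∘ wireSnd) =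
        (flat σ (x ∘ wireFst) * flat ρ (x ∘ wireSnd)) *
          star (flat σ (y ∘ wireFst) * flat ρ (y ∘ wireSnd)) := by
      simp only [ketbra, Matrix.vecMulVec_apply, Pi.star_apply, star_mul']
      ring
    refine (congrArg (fun z : ℂ => _ * (_ * (_ * z))) e4).trans ?_
    have e5 : ∀ x : Wires a b → Bool, ancVec ρ σ (x ∘ Sum.inr) = (if x wireSign then 0 else 1) *
        ((if x wireBranch then 0 else 1) * ((if x wireCtrl then 0 else 1) *
          (flat σ (x ∘ wireFst) * flat ρ (x ∘ wireSnd)))) := fun x => by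
      have : ancVec ρ σ (x ∘ Sum.inr) = if x wireSign || x wireBranch || x wireCtrl then 0 else
          flat σ (x ∘ wireFst) * flat ρ (x ∘ wireSnd) := rfl
      rw [this]
      cases x wireSign <;> cases x wireBranch <;> cases x wireCtrl <;> simp
    rw [e5, e5]
    generalize flat σ (x ∘ wireFst) * flat ρ (x ∘ wireSnd) = u
    generalize flat σ (y ∘ wireFst) * flat ρ (y ∘ wireSnd) = v
    cases x wireSign <;> cases x wireBranch <;> cases x wireCtrl <;>
      cases y wireSign <;> cases y wireBranch <;> cases y wireCtrl <;> simp

end Wires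

/-! ### One step of density matrix exponentiation as a circuit. -/

section Step

variable {a b : ℕ}

/-- One step of density matrix exponentiation. -/
def stepCircuit (a b : ℕ) (θ : ℝ) : List (Instr a b (Wires a b)) :=
  loadSamples a b ++ stepGates wireSign wireBranch wireCtrl (pairs wireFst wireSnd)
    (pairs wireCopy wireTgt) θ

lemma sampleCount_stepCircuit (θ : ℝ) : sampleCount (stepCircuit a b θ) = 2 := by
  rw [stepCircuit, stepGates, sampleCount_append, sampleCount_append, sampleCount_superposeGates,
    sampleCount_partialSwapGates]
  rfl

/-- Three resets, `3 + 7 (a + b)` gates for the superposition and `5 + 14 (1 + a + 2b)` for the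
partial swap. -/
lemma gateCount_stepCircuit_le (θ : ℝ) : gateCount (stepCircuit a b θ) ≤ 25 + 35 * (a + b) := by
  rw [stepCircuit, stepGates, gateCount_append, gateCount_append, gateCount_superposeGates,
    gateCount_partialSwapGates, length_pairs, length_pairs]
  have : gateCount (loadSamples a b) = 3 := rfl
  rw [this]
  simp only [Fintype.card_sum, Fintype.card_fin, Fintype.card_unit]
  omega

/-- Discard the ancilla qubits and identify the basis of the remaining ones. -/
def toSys (a b : ℕ) : Op (Wires a b → Bool) →ₗ[ℂ] Op (Sys (Q a) (Q b)) :=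
  relabel (sysBasis a b) ∘ₗ discard _ _

lemma relabel_conjBy {α β : Type*} [Fintype α] [DecidableEq α] [Fintype β] [DecidableEq β]
    (e : α ≃ β) (K X : Op α) :
    relabel e (conjBy K X) = conjBy (K.submatrix e.symm e.symm) (relabel e X) := by
  have : ∀ Y : Op α, relabel e Y = Y.submatrix e.symm e.symm := fun _ => rfl
  rw [this, this, conjBy_apply, conjBy_apply, Matrix.conjTranspose_submatrix,
    Matrix.submatrix_mul_equiv, Matrix.submatrix_mul_equiv]

/-- Both sides are sums over Kraus operators. Those of the circuit carry in addition the value of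
the control qubit; they vanish when it is `|1⟩` and coincide with `stepKraus` when it is `|0⟩`. -/
lemma toSys_comp_evalCircuit_stepCircuit (ρ σ : Q a × Q b → ℂ) (θ : ℝ) :
    toSys a b ∘ₗ evalCircuit ρ σ (stepCircuit a b θ) =
      onSys (dmeStep (upsilon ρ σ) θ) ∘ₗ toSys a b := by
  obtain ⟨U, hU, hU'⟩ := realizes_stepGates (a := a) (b := b) (c := wireSign) (d := wireBranch)
    (h := wireCtrl) (ps := pairs wireFst wireSnd) (qs := pairs wireCopy wireTgt) (by simp) (by simp)
    (by simp) (pairs_ne injective_samples fun j => by simp [wireFst_apply, wireSnd_apply])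
    (fun p hp => ((pairs_ne injective_samples (h := wireSign)
      fun j => by simp [wireFst_apply, wireSnd_apply]) p hp).imp_right And.left)
    (fun p hp => ((pairs_ne injective_samples (h := wireCtrl)
      fun j => by simp [wireFst_apply, wireSnd_apply]) p hp).imp_right And.left)
    (pairs_ne injective_copy_tgt fun j => by
      rcases j with j | j | j <;> simp [wireCopy, wireTgt, wireFst_apply, wireSnd_apply])
    (fun p hp => ((pairs_ne injective_copy_tgt (h := wireSign) fun j => by
      rcases j with j | j | j <;> simp [wireCopy, wireTgt, wireFst_apply, wireSnd_apply]) p hp).imp_right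
        And.left)
    (swaps_pairs_involutive injective_copy_tgt) θ
  obtain ⟨W, hW⟩ : ∃ W : Matrix (Wires a b → Bool) (SysQubits a b → Bool) ℂ,
      ∀ w t, W w t = (U *ᵥ fun w => attach (SysQubits a b) (ancVec ρ σ) w t) w := ⟨_, fun _ _ => rfl⟩
  have key : ∀ (p q : Sys (Q a) (Q b)) (h : Bool) (y : (Bool × Q a) × Tgt (Q a) (Q b)),
      W (wireVal p (h, y)) ((sysBasis a b).symm q) =
        if h then 0 else sysOp (fun _ => stepKraus ρ σ θ y) p q := by
    rintro p q h ⟨⟨c, x⟩, t⟩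
    set g : (Wires a b → Bool) → ℂ := fun w => if w ∘ Sum.inl = (sysBasis a b).symm q then
      flat σ (w ∘ wireFst) * flat ρ (w ∘ wireSnd) else 0 with hg
    have hcol : (fun w => attach (SysQubits a b) (ancVec ρ σ) w ((sysBasis a b).symm q)) =
        fun w => if w wireSign || w wireBranch || w wireCtrl then 0 else g w := by
      funext w
      simp only [hg, attach, Matrix.of_apply]
      by_cases h1 : w ∘ Sum.inl = (sysBasis a b).symm q
      · rw [if_pos h1, if_pos h1]; rfl
      · rw [if_neg h1, if_neg h1]; simp
    have hgi : ∀ (i : Fin 3) w d, g (Function.update w (.inr (.inl i)) d) = g w := by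
      intro i w d
      have h1 : Function.update w (Sum.inr (Sum.inl i)) d ∘ Sum.inl = w ∘ Sum.inl := by
        funext j; simp
      have h2 : Function.update w (Sum.inr (Sum.inl i)) d ∘ wireFst = w ∘ wireFst := by
        funext j; simp [wireFst_apply]
      have h3 : Function.update w (Sum.inr (Sum.inl i)) d ∘ wireSnd = w ∘ wireSnd := by
        funext j; simp [wireSnd_apply]
      simp only [hg, h1, h2, h3]
    have hgv : ∀ p x, g (wireVal p x) = if p = q then
        σ x.2.2.2.1 * ρ (x.2.1.2, x.2.2.2.2) else 0 := by
      intro p x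
      have : wireVal p x ∘ Sum.inl = (sysBasis a b).symm q ↔ p = q :=
        (sysBasis a b).symm.injective.eq_iff
      simp only [hg, this]
      rfl
    set G : (Wires a b → Bool) → ℂ := fun w => (1 / 2 : ℂ) *
      (if w wireSign && w wireBranch then -1 else 1) *
      (if w wireBranch then g (w ∘ swaps (pairs wireFst wireSnd)) else g w) with hG
    have hGv : ∀ p h c x t, G (wireVal p (h, ((c, x), t))) = if p = q then
        upsilonVec ρ σ c x t else 0 := by
      intro p h c x t
      have h1 : wireVal p (h, ((c, x), t)) wireSign = c := rfl
      have h2 : wireVal p (h, ((c, x), t)) wireBranch = t.1 := rfl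
      simp only [hG, wireVal_comp_swaps_samples, hgv, upsilonVec, h1, h2]
      by_cases hpq : p = q
      · simp only [if_pos hpq]
        split_ifs <;> ring
      · simp only [if_neg hpq, ite_self, mul_zero]
    have hval := hU' g G (hgi 0) (hgi 1) (fun w => rfl) (wireVal p (h, ((c, x), t)))
    rw [← hcol] at hval
    rw [hW]
    refine hval.trans ?_
    have h1 : wireVal p (h, ((c, x), t)) wireCtrl = h := rfl
    have h2 : wireVal p (h, ((c, x), t)) wireSign = c := rfl
    rw [wireVal_comp_swaps_copy, hGv, hGv, h1, h2]
    congr 1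
    have e1 : p = q ↔ p.2.1.2 = q.2.1.2 ∧ (sysEquivTgt _ _ p).2 = (sysEquivTgt _ _ q).2 := by
      rw [← (sysEquivTgt (Q a) (Q b)).injective.eq_iff, Prod.ext_iff]; rfl
    have e2 : (sysEquivTgt _ _).symm (p.2.1.2, t) = q ↔
        p.2.1.2 = q.2.1.2 ∧ t = (sysEquivTgt _ _ q).2 := by
      rw [Equiv.symm_apply_eq, Prod.ext_iff]; rfl
    have e3 : Real.cos (if c then -θ else θ) = Real.cos θ := by split_ifs <;> simp
    simp only [e1, e2, sysOp, stepKraus, swapKraus, Matrix.of_apply, e3]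
    by_cases hd : p.2.1.2 = q.2.1.2 <;> simp [hd]
  refine LinearMap.ext fun X => ?_
  rw [LinearMap.comp_apply, LinearMap.comp_apply, stepCircuit, evalCircuit_append, hU,
    LinearMap.comp_apply, evalCircuit_loadSamples, toSys, LinearMap.comp_apply,
    discard_conjBy_attachState, map_sum, onSys_dmeStep_upsilon, LinearMap.sum_apply,
    ← (ancBasis a b).symm.sum_comp, Fintype.sum_prod_type, Fintype.sum_bool]
  simp only [← hW]
  have hsum : ∀ h y, relabel (sysBasis a b) (conjBy (Matrix.of fun s t =>
      W (Sum.elim s ((ancBasis a b).symm (h, y))) t) (discard _ _ X)) =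
      conjBy (if h then 0 else sysOp fun _ => stepKraus ρ σ θ y) (toSys a b X) := by
    intro h y
    rw [relabel_conjBy]
    refine congrArg (fun K => conjBy K (toSys a b X)) ?_
    ext p q
    refine (key p q h y).trans ?_
    split_ifs <;> rfl
  simp only [hsum]
  simp [conjBy_apply]
  rfl

end Step

/-! ### Gates on the system qubits and the discarding of ancillas. -/

section SystemGates

lemma traceSnd_conjBy_kronecker_one {α β : Type*} [Fintype α] [DecidableEq α] [Fintype β]
    [DecidableEq β] (K : Op α) (Y : Op (α × β)) :
    traceSnd (conjBy (K ⊗ₖ (1 : Op β)) Y) = conjBy K (traceSnd Y) := by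
  have h1 : ∀ (Z : Op (α × β)) p x z, ((K ⊗ₖ (1 : Op β)) * Z) (p, x) z =
      ∑ r, K p r * Z (r, x) z := fun Z p x z => by
    rw [Matrix.mul_apply, Fintype.sum_prod_type]
    refine Finset.sum_congr rfl fun r _ => ?_
    simp [Matrix.one_apply]
  have h2 : ∀ (Z : Op (α × β)) z q x, (Z * (K ⊗ₖ (1 : Op β))ᴴ) z (q, x) =
      ∑ r, Z z (r, x) * star (K q r) := fun Z z q x => by
    rw [Matrix.mul_apply, Fintype.sum_prod_type]
    refine Finset.sum_congr rfl fun r _ => ?_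
    rw [Finset.sum_eq_single x]
    · simp
    · intro y _ hy
      simp [hy.symm]
    · simp
  ext p q
  simp only [traceSnd, LinearMap.coe_mk, AddHom.coe_mk, Matrix.of_apply, conjBy_apply, h2, h1,
    Matrix.mul_apply, Matrix.conjTranspose_apply]
  rw [Finset.sum_comm]
  refine Finset.sum_congr rfl fun s _ => ?_
  rw [← Finset.sum_mul, Finset.sum_comm]
  simp only [Finset.mul_sum]

lemma traceSnd_relabel_conjBy {α β γ : Type*} [Fintype α] [DecidableEq α] [Fintype β]
    [DecidableEq β] [Fintype γ] [DecidableEq γ] (e : α × β ≃ γ) {K : Op α} {U : Op γ}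
    (h : U.submatrix e e = K ⊗ₖ (1 : Op β)) (X : Op γ) :
    traceSnd (relabel e.symm (conjBy U X)) = conjBy K (traceSnd (relabel e.symm X)) := by
  rw [relabel_conjBy, Equiv.symm_symm, h, traceSnd_conjBy_kronecker_one]

variable {a b : ℕ}

/-- The computational basis of all qubits. -/
def wireBasis (a b : ℕ) : Sys (Q a) (Q b) × (Anc a b → Bool) ≃ (Wires a b → Bool) :=
  ((sysBasis a b).symm.prodCongr (Equiv.refl _)).trans (Equiv.sumArrowEquivProdArrow _ _ _).symm

lemma wireBasis_apply (p : Sys (Q a) (Q b)) (k : Anc a b → Bool) :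
    wireBasis a b (p, k) = wireVal p (ancBasis a b k) :=
  congrArg (Sum.elim _) ((ancBasis a b).symm_apply_apply k).symm

lemma toSys_eq (X : Op (Wires a b → Bool)) :
    toSys a b X = traceSnd (relabel (wireBasis a b).symm X) := rfl

/-- An action on system qubits alone is a matrix `K ⊗ 1`, which commutes with the partial trace over
the ancillas. -/
lemma toSys_comp_of_realizes {l : List (Instr a b (Wires a b))}
    {T : ((Wires a b → Bool) → ℂ) → (Wires a b → Bool) → ℂ} (h : Realizes l T)
    {K : Op (Sys (Q a) (Q b))}
    (hK : ∀ ψ p x, T ψ (wireVal p x) = ∑ q, K p q * ψ (wireVal q x)) (ρ σ : Q a × Q b → ℂ) :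
    toSys a b ∘ₗ evalCircuit ρ σ l = conjBy K ∘ₗ toSys a b := by
  obtain ⟨U, hU, hT⟩ := h
  have hentry : U.submatrix (wireBasis a b) (wireBasis a b) = K ⊗ₖ 1 := by
    ext ⟨p, x⟩ ⟨q, y⟩
    rw [Matrix.submatrix_apply, Matrix.kroneckerMap_apply, Matrix.one_apply]
    have h1 := hT (Pi.single (wireBasis a b (q, y)) 1) (wireVal p (ancBasis a b x))
    rw [Matrix.mulVec_single_one, hK, ← wireBasis_apply] at h1
    refine h1.trans ?_
    have h2 : ∀ q', (Pi.single (wireBasis a b (q, y)) 1 : (Wires a b → Bool) → ℂ) (wireVal q' (ancBasis a b x)) =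
        if (q', x) = (q, y) then 1 else 0 := by
      intro q'
      rw [Pi.single_apply, ← wireBasis_apply]
      simp only [(wireBasis a b).injective.eq_iff]
    simp only [h2, mul_ite, mul_one, mul_zero, Prod.mk.injEq]
    by_cases hxy : x = y <;> simp [hxy]
  refine LinearMap.ext fun X => ?_
  rw [LinearMap.comp_apply, LinearMap.comp_apply, hU, toSys_eq, toSys_eq,
    traceSnd_relabel_conjBy _ hentry]

lemma update_wireVal_wireC (p : Sys (Q a) (Q b)) (x) (c : Bool) :
    Function.update (wireVal p x) wireC c = wireVal (p.1, ((c, p.2.1.2), p.2.2)) x := by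
  funext i
  by_cases hi : i = wireC
  · subst hi; rw [Function.update_self]; rfl
  · rw [Function.update_of_ne hi]
    rcases i with (i | i | i | i) | i
    · rfl
    · fin_cases i
      · exact absurd rfl hi
      · rfl
    all_goals rfl

lemma update_wireVal_wireD (p : Sys (Q a) (Q b)) (x) (c : Bool) :
    Function.update (wireVal p x) wireD c = wireVal (p.1, ((p.2.1.1, c), p.2.2)) x := by
  funext i
  by_cases hi : i = wireD
  · subst hi; rw [Function.update_self]; rfl
  · rw [Function.update_of_ne hi]
    rcases i with (i | i | i | i) | i
    · rfl
    · fin_cases i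
      · rfl
      · exact absurd rfl hi
    all_goals rfl

lemma toSys_comp_pauliX (ρ σ : Q a × Q b → ℂ) :
    toSys a b ∘ₗ evalCircuit ρ σ [gate1 wireC xGate] =
      onSys (conjBy (pauliX _)) ∘ₗ toSys a b := by
  rw [onSys_conjBy]
  refine toSys_comp_of_realizes (realizes_xGate _) (fun ψ p x => ?_) ρ σ
  have hC : wireVal p x wireC = p.2.1.1 := rfl
  rw [update_wireVal_wireC, hC, Finset.sum_eq_single (p.1, ((!p.2.1.1, p.2.1.2), p.2.2))]
  · simp [sysOp, pauliX, sysEquivTgt]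
  · rintro ⟨y, ⟨c, d⟩, z⟩ - hq
    have : sysOp (fun _ => pauliX _) p (y, ((c, d), z)) = 0 := by
      simp only [sysOp, pauliX, sysEquivTgt, Equiv.coe_fn_mk]
      split_ifs with h1 h2
      · refine absurd ?_ hq
        obtain ⟨h3, h4⟩ := h2
        obtain ⟨p1, ⟨p2, p3⟩, p4⟩ := p
        simp_all
      · exact if_neg h2
      · rfl
    rw [this, zero_mul]
  · simp

lemma toSys_comp_phaseGate (ρ σ : Q a × Q b → ℂ) (φ : ℝ) :
    toSys a b ∘ₗ evalCircuit ρ σ [gate2 wireC wireD (zzGate φ)] =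
      conjBy (phaseGate (Q a) (Q b) φ) ∘ₗ toSys a b := by
  refine toSys_comp_of_realizes (realizes_diagGate (by simp) _ _) (fun ψ p x => ?_) ρ σ
  rw [Finset.sum_eq_single p]
  · rw [phaseGate, Matrix.diagonal_apply_eq]; rfl
  · intro q _ hq
    rw [phaseGate, Matrix.diagonal_apply_ne _ hq.symm, zero_mul]
  · simp

lemma toSys_comp_hadamardD (ρ σ : Q a × Q b → ℂ) :
    toSys a b ∘ₗ evalCircuit ρ σ [gate1 wireD hGate] =
      conjBy (hadamardD (Q a) (Q b)) ∘ₗ toSys a b := by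
  refine toSys_comp_of_realizes (realizes_hGate _) (fun ψ p x => ?_) ρ σ
  have h := hadamardD_mul_apply (Matrix.of fun q (_ : Unit) => ψ (wireVal q x)) p.1 p.2.1.1 p.2.1.2
    p.2.2 ()
  rw [Matrix.mul_apply] at h
  rw [update_wireVal_wireD, update_wireVal_wireD]
  exact h.symm

end SystemGates

/-! ### Assembly of the circuit, with counts of samples and gates. -/

section FullCircuit

variable {a b : ℕ}

lemma onSys_comp {A B : Type*} [Fintype A] [DecidableEq A] [Fintype B] [DecidableEq B]
    (S T : Op (Tgt A B) →ₗ[ℂ] Op (Tgt A B)) : onSys (S ∘ₗ T) = onSys S ∘ₗ onSys T := by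
  refine LinearMap.ext fun X => ?_
  simp only [onSys, LinearMap.comp_apply]
  rw [idTensor_comp]
  rfl

lemma onSys_pow {A B : Type*} [Fintype A] [DecidableEq A] [Fintype B] [DecidableEq B]
    (T : Op (Tgt A B) →ₗ[ℂ] Op (Tgt A B)) (m : ℕ) : onSys (T ^ m) = onSys T ^ m := by
  induction m with
  | zero => rfl
  | succ m ih =>
    rw [pow_succ, pow_succ, ← ih]
    exact onSys_comp _ _

/-- The circuit `l` simulates the channel `T` on `B H Â B̂` if the unknown states are `ρ` and `σ`. -/
def Simulates (ρ σ : Q a × Q b → ℂ) (l : List (Instr a b (Wires a b)))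
    (T : Op (Sys (Q a) (Q b)) →ₗ[ℂ] Op (Sys (Q a) (Q b))) : Prop :=
  toSys a b ∘ₗ evalCircuit ρ σ l = T ∘ₗ toSys a b

/-- The intertwining relation holds for arbitrary contents of the ancillas, including correlations
with the system, so subcircuits compose without restoring the ancillas. -/
lemma Simulates.append {ρ σ : Q a × Q b → ℂ} {l l' : List (Instr a b (Wires a b))}
    {T T' : Op (Sys (Q a) (Q b)) →ₗ[ℂ] Op (Sys (Q a) (Q b))} (h : Simulates ρ σ l T)
    (h' : Simulates ρ σ l' T') : Simulates ρ σ (l ++ l') (T' ∘ₗ T) := by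
  rw [Simulates, evalCircuit_append, ← LinearMap.comp_assoc, h', LinearMap.comp_assoc, h,
    LinearMap.comp_assoc]

/-- Density matrix exponentiation with `m` steps. -/
def dmeCircuit (a b : ℕ) (θ : ℝ) : ℕ → List (Instr a b (Wires a b))
  | 0 => []
  | m + 1 => stepCircuit a b θ ++ dmeCircuit a b θ m

lemma simulates_dmeCircuit (ρ σ : Q a × Q b → ℂ) (θ : ℝ) (m : ℕ) :
    Simulates ρ σ (dmeCircuit a b θ m) (onSys (dmeStep (upsilon ρ σ) θ ^ m)) := by
  rw [onSys_pow]
  induction m with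
  | zero => rfl
  | succ m ih =>
    rw [dmeCircuit, pow_succ]
    exact Simulates.append (toSys_comp_evalCircuit_stepCircuit ρ σ θ) ih

lemma sampleCount_dmeCircuit (θ : ℝ) (m : ℕ) : sampleCount (dmeCircuit a b θ m) = 2 * m := by
  induction m with
  | zero => rfl
  | succ m ih => rw [dmeCircuit, sampleCount_append, sampleCount_stepCircuit, ih]; ring

lemma gateCount_dmeCircuit_le (θ : ℝ) (m : ℕ) :
    gateCount (dmeCircuit a b θ m) ≤ m * (25 + 35 * (a + b)) := by
  induction m with
  | zero => simp [dmeCircuit, gateCount]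
  | succ m ih =>
    rw [dmeCircuit, gateCount_append]
    have := gateCount_stepCircuit_le (a := a) (b := b) θ
    linarith

/-- The circuit for the channel `𝒢`. -/
def gCircuit (a b m : ℕ) : List (Instr a b (Wires a b)) :=
  dmeCircuit a b (2 / m) m ++ [gate1 wireC xGate]

/-- The circuit for the channel `𝒢_inv`. -/
def gInvCircuit (a b m : ℕ) : List (Instr a b (Wires a b)) :=
  [gate1 wireC xGate] ++ dmeCircuit a b (-2 / m) m

lemma simulates_gCircuit (ρ σ : Q a × Q b → ℂ) (m : ℕ) :
    Simulates ρ σ (gCircuit a b m) (onSys (chanG ρ σ m)) := by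
  rw [chanG, onSys_comp]
  exact (simulates_dmeCircuit ρ σ _ m).append (toSys_comp_pauliX ρ σ)

lemma simulates_gInvCircuit (ρ σ : Q a × Q b → ℂ) (m : ℕ) :
    Simulates ρ σ (gInvCircuit a b m) (onSys (chanGinv ρ σ m)) := by
  rw [chanGinv, onSys_comp]
  exact Simulates.append (toSys_comp_pauliX ρ σ) (simulates_dmeCircuit ρ σ _ m)

lemma sampleCount_gCircuit (m : ℕ) : sampleCount (gCircuit a b m) = 2 * m := by
  rw [gCircuit, sampleCount_append, sampleCount_dmeCircuit]; rfl

lemma sampleCount_gInvCircuit (m : ℕ) : sampleCount (gInvCircuit a b m) = 2 * m := by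
  rw [gInvCircuit, sampleCount_append, sampleCount_dmeCircuit]; exact zero_add _

lemma gateCount_gCircuit_le (m : ℕ) :
    gateCount (gCircuit a b m) ≤ m * (25 + 35 * (a + b)) + 1 := by
  rw [gCircuit, gateCount_append]
  exact Nat.add_le_add_right (gateCount_dmeCircuit_le _ _) _

lemma gateCount_gInvCircuit_le (m : ℕ) :
    gateCount (gInvCircuit a b m) ≤ m * (25 + 35 * (a + b)) + 1 := by
  rw [gInvCircuit, gateCount_append, add_comm]
  exact Nat.add_le_add_right (gateCount_dmeCircuit_le _ _) _

/-- The circuit for the alternating phase modulation sequence. -/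
def alternateCircuit (g g' : List (Instr a b (Wires a b))) : List ℝ → List (Instr a b (Wires a b))
  | [] => []
  | φ :: l => g ++ ([gate2 wireC wireD (zzGate φ)] ++ alternateCircuit g' g l)

lemma simulates_alternateCircuit {ρ σ : Q a × Q b → ℂ} {g g' : List (Instr a b (Wires a b))}
    {G G' : Op (Sys (Q a) (Q b)) →ₗ[ℂ] Op (Sys (Q a) (Q b))} (h : Simulates ρ σ g G)
    (h' : Simulates ρ σ g' G') (Φ : List ℝ) :
    Simulates ρ σ (alternateCircuit g g' Φ) (alternate G G' Φ) := by
  induction Φ generalizing g g' G G' with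
  | nil => rfl
  | cons φ l ih =>
    exact h.append (Simulates.append (toSys_comp_phaseGate ρ σ φ) (ih h' h))

lemma sampleCount_alternateCircuit {g g' : List (Instr a b (Wires a b))} {n : ℕ}
    (h : sampleCount g = n) (h' : sampleCount g' = n) (Φ : List ℝ) :
    sampleCount (alternateCircuit g g' Φ) = Φ.length * n := by
  induction Φ generalizing g g' with
  | nil => simp [alternateCircuit, sampleCount]
  | cons φ l ih =>
    have : sampleCount ([gate2 wireC wireD (zzGate φ)] : List (Instr a b (Wires a b))) = 0 := by
      simp [sampleCount, samples_gate2]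
    rw [alternateCircuit, sampleCount_append, sampleCount_append, ih h' h, h, this, List.length_cons]
    ring

lemma gateCount_alternateCircuit_le {g g' : List (Instr a b (Wires a b))} {n : ℕ}
    (h : gateCount g ≤ n) (h' : gateCount g' ≤ n) (Φ : List ℝ) :
    gateCount (alternateCircuit g g' Φ) ≤ Φ.length * (n + 1) := by
  induction Φ generalizing g g' with
  | nil => simp [alternateCircuit, gateCount]
  | cons φ l ih =>
    have : gateCount ([gate2 wireC wireD (zzGate φ)] : List (Instr a b (Wires a b))) = 1 := by
      simp [gateCount, gates_gate2]
    rw [alternateCircuit, gateCount_append, gateCount_append, this, List.length_cons]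
    have := ih h' h
    linarith

/-- The circuit for the whole algorithm. -/
def uhlmannCircuit (a b m : ℕ) (Φ : List ℝ) : List (Instr a b (Wires a b)) :=
  [gate1 wireD hGate] ++ (alternateCircuit (gCircuit a b m) (gInvCircuit a b m) Φ ++
    [gate1 wireD hGate])

lemma simulates_uhlmannCircuit (ρ σ : Q a × Q b → ℂ) (m : ℕ) (Φ : List ℝ) :
    Simulates ρ σ (uhlmannCircuit a b m Φ) (uhlmannPurifiedSample ρ σ m Φ) := by
  rw [uhlmannPurifiedSample, qsvt, ← LinearMap.comp_assoc]
  exact Simulates.append (toSys_comp_hadamardD ρ σ) (Simulates.append (simulates_alternateCircuit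
    (simulates_gCircuit ρ σ m) (simulates_gInvCircuit ρ σ m) Φ) (toSys_comp_hadamardD ρ σ))

lemma sampleCount_uhlmannCircuit (m : ℕ) (Φ : List ℝ) :
    sampleCount (uhlmannCircuit a b m Φ) = 2 * m * Φ.length := by
  have : sampleCount ([gate1 wireD hGate] : List (Instr a b (Wires a b))) = 0 := rfl
  rw [uhlmannCircuit, sampleCount_append, sampleCount_append, sampleCount_alternateCircuit
    (sampleCount_gCircuit m) (sampleCount_gInvCircuit m), this]
  ring

lemma gateCount_uhlmannCircuit_le (m : ℕ) (Φ : List ℝ) :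
    gateCount (uhlmannCircuit a b m Φ) ≤ Φ.length * (m * (25 + 35 * (a + b)) + 2) + 2 := by
  have : gateCount ([gate1 wireD hGate] : List (Instr a b (Wires a b))) = 1 := rfl
  rw [uhlmannCircuit, gateCount_append, gateCount_append, this]
  have := gateCount_alternateCircuit_le (gateCount_gCircuit_le (a := a) (b := b) m)
    (gateCount_gInvCircuit_le (a := a) (b := b) m) Φ
  linarith

end FullCircuit

/-! ### Renaming of qubits. -/

section Transport

variable {ι ι' κ : Type} [Fintype ι] [DecidableEq ι] [Fintype ι'] [DecidableEq ι'] [Fintype κ]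
  [DecidableEq κ] {a b : ℕ}

/-- An instruction with renamed qubits. -/
def Instr.map (f : ι ≃ ι') : Instr a b ι → Instr a b ι'
  | .gate k hk e U => .gate k hk (e.trans f.toEmbedding) U
  | .loadRho e => .loadRho (e.trans f.toEmbedding)
  | .loadSigma e => .loadSigma (e.trans f.toEmbedding)
  | .reset i => .reset (f i)

/-- The renaming of the qubits of a basis state. -/
def renameBasis (f : ι ≃ ι') : (ι → Bool) ≃ (ι' → Bool) := f.arrowCongr (Equiv.refl Bool)

lemma relabel_renameBasis_apply (f : ι ≃ ι') (X : Op (ι → Bool)) (x y : ι' → Bool) :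
    relabel (renameBasis f) X x y = X (x ∘ f) (y ∘ f) := rfl

lemma actOn_trans (f : ι ≃ ι') (e : κ ↪ ι) (U : Op (κ → Bool)) :
    actOn (e.trans f.toEmbedding) U =
      (actOn e U).submatrix (renameBasis f).symm (renameBasis f).symm := by
  ext x y
  have h : (∀ i, i ∉ Set.range (e.trans f.toEmbedding) → x i = y i) ↔
      ∀ i, i ∉ Set.range e → (x ∘ f) i = (y ∘ f) i := by
    constructor
    · intro h i hi
      refine h (f i) fun ⟨k, hk⟩ => hi ⟨k, f.injective hk⟩
    · intro h i hi
      obtain ⟨j, rfl⟩ := f.surjective i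
      exact h j fun ⟨k, hk⟩ => hi ⟨k, congrArg f hk⟩
  simp only [actOn, h]
  rfl

lemma replaceOn_trans (f : ι ≃ ι') (e : κ ↪ ι) (τ : Op (κ → Bool)) :
    replaceOn (e.trans f.toEmbedding) τ ∘ₗ relabel (renameBasis f) =
      relabel (renameBasis f) ∘ₗ replaceOn e τ := by
  refine LinearMap.ext fun X => ?_
  ext x y
  have h : ∀ (z : κ → Bool) (x : ι' → Bool),
      Function.extend (e.trans f.toEmbedding) z x ∘ f = Function.extend e z (x ∘ f) := fun z x => by
    funext i
    by_cases hi : i ∈ Set.range e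
    · obtain ⟨k, rfl⟩ := hi
      rw [e.injective.extend_apply]
      exact (e.trans f.toEmbedding).injective.extend_apply _ _ k
    · rw [extend_apply_of_notMem e _ _ hi, Function.comp_apply, extend_apply_of_notMem]
      · rfl
      · exact fun ⟨k, hk⟩ => hi ⟨k, f.injective hk⟩
  rw [LinearMap.comp_apply, LinearMap.comp_apply, relabel_renameBasis_apply]
  simp only [replaceOn, LinearMap.coe_mk, AddHom.coe_mk, Matrix.of_apply,
    relabel_renameBasis_apply, h]
  rfl

lemma eval_map (f : ι ≃ ι') (ρ σ : Q a × Q b → ℂ) (c : Instr a b ι) :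
    (c.map f).eval ρ σ ∘ₗ relabel (renameBasis f) = relabel (renameBasis f) ∘ₗ c.eval ρ σ := by
  cases c with
  | gate k hk e U =>
    refine LinearMap.ext fun X => ?_
    simp only [Instr.map, Instr.eval, LinearMap.comp_apply]
    rw [relabel_conjBy, actOn_trans]
  | loadRho e => exact replaceOn_trans f e _
  | loadSigma e => exact replaceOn_trans f e _
  | reset i =>
    rw [Instr.map, eval_reset, eval_reset]
    exact replaceOn_trans f (emb1 i) _

lemma evalCircuit_map (f : ι ≃ ι') (ρ σ : Q a × Q b → ℂ) (l : List (Instr a b ι)) :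
    evalCircuit ρ σ (l.map (Instr.map f)) ∘ₗ relabel (renameBasis f) =
      relabel (renameBasis f) ∘ₗ evalCircuit ρ σ l := by
  induction l with
  | nil => rfl
  | cons c l ih =>
    rw [List.map_cons, evalCircuit, evalCircuit, LinearMap.comp_assoc, eval_map,
      ← LinearMap.comp_assoc, ih, LinearMap.comp_assoc]

lemma samples_map (f : ι ≃ ι') (c : Instr a b ι) : (c.map f).samples = c.samples := by
  cases c <;> rfl

lemma gates_map (f : ι ≃ ι') (c : Instr a b ι) : (c.map f).gates = c.gates := by
  cases c <;> rfl

lemma sampleCount_map (f : ι ≃ ι') (l : List (Instr a b ι)) :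
    sampleCount (l.map (Instr.map f)) = sampleCount l := by
  rw [sampleCount, sampleCount, List.map_map]
  exact congrArg List.sum (List.map_congr_left fun c _ => samples_map f c)

lemma gateCount_map (f : ι ≃ ι') (l : List (Instr a b ι)) :
    gateCount (l.map (Instr.map f)) = gateCount l := by
  rw [gateCount, gateCount, List.map_map]
  exact congrArg List.sum (List.map_congr_left fun c _ => gates_map f c)

end Transport

/-! ### The realized channel and the resource bounds. -/

section Implementation

variable {a b : ℕ}

lemma discard_relabel {S K K' : Type} [Fintype S] [DecidableEq S] [Fintype K] [DecidableEq K]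
    [Fintype K'] [DecidableEq K'] (f : K ≃ K') (X : Op (S ⊕ K → Bool)) :
    discard S K' (relabel (renameBasis (Equiv.sumCongr (Equiv.refl S) f)) X) = discard S K X := by
  ext s t
  rw [discard_apply, discard_apply, ← (renameBasis f).symm.sum_comp]
  refine Finset.sum_congr rfl fun k _ => ?_
  have h : ∀ s : S → Bool, Sum.elim s k ∘ Equiv.sumCongr (Equiv.refl S) f =
      Sum.elim s ((renameBasis f).symm k) := fun s => by
    funext i
    rcases i with i | i <;> rfl
  rw [relabel_renameBasis_apply, h, h]

lemma traceSnd_append_zeroState {α κ : Type} [Fintype α] [DecidableEq α] [Fintype κ]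
    [DecidableEq κ] (X : Op α) : traceSnd (append (zeroState κ) X) = X := by
  ext i j
  simp only [traceSnd, UhlmannSample.append, LinearMap.coe_mk, AddHom.coe_mk, Matrix.of_apply,
    Matrix.kroneckerMap_apply, zeroState]
  rw [Finset.sum_eq_single (fun _ => false)]
  · simp
  · intro k _ hk
    rw [Matrix.single_apply, if_neg fun h => hk h.1.symm, mul_zero]
  · simp

/-- A simulation does not depend on the ancilla state, so it applies to ancillas in `|0⟩`, where
appending followed by discarding is the identity. -/
lemma realizedMap_eq {k : ℕ} (f : Anc a b ≃ Fin k) {ρ σ : Q a × Q b → ℂ}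
    {l : List (Instr a b (Wires a b))} {T : Op (Sys (Q a) (Q b)) →ₗ[ℂ] Op (Sys (Q a) (Q b))}
    (h : Simulates ρ σ l T) :
    realizedMap (l.map (Instr.map (Equiv.sumCongr (Equiv.refl (SysQubits a b)) f))) ρ σ = T := by
  refine LinearMap.ext fun Y => ?_
  set F := renameBasis (Equiv.sumCongr (Equiv.refl (SysQubits a b)) f) with hF
  set Z : Op (SysQubits a b ⊕ Fin k → Bool) :=
    relabel (Equiv.sumArrowEquivProdArrow (SysQubits a b) (Fin k) Bool).symm
      (append (zeroState (Fin k)) (relabel (sysBasis a b).symm Y)) with hZ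
  have hZF : relabel F (relabel F.symm Z) = Z := by ext x y; simp [relabel]
  have h1 : discard _ _ Z = relabel (sysBasis a b).symm Y := by
    rw [discard, LinearMap.comp_apply]
    have : relabel (Equiv.sumArrowEquivProdArrow (SysQubits a b) (Fin k) Bool) Z =
        append (zeroState (Fin k)) (relabel (sysBasis a b).symm Y) := by
      rw [hZ]; ext x y; simp [relabel]
    rw [this, traceSnd_append_zeroState]
  have h2 : relabel (sysBasis a b) (discard _ _ Z) = Y := by
    rw [h1]; ext x y; simp [relabel]
  have h3 : realizedMap (l.map (Instr.map (Equiv.sumCongr (Equiv.refl (SysQubits a b)) f))) ρ σ Y =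
      relabel (sysBasis a b) (discard _ _ (evalCircuit ρ σ
        (l.map (Instr.map (Equiv.sumCongr (Equiv.refl (SysQubits a b)) f))) Z)) := rfl
  have h4 := LinearMap.congr_fun (evalCircuit_map (Equiv.sumCongr (Equiv.refl (SysQubits a b)) f)
    ρ σ l) (relabel F.symm Z)
  rw [LinearMap.comp_apply, LinearMap.comp_apply, ← hF, hZF] at h4
  have h5 := LinearMap.congr_fun h (relabel F.symm Z)
  rw [LinearMap.comp_apply, LinearMap.comp_apply] at h5
  rw [h3, h4, hF, discard_relabel]
  refine h5.trans (congrArg T ?_)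
  rw [toSys, LinearMap.comp_apply, ← discard_relabel f, ← hF, hZF, h2]

/-- From `log 2 ≥ 0.69` one has `C log (d_A d_B) ≥ 69 (a + b)`. This covers both the `5 + 3 (a + b)`
qubits and the gate count, at most `69 (a + b)` for each of the `2 m u + 1` samples, where `u` is
the number of phases. -/
lemma implementedWith {C N : ℝ} (hab : 1 ≤ a + b) {m : ℕ} (hm : 1 ≤ m) {Φ : List ℝ}
    (hC : 100 ≤ C) (hN : (2 * m * Φ.length + 1 : ℝ) ≤ N) : ImplementedWith C N a b m Φ := by
  have hcard : Fintype.card (Anc a b) = 3 + 2 * (a + b) := by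
    simp only [Fintype.card_sum, Fintype.card_fin]; ring
  have hlog : (0.69 : ℝ) * (a + b : ℕ) ≤ Real.log ((2 : ℝ) ^ a * 2 ^ b) := by
    rw [← pow_add, Real.log_pow, mul_comm]
    exact mul_le_mul_of_nonneg_left (by linarith [Real.log_two_gt_d9]) (Nat.cast_nonneg _)
  have hn : (1 : ℝ) ≤ ((a + b : ℕ) : ℝ) := by exact_mod_cast hab
  set n := a + b with hn'
  have hCn : 69 * (n : ℝ) ≤ C * Real.log ((2 : ℝ) ^ a * 2 ^ b) :=
    calc 69 * (n : ℝ) = 100 * (0.69 * n) := by ring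
      _ ≤ C * Real.log ((2 : ℝ) ^ a * 2 ^ b) :=
        mul_le_mul hC hlog (by positivity) (by linarith)
  refine ⟨3 + 2 * n, 2 * m * Φ.length + 1, (uhlmannCircuit a b m Φ).map (Instr.map
    (Equiv.sumCongr (Equiv.refl _) (Fintype.equivFinOfCardEq hcard))), fun ρ σ _ _ =>
      realizedMap_eq _ (simulates_uhlmannCircuit ρ σ m Φ), ?_, ?_, ?_, ?_⟩
  · rw [sampleCount_map, sampleCount_uhlmannCircuit]
  · exact_mod_cast hN
  · rw [gateCount_map]
    have h1 : gateCount (uhlmannCircuit a b m Φ) ≤ 69 * n * (2 * m * Φ.length + 1) := by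
      refine (gateCount_uhlmannCircuit_le m Φ).trans ?_
      rw [← hn']
      have e1 : Φ.length * m * 1 ≤ Φ.length * m * n := Nat.mul_le_mul_left _ hab
      have e2 : Φ.length * 1 ≤ Φ.length * m := Nat.mul_le_mul_left _ hm
      nlinarith
    have h2 : (gateCount (uhlmannCircuit a b m Φ) : ℝ) ≤
        69 * n * (2 * m * Φ.length + 1 : ℕ) := by exact_mod_cast h1
    refine h2.trans ?_
    rw [mul_right_comm C]
    exact mul_le_mul_of_nonneg_right hCn (Nat.cast_nonneg _)
  · refine le_trans ?_ hCn
    rw [← hn']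
    push_cast
    linarith

end Implementation

end UhlmannSample

end

/-! ### Choice of the absolute constant and the two accuracy statements. -/

theorem mainTheorem2 :
    ∃ C : ℝ, 0 < C ∧
      -- accuracy in the diamond norm
      (∀ δ s : ℝ, 0 < δ → δ < 1 → 0 < s → s ≤ 1 →
        ∃ (m : ℕ) (Φ : List ℝ), 1 ≤ m ∧ Odd Φ.length ∧
          ∀ a b : ℕ, 1 ≤ a + b →
            ImplementedWith C (C * (1 / (δ * s ^ 2)) * Real.log (2 / δ) ^ 2) a b m Φ ∧
            ∀ ρ σ : Q a × Q b → ℂ, IsPureState ρ → IsPureState σ →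
              s ∈ lowerBounds (nonzeroSingularValues (rootProduct ρ σ)) →
              SineBlockEncoding ρ σ m (δ / (2 * Φ.length)) ∧
              ∃ Uideal : Op (Sys (Q a) (Q b)),
                IsBlockEncoding blockH Uideal (ketbra ρ σ ⊗ₖ uhlmannIsometry ρ σ) ∧
                DiamondClose (uhlmannPurifiedSample ρ σ m Φ ∘ₗ prep σ)
                  (conjBy Uideal ∘ₗ prep σ) δ) ∧
      -- accuracy in the fidelity difference
      (∀ (δ s : ℝ) (r : ℕ), 0 < δ → δ < 1 → 0 < s → s ≤ 1 → 1 ≤ r →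
        ∃ (m : ℕ) (Φ : List ℝ), 1 ≤ m ∧ Odd Φ.length ∧
          ∀ a b : ℕ, 1 ≤ a + b →
            ImplementedWith C
              (C * (1 / δ) * min (1 / s ^ 2) ((r : ℝ) ^ 2 / δ ^ 2) * Real.log (2 / δ) ^ 2)
              a b m Φ ∧
            ∀ ρ σ : Q a × Q b → ℂ, IsPureState ρ → IsPureState σ →
              s ∈ lowerBounds (nonzeroSingularValues (rootProduct ρ σ)) →
              (rootProduct ρ σ).rank ≤ r →
              SineBlockEncoding ρ σ m (δ / (2 * Φ.length)) ∧
              fidelity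
                  (idTensor (Q a) (traceSnd ∘ₗ uhlmannPurifiedSample ρ σ m Φ ∘ₗ prep σ)
                    (ketbra ρ ρ))
                  (ketbra σ σ) ≥
                fidelity (reduced ρ) (reduced σ) - δ) := by
  -- The second factor comes from the parameter count; the factor `64 = 8²` is lost in the second
  -- part through the threshold `δ/(8r)`.
  refine ⟨64 * 3078144000, by norm_num, fun δ s hδ hδ1 hs hs1 => ?_,
    fun δ s r hδ hδ1 hs hs1 hr => ?_⟩
  · obtain ⟨m, Φ, p, h, hw⟩ := exists_goodParameters hδ hδ1 hs hs1
    have hm : 1 ≤ m := le_trans (by norm_num) h.le_m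
    refine ⟨m, Φ, hm, h.odd_length, fun a b hab => ⟨?_, fun ρ σ hρ hσ hlow =>
      ⟨h.sineBlockEncoding hδ hρ hσ, h.exists_ideal hδ hδ1 hρ hσ hlow⟩⟩⟩
    refine implementedWith hab hm (by norm_num) (hw.trans ?_)
    have : 0 ≤ 1 / (δ * s ^ 2) := by positivity
    gcongr
    norm_num
  · have hr' : (1 : ℝ) ≤ r := by exact_mod_cast hr
    have hpos : 0 < δ / (8 * r) := by positivity
    have hle : δ / (8 * r) ≤ 1 := by
      rw [div_le_one (by positivity)]
      linarith
    -- The threshold is `max s (δ/(8r))`: singular values below `δ/(8r)` may be neglected for the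
    -- fidelity, which yields the minimum in the sample bound.
    obtain ⟨m, Φ, p, h, hw⟩ := exists_goodParameters hδ hδ1 (lt_max_of_lt_left hs)
      (max_le hs1 hle)
    have hm : 1 ≤ m := le_trans (by norm_num) h.le_m
    refine ⟨m, Φ, hm, h.odd_length, fun a b hab => ⟨?_, fun ρ σ hρ hσ hlow hrank =>
      ⟨h.sineBlockEncoding hδ hρ hσ, h.fidelity_ge hδ hδ1 hρ hσ hr hlow hrank rfl⟩⟩⟩
    refine implementedWith hab hm (by norm_num) (hw.trans ?_)
    set t := max s (δ / (8 * r)) with ht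
    have ht0 : 0 < t := lt_max_of_lt_left hs
    have h1 : 1 / t ^ 2 ≤ 64 * min (1 / s ^ 2) ((r : ℝ) ^ 2 / δ ^ 2) := by
      rw [mul_min_of_nonneg _ _ (by norm_num)]
      refine le_min ?_ ?_
      · have : 1 / t ^ 2 ≤ 1 / s ^ 2 := by
          have : s ≤ t := le_max_left _ _
          gcongr
        have h0 : 0 ≤ 1 / s ^ 2 := by positivity
        linarith
      · have e : 64 * ((r : ℝ) ^ 2 / δ ^ 2) = 1 / (δ / (8 * r)) ^ 2 := by
          field_simp
          norm_num
        rw [e]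
        have : δ / (8 * r) ≤ t := le_max_right _ _
        gcongr
    calc 3078144000 * (1 / (δ * t ^ 2)) * Real.log (2 / δ) ^ 2
        = 3078144000 * (1 / δ) * (1 / t ^ 2) * Real.log (2 / δ) ^ 2 := by
          rw [← one_div_mul_one_div, ← mul_assoc]
      _ ≤ 3078144000 * (1 / δ) * (64 * min (1 / s ^ 2) ((r : ℝ) ^ 2 / δ ^ 2)) *
          Real.log (2 / δ) ^ 2 := by gcongr
      _ = 64 * 3078144000 * (1 / δ) * min (1 / s ^ 2) ((r : ℝ) ^ 2 / δ ^ 2) *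
          Real.log (2 / δ) ^ 2 := by ring
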